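/- **Notation.** Let $K\subset\mathbb R$ be one of $\mathbb Q$, $\mathbb Q(\sqrt2)$, $\mathbb Q(\sqrt5)$, with ring of integers $\mathcal O_K$; let $D$ be the Hamilton quaternion algebra $\left(\frac{-1,-1}{K}\right)$ with basis $1,i,j,k$, $\omega=\frac{1+i+j+k}2$, $\varphi=\frac{1+\sqrt5}2$. For an $\mathcal O_K$-order $\mathcal O\subset D$ write $\mathcal O^\times/\mathrm{sc}$ for the image of $\mathcal O^\times$ in $D^\times/K^\times$. For a prime $P$ of $\mathcal O_K$ the $\{P\}$-arithmetic group of $\mathcal O$ is the image of $\mathcal O[1/P]^\times$ in $D^\times/K^\times$; a subgroup of $D^\times/K^\times$ commensurable with it is called $\{P\}$-arithmetic. Let $X_P=PGL_2(K_P)/PGL_2(\mathcal O_P)$ be the $(N(P)+1)$-regular tree with origin $v_0$; the neighbours of $gv_0$ are the vertices $gmv_0$ with $m\in M_2(\mathcal O_P)$ and $\det m$ a uniformizer. A splitting $D\otimes K_P\cong M_2(K_P)$ makes $D^\times/K^\times$ act on $X_P$. Map $D^\times/K^\times$ to $PU(2)\subset PGL_2(\mathbb C)$ by $$a+bi+cj+dk\mapsto\begin{pmatrix}a+b\sqrt{-1}&c+d\sqrt{-1}\\-c+d\sqrt{-1}&a-b\sqrt{-1}\end{pmatrix}.$$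 For a splitting, a subgroup $C$ and an element $T$ of $D^\times/K^\times$ form a *Super-Golden-Gate set* (with respect to $P$ and $\mathcal O$) if $K$ is totally real, $C$ is finite, $C$ and $T$ lie in a $\{P\}$-arithmetic group, $C$ fixes $v_0$ and acts simply transitively on its neighbours, and $T$ has order $2$ and inverts an edge at $v_0$. Consider the splittings (for $x=a+bi+cj+dk$) $$A_\rho:\ x\mapsto\begin{pmatrix}a+c+\rho d&b+\rho c-d\\-b+\rho c-d&a-c-\rho d\end{pmatrix}\ (\rho^2=-2),\qquad B_\rho:\ x\mapsto\begin{pmatrix}a+2c+\rho d&b+\rho c-2d\\-b+\rho c-2d&a-2c-\rho d\end{pmatrix}\ (\rho^2=-5),$$ $$E_\rho:\ x\mapsto\begin{pmatrix}a+\frac{c(1+\rho)+d(1-\rho)}2&b+\frac{c(1-\rho)-d(1+\rho)}2\\-b+\frac{c(1-\rho)-d(1+\rho)}2&a-\frac{c(1+\rho)+d(1-\rho)}2\end{pmatrix}\ (\rho^2=-3),\qquad V_\rho:\ x\mapsto\begin{pmatrix}a+\rho b&c+\rho d\\-c+\rho d&a-\rho b\end{pmatrix}\ (\rho^2=-1),$$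 $$R_\rho:\ x\mapsto\begin{pmatrix}a+b+c(\alpha-\beta)+d(\alpha+\beta)&\sqrt2(b+c\alpha+d\beta)\\-\sqrt2(b-c\beta+d\alpha)&a-b-c(\alpha-\beta)-d(\alpha+\beta)\end{pmatrix},\quad \alpha=\tfrac{2+\sqrt2\rho}3,\ \beta=\tfrac{2\sqrt2-\rho}3\ (\rho^2=-7),$$ $$I_\rho:\ x\mapsto\begin{pmatrix}a+c\alpha+d\beta&b+c\beta-d\alpha\\-b+c\beta-d\alpha&a-c\alpha-d\beta\end{pmatrix},\quad \alpha=\tfrac{\sqrt5-\rho}2,\ \beta=\tfrac{\sqrt5+\rho}2\ (\rho^2=-7).$$ Consider the following pairs $(C,T)$, given by quaternions and by the corresponding matrices in $PU(2)$ ($\mathbf i=\sqrt{-1}$). 1. $K=\mathbb Q$, $\mathcal O=\mathbb Z+\mathbb Zi+\mathbb Zj+\mathbb Zk$ (an order). * $P=(3)$, splitting $A_\rho$. $C_4=\langle i,j\rangle=\{1,i,j,k\}=\mathcal O^\times/\mathrm{sc}$, corresponding to $\left\{\begin{pmatrix}1&0\\0&1\end{pmatrix},\begin{pmatrix}\mathbf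 i&0\\0&-\mathbf i\end{pmatrix},\begin{pmatrix}0&1\\-1&0\end{pmatrix},\begin{pmatrix}0&\mathbf i\\\mathbf i&0\end{pmatrix}\right\}$; $T_4=i+j+k\leftrightarrow\begin{pmatrix}1&1-\mathbf i\\1+\mathbf i&-1\end{pmatrix}$. There is a root $\rho\equiv508\pmod{3^6}$ in $\mathbb Q_3$, and for it $T_4v_0=\begin{pmatrix}3&1\\0&1\end{pmatrix}v_0$. * $P=(5)$, splitting $V_\rho$. $C_6=\langle1+i+j+k,\ i-j\rangle\cong\mathrm{Sym}_3$, corresponding to $\left\langle\begin{pmatrix}1&1\\\mathbf i&-\mathbf i\end{pmatrix},\begin{pmatrix}0&\mathbf i\\1&0\end{pmatrix}\right\rangle$; $T_6=j+2k\leftrightarrow\begin{pmatrix}0&2-\mathbf i\\2+\mathbf i&0\end{pmatrix}$. 2. $K=\mathbb Q$, $\mathcal O=\mathbb Z[i,\omega]=\mathbb Z\oplus\mathbb Zi\oplus\mathbb Zj\oplus\mathbb Z\omega$, a maximal order; $P=(11)$, splitting $A_\rho$. $C_{12}=\langle i,\omega\rangle=\mathcal O^\times/\mathrm{sc}\cong\mathrm{Alt}_4$,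 corresponding to $\left\langle\begin{pmatrix}\mathbf i&0\\0&-\mathbf i\end{pmatrix},\begin{pmatrix}1&1\\\mathbf i&-\mathbf i\end{pmatrix}\right\rangle$; $T_{12}=3i+j+k\leftrightarrow\begin{pmatrix}3&1-\mathbf i\\1+\mathbf i&-3\end{pmatrix}$. 3. $K=\mathbb Q(\sqrt2)$, $\mathcal O=\mathcal O_K\oplus\mathcal O_K\frac{1+i}{\sqrt2}\oplus\mathcal O_K\frac{1+j}{\sqrt2}\oplus\mathcal O_K\omega$, a maximal order. * $P=(5-\sqrt2)$, splitting $B_\rho$. $C_{24}=\langle\frac{1+i}{\sqrt2},\omega\rangle=\mathcal O^\times/\mathrm{sc}\cong\mathrm{Sym}_4$, corresponding to $\left\langle\begin{pmatrix}1&0\\0&\mathbf i\end{pmatrix},\begin{pmatrix}1&1\\\mathbf i&-\mathbf i\end{pmatrix}\right\rangle$; $T_{24}=(1+\frac1{\sqrt2})i+\frac j{\sqrt2}+(1-\sqrt2)k\leftrightarrow\begin{pmatrix}-1-\sqrt2&2-\sqrt2+\mathbf i\\2-\sqrt2-\mathbf i&1+\sqrt2\end{pmatrix}$. * $P=(3-\sqrt2)$,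 splitting $E_\rho$. $C_8=\langle k,\frac{1+i}{\sqrt2}\rangle\le\mathcal O^\times/\mathrm{sc}$, isomorphic to $\mathrm{Dih}_4$ (of order 8), corresponding to $\left\langle\begin{pmatrix}0&1\\1&0\end{pmatrix},\begin{pmatrix}1&0\\0&\mathbf i\end{pmatrix}\right\rangle$; $T_8=i+j+\frac{k-i}{\sqrt2}\leftrightarrow\begin{pmatrix}\sqrt2-1&1-\sqrt2\,\mathbf i\\1+\sqrt2\,\mathbf i&1-\sqrt2\end{pmatrix}$. * $P=(\sqrt2)$, splitting $R_\rho$. $C_3=\langle\omega\rangle\le\mathcal O^\times/\mathrm{sc}$, corresponding to $\left\langle\begin{pmatrix}1&1\\\mathbf i&-\mathbf i\end{pmatrix}\right\rangle$; $T_3=(1-\frac1{\sqrt2})j+\frac1{\sqrt2}k\leftrightarrow\begin{pmatrix}0&\sqrt2\\1+\mathbf i&0\end{pmatrix}$. Moreover, over $\mathbb Q(\sqrt2)$ the group $C_6$ becomes $\langle\omega,\frac{i-j}{\sqrt2}\rangle\le\mathcal O^\times/\mathrm{sc}$. 4. $K=\mathbb Q(\sqrt5)$, $\mathcal O$ the icosians,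 i.e. the set of $\frac12\big((a+b\varphi)+(c+d\varphi)i+(e+f\varphi)j+(g+h\varphi)k\big)$ with $a,\dots,h\in\mathbb Z$, $a+c+e+g\equiv b+d+f+h\equiv0\pmod 2$ and $(c,e,a)\equiv(b,d,f)$ or $(b,d,f)+(1,1,1)\pmod2$; a maximal order. * $P=(7+5\varphi)$, splitting $A_\rho$. $C_{60}=\langle\omega,\frac{i+\varphi^{-1}j+\varphi k}2\rangle=\mathcal O^\times/\mathrm{sc}\cong\mathrm{Alt}_5$, corresponding to $\left\langle\begin{pmatrix}1&1\\\mathbf i&-\mathbf i\end{pmatrix},\begin{pmatrix}1&\varphi-\mathbf i/\varphi\\\varphi+\mathbf i/\varphi&-1\end{pmatrix}\right\rangle$; $T_{60}=(2+\varphi)i+j+k\leftrightarrow\begin{pmatrix}2+\varphi&1-\mathbf i\\1+\mathbf i&-2-\varphi\end{pmatrix}$. * $P=(4-\varphi)$, splitting $A_\rho$. $C_{12}'=\langle\omega,\frac{i-\varphi^{-1}j+\varphi k}2\rangle\le\mathcal O^\times/\mathrm{sc}$, isomorphic to $\mathrm{Alt}_4$, corresponding to $\left\langle\begin{pmatrix}1&1\\\mathbf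 i&-\mathbf i\end{pmatrix},\begin{pmatrix}1&\varphi+\mathbf i/\varphi\\\varphi-\mathbf i/\varphi&-1\end{pmatrix}\right\rangle$; $T_{12}'=(\varphi-1)i+j+k\leftrightarrow\begin{pmatrix}\varphi-1&1-\mathbf i\\1+\mathbf i&1-\varphi\end{pmatrix}$. * $P=(2)$, splitting $I_\rho$, with $\rho\equiv-1\pmod 4$. $C_5=\langle\frac{\varphi+i/\varphi+j}2\rangle\le\mathcal O^\times/\mathrm{sc}$, corresponding to $\left\langle\begin{pmatrix}1+\varphi+\mathbf i&\varphi\\-\varphi&1+\varphi-\mathbf i\end{pmatrix}\right\rangle$; $T_5=j+k\leftrightarrow\begin{pmatrix}0&1\\\mathbf i&0\end{pmatrix}$. **Claim.** All the assertions about orders, unit groups, isomorphism types and corresponding matrices made in this list hold; each listed $P$ is a prime ideal; the required root $\rho\in K_P$ exists, and for every such $\rho$ the listed map is an isomorphism $D\otimes K_P\cong M_2(K_P)$ for which $(C,T)$ is a Super-Golden-Gate set. In each case $\langle C,T\rangle$ is the free product $C*\langle T\rangle\cong C*\mathbb Z/2\mathbb Z$, both in $D^\times/K^\times$ and in $PU(2)$.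 For $C_{24},T_{24}$ and for $C_{60},T_{60}$ the group $\langle C,T\rangle$ is the full $\{P\}$-arithmetic group of $\mathcal O$. -/

import Mathlib

open NumberField IsDedekindDomain
open scoped MatrixGroups Quaternion

noncomputable section

namespace SuperGolden

/-! ### The group `D^×/K^×` for the Hamilton quaternions `D` over a field `K` -/

/-- The subgroup `K^×` of scalars in `D^×`. -/
def scalars (K : Type*) [Field K] : Subgroup (ℍ[K])ˣ :=
  (Units.map (algebraMap K ℍ[K] : K →* ℍ[K])).range

instance scalars_normal (K : Type*) [Field K] : (scalars K).Normal where
  conj_mem := by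
    rintro _ ⟨k, rfl⟩ g
    refine ⟨k, ?_⟩
    rw [eq_mul_inv_iff_mul_eq]
    ext1
    exact Algebra.commutes (k : K) (g : ℍ[K])

/-- `D^×/K^×`. -/
abbrev PD (K : Type*) [Field K] : Type _ := (ℍ[K])ˣ ⧸ scalars K

open Classical in
/-- The class in `D^×/K^×` of an invertible quaternion (and `1` for a non-invertible one). -/
def cls {K : Type*} [Field K] (x : ℍ[K]) : PD K :=
  if h : IsUnit x then QuotientGroup.mk h.unit else 1

open Classical in
/-- The class in `PGL₂(F)` of an invertible matrix (and `1` for a non-invertible one). -/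
def pgl {F : Type*} [Field F] (m : Matrix (Fin 2) (Fin 2) F) : PGL(2, F) :=
  if h : IsUnit m then Matrix.ProjGenLinGroup.mk h.unit else 1

/-- The map of Hamilton quaternions induced by a map of coefficients. -/
def mapQuat {K L : Type*} [Field K] [Field L] (f : K →+* L) : ℍ[K] →+* ℍ[L] where
  toFun x := ⟨f x.re, f x.imI, f x.imJ, f x.imK⟩
  map_one' := by ext <;> simp
  map_zero' := by ext <;> simp
  map_mul' x y := by
    apply Quaternion.ext
    · refine Eq.trans ?_ (Quaternion.re_mul _ _).symm
      simp
    · refine Eq.trans ?_ (Quaternion.imI_mul _ _).symm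
      simp
    · refine Eq.trans ?_ (Quaternion.imJ_mul _ _).symm
      simp
    · refine Eq.trans ?_ (Quaternion.imK_mul _ _).symm
      simp
  map_add' x y := by
    apply Quaternion.ext
    · exact map_add f _ _
    · exact map_add f _ _
    · exact map_add f _ _
    · exact map_add f _ _

/-- The map `D^×/K^× → (D ⊗ L)^×/L^×` induced by `K → L`. -/
def PD.map {K L : Type*} [Field K] [Field L] (f : K →+* L) : PD K →* PD L :=
  QuotientGroup.map _ _ (Units.map (mapQuat f : ℍ[K] →* ℍ[L])) <| by
    rintro _ ⟨k, rfl⟩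
    refine ⟨Units.map (f : K →* L) k, ?_⟩
    ext1
    change algebraMap L ℍ[L] (f k) = mapQuat f (algebraMap K ℍ[K] k)
    apply Quaternion.ext
    · rfl
    · exact (map_zero f).symm
    · exact (map_zero f).symm
    · exact (map_zero f).symm

/-- The map `D^×/K^× → PGL₂(F)` induced by a `K`-algebra map `D → M₂(F)`. -/
def PD.toPGL {K F : Type*} [Field K] [Field F] [Algebra K F]
    (f : ℍ[K] →ₐ[K] Matrix (Fin 2) (Fin 2) F) : PD K →* PGL(2, F) :=
  QuotientGroup.lift _
    (Matrix.ProjGenLinGroup.mk.comp (Units.map (f : ℍ[K] →* Matrix (Fin 2) (Fin 2) F))) <| by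
    rintro _ ⟨k, rfl⟩
    have h : Units.map (f : ℍ[K] →* Matrix (Fin 2) (Fin 2) F)
        (Units.map (algebraMap K ℍ[K] : K →* ℍ[K]) k) =
        Matrix.GeneralLinearGroup.scalar (Fin 2) (Units.map (algebraMap K F : K →* F) k) := by
      ext1
      change f (algebraMap K ℍ[K] k) = _
      rw [f.commutes]
      rfl
    rw [MonoidHom.mem_ker, MonoidHom.comp_apply, h, Matrix.ProjGenLinGroup.mk_scalar]

/-! ### `PU(2)` -/

/-- `PU(2)`, as a subgroup of `PGL₂(ℂ)`: the image of `U(2)`. -/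
def PU2 : Subgroup (PGL(2, ℂ)) :=
  ((Matrix.ProjGenLinGroup.mk (n := Fin 2) (R := ℂ)).comp
    (Unitary.toUnits : unitary (Matrix (Fin 2) (Fin 2) ℂ) →* _)).range

/-- The standard map from the real quaternions to `M₂(ℂ)`. -/
def quatToMat : ℍ[ℝ] →ₐ[ℝ] Matrix (Fin 2) (Fin 2) ℂ where
  toFun x := !![x.re + Complex.I * x.imI, x.imJ + Complex.I * x.imK;
    -x.imJ + Complex.I * x.imK, x.re - Complex.I * x.imI]
  map_one' := by ext a b; fin_cases a <;> fin_cases b <;> simp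
  map_zero' := by ext a b; fin_cases a <;> fin_cases b <;> simp
  map_mul' x y := by
    ext a b
    fin_cases a <;> fin_cases b <;> simp [Matrix.mul_apply, Fin.sum_univ_two] <;>
      ring_nf <;> simp [Complex.I_sq] <;> ring
  map_add' x y := by
    ext a b
    fin_cases a <;> fin_cases b <;> simp <;> ring
  commutes' r := by
    ext a b
    fin_cases a <;> fin_cases b <;>
      simp [Quaternion.algebraMap_def, Matrix.algebraMap_matrix_apply]

/-- The map `D^×/K^× → PU(2) ⊆ PGL₂(ℂ)` attached to a real embedding of `K`. -/
def toPU {K : Type*} [Field K] (σ : K →+* ℝ) : PD K →* PGL(2, ℂ) :=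
  (PD.toPGL quatToMat).comp (PD.map σ)

/-! ### The tree of `PGL₂(K_P)` -/

section Tree

variable {K : Type*} [Field K] [NumberField K] (v : HeightOneSpectrum (𝓞 K))

/-- `PGL₂(O_P)` as a subgroup of `PGL₂(K_P)`. -/
def maxCompact : Subgroup (PGL(2, v.adicCompletion K)) :=
  (Matrix.ProjGenLinGroup.map (n := Fin 2) (v.adicCompletionIntegers K).subtype).range

/-- The vertices of the tree `X_P`: the cosets `PGL₂(K_P)/PGL₂(O_P)`. -/
abbrev Vertex : Type _ := PGL(2, v.adicCompletion K) ⧸ maxCompact v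

/-- The origin of the tree. -/
def origin : Vertex v := QuotientGroup.mk 1

/-- The vertex `g · v₀`, that is the homothety class of the lattice `g · O_P²`. -/
def vertexOf (g : GL (Fin 2) (v.adicCompletion K)) : Vertex v :=
  QuotientGroup.mk (Matrix.ProjGenLinGroup.mk g)

/-- Two vertices are adjacent if they are the classes of lattices `g · O_P² ⊇ g · m · O_P²`, where
`m` is an integral matrix whose determinant is a uniformizer of `K_P`. -/
def TreeAdj (x y : Vertex v) : Prop :=
  ∃ g m : GL (Fin 2) (v.adicCompletion K),
    (∀ a b, (m : Matrix (Fin 2) (Fin 2) (v.adicCompletion K)) a b ∈ v.adicCompletionIntegers K) ∧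
    Valued.v (m : Matrix (Fin 2) (Fin 2) (v.adicCompletion K)).det = WithZero.exp (-1 : ℤ) ∧
    x = vertexOf v g ∧ y = vertexOf v (g * m)

end Tree

/-! ### Orders, their unit groups and the `{P}`-arithmetic groups -/

section Integral

variable {K : Type*} [Field K] (v : HeightOneSpectrum (𝓞 K))
  (O : Subalgebra (𝓞 K) ℍ[K])

/-- `x ∈ O[1/P]`, that is `x` is `O`-integral outside `P`. -/
def IntegralOutside (x : ℍ[K]) : Prop := ∃ n : ℕ, ∀ a ∈ v.asIdeal ^ n, algebraMap (𝓞 K) ℍ[K] a * x ∈ O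

theorem IntegralOutside.mul {x y : ℍ[K]} (hx : IntegralOutside v O x)
    (hy : IntegralOutside v O y) : IntegralOutside v O (x * y) := by
  obtain ⟨n, hn⟩ := hx
  obtain ⟨m, hm⟩ := hy
  refine ⟨n + m, fun a ha => ?_⟩
  rw [pow_add] at ha
  induction ha using Submodule.mul_induction_on' with
  | mem_mul_mem b hb c hc =>
    have h : algebraMap (𝓞 K) ℍ[K] (b * c) * (x * y) =
        (algebraMap (𝓞 K) ℍ[K] b * x) * (algebraMap (𝓞 K) ℍ[K] c * y) := by
      rw [map_mul, mul_assoc, mul_assoc, ← mul_assoc (algebraMap (𝓞 K) ℍ[K] c) x y,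
        Algebra.commutes c x, mul_assoc]
    rw [h]
    exact O.mul_mem (hn b hb) (hm c hc)
  | add b _ c _ h1 h2 =>
    rw [map_add, add_mul]
    exact O.add_mem h1 h2

end Integral

section Orders

variable {K : Type*} [Field K] [NumberField K]

/-- `O` is an order of `D` over the ring of integers of `K`. -/
def IsOrder (O : Subalgebra (𝓞 K) ℍ[K]) : Prop :=
  (Subalgebra.toSubmodule O).FG ∧ Submodule.span K (O : Set ℍ[K]) = ⊤

/-- `O` is a maximal order of `D`. -/
def IsMaximalOrder (O : Subalgebra (𝓞 K) ℍ[K]) : Prop :=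
  Maximal IsOrder O

/-- `O^×` modulo scalars, in `D^×/K^×`. -/
def unitGroup (O : Subalgebra (𝓞 K) ℍ[K]) : Subgroup (PD K) :=
  Subgroup.map (QuotientGroup.mk' (scalars K))
    { carrier := {u | (u : ℍ[K]) ∈ O ∧ ((u⁻¹ : (ℍ[K])ˣ) : ℍ[K]) ∈ O}
      one_mem' := by simp [O.one_mem]
      mul_mem' := by
        rintro u w ⟨h1, h2⟩ ⟨h3, h4⟩
        refine ⟨?_, ?_⟩
        · simpa using O.mul_mem h1 h3
        · simpa [mul_inv_rev] using O.mul_mem h4 h2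
      inv_mem' := by
        rintro u ⟨h1, h2⟩
        exact ⟨h2, by simpa using h1⟩ }

variable (v : HeightOneSpectrum (𝓞 K)) (O : Subalgebra (𝓞 K) ℍ[K])

/-- The `{P}`-arithmetic group of `O`: the group `O[1/P]^×` modulo scalars, in `D^×/K^×`. -/
def arithGroup : Subgroup (PD K) :=
  Subgroup.map (QuotientGroup.mk' (scalars K))
    { carrier := {u | IntegralOutside v O (u : ℍ[K]) ∧
        IntegralOutside v O ((u⁻¹ : (ℍ[K])ˣ) : ℍ[K])}
      one_mem' := by
        have h : IntegralOutside v O (1 : ℍ[K]) :=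
          ⟨0, fun a _ => O.mul_mem (O.algebraMap_mem a) O.one_mem⟩
        exact ⟨by simpa using h, by simpa using h⟩
      mul_mem' := by
        rintro u w ⟨h1, h2⟩ ⟨h3, h4⟩
        refine ⟨?_, ?_⟩
        · simpa using h1.mul v O h3
        · simpa [mul_inv_rev] using h4.mul v O h2
      inv_mem' := by
        rintro u ⟨h1, h2⟩
        exact ⟨h2, by simpa using h1⟩ }

/-- A subgroup of `D^×/K^×` is `{P}`-arithmetic if it is commensurable with the `{P}`-arithmetic
group of the order `O`. -/
def IsArithmetic (Λ : Subgroup (PD K)) : Prop :=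
  Subgroup.Commensurable Λ (arithGroup v O)

variable {v}

/-- The map `D^×/K^× → PGL₂(K_P)` attached to a splitting of `D ⊗ K_P` (the Hamilton quaternions
over `K_P`). -/
def treeMap (e : ℍ[v.adicCompletion K] ≃ₐ[v.adicCompletion K]
    Matrix (Fin 2) (Fin 2) (v.adicCompletion K)) : PD K →* PGL(2, v.adicCompletion K) :=
  (PD.toPGL (e : ℍ[v.adicCompletion K] →ₐ[v.adicCompletion K] _)).comp
    (PD.map (algebraMap K (v.adicCompletion K)))

/-- `C` and `T` form a Super-Golden-Gate set with respect to the prime `P`, the order `O` and the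
splitting `e` of `D ⊗ K_P`: the finite group `C` and the involution `T` lie in a `{P}`-arithmetic
group of the totally definite algebra `D`, the group `C` fixes the origin of the tree `X_P` and
acts simply transitively on its neighbors, and `T` inverts an edge at the origin. -/
structure IsSuperGoldenGateSet (O : Subalgebra (𝓞 K) ℍ[K])
    (e : ℍ[v.adicCompletion K] ≃ₐ[v.adicCompletion K]
      Matrix (Fin 2) (Fin 2) (v.adicCompletion K))
    (C : Subgroup (PD K)) (T : PD K) : Prop where
  totallyReal : IsTotallyReal K
  order : IsOrder O
  arithmetic : ∃ Λ : Subgroup (PD K), IsArithmetic v O Λ ∧ C ≤ Λ ∧ T ∈ Λ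
  finite : Finite C
  fixes_origin : ∀ c ∈ C, treeMap e c • origin v = origin v
  simply_transitive : ∀ x y : Vertex v, TreeAdj v (origin v) x → TreeAdj v (origin v) y →
    ∃! c : PD K, c ∈ C ∧ treeMap e c • x = y
  involution : orderOf T = 2
  inverts_edge : ∃ w : Vertex v, TreeAdj v (origin v) w ∧
    treeMap e T • origin v = w ∧ treeMap e T • w = origin v

end Orders

/-- The prime `P` is generated by the element `x` of `K`. -/
def IsGeneratedBy {K : Type*} [Field K] [NumberField K] (v : HeightOneSpectrum (𝓞 K)) (x : K) :
    Prop :=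
  ∃ a : 𝓞 K, (a : K) = x ∧ v.asIdeal = Ideal.span {a}

/-- The subgroup generated by `C` and the involution `T` is the free product of `C` and
`⟨T⟩ ≅ ℤ/2ℤ`. -/
def IsFreeProduct {G : Type*} [Group G] (C : Subgroup G) (T : G) : Prop :=
  ∃ φ : Monoid.Coprod C (Multiplicative (ZMod 2)) ≃* ↥(C ⊔ Subgroup.zpowers T),
    (∀ c : C, (φ (Monoid.Coprod.inl c) : G) = c) ∧
    (φ (Monoid.Coprod.inr (Multiplicative.ofAdd 1)) : G) = T

/-- Under the real embedding `σ` of `K`, the group `C` and the element `T` correspond to the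
subgroup `C'` and the element `T'` of `PU(2)`, and there also they generate the free product of
`C'` and `⟨T'⟩ ≅ ℤ/2ℤ`. -/
def CorrespondsTo {K : Type*} [Field K] (σ : K →+* ℝ) (C : Subgroup (PD K)) (T : PD K)
    (C' : Subgroup (PGL(2, ℂ))) (T' : PGL(2, ℂ)) : Prop :=
  C' ≤ PU2 ∧ T' ∈ PU2 ∧ C.map (toPU σ) = C' ∧ toPU σ T = T' ∧
    IsFreeProduct C T ∧ IsFreeProduct C' T'

/-! ### The fields `ℚ(√2)` and `ℚ(√5)` -/

/-- The field `ℚ(√2)`, inside `ℝ`. -/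
abbrev K2 : Type := IntermediateField.adjoin ℚ {(√2 : ℝ)}

/-- The field `ℚ(√5)`, inside `ℝ`. -/
abbrev K5 : Type := IntermediateField.adjoin ℚ {(√5 : ℝ)}

theorem isIntegral_sqrt (n : ℕ) : IsIntegral ℚ (√(n : ℝ)) := by
  refine ⟨Polynomial.X ^ 2 - Polynomial.C (n : ℚ), Polynomial.monic_X_pow_sub_C _ two_ne_zero, ?_⟩
  simp

instance : NumberField K2 where
  to_charZero := inferInstance
  to_finiteDimensional :=
    IntermediateField.adjoin.finiteDimensional (by simpa using isIntegral_sqrt 2)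

instance : NumberField K5 where
  to_charZero := inferInstance
  to_finiteDimensional :=
    IntermediateField.adjoin.finiteDimensional (by simpa using isIntegral_sqrt 5)

/-- `√2` as an element of `ℚ(√2)`. -/
def r2 : K2 := IntermediateField.AdjoinSimple.gen ℚ (√2 : ℝ)

/-- `√5` as an element of `ℚ(√5)`. -/
def r5 : K5 := IntermediateField.AdjoinSimple.gen ℚ (√5 : ℝ)

/-- The golden ratio as an element of `ℚ(√5)`. -/
def phi : K5 := (1 + r5) / 2

/-! ### The splittings -/

section Splittings

variable {F : Type*} [Field F]

/-- The matrix of `a + bi + cj + dk`, where `ρ² = -2`. -/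
def splitTwo (ρ : F) (x : ℍ[F]) : Matrix (Fin 2) (Fin 2) F :=
  !![x.re + x.imJ + ρ * x.imK, x.imI + ρ * x.imJ - x.imK;
    -x.imI + ρ * x.imJ - x.imK, x.re - x.imJ - ρ * x.imK]

/-- The matrix of `a + bi + cj + dk`, where `ρ² = -5`. -/
def splitFive (ρ : F) (x : ℍ[F]) : Matrix (Fin 2) (Fin 2) F :=
  !![x.re + 2 * x.imJ + ρ * x.imK, x.imI + ρ * x.imJ - 2 * x.imK;
    -x.imI + ρ * x.imJ - 2 * x.imK, x.re - 2 * x.imJ - ρ * x.imK]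

/-- The matrix of `a + bi + cj + dk`, where `ρ² = -3`. -/
def splitThree (ρ : F) (x : ℍ[F]) : Matrix (Fin 2) (Fin 2) F :=
  !![x.re + (x.imJ * (1 + ρ) + x.imK * (1 - ρ)) / 2,
      x.imI + (x.imJ * (1 - ρ) - x.imK * (1 + ρ)) / 2;
    -x.imI + (x.imJ * (1 - ρ) - x.imK * (1 + ρ)) / 2,
      x.re - (x.imJ * (1 + ρ) + x.imK * (1 - ρ)) / 2]

/-- The matrix of `a + bi + cj + dk`, where `ρ² = -1`. -/
def splitOne (ρ : F) (x : ℍ[F]) : Matrix (Fin 2) (Fin 2) F :=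
  !![x.re + ρ * x.imI, x.imJ + ρ * x.imK; -x.imJ + ρ * x.imK, x.re - ρ * x.imI]

/-- The matrix of `a + bi + cj + dk`, where `r² = 2` and `α² + β² = -1`. -/
def splitRamified (r α β : F) (x : ℍ[F]) : Matrix (Fin 2) (Fin 2) F :=
  !![x.re + x.imI + x.imJ * (α - β) + x.imK * (α + β), r * (x.imI + x.imJ * α + x.imK * β);
    -r * (x.imI - x.imJ * β + x.imK * α), x.re - x.imI - x.imJ * (α - β) - x.imK * (α + β)]

/-- The matrix of `a + bi + cj + dk`, where `α² + β² = -1`. -/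
def splitInert (α β : F) (x : ℍ[F]) : Matrix (Fin 2) (Fin 2) F :=
  !![x.re + x.imJ * α + x.imK * β, x.imI + x.imJ * β - x.imK * α;
    -x.imI + x.imJ * β - x.imK * α, x.re - x.imJ * α - x.imK * β]

end Splittings

/-! ### The gates, as quaternions -/

section Gates

/-- The quaternion `(1 + i + j + k) / 2`. -/
def omega (K : Type*) [Field K] : ℍ[K] := ⟨1 / 2, 1 / 2, 1 / 2, 1 / 2⟩

/-- The subgroup of `D^×/K^×` generated by the classes of the elements of `S`. -/
def gen {K : Type*} [Field K] (S : Set ℍ[K]) : Subgroup (PD K) := Subgroup.closure (cls '' S)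

def C4 : Subgroup (PD ℚ) := gen {⟨0, 1, 0, 0⟩, ⟨0, 0, 1, 0⟩}
def T4 : PD ℚ := cls ⟨0, 1, 1, 1⟩

def C12 : Subgroup (PD ℚ) := gen {⟨0, 1, 0, 0⟩, omega ℚ}
def T12 : PD ℚ := cls ⟨0, 3, 1, 1⟩

def C24 : Subgroup (PD K2) := gen {⟨1 / r2, 1 / r2, 0, 0⟩, omega K2}
def T24 : PD K2 := cls ⟨0, 1 + 1 / r2, 1 / r2, 1 - r2⟩

def C8 : Subgroup (PD K2) := gen {⟨0, 0, 0, 1⟩, ⟨1 / r2, 1 / r2, 0, 0⟩}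
def T8 : PD K2 := cls ⟨0, 1 - 1 / r2, 1, 1 / r2⟩

def C3 : Subgroup (PD K2) := gen {omega K2}
def T3 : PD K2 := cls ⟨0, 0, 1 - 1 / r2, 1 / r2⟩

def C6 : Subgroup (PD ℚ) := gen {⟨1, 1, 1, 1⟩, ⟨0, 1, -1, 0⟩}
def T6 : PD ℚ := cls ⟨0, 0, 1, 2⟩

def C60 : Subgroup (PD K5) := gen {omega K5, ⟨0, 1 / 2, phi⁻¹ / 2, phi / 2⟩}
def T60 : PD K5 := cls ⟨0, 2 + phi, 1, 1⟩

def C12' : Subgroup (PD K5) := gen {omega K5, ⟨0, 1 / 2, -phi⁻¹ / 2, phi / 2⟩}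
def T12' : PD K5 := cls ⟨0, phi - 1, 1, 1⟩

def C5 : Subgroup (PD K5) := gen {⟨phi / 2, phi⁻¹ / 2, 1 / 2, 0⟩}
def T5 : PD K5 := cls ⟨0, 0, 1, 1⟩

end Gates

/-! ### The gates, as complex matrices -/

section ComplexGates

open Complex (I)

/-- The subgroup of `PGL₂(ℂ)` generated by the classes of the matrices in `S`. -/
def genU (S : Set (Matrix (Fin 2) (Fin 2) ℂ)) : Subgroup (PGL(2, ℂ)) :=
  Subgroup.closure (pgl '' S)

/-- `√2` as a complex number. -/
def s2 : ℂ := ((√2 : ℝ) : ℂ)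

/-- The golden ratio as a complex number. -/
def gr : ℂ := (((1 + √5) / 2 : ℝ) : ℂ)

def C4U : Subgroup (PGL(2, ℂ)) := genU {!![I, 0; 0, -I], !![0, 1; -1, 0]}
def T4U : PGL(2, ℂ) := pgl !![1, 1 - I; 1 + I, -1]

def C12U : Subgroup (PGL(2, ℂ)) := genU {!![I, 0; 0, -I], !![1, 1; I, -I]}
def T12U : PGL(2, ℂ) := pgl !![3, 1 - I; 1 + I, -3]

def C24U : Subgroup (PGL(2, ℂ)) := genU {!![1, 0; 0, I], !![1, 1; I, -I]}
def T24U : PGL(2, ℂ) := pgl !![-1 - s2, 2 - s2 + I; 2 - s2 - I, 1 + s2]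

def C8U : Subgroup (PGL(2, ℂ)) := genU {!![0, 1; 1, 0], !![1, 0; 0, I]}
def T8U : PGL(2, ℂ) := pgl !![s2 - 1, 1 - s2 * I; 1 + s2 * I, 1 - s2]

def C3U : Subgroup (PGL(2, ℂ)) := genU {!![1, 1; I, -I]}
def T3U : PGL(2, ℂ) := pgl !![0, s2; 1 + I, 0]

def C6U : Subgroup (PGL(2, ℂ)) := genU {!![1, 1; I, -I], !![0, I; 1, 0]}
def T6U : PGL(2, ℂ) := pgl !![0, 2 - I; 2 + I, 0]

def C60U : Subgroup (PGL(2, ℂ)) :=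
  genU {!![1, 1; I, -I], !![1, gr - I / gr; gr + I / gr, -1]}
def T60U : PGL(2, ℂ) := pgl !![2 + gr, 1 - I; 1 + I, -2 - gr]

def C12U' : Subgroup (PGL(2, ℂ)) :=
  genU {!![1, 1; I, -I], !![1, gr + I / gr; gr - I / gr, -1]}
def T12U' : PGL(2, ℂ) := pgl !![gr - 1, 1 - I; 1 + I, 1 - gr]

def C5U : Subgroup (PGL(2, ℂ)) := genU {!![1 + gr + I, gr; -gr, 1 + gr - I]}
def T5U : PGL(2, ℂ) := pgl !![0, 1; I, 0]

end ComplexGates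

/-! ### The orders -/

section OrderLattices

/-- The Lipschitz quaternions, as a module. -/
def lipschitz : Submodule (𝓞 ℚ) ℍ[ℚ] :=
  Submodule.span (𝓞 ℚ) {1, ⟨0, 1, 0, 0⟩, ⟨0, 0, 1, 0⟩, ⟨0, 0, 0, 1⟩}

/-- The Hurwitz quaternions, as a module. -/
def hurwitz : Submodule (𝓞 ℚ) ℍ[ℚ] :=
  Submodule.span (𝓞 ℚ) {1, ⟨0, 1, 0, 0⟩, ⟨0, 0, 1, 0⟩, omega ℚ}

/-- The octahedral order over `ℤ[√2]`, as a module. -/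
def octahedral : Submodule (𝓞 K2) ℍ[K2] :=
  Submodule.span (𝓞 K2) {1, ⟨1 / r2, 1 / r2, 0, 0⟩, ⟨1 / r2, 0, 1 / r2, 0⟩, omega K2}

/-- The icosians, as a set. -/
def icosians : Set ℍ[K5] :=
  {x | ∃ a b c d e f g h : ℤ,
    x = ⟨(a + b * phi) / 2, (c + d * phi) / 2, (e + f * phi) / 2, (g + h * phi) / 2⟩ ∧
    a + c + e + g ≡ 0 [ZMOD 2] ∧ b + d + f + h ≡ 0 [ZMOD 2] ∧
    ((c ≡ b [ZMOD 2] ∧ e ≡ d [ZMOD 2] ∧ a ≡ f [ZMOD 2]) ∨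
      (c ≡ b + 1 [ZMOD 2] ∧ e ≡ d + 1 [ZMOD 2] ∧ a ≡ f + 1 [ZMOD 2]))}

end OrderLattices

end SuperGolden

end

open SuperGolden

namespace SuperGolden

set_option linter.unusedSectionVars false

/-! ### Quaternions and their classes modulo scalars -/

section Quat

variable {K : Type*} [Field K]

/-! Every gate set is verified by linear algebra in dimension two over the residue field of `P`. The
splittings carry reduced norm and trace to determinant and trace, and the elements that matter go to
integral matrices. A neighbour of the origin is the class of an integral matrix `M` whose
determinant is a uniformizer. Such an `M` is nonzero and singular modulo `P`, and the image line of
its reduction determines the vertex (`vtx_eq_of_adjugate_mul`). Hence there are at most `N(P) + 1`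
neighbours, one for each point of the projective line.

An element of `C` is represented by an integral matrix of unit determinant. If its characteristic
polynomial has no root modulo `P`, the reduction has no eigenvector, so the element fixes the origin
but no neighbour (`IsElliptic.smul_ne`). A group of such elements acts freely on the neighbours, and
once it has `N(P) + 1` elements it acts simply transitively. Only a few polynomials occur: a unit of
the order can be scaled to norm one, because totally positive units of the three fields are squares;
then all conjugates of its trace lie in `[-2, 2]`, since the algebra is totally definite. This
leaves classes of order 1, 2, 3, and 4 over `ℚ(√2)` or 5 over `ℚ(√5)`, and for each prime it remains
to look for roots in a small finite field.

The involution `T` is the class of a pure quaternion whose norm generates `P`. Modulo `P` its matrix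
`N` is nonzero with `N² = 0`, so its kernel and its image are the same line `ℓ`. A nontrivial `c ∈
C` moves `ℓ`, so `N c` maps `ℓ` onto `ℓ`. Therefore every product `T c₁ T c₂ ⋯` has an integral
representative that is nonzero and singular modulo `P`; no element of `C` has one. This is the free
product statement (`notMem_of_altProd`). It passes to `PU(2)` because `D^×/K^×` embeds there.

The unit groups of the Hurwitz, octahedral and icosian orders are found by a sandwich. The whole
unit group acts freely on the neighbours, hence has at most `N(P) + 1` elements; its subgroup `C`
maps onto a symmetric or alternating group of exactly that size, through conjugation on the
diagonals of a cube or on the five frames of an icosahedron.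

For `C24` and `C60` the order is its own dual for the trace form, so an element whose matrix
vanishes modulo `P` is divisible in the order by the generator of `P`. Multiplication by a suitable
unit and then by `T` makes the matrix vanish modulo `P`, and this lowers the exponent of `P` in the
norm. The descent ends in the unit group (`cls_mem_sup_of_normSq_eq`).

The group `C6` is not contained in the arithmetic group of the Lipschitz order. It normalizes that
group, and adjoining it gives a commensurable one. -/

theorem isUnit_of_normSq_ne_zero {x : ℍ[K]} (h : Quaternion.normSq x ≠ 0) : IsUnit x := by
  have h1 : (Quaternion.normSq x)⁻¹ • ((Quaternion.normSq x : K) : ℍ[K]) = 1 := by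
    rw [Quaternion.smul_coe, inv_mul_cancel₀ h, Quaternion.coe_one]
  refine ⟨⟨x, (Quaternion.normSq x)⁻¹ • star x, ?_, ?_⟩, rfl⟩
  · rw [mul_smul_comm, Quaternion.self_mul_star, h1]
  · rw [smul_mul_assoc, Quaternion.star_mul_self, h1]

theorem isUnit_iff_normSq_ne_zero {x : ℍ[K]} : IsUnit x ↔ Quaternion.normSq x ≠ 0 :=
  ⟨fun h => (h.map Quaternion.normSq).ne_zero, isUnit_of_normSq_ne_zero⟩

theorem cls_coe (u : (ℍ[K])ˣ) : cls (u : ℍ[K]) = QuotientGroup.mk u := by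
  rw [cls, dif_pos u.isUnit]
  congr
  ext1
  rfl

theorem exists_cls_eq (c : PD K) : ∃ u : (ℍ[K])ˣ, cls (u : ℍ[K]) = c := by
  induction c using QuotientGroup.induction_on with
  | H u => exact ⟨u, cls_coe u⟩

theorem cls_one : cls (1 : ℍ[K]) = 1 := by
  simpa using cls_coe (1 : (ℍ[K])ˣ)

theorem cls_mul {x y : ℍ[K]} (hx : IsUnit x) (hy : IsUnit y) : cls (x * y) = cls x * cls y := by
  obtain ⟨u, rfl⟩ := hx
  obtain ⟨w, rfl⟩ := hy
  rw [← Units.val_mul, cls_coe, cls_coe, cls_coe, QuotientGroup.mk_mul]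

theorem cls_eq_cls_iff {x y : ℍ[K]} (hx : IsUnit x) (hy : IsUnit y) :
    cls x = cls y ↔ ∃ κ : K, κ ≠ 0 ∧ y = κ • x := by
  obtain ⟨u, rfl⟩ := hx
  obtain ⟨w, rfl⟩ := hy
  rw [cls_coe, cls_coe, QuotientGroup.eq]
  constructor
  · rintro ⟨κ, hκ⟩
    refine ⟨κ, κ.ne_zero, ?_⟩
    have h : w = u * Units.map (algebraMap K ℍ[K] : K →* ℍ[K]) κ := by
      rw [hκ, mul_inv_cancel_left]
    rw [h, Units.val_mul, Algebra.smul_def, Algebra.commutes]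
    rfl
  · rintro ⟨κ, hκ, h⟩
    refine ⟨Units.mk0 κ hκ, ?_⟩
    rw [eq_inv_mul_iff_mul_eq]
    ext1
    rw [h, Algebra.smul_def, Algebra.commutes]
    rfl

theorem isUnit_smul_of_ne_zero {x : ℍ[K]} {κ : K} (hκ : κ ≠ 0) (hx : IsUnit x) :
    IsUnit (κ • x) := by
  rw [Algebra.smul_def]
  exact ((IsUnit.mk0 κ hκ).map (algebraMap K ℍ[K])).mul hx

theorem cls_smul {κ : K} (hκ : κ ≠ 0) (x : ℍ[K]) : cls (κ • x) = cls x := by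
  by_cases hx : IsUnit x
  · exact ((cls_eq_cls_iff hx (isUnit_smul_of_ne_zero hκ hx)).2 ⟨κ, hκ, rfl⟩).symm
  · have h : ¬ IsUnit (κ • x) := fun h => hx <| by
      simpa [smul_smul, inv_mul_cancel₀ hκ] using isUnit_smul_of_ne_zero (inv_ne_zero hκ) h
    rw [cls, cls, dif_neg h, dif_neg hx]

theorem pgl_coe {F : Type*} [Field F] (g : GL (Fin 2) F) :
    pgl (g : Matrix (Fin 2) (Fin 2) F) = Matrix.ProjGenLinGroup.mk g := by
  rw [pgl, dif_pos g.isUnit]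
  congr
  ext1
  rfl

theorem pgl_smul {F : Type*} [Field F] {κ : F} (hκ : κ ≠ 0) (m : Matrix (Fin 2) (Fin 2) F) :
    pgl (κ • m) = pgl m := by
  have key : ∀ {κ : F}, κ ≠ 0 → ∀ {m : Matrix (Fin 2) (Fin 2) F}, IsUnit m → IsUnit (κ • m) := by
    intro κ hκ m hm
    rw [Algebra.smul_def]
    exact ((IsUnit.mk0 κ hκ).map (algebraMap F _)).mul hm
  by_cases hm : IsUnit m
  · obtain ⟨g, rfl⟩ := hm
    have h : κ • (g : Matrix (Fin 2) (Fin 2) F) =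
        ((g * Matrix.GeneralLinearGroup.scalar (Fin 2) (Units.mk0 κ hκ) : GL (Fin 2) F) :
          Matrix (Fin 2) (Fin 2) F) := by
      ext a b
      simp [mul_comm]
    rw [h, pgl_coe, pgl_coe, map_mul, Matrix.ProjGenLinGroup.mk_scalar, mul_one]
  · have h : ¬ IsUnit (κ • m) := fun h => hm <| by
      simpa [smul_smul, inv_mul_cancel₀ hκ] using key (inv_ne_zero hκ) h
    rw [pgl, pgl, dif_neg h, dif_neg hm]

theorem PD.map_cls {L : Type*} [Field L] (f : K →+* L) {x : ℍ[K]} (hx : IsUnit x) :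
    PD.map f (cls x) = cls (mapQuat f x) := by
  obtain ⟨u, rfl⟩ := hx
  rw [cls_coe, show mapQuat f (u : ℍ[K]) = (Units.map (mapQuat f : ℍ[K] →* ℍ[L]) u : (ℍ[L])ˣ) from
    rfl, cls_coe]
  rfl

theorem PD.toPGL_cls {F : Type*} [Field F] [Algebra K F]
    (f : ℍ[K] →ₐ[K] Matrix (Fin 2) (Fin 2) F) {x : ℍ[K]} (hx : IsUnit x) :
    PD.toPGL f (cls x) = pgl (f x) := by
  obtain ⟨u, rfl⟩ := hx
  rw [cls_coe, show f (u : ℍ[K]) =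
    (Units.map (f : ℍ[K] →* Matrix (Fin 2) (Fin 2) F) u : (Matrix (Fin 2) (Fin 2) F)ˣ) from
    rfl, pgl_coe]
  rfl

@[simp]
theorem mapQuat_re {L : Type*} [Field L] (f : K →+* L) (x : ℍ[K]) :
    (mapQuat f x).re = f x.re := rfl

@[simp]
theorem mapQuat_imI {L : Type*} [Field L] (f : K →+* L) (x : ℍ[K]) :
    (mapQuat f x).imI = f x.imI := rfl

@[simp]
theorem mapQuat_imJ {L : Type*} [Field L] (f : K →+* L) (x : ℍ[K]) :
    (mapQuat f x).imJ = f x.imJ := rfl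

@[simp]
theorem mapQuat_imK {L : Type*} [Field L] (f : K →+* L) (x : ℍ[K]) :
    (mapQuat f x).imK = f x.imK := rfl

theorem normSq_mapQuat {L : Type*} [Field L] (f : K →+* L) (x : ℍ[K]) :
    Quaternion.normSq (mapQuat f x) = f (Quaternion.normSq x) := by
  simp [Quaternion.normSq_def']

theorem mapQuat_smul {L : Type*} [Field L] (f : K →+* L) (κ : K) (x : ℍ[K]) :
    mapQuat f (κ • x) = f κ • mapQuat f x := by
  ext <;> simp

theorem isUnit_mapQuat {L : Type*} [Field L] (f : K →+* L) {x : ℍ[K]} (hx : IsUnit x) :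
    IsUnit (mapQuat f x) := hx.map (mapQuat f)

end Quat

section TreeMap

variable {K : Type*} [Field K] [NumberField K] {v : HeightOneSpectrum (𝓞 K)}

theorem treeMap_cls (e : ℍ[v.adicCompletion K] ≃ₐ[v.adicCompletion K]
    Matrix (Fin 2) (Fin 2) (v.adicCompletion K)) {x : ℍ[K]} (hx : IsUnit x) :
    treeMap e (cls x) = pgl (e (mapQuat (algebraMap K (v.adicCompletion K)) x)) := by
  rw [treeMap, MonoidHom.comp_apply, PD.map_cls _ hx, PD.toPGL_cls _ (isUnit_mapQuat _ hx)]
  rfl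

end TreeMap

/-! ### Integral matrices over the completion and their reductions -/

section Local

variable {K : Type*} [Field K] [NumberField K] (v : HeightOneSpectrum (𝓞 K))

/-- The residue field of the completion at `v`. -/
abbrev Residue : Type _ := IsLocalRing.ResidueField (v.adicCompletionIntegers K)

/-- Reduction of integral matrices modulo the maximal ideal. -/
noncomputable def red : Matrix (Fin 2) (Fin 2) (v.adicCompletionIntegers K) →+*
    Matrix (Fin 2) (Fin 2) (Residue v) :=
  (IsLocalRing.residue (v.adicCompletionIntegers K)).mapMatrix

/-- Integral matrices as matrices over the completion. -/
noncomputable def incl : Matrix (Fin 2) (Fin 2) (v.adicCompletionIntegers K) →+*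
    Matrix (Fin 2) (Fin 2) (v.adicCompletion K) :=
  (v.adicCompletionIntegers K).subtype.mapMatrix

theorem incl_apply (M : Matrix (Fin 2) (Fin 2) (v.adicCompletionIntegers K)) (a b : Fin 2) :
    incl v M a b = (M a b : v.adicCompletion K) := rfl

theorem red_apply (M : Matrix (Fin 2) (Fin 2) (v.adicCompletionIntegers K)) (a b : Fin 2) :
    red v M a b = IsLocalRing.residue _ (M a b) := rfl

theorem incl_injective : Function.Injective (incl v) := fun M N h => by
  refine Matrix.ext fun a b => Subtype.ext ?_
  exact congrFun (congrFun h a) b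

theorem det_incl (M : Matrix (Fin 2) (Fin 2) (v.adicCompletionIntegers K)) :
    (incl v M).det = (M.det : v.adicCompletion K) :=
  ((v.adicCompletionIntegers K).subtype.map_det M).symm

theorem det_red (M : Matrix (Fin 2) (Fin 2) (v.adicCompletionIntegers K)) :
    (red v M).det = IsLocalRing.residue _ M.det :=
  ((IsLocalRing.residue (v.adicCompletionIntegers K)).map_det M).symm

theorem residue_eq_zero_iff (z : v.adicCompletionIntegers K) :
    IsLocalRing.residue _ z = 0 ↔ Valued.v (z : v.adicCompletion K) < 1 := by
  rw [IsLocalRing.residue_eq_zero_iff, IsLocalRing.mem_maximalIdeal, mem_nonunits_iff,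
    HeightOneSpectrum.adicCompletionIntegers.isUnit_iff_valued_eq_one]
  exact ⟨fun h => lt_of_le_of_ne z.2 h, fun h => h.ne⟩

theorem valued_algebraMap (x : K) :
    Valued.v (algebraMap K (v.adicCompletion K) x) = v.valuation K x :=
  HeightOneSpectrum.valuedAdicCompletion_eq_valuation' v x

theorem coe_algebraMap_integers (a : 𝓞 K) :
    ((algebraMap (𝓞 K) (v.adicCompletionIntegers K) a : v.adicCompletionIntegers K) :
      v.adicCompletion K) = algebraMap K (v.adicCompletion K) (a : K) := rfl

theorem residue_algebraMap_eq_zero_iff (a : 𝓞 K) :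
    IsLocalRing.residue _ (algebraMap (𝓞 K) (v.adicCompletionIntegers K) a) = 0 ↔
      a ∈ v.asIdeal := by
  rw [residue_eq_zero_iff, coe_algebraMap_integers, valued_algebraMap]
  exact v.valuation_lt_one_iff_mem a

/-- `K` is dense in the completion, so some `x ∈ K` lies within distance less than one of a lift of
`z`. The ultrametric inequality makes `x` integral at `P`, and an element of `K` integral at `P` is
congruent modulo `P` to an algebraic integer. -/
theorem exists_residue_eq (z : Residue v) :
    ∃ a : 𝓞 K, IsLocalRing.residue _ (algebraMap (𝓞 K) (v.adicCompletionIntegers K) a) = z := by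
  obtain ⟨z, rfl⟩ := IsLocalRing.residue_surjective z
  have hopen : IsOpen {y : v.adicCompletion K | Valued.v (y - z) < (1 : WithZero (Multiplicative ℤ))} := by
    rw [isOpen_iff_mem_nhds]
    intro y hy
    rw [Valued.mem_nhds]
    refine ⟨1, fun w hw => ?_⟩
    have : Valued.v (w - y) < (1 : WithZero (Multiplicative ℤ)) := by simpa using hw
    have h2 := Valuation.map_add_lt _ this hy
    simpa using h2
  obtain ⟨y, hy, x, rfl⟩ := (HeightOneSpectrum.denseRange_algebraMap K v).inter_open_nonempty _
    hopen ⟨z, by simp⟩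
  have hx : v.valuation K x ≤ 1 := by
    rw [← valued_algebraMap]
    have h1 := Valuation.map_add Valued.v (algebraMap K (v.adicCompletion K) x - z) z
    rw [sub_add_cancel] at h1
    exact h1.trans (max_le (le_of_lt hy) z.2)
  obtain ⟨a, ha⟩ := v.exists_valuation_sub_lt_of_integer hx 1
  refine ⟨a, ?_⟩
  rw [← sub_eq_zero, ← map_sub, residue_eq_zero_iff]
  have h2 := Valuation.map_add_lt Valued.v (y := algebraMap K (v.adicCompletion K) x - z)
    (x := algebraMap K (v.adicCompletion K) (a - x)) (by rw [valued_algebraMap]; exact ha) hy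
  rw [map_sub, sub_add_sub_cancel] at h2
  exact h2

/-- The residue field has at most as many elements as `𝓞 K ⧸ v`. -/
theorem card_residue_le (h : Finite (𝓞 K ⧸ v.asIdeal)) :
    Finite (Residue v) ∧ Nat.card (Residue v) ≤ Nat.card (𝓞 K ⧸ v.asIdeal) := by
  let f : 𝓞 K ⧸ v.asIdeal →+* Residue v := Ideal.Quotient.lift v.asIdeal
    ((IsLocalRing.residue _).comp (algebraMap (𝓞 K) (v.adicCompletionIntegers K)))
    fun a ha => (residue_algebraMap_eq_zero_iff v a).2 ha
  have hf : Function.Surjective f := fun z => by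
    obtain ⟨a, ha⟩ := exists_residue_eq v z
    exact ⟨Ideal.Quotient.mk _ a, ha⟩
  exact ⟨Finite.of_surjective f hf, Nat.card_le_card_of_surjective f hf⟩

end Local

/-! ### Neighbors of the origin -/

theorem isUnit_iff_det_ne_zero {F : Type*} [Field F] {m : Matrix (Fin 2) (Fin 2) F} :
    IsUnit m ↔ m.det ≠ 0 := by
  rw [Matrix.isUnit_iff_isUnit_det, isUnit_iff_ne_zero]

theorem pgl_mul {F : Type*} [Field F] {m n : Matrix (Fin 2) (Fin 2) F} (hm : IsUnit m)
    (hn : IsUnit n) : pgl (m * n) = pgl m * pgl n := by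
  obtain ⟨g, rfl⟩ := hm
  obtain ⟨h, rfl⟩ := hn
  rw [← Units.val_mul, pgl_coe, pgl_coe, pgl_coe, map_mul]

theorem pgl_eq_pgl_iff {F : Type*} [Field F] {m n : Matrix (Fin 2) (Fin 2) F} (hm : IsUnit m)
    (hn : IsUnit n) : pgl m = pgl n ↔ ∃ κ : F, κ ≠ 0 ∧ n = κ • m := by
  refine ⟨fun h => ?_, ?_⟩
  · obtain ⟨g, rfl⟩ := hm
    obtain ⟨g', rfl⟩ := hn
    rw [pgl_coe, pgl_coe, Matrix.ProjGenLinGroup.mk_eq_mk_iff] at h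
    obtain ⟨u, hu⟩ := h
    refine ⟨u, u.ne_zero, ?_⟩
    rw [← hu]
    ext a b
    simp [mul_comm]
  · rintro ⟨κ, hκ, rfl⟩
    exact (pgl_smul hκ m).symm

theorem valued_det_eq_one_iff {K : Type*} [Field K] [NumberField K] {v : HeightOneSpectrum (𝓞 K)}
    (U : Matrix (Fin 2) (Fin 2) (v.adicCompletionIntegers K)) :
    Valued.v (incl v U).det = 1 ↔ IsUnit U.det := by
  rw [det_incl, HeightOneSpectrum.adicCompletionIntegers.isUnit_iff_valued_eq_one]

section Vertices

variable {K : Type*} [Field K] [NumberField K] {v : HeightOneSpectrum (𝓞 K)}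

/-- The vertex of the tree attached to an invertible matrix. -/
noncomputable def vtx (m : Matrix (Fin 2) (Fin 2) (v.adicCompletion K)) : Vertex v :=
  QuotientGroup.mk (pgl m)

theorem vertexOf_eq (g : GL (Fin 2) (v.adicCompletion K)) :
    vertexOf v g = vtx (g : Matrix (Fin 2) (Fin 2) (v.adicCompletion K)) := by
  rw [vtx, pgl_coe, vertexOf]

theorem pgl_one {F : Type*} [Field F] : pgl (1 : Matrix (Fin 2) (Fin 2) F) = 1 := by
  simpa using pgl_coe (1 : GL (Fin 2) F)

theorem origin_eq : origin v = vtx 1 := by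
  rw [vtx, pgl_one, origin]

theorem vtx_mul_incl {m : Matrix (Fin 2) (Fin 2) (v.adicCompletion K)} (hm : IsUnit m)
    {U : Matrix (Fin 2) (Fin 2) (v.adicCompletionIntegers K)} (hU : IsUnit U.det) :
    vtx (m * incl v U) = vtx m := by
  have h1 : IsUnit U := (Matrix.isUnit_iff_isUnit_det U).2 hU
  rw [vtx, vtx, eq_comm, QuotientGroup.eq, pgl_mul hm (h1.map (incl v)), inv_mul_cancel_left]
  obtain ⟨g, rfl⟩ := h1
  refine ⟨Matrix.ProjGenLinGroup.mk g, ?_⟩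
  rw [show incl v (g : Matrix (Fin 2) (Fin 2) (v.adicCompletionIntegers K)) =
    (Matrix.GeneralLinearGroup.map (v.adicCompletionIntegers K).subtype g : GL (Fin 2) _) from rfl,
    pgl_coe]
  rfl

/-- Equality of vertices gives an integral invertible factor and a scalar `κ`. Comparison of
determinants yields `v(κ)² = 1`, so `κ` is a unit and can be absorbed into the factor. -/
theorem exists_mul_incl_of_vtx_eq {m n : Matrix (Fin 2) (Fin 2) (v.adicCompletion K)}
    (hm : IsUnit m) (hn : IsUnit n) (hd : Valued.v m.det = Valued.v n.det) (h : vtx m = vtx n) :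
    ∃ U : Matrix (Fin 2) (Fin 2) (v.adicCompletionIntegers K), IsUnit U.det ∧
      n = m * incl v U := by
  rw [vtx, vtx, QuotientGroup.eq] at h
  obtain ⟨p, hp⟩ := h
  obtain ⟨g, rfl⟩ := Matrix.ProjGenLinGroup.mk_surjective p
  have h1 : pgl n = pgl (m * incl v (g : Matrix (Fin 2) (Fin 2) (v.adicCompletionIntegers K))) := by
    rw [pgl_mul hm (g.isUnit.map (incl v)), ← inv_mul_eq_iff_eq_mul, ← hp,
      show incl v (g : Matrix (Fin 2) (Fin 2) (v.adicCompletionIntegers K)) =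
      (Matrix.GeneralLinearGroup.map (v.adicCompletionIntegers K).subtype g : GL (Fin 2) _) from
      rfl, pgl_coe]
    rfl
  obtain ⟨κ, hκ, h2⟩ := (pgl_eq_pgl_iff (hm.mul (g.isUnit.map (incl v))) hn).1 h1.symm
  have hg : IsUnit (g : Matrix (Fin 2) (Fin 2) (v.adicCompletionIntegers K)).det :=
    (Matrix.isUnit_iff_isUnit_det _).1 g.isUnit
  have h3 : Valued.v κ ^ 2 = 1 := by
    have h4 := congrArg (fun x => Valued.v x.det) h2
    simp only [Matrix.det_smul, Matrix.det_mul, map_mul, (valued_det_eq_one_iff _).2 hg, mul_one,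
      Fintype.card_fin, map_pow] at h4
    rw [hd] at h4
    have h5 : Valued.v n.det ≠ 0 := (Valuation.ne_zero_iff _).2 (isUnit_iff_det_ne_zero.1 hn)
    exact (mul_eq_right₀ h5).1 h4.symm
  have h4 : Valued.v κ = 1 := by
    rcases lt_trichotomy (Valued.v κ) 1 with h5 | h5 | h5
    · exact absurd h3 (pow_lt_one₀ zero_le h5 two_ne_zero).ne
    · exact h5
    · exact absurd h3 (one_lt_pow₀ h5 two_ne_zero).ne'
  refine ⟨(⟨κ, h4.le⟩ : v.adicCompletionIntegers K) •
    (g : Matrix (Fin 2) (Fin 2) (v.adicCompletionIntegers K)), ?_, ?_⟩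
  · rw [Matrix.det_smul]
    refine IsUnit.mul (IsUnit.pow _ ?_) hg
    exact HeightOneSpectrum.adicCompletionIntegers.isUnit_iff_valued_eq_one.2 h4
  · rw [h2, ← Matrix.mul_smul]
    rfl

/-- `M` is an integral matrix whose determinant is a uniformizer. -/
def IsStep (M : Matrix (Fin 2) (Fin 2) (v.adicCompletionIntegers K)) : Prop :=
  Valued.v (incl v M).det = WithZero.exp (-1 : ℤ)

theorem IsStep.isUnit {M : Matrix (Fin 2) (Fin 2) (v.adicCompletionIntegers K)} (h : IsStep M) :
    IsUnit (incl v M) := by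
  rw [isUnit_iff_det_ne_zero, ← Valuation.ne_zero_iff Valued.v, h]
  exact WithZero.coe_ne_zero

/-- Adjacency allows any `g` that represents the origin. Modulo scalars such a `g` is integral and
invertible, and multiplying the step `m` by it on the left yields another step. -/
theorem treeAdj_origin_iff {w : Vertex v} :
    TreeAdj v (origin v) w ↔ ∃ M, IsStep M ∧ w = vtx (incl v M) := by
  constructor
  · rintro ⟨g, m, hm, hd, hg, rfl⟩
    rw [vertexOf_eq, origin_eq] at hg
    have hg' : g.1.det ≠ 0 := isUnit_iff_det_ne_zero.1 g.isUnit
    rw [vtx, vtx, eq_comm, QuotientGroup.eq, pgl_one, mul_one, ← inv_mem_iff, inv_inv] at hg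
    obtain ⟨p, hp⟩ := hg
    obtain ⟨u, rfl⟩ := Matrix.ProjGenLinGroup.mk_surjective p
    have h1 : pgl (incl v (u : Matrix (Fin 2) (Fin 2) (v.adicCompletionIntegers K))) = pgl g.1 := by
      rw [← hp, show incl v (u : Matrix (Fin 2) (Fin 2) (v.adicCompletionIntegers K)) =
        (Matrix.GeneralLinearGroup.map (v.adicCompletionIntegers K).subtype u : GL (Fin 2) _) from
        rfl, pgl_coe]
      rfl
    let N : Matrix (Fin 2) (Fin 2) (v.adicCompletionIntegers K) := fun a b => ⟨m.1 a b, hm a b⟩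
    have hN : incl v N = m.1 := rfl
    refine ⟨u.1 * N, ?_, ?_⟩
    · rw [IsStep, map_mul, Matrix.det_mul, map_mul, hN, hd, (valued_det_eq_one_iff _).2, one_mul]
      exact (Matrix.isUnit_iff_isUnit_det _).1 u.isUnit
    · rw [vertexOf_eq, vtx, vtx, Units.val_mul, pgl_mul g.isUnit m.isUnit, map_mul,
        pgl_mul (u.isUnit.map (incl v)) (hN ▸ m.isUnit), h1, hN]
  · rintro ⟨M, hM, rfl⟩
    refine ⟨1, hM.isUnit.unit, fun a b => (M a b).2, hM, ?_, ?_⟩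
    · rw [vertexOf_eq, origin_eq]
      rfl
    · rw [vertexOf_eq, one_mul]
      rfl

theorem IsStep.det_red_eq_zero {M : Matrix (Fin 2) (Fin 2) (v.adicCompletionIntegers K)}
    (h : IsStep M) : (red v M).det = 0 := by
  rw [det_red, residue_eq_zero_iff, ← det_incl, h]
  exact WithZero.exp_lt_exp.2 (by norm_num)

theorem le_exp_neg_one_iff {x : WithZero (Multiplicative ℤ)} :
    x ≤ WithZero.exp (-1 : ℤ) ↔ x < 1 := by
  rw [← WithZero.lt_mul_exp_iff_le WithZero.exp_ne_zero, ← WithZero.exp_add]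
  rfl

/-- If all entries were divisible by a uniformizer, the determinant would be divisible by its
square. -/
theorem IsStep.red_ne_zero {M : Matrix (Fin 2) (Fin 2) (v.adicCompletionIntegers K)}
    (h : IsStep M) : red v M ≠ 0 := by
  intro h0
  have key : ∀ a b, Valued.v (M a b : v.adicCompletion K) ≤ WithZero.exp (-1 : ℤ) := fun a b => by
    rw [le_exp_neg_one_iff, ← residue_eq_zero_iff, ← red_apply, h0]
    rfl
  have h1 : Valued.v (incl v M).det ≤ WithZero.exp (-2 : ℤ) := by
    rw [Matrix.det_fin_two]
    refine (Valuation.map_sub _ _ _).trans (max_le ?_ ?_) <;> rw [map_mul] <;>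
    exact (mul_le_mul' (key _ _) (key _ _)).trans (by rw [← WithZero.exp_add]; rfl)
  rw [h, WithZero.exp_le_exp] at h1
  norm_num at h1

/-- `M⁻¹ N` is `adj(M) N` divided by `det M`, a uniformizer. The hypothesis says exactly that this
division leaves an integral matrix, and its determinant is a unit because `M` and `N` have
determinants of the same valuation. -/
theorem vtx_eq_of_adjugate_mul {M N : Matrix (Fin 2) (Fin 2) (v.adicCompletionIntegers K)}
    (hM : IsStep M) (hN : IsStep N) (h : (red v M).adjugate * red v N = 0) :
    vtx (incl v M) = vtx (incl v N) := by
  set d : v.adicCompletion K := (incl v M).det with hd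
  have hdv : Valued.v d = WithZero.exp (-1 : ℤ) := hM
  have hd0 : d ≠ 0 := isUnit_iff_det_ne_zero.1 hM.isUnit
  have key : ∀ a b, Valued.v ((d⁻¹ • ((incl v M).adjugate * incl v N)) a b) ≤ 1 := fun a b => by
    have h1 : red v (M.adjugate * N) = 0 := by
      rw [map_mul, red, RingHom.map_adjugate]
      exact h
    have h2 : Valued.v ((M.adjugate * N) a b : v.adicCompletion K) ≤ WithZero.exp (-1 : ℤ) := by
      rw [le_exp_neg_one_iff, ← residue_eq_zero_iff, ← red_apply, h1]
      rfl
    have h3 : (incl v M).adjugate * incl v N = incl v (M.adjugate * N) := by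
      rw [map_mul, incl, RingHom.map_adjugate]
    rw [h3, Matrix.smul_apply, smul_eq_mul, map_mul, map_inv₀, hdv, incl_apply]
    calc _ ≤ (WithZero.exp (-1 : ℤ))⁻¹ * WithZero.exp (-1 : ℤ) := mul_le_mul_right h2 _
      _ = 1 := inv_mul_cancel₀ WithZero.exp_ne_zero
  let U : Matrix (Fin 2) (Fin 2) (v.adicCompletionIntegers K) := fun a b => ⟨_, key a b⟩
  have hU : incl v U = d⁻¹ • ((incl v M).adjugate * incl v N) := rfl
  have h4 : incl v M * incl v U = incl v N := by
    rw [hU, Matrix.mul_smul, ← mul_assoc, Matrix.mul_adjugate, Matrix.smul_mul, one_mul, smul_smul,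
      ← hd, inv_mul_cancel₀ hd0, one_smul]
  rw [← h4, vtx_mul_incl hM.isUnit]
  rw [← valued_det_eq_one_iff]
  have h5 := congrArg (fun m => Valued.v m.det) h4
  simp only [Matrix.det_mul, map_mul] at h5
  rw [hM, hN] at h5
  exact (mul_eq_left₀ WithZero.exp_ne_zero).1 h5

end Vertices

/-! ### Groups acting freely on the neighbors of the origin -/

section Free

variable {K : Type*} [Field K] [NumberField K] {v : HeightOneSpectrum (𝓞 K)}

/-- The splitting `e` carries the reduced norm and trace to the determinant and trace. -/
structure IsStandard (e : ℍ[v.adicCompletion K] ≃ₐ[v.adicCompletion K]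
    Matrix (Fin 2) (Fin 2) (v.adicCompletion K)) : Prop where
  det_eq : ∀ y, (e y).det = Quaternion.normSq y
  trace_eq : ∀ y, (e y).trace = 2 * y.re

/-- `M` is an integral matrix, the image of `x` under the splitting `e`. -/
def IntModel (e : ℍ[v.adicCompletion K] ≃ₐ[v.adicCompletion K]
    Matrix (Fin 2) (Fin 2) (v.adicCompletion K)) (x : ℍ[K])
    (M : Matrix (Fin 2) (Fin 2) (v.adicCompletionIntegers K)) : Prop :=
  e (mapQuat (algebraMap K (v.adicCompletion K)) x) = incl v M

/-- `m` has no eigenvector. -/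
def NoEigenvector {F : Type*} [Field F] (m : Matrix (Fin 2) (Fin 2) F) : Prop :=
  ∀ u : Fin 2 → F, u ≠ 0 → ∀ r : F, m.mulVec u ≠ r • u

/-- `c` is represented by an integral matrix of unit determinant, without eigenvectors modulo `v`
unless `c = 1`. -/
def IsElliptic (e : ℍ[v.adicCompletion K] ≃ₐ[v.adicCompletion K]
    Matrix (Fin 2) (Fin 2) (v.adicCompletion K)) (c : PD K) : Prop :=
  ∃ x M, IsUnit x ∧ cls x = c ∧ IntModel e x M ∧ IsUnit M.det ∧ (c ≠ 1 → NoEigenvector (red v M))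

variable {e : ℍ[v.adicCompletion K] ≃ₐ[v.adicCompletion K]
    Matrix (Fin 2) (Fin 2) (v.adicCompletion K)}

theorem IntModel.mul {x y : ℍ[K]} {M N : Matrix (Fin 2) (Fin 2) (v.adicCompletionIntegers K)}
    (hx : IntModel e x M) (hy : IntModel e y N) : IntModel e (x * y) (M * N) := by
  rw [IntModel, map_mul, map_mul, hx, hy, map_mul]

theorem IntModel.add {x y : ℍ[K]} {M N : Matrix (Fin 2) (Fin 2) (v.adicCompletionIntegers K)}
    (hx : IntModel e x M) (hy : IntModel e y N) : IntModel e (x + y) (M + N) := by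
  rw [IntModel, map_add, map_add, hx, hy, map_add]

theorem intModel_one : IntModel e 1 1 := by
  rw [IntModel, map_one, map_one, map_one]

theorem IntModel.smul {x : ℍ[K]} {M : Matrix (Fin 2) (Fin 2) (v.adicCompletionIntegers K)} (a : 𝓞 K)
    (hx : IntModel e x M) :
    IntModel e ((a : K) • x) (algebraMap (𝓞 K) (v.adicCompletionIntegers K) a • M) := by
  rw [IntModel, mapQuat_smul, map_smul, hx]
  rfl

theorem IntModel.det (he : IsStandard e) {x : ℍ[K]}
    {M : Matrix (Fin 2) (Fin 2) (v.adicCompletionIntegers K)} (hx : IntModel e x M) :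
    (M.det : v.adicCompletion K) = algebraMap K _ (Quaternion.normSq x) := by
  rw [← det_incl, ← hx, he.det_eq, normSq_mapQuat]

theorem IntModel.trace (he : IsStandard e) {x : ℍ[K]}
    {M : Matrix (Fin 2) (Fin 2) (v.adicCompletionIntegers K)} (hx : IntModel e x M) :
    (M.trace : v.adicCompletion K) = algebraMap K _ (2 * x.re) := by
  have h : (M.trace : v.adicCompletion K) = (incl v M).trace := by
    rw [Matrix.trace_fin_two, Matrix.trace_fin_two]
    rfl
  rw [h, ← hx, he.trace_eq, mapQuat_re, map_mul, map_ofNat]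

theorem IntModel.det_eq (he : IsStandard e) {x : ℍ[K]}
    {M : Matrix (Fin 2) (Fin 2) (v.adicCompletionIntegers K)} (hx : IntModel e x M) {n : 𝓞 K}
    (hn : Quaternion.normSq x = n) : M.det = algebraMap (𝓞 K) _ n := by
  refine Subtype.ext ?_
  rw [hx.det he, hn]
  rfl

theorem IntModel.trace_eq (he : IsStandard e) {x : ℍ[K]}
    {M : Matrix (Fin 2) (Fin 2) (v.adicCompletionIntegers K)} (hx : IntModel e x M) {t : 𝓞 K}
    (ht : 2 * x.re = t) : M.trace = algebraMap (𝓞 K) _ t := by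
  refine Subtype.ext ?_
  rw [hx.trace he, ht]
  rfl

/-- An eigenvalue of the reduction is a root of `z² - tz + n` in the residue field, and it lifts to
an algebraic integer `a` by `exists_residue_eq`. -/
theorem IntModel.noEigenvector (he : IsStandard e) {x : ℍ[K]}
    {M : Matrix (Fin 2) (Fin 2) (v.adicCompletionIntegers K)} (hx : IntModel e x M) {t n : 𝓞 K}
    (ht : 2 * x.re = t) (hn : Quaternion.normSq x = n)
    (h : ∀ a : 𝓞 K, a ^ 2 - t * a + n ∉ v.asIdeal) : NoEigenvector (red v M) := by
  intro u hu r hr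
  obtain ⟨a, rfl⟩ := exists_residue_eq v r
  apply h a
  rw [← residue_algebraMap_eq_zero_iff, map_add, map_sub, map_mul, map_pow, ← hx.det_eq he hn,
    ← hx.trace_eq he ht]
  have h2 : (red v M -
      Matrix.scalar (Fin 2) (IsLocalRing.residue _ (algebraMap (𝓞 K) _ a))).mulVec u = 0 := by
    rw [Matrix.sub_mulVec, hr, sub_eq_zero]
    ext i
    simp [Matrix.mulVec_diagonal]
  have h1 := Matrix.exists_mulVec_eq_zero_iff.1 ⟨u, hu, h2⟩
  rw [Matrix.det_fin_two] at h1
  simp only [red_apply, Matrix.sub_apply, Matrix.scalar_apply, Matrix.diagonal_apply] at h1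
  simp only [Matrix.trace_fin_two, Matrix.det_fin_two, map_add, map_sub, map_mul, map_pow]
  rw [← h1]
  simp
  ring

theorem isElliptic_one : IsElliptic e 1 :=
  ⟨1, 1, isUnit_one, cls_one, intModel_one, by simp, fun h => absurd rfl h⟩

theorem IntModel.isElliptic (he : IsStandard e) {x : ℍ[K]}
    {M : Matrix (Fin 2) (Fin 2) (v.adicCompletionIntegers K)} (hx : IntModel e x M) {t n : 𝓞 K}
    (ht : 2 * x.re = t) (hn : Quaternion.normSq x = n)
    (h : ∀ a : 𝓞 K, a ^ 2 - t * a + n ∉ v.asIdeal) : IsElliptic e (cls x) := by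
  -- The absence of the root `0` says that the norm is prime to `P`, which makes the determinant a
  -- unit.
  have h0 : n ∉ v.asIdeal := by simpa using h 0
  have h1 : IsUnit M.det := by
    rw [HeightOneSpectrum.adicCompletionIntegers.isUnit_iff_valued_eq_one, hx.det_eq he hn,
      coe_algebraMap_integers, valued_algebraMap]
    exact v.valuation_eq_one_iff_notMem.2 h0
  refine ⟨x, M, isUnit_of_normSq_ne_zero ?_, rfl, hx, h1, fun _ => hx.noEigenvector he ht hn h⟩
  rw [hn]
  intro h2
  rw [RingOfIntegers.coe_eq_zero_iff] at h2
  exact h0 (h2 ▸ v.asIdeal.zero_mem)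

/-- The image line of a nonzero singular matrix is determined by a vector in it. -/
theorem exists_mulVec_ne_zero {F : Type*} [Field F] {m : Matrix (Fin 2) (Fin 2) F} (hm : m ≠ 0) :
    ∃ z, m.mulVec z ≠ 0 := by
  by_contra! h
  apply hm
  ext a b
  have := congrFun (h (Pi.single b 1)) a
  simpa using this

theorem exists_smul_of_det_eq_zero {F : Type*} [Field F] {m : Matrix (Fin 2) (Fin 2) F}
    (hm : m.det = 0) {u : Fin 2 → F} (hu : u ≠ 0) {z : Fin 2 → F} (hz : m.mulVec z = u)
    (y : Fin 2 → F) : ∃ r : F, m.mulVec y = r • u := by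
  rw [Matrix.det_fin_two] at hm
  have h0 : m 0 0 * z 0 + m 0 1 * z 1 = u 0 := by
    rw [← hz]; simp [Matrix.mulVec, dotProduct, Fin.sum_univ_two]
  have h1 : m 1 0 * z 0 + m 1 1 * z 1 = u 1 := by
    rw [← hz]; simp [Matrix.mulVec, dotProduct, Fin.sum_univ_two]
  by_cases hu0 : u 0 = 0
  · have hu1 : u 1 ≠ 0 := fun hu1 => hu (by ext i; fin_cases i <;> assumption)
    refine ⟨m.mulVec y 1 / u 1, ?_⟩
    ext i
    fin_cases i
    · simp only [Fin.zero_eta, Pi.smul_apply, smul_eq_mul, hu0, mul_zero]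
      apply mul_right_cancel₀ hu1
      simp only [Matrix.mulVec, dotProduct, Fin.sum_univ_two]
      rw [hu0] at h0
      grind
    · simp [div_mul_cancel₀ _ hu1]
  · refine ⟨m.mulVec y 0 / u 0, ?_⟩
    ext i
    fin_cases i
    · simp [div_mul_cancel₀ _ hu0]
    · simp only [Fin.mk_one, Pi.smul_apply, smul_eq_mul]
      rw [div_mul_eq_mul_div, eq_div_iff hu0]
      simp only [Matrix.mulVec, dotProduct, Fin.sum_univ_two]
      grind

/-- Both matrices have the image line spanned by `u`. Every value of `n` is thus a value of `m`, and
`adj(m) m = det m = 0`. -/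
theorem adjugate_mul_eq_zero {F : Type*} [Field F] {m n : Matrix (Fin 2) (Fin 2) F}
    (hm : m.det = 0) (hn : n.det = 0) {u : Fin 2 → F} (hu : u ≠ 0) {z w : Fin 2 → F} {r : F}
    (hr : r ≠ 0) (hz : m.mulVec z = u) (hw : n.mulVec w = r • u) : m.adjugate * n = 0 := by
  ext a b
  obtain ⟨s, hs⟩ := exists_smul_of_det_eq_zero hn (smul_ne_zero hr hu) hw (Pi.single b 1)
  have h : (m.adjugate * n).mulVec (Pi.single b 1) = 0 := by
    rw [← Matrix.mulVec_mulVec, hs, smul_smul, ← hz, Matrix.mulVec_smul, Matrix.mulVec_mulVec,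
      Matrix.adjugate_mul, hm, zero_smul, Matrix.zero_mulVec, smul_zero]
  have := congrFun h a
  simpa using this

theorem treeMap_smul_vtx {x : ℍ[K]} {M : Matrix (Fin 2) (Fin 2) (v.adicCompletionIntegers K)}
    (hx : IsUnit x) (h : IntModel e x M) {m : Matrix (Fin 2) (Fin 2) (v.adicCompletion K)}
    (hm : IsUnit m) : treeMap e (cls x) • vtx m = vtx (incl v M * m) := by
  have h1 : IsUnit (incl v M) := by
    rw [← h]
    exact (isUnit_mapQuat _ hx).map e
  rw [treeMap_cls e hx, h, vtx, vtx, pgl_mul h1 hm]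
  rfl

theorem IsElliptic.smul_origin {c : PD K} (hc : IsElliptic e c) :
    treeMap e c • origin v = origin v := by
  obtain ⟨x, M, hx, rfl, hM, hd, -⟩ := hc
  rw [origin_eq, treeMap_smul_vtx hx hM isUnit_one, mul_one]
  simpa using vtx_mul_incl (v := v) isUnit_one hd

theorem IsStep.mul_left {M N : Matrix (Fin 2) (Fin 2) (v.adicCompletionIntegers K)}
    (hN : IsStep N) (hM : IsUnit M.det) : IsStep (M * N) := by
  rw [IsStep, map_mul, Matrix.det_mul, map_mul, hN, (valued_det_eq_one_iff _).2 hM, one_mul]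

theorem IsElliptic.smul_adj {c : PD K} (hc : IsElliptic e c) {w : Vertex v}
    (hw : TreeAdj v (origin v) w) : TreeAdj v (origin v) (treeMap e c • w) := by
  obtain ⟨x, M, hx, rfl, hM, hd, -⟩ := hc
  obtain ⟨N, hN, rfl⟩ := treeAdj_origin_iff.1 hw
  rw [treeMap_smul_vtx hx hM hN.isUnit, ← map_mul]
  exact treeAdj_origin_iff.2 ⟨_, hN.mul_left hd, rfl⟩

/-- A fixed neighbour gives `M N = N U` with `U` integral. Modulo `P` the image line of `N` is then
invariant under `M`, so it consists of eigenvectors. -/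
theorem IsElliptic.smul_ne {c : PD K} (hc : IsElliptic e c) (h1 : c ≠ 1) {w : Vertex v}
    (hw : TreeAdj v (origin v) w) : treeMap e c • w ≠ w := by
  obtain ⟨x, M, hx, rfl, hM, hd, hne⟩ := hc
  obtain ⟨N, hN, rfl⟩ := treeAdj_origin_iff.1 hw
  intro h
  rw [treeMap_smul_vtx hx hM hN.isUnit, ← map_mul] at h
  have hMN := hN.mul_left hd
  obtain ⟨U, -, hU⟩ := exists_mul_incl_of_vtx_eq hN.isUnit hMN.isUnit (by rw [hN, hMN]) h.symm
  rw [← map_mul] at hU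
  have h2 := congrArg (red v) (incl_injective v hU)
  rw [map_mul, map_mul] at h2
  obtain ⟨z, hz⟩ := exists_mulVec_ne_zero hN.red_ne_zero
  obtain ⟨r, hr⟩ := exists_smul_of_det_eq_zero hN.det_red_eq_zero hz rfl ((red v U).mulVec z)
  apply hne h1 _ hz r
  rw [Matrix.mulVec_mulVec, h2, ← Matrix.mulVec_mulVec, hr]

/-- The neighbors of the origin. -/
abbrev Neighbor (v : HeightOneSpectrum (𝓞 K)) : Type _ := {w : Vertex v // TreeAdj v (origin v) w}

/-- The neighbors of the origin inject into the projective line over the residue field. -/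
theorem exists_injective_neighbor :
    ∃ f : Neighbor v → Projectivization (Residue v) (Fin 2 → Residue v), Function.Injective f := by
  choose M hM hw using fun w : Neighbor v => treeAdj_origin_iff.1 w.2
  choose z hz using fun w => exists_mulVec_ne_zero (hM w).red_ne_zero
  refine ⟨fun w => Projectivization.mk _ _ (hz w), fun w w' h => ?_⟩
  rw [Projectivization.mk_eq_mk_iff] at h
  obtain ⟨r, hr⟩ := h
  refine Subtype.ext ?_
  rw [hw, hw]
  exact (vtx_eq_of_adjugate_mul (hM w') (hM w) <| adjugate_mul_eq_zero (hM w').det_red_eq_zero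
    (hM w).det_red_eq_zero (hz w') r.ne_zero rfl hr.symm).symm

theorem card_neighbor_le (h : Finite (𝓞 K ⧸ v.asIdeal)) :
    Finite (Neighbor v) ∧ Nat.card (Neighbor v) ≤ Nat.card (𝓞 K ⧸ v.asIdeal) + 1 := by
  obtain ⟨h1, h2⟩ := card_residue_le v h
  obtain ⟨f, hf⟩ := exists_injective_neighbor (v := v)
  refine ⟨Finite.of_injective f hf, (Nat.card_le_card_of_injective f hf).trans ?_⟩
  rw [Projectivization.card_of_finrank_two _ _ (by simp)]
  exact Nat.succ_le_succ h2

theorem injective_smul {U : Subgroup (PD K)} (hU : ∀ c ∈ U, IsElliptic e c) (w : Neighbor v) :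
    Function.Injective fun c : U => (⟨treeMap e c • w.1, (hU c c.2).smul_adj w.2⟩ : Neighbor v) := by
  intro c d h
  have h1 : treeMap e c • w.1 = treeMap e d • w.1 := congrArg Subtype.val h
  by_contra hcd
  refine (hU _ (U.mul_mem (U.inv_mem c.2) d.2)).smul_ne (fun h2 => hcd ?_) w.2 ?_
  · exact Subtype.ext (inv_mul_eq_one.1 h2)
  · rw [map_mul, mul_smul, ← h1, ← mul_smul, ← map_mul, inv_mul_cancel, map_one, one_smul]

theorem card_le_of_isElliptic (h : Finite (𝓞 K ⧸ v.asIdeal)) {U : Subgroup (PD K)}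
    (hU : ∀ c ∈ U, IsElliptic e c) (w : Neighbor v) :
    Finite U ∧ Nat.card U ≤ Nat.card (𝓞 K ⧸ v.asIdeal) + 1 := by
  have h1 := card_neighbor_le h
  have := h1.1
  exact ⟨Finite.of_injective _ (injective_smul hU w),
    (Nat.card_le_card_of_injective _ (injective_smul hU w)).trans h1.2⟩

/-- The orbit map at `x` is injective because the action is free. Its source has at least `N(P) + 1`
elements and its target at most that many, so it is a bijection. -/
theorem simply_transitive_of_isElliptic (h : Finite (𝓞 K ⧸ v.asIdeal)) {C : Subgroup (PD K)}
    (hC : ∀ c ∈ C, IsElliptic e c) (hcard : Nat.card (𝓞 K ⧸ v.asIdeal) + 1 ≤ Nat.card C)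
    {x y : Vertex v} (hx : TreeAdj v (origin v) x) (hy : TreeAdj v (origin v) y) :
    ∃! c : PD K, c ∈ C ∧ treeMap e c • x = y := by
  have h1 := card_neighbor_le h
  have := h1.1
  have hinj := injective_smul hC ⟨x, hx⟩
  have := Finite.of_injective _ hinj
  have hbij := hinj.bijective_of_nat_card_le (h1.2.trans hcard)
  obtain ⟨c, hc⟩ := hbij.2 ⟨y, hy⟩
  refine ⟨c, ⟨c.2, congrArg Subtype.val hc⟩, fun d hd => ?_⟩
  have := @hbij.1 ⟨d, hd.1⟩ c (Subtype.ext (hd.2.trans (congrArg Subtype.val hc).symm))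
  exact congrArg Subtype.val this

end Free

/-! ### Free products with a group of order two -/

section FreeProduct

variable {G : Type*} [Group G]

/-- The products `T c₁ T c₂ ⋯ T cₙ` with `n ≥ 1`, where only `cₙ` may be trivial. -/
inductive AltProd (C : Subgroup G) (T : G) : G → Prop
  | last (c : G) (hc : c ∈ C) : AltProd C T (T * c)
  | cons (c g : G) (hc : c ∈ C) (h1 : c ≠ 1) (hg : AltProd C T g) : AltProd C T (T * c * g)

/-- The homomorphism from `ℤ/2ℤ` given by an element of square one. -/
def zmodTwoHom (T : G) (hT : T * T = 1) : Multiplicative (ZMod 2) →* G where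
  toFun z := T ^ (z.toAdd : ZMod 2).val
  map_one' := by simp
  map_mul' x y := by
    revert x y
    refine Multiplicative.forall.2 fun x => Multiplicative.forall.2 fun y => ?_
    rw [← ofAdd_add, toAdd_ofAdd, toAdd_ofAdd, toAdd_ofAdd]
    have h1 : ∀ x : ZMod 2, x = 0 ∨ x = 1 := by decide
    rcases h1 x with rfl | rfl <;> rcases h1 y with rfl | rfl <;>
      simp [hT, show (1 : ZMod 2) + 1 = 0 from rfl, ZMod.val_one]

/-- Every word of the coproduct reduces to some `c` or to `c w'` with `w'` an alternating word that
begins with `T`. If `c w'` were mapped to `1`, the alternating product `w'` would be mapped to `c⁻¹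
∈ C`, which is excluded. -/
theorem isFreeProduct_of_altProd {C : Subgroup G} {T : G} (hT : T * T = 1)
    (h : ∀ g, AltProd C T g → g ∉ C) : IsFreeProduct C T := by
  let t : Multiplicative (ZMod 2) := Multiplicative.ofAdd 1
  let f : Monoid.Coprod C (Multiplicative (ZMod 2)) →* G :=
    Monoid.Coprod.lift C.subtype (zmodTwoHom T hT)
  have hft : f (Monoid.Coprod.inr t) = T := by
    simp [f, t, zmodTwoHom, ZMod.val_one]
  have hfc : ∀ c, f (Monoid.Coprod.inl c) = c := fun c => by simp [f]
  have htt : (Monoid.Coprod.inr t : Monoid.Coprod C (Multiplicative (ZMod 2))) *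
      Monoid.Coprod.inr t = 1 := by
    rw [← map_mul, show t * t = 1 by decide, map_one]
  have hz : ∀ z : Multiplicative (ZMod 2), z = 1 ∨ z = t := by decide
  have key : ∀ w : Monoid.Coprod C (Multiplicative (ZMod 2)), ∃ c : C,
      w = Monoid.Coprod.inl c ∨ ∃ w', AltProd (Monoid.Coprod.inl : C →* Monoid.Coprod C
        (Multiplicative (ZMod 2))).range (Monoid.Coprod.inr t) w' ∧
        w = Monoid.Coprod.inl c * w' := by
    intro w
    induction w using Monoid.Coprod.induction_on' with
    | one => exact ⟨1, Or.inl (map_one _).symm⟩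
    | inl_mul d w ih =>
      obtain ⟨c, rfl | ⟨w', hw', rfl⟩⟩ := ih
      · exact ⟨d * c, Or.inl (map_mul _ _ _).symm⟩
      · exact ⟨d * c, Or.inr ⟨w', hw', by rw [map_mul, mul_assoc]⟩⟩
    | inr_mul z w ih =>
      rcases hz z with rfl | rfl
      · simpa using ih
      obtain ⟨c, rfl | ⟨w', hw', rfl⟩⟩ := ih
      · exact ⟨1, Or.inr ⟨_, AltProd.last _ ⟨c, rfl⟩, by rw [map_one, one_mul]⟩⟩
      -- When `c` is trivial the new `T` meets the leading `T` of `w'` and the two cancel; otherwise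
      -- the alternating word becomes longer.
      by_cases hc : c = 1
      · subst hc
        rw [map_one, one_mul]
        cases hw' with
        | last d hd =>
          obtain ⟨d, rfl⟩ := hd
          exact ⟨d, Or.inl (by rw [← mul_assoc, htt, one_mul])⟩
        | cons d g hd h1 hg =>
          obtain ⟨d, rfl⟩ := hd
          exact ⟨d, Or.inr ⟨g, hg, by rw [← mul_assoc, ← mul_assoc, htt, one_mul]⟩⟩
      · refine ⟨1, Or.inr ⟨_, AltProd.cons _ _ ⟨c, rfl⟩ (fun h1 => hc ?_) hw', ?_⟩⟩
        · exact Monoid.Coprod.inl_injective (h1.trans (map_one _).symm)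
        · rw [map_one, one_mul, mul_assoc]
  have hAlt : ∀ w, AltProd (Monoid.Coprod.inl : C →* Monoid.Coprod C
      (Multiplicative (ZMod 2))).range (Monoid.Coprod.inr t) w → AltProd C T (f w) := by
    intro w hw
    induction hw with
    | last d hd =>
      obtain ⟨d, rfl⟩ := hd
      rw [map_mul, hft, hfc]
      exact AltProd.last _ d.2
    | cons d g hd h1 hg ih =>
      obtain ⟨d, rfl⟩ := hd
      rw [map_mul, map_mul, hft, hfc]
      refine AltProd.cons _ _ d.2 (fun h2 => h1 ?_) ih
      rw [show d = 1 from Subtype.ext h2, map_one]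
  have hinj : Function.Injective f := by
    rw [injective_iff_map_eq_one]
    intro w hw
    obtain ⟨c, rfl | ⟨w', hw', rfl⟩⟩ := key w
    · rw [hfc] at hw
      rw [show c = 1 from Subtype.ext hw, map_one]
    · rw [map_mul, hfc] at hw
      refine absurd ?_ (h _ (hAlt w' hw'))
      rw [← inv_eq_of_mul_eq_one_right hw]
      exact C.inv_mem c.2
  have hrange : f.range = C ⊔ Subgroup.zpowers T := by
    rw [Monoid.Coprod.range_lift, Subgroup.range_subtype]
    congr 1
    apply le_antisymm
    · rintro _ ⟨z, rfl⟩
      exact Subgroup.npow_mem_zpowers T _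
    · rw [Subgroup.zpowers_le]
      exact ⟨t, by simp [t, zmodTwoHom, ZMod.val_one]⟩
  refine ⟨(MonoidHom.ofInjective hinj).trans (MulEquiv.subgroupCongr hrange), fun c => ?_, ?_⟩
  · exact hfc c
  · exact hft

theorem isFreeProduct_map {G' : Type*} [Group G'] (f : G →* G') (hf : Function.Injective f)
    {C : Subgroup G} {T : G} (hT : T * T = 1) (h : ∀ g, AltProd C T g → g ∉ C) :
    IsFreeProduct (C.map f) (f T) := by
  have key : ∀ g', AltProd (C.map f) (f T) g' → ∃ g, AltProd C T g ∧ f g = g' := by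
    intro g' hg'
    induction hg' with
    | last d hd =>
      obtain ⟨d, hd, rfl⟩ := hd
      exact ⟨_, AltProd.last d hd, map_mul _ _ _⟩
    | cons d g hd h1 hg ih =>
      obtain ⟨d, hd, rfl⟩ := hd
      obtain ⟨g, hg', rfl⟩ := ih
      exact ⟨_, AltProd.cons d g hd (fun h2 => h1 (by rw [h2, map_one])) hg', by simp⟩
  refine isFreeProduct_of_altProd (by rw [← map_mul, hT, map_one]) fun g' hg' => ?_
  obtain ⟨g, hg, rfl⟩ := key g' hg'
  rintro ⟨c, hc, hcg⟩
  exact h g hg (hf hcg ▸ hc)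

end FreeProduct

/-! ### Super-Golden-Gate sets -/

section Gates

variable {K : Type*} [Field K] [NumberField K] {v : HeightOneSpectrum (𝓞 K)}
variable {e : ℍ[v.adicCompletion K] ≃ₐ[v.adicCompletion K]
    Matrix (Fin 2) (Fin 2) (v.adicCompletion K)}

/-- `T` is represented by a pure quaternion with an integral matrix whose determinant is a
uniformizer. -/
def IsFlip (e : ℍ[v.adicCompletion K] ≃ₐ[v.adicCompletion K]
    Matrix (Fin 2) (Fin 2) (v.adicCompletion K)) (T : PD K) : Prop :=
  ∃ x M, IsUnit x ∧ cls x = T ∧ x.re = 0 ∧ IntModel e x M ∧ IsStep M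

theorem mul_self_of_re_eq_zero {F : Type*} [Field F] [CharZero F] {x : ℍ[F]} (hx : x.re = 0) :
    x * x = -((Quaternion.normSq x : F) : ℍ[F]) := by
  rw [← Quaternion.self_mul_star, Quaternion.star_eq_neg.2 hx, mul_neg, neg_neg]

theorem IsFlip.mul_self {T : PD K} (hT : IsFlip e T) : T * T = 1 := by
  obtain ⟨x, M, hx, rfl, h0, -, -⟩ := hT
  rw [← cls_mul hx hx, mul_self_of_re_eq_zero h0, ← Quaternion.coe_neg,
    show ((-Quaternion.normSq x : K) : ℍ[K]) = (-Quaternion.normSq x) • (1 : ℍ[K]) by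
    rw [← Quaternion.coe_one, Quaternion.smul_coe, mul_one], cls_smul, cls_one]
  exact neg_ne_zero.2 (isUnit_iff_normSq_ne_zero.1 hx)

theorem IsFlip.smul_origin {T : PD K} (hT : IsFlip e T) :
    TreeAdj v (origin v) (treeMap e T • origin v) := by
  obtain ⟨x, M, hx, rfl, -, hM, hs⟩ := hT
  rw [treeAdj_origin_iff]
  refine ⟨M, hs, ?_⟩
  rw [origin_eq, treeMap_smul_vtx hx hM isUnit_one, mul_one]

theorem exp_neg_one_lt_one : (WithZero.exp (-1 : ℤ)) < 1 := WithZero.exp_lt_exp.2 (by norm_num)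

/-- An integral matrix, nonzero modulo `v`, with nonunit determinant does not represent an element
that is also represented by an integral matrix of unit determinant. -/
theorem cls_ne_cls_of_red_ne_zero {x y : ℍ[K]} (hx : IsUnit x) (hy : IsUnit y)
    {X Y : Matrix (Fin 2) (Fin 2) (v.adicCompletionIntegers K)} (hX : IntModel e x X)
    (hY : IntModel e y Y) (h0 : red v X ≠ 0) (hd : (red v X).det = 0) (hYd : IsUnit Y.det) :
    cls x ≠ cls y := by
  intro h
  obtain ⟨κ, hκ, rfl⟩ := (cls_eq_cls_iff hy hx).1 h.symm
  have h1 : Valued.v (incl v X).det < 1 := by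
    rwa [det_incl, ← residue_eq_zero_iff, ← det_red]
  rw [← hX, mapQuat_smul, map_smul, hY, Matrix.det_smul, map_mul, (valued_det_eq_one_iff _).2 hYd,
    mul_one, Fintype.card_fin, map_pow] at h1
  -- From `det X = κ² det Y` with `det Y` a unit, `κ` lies in the maximal ideal. Then `X = κ Y`
  -- vanishes modulo `v`.
  have h2 : Valued.v (algebraMap K (v.adicCompletion K) κ) < 1 := by
    by_contra! h3
    exact absurd h1 (one_le_pow₀ h3).not_gt
  apply h0
  ext a b
  have h3 : (X a b : v.adicCompletion K) = algebraMap K _ κ * (Y a b : v.adicCompletion K) := by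
    rw [← incl_apply, ← hX, mapQuat_smul, map_smul, hY]
    rfl
  rw [red_apply, Matrix.zero_apply, residue_eq_zero_iff, h3, map_mul]
  exact mul_lt_one_of_lt_of_le h2 (Y a b).2

theorem exists_smul_of_mulVec_eq_zero {F : Type*} [Field F] {m : Matrix (Fin 2) (Fin 2) F}
    (hm : m ≠ 0) {u w : Fin 2 → F} (hu : u ≠ 0) (h1 : m.mulVec u = 0) (h2 : m.mulVec w = 0) :
    ∃ r : F, w = r • u := by
  have h3 : u 0 * w 1 = u 1 * w 0 := by
    by_contra h
    apply hm
    ext a b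
    have h4 := congrFun h1 a
    have h5 := congrFun h2 a
    simp only [Matrix.mulVec, dotProduct, Fin.sum_univ_two, Pi.zero_apply] at h4 h5
    fin_cases b
    · simp only [Fin.zero_eta, Matrix.zero_apply]
      grind
    · simp only [Fin.mk_one, Matrix.zero_apply]
      grind
  by_cases hu0 : u 0 = 0
  · have hu1 : u 1 ≠ 0 := fun hu1 => hu (by ext i; fin_cases i <;> assumption)
    refine ⟨w 1 / u 1, ?_⟩
    ext i
    fin_cases i
    · simp only [Fin.zero_eta, Pi.smul_apply, smul_eq_mul]
      grind
    · simp [div_mul_cancel₀ _ hu1]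
  · refine ⟨w 0 / u 0, ?_⟩
    ext i
    fin_cases i
    · simp [div_mul_cancel₀ _ hu0]
    · simp only [Fin.mk_one, Pi.smul_apply, smul_eq_mul]
      grind

theorem mul_self_eq_zero_of_trace_eq_zero {F : Type*} [Field F] {m : Matrix (Fin 2) (Fin 2) F}
    (ht : m.trace = 0) (hd : m.det = 0) : m * m = 0 := by
  rw [Matrix.trace_fin_two] at ht
  rw [Matrix.det_fin_two] at hd
  ext a b
  fin_cases a <;> fin_cases b <;> simp [Matrix.mul_apply, Fin.sum_univ_two] <;> grind

/-- Modulo `P` the matrix `N` of `T` satisfies `N² = 0`, having trace and determinant zero; its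
kernel and its image are one line. By induction, each alternating product has an integral
representative that is nonzero modulo `P` and is killed by `N` from the left. Such a matrix is
singular modulo `P`, whereas the elements of `C` have representatives of unit determinant. -/
theorem notMem_of_altProd (he : IsStandard e) {C : Subgroup (PD K)}
    (hC : ∀ c ∈ C, IsElliptic e c) {T : PD K} (hT : IsFlip e T) (g : PD K)
    (hg : AltProd C T g) : g ∉ C := by
  obtain ⟨τ, N, hτ, rfl, hre, hN, hs⟩ := hT
  have hNN : red v N * red v N = 0 := by
    refine mul_self_eq_zero_of_trace_eq_zero ?_ hs.det_red_eq_zero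
    have h5 : N.trace = 0 := by
      refine Subtype.ext ?_
      rw [hN.trace he, hre, mul_zero, map_zero]
      rfl
    rw [Matrix.trace_fin_two] at h5 ⊢
    rw [red_apply, red_apply, ← map_add, h5, map_zero]
  have key : ∃ x X, IsUnit x ∧ cls x = g ∧ IntModel e x X ∧ red v X ≠ 0 ∧
      red v N * red v X = 0 := by
    induction hg with
    | last c hc =>
      obtain ⟨x, X, hx, rfl, hX, hd, -⟩ := hC c hc
      refine ⟨τ * x, N * X, hτ.mul hx, cls_mul hτ hx, hN.mul hX, fun h => ?_, ?_⟩
      · have h1 : IsUnit (red v X) := ((Matrix.isUnit_iff_isUnit_det X).2 hd).map (red v)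
        rw [map_mul, h1.mul_left_eq_zero] at h
        exact hs.red_ne_zero h
      · rw [map_mul, ← mul_assoc, hNN, zero_mul]
    | cons c g hc h1 hg ih =>
      obtain ⟨x, X, hx, rfl, hX, hd, hne⟩ := hC c hc
      obtain ⟨y, Y, hy, rfl, hY, hY0, hNY⟩ := ih
      refine ⟨τ * x * y, N * X * Y, (hτ.mul hx).mul hy, ?_, (hN.mul hX).mul hY, fun h => ?_, ?_⟩
      · rw [cls_mul (hτ.mul hx) hy, cls_mul hτ hx]
      -- A nonzero vector in the image of `Y` spans the kernel of `N`. If `N X Y` were zero, `X`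
      -- would send this vector back into the kernel, so it would be an eigenvector of `X`.
      · obtain ⟨z, hz⟩ := exists_mulVec_ne_zero hY0
        have h2 : (red v N).mulVec ((red v X).mulVec ((red v Y).mulVec z)) = 0 := by
          rw [Matrix.mulVec_mulVec, Matrix.mulVec_mulVec, ← map_mul, ← map_mul, h,
            Matrix.zero_mulVec]
        have h3 : (red v N).mulVec ((red v Y).mulVec z) = 0 := by
          rw [Matrix.mulVec_mulVec, hNY, Matrix.zero_mulVec]
        obtain ⟨r, hr⟩ := exists_smul_of_mulVec_eq_zero hs.red_ne_zero hz h3 h2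
        exact hne h1 _ hz r hr
      · rw [map_mul, map_mul, mul_assoc, ← mul_assoc, hNN, zero_mul]
  obtain ⟨x, X, hx, rfl, hX, hX0, hNX⟩ := key
  intro hgC
  obtain ⟨y, Y, hy, hyx, hY, hYd, -⟩ := hC _ hgC
  refine cls_ne_cls_of_red_ne_zero hx hy hX hY hX0 ?_ hYd hyx.symm
  by_contra h
  have h1 : IsUnit (red v X) := (Matrix.isUnit_iff_isUnit_det _).2 (isUnit_iff_ne_zero.2 h)
  rw [h1.mul_left_eq_zero] at hNX
  exact hs.red_ne_zero hNX

theorem isSuperGoldenGateSet (hK : IsTotallyReal K) {O : Subalgebra (𝓞 K) ℍ[K]} (hO : IsOrder O)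
    (hq : Finite (𝓞 K ⧸ v.asIdeal)) {C : Subgroup (PD K)} {T : PD K}
    (hΛ : ∃ Λ : Subgroup (PD K), IsArithmetic v O Λ ∧ C ≤ Λ ∧ T ∈ Λ)
    (he : IsStandard e) (hC : ∀ c ∈ C, IsElliptic e c)
    (hcard : Nat.card (𝓞 K ⧸ v.asIdeal) + 1 ≤ Nat.card C) (hT : IsFlip e T) :
    IsSuperGoldenGateSet O e C T where
  totallyReal := hK
  order := hO
  arithmetic := hΛ
  finite := (card_le_of_isElliptic hq hC ⟨_, hT.smul_origin⟩).1
  fixes_origin c hc := (hC c hc).smul_origin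
  simply_transitive _ _ hx hy := simply_transitive_of_isElliptic hq hC hcard hx hy
  involution := by
    refine orderOf_eq_prime (by rw [pow_two, hT.mul_self]) fun h => ?_
    -- If `T` were trivial, the alternating product `T · 1` would lie in `C`.
    have h1 := AltProd.last (C := C) (T := T) 1 C.one_mem
    rw [h, mul_one] at h1
    exact notMem_of_altProd he hC hT 1 (h ▸ h1) C.one_mem
  inverts_edge := by
    refine ⟨_, hT.smul_origin, rfl, ?_⟩
    rw [← mul_smul, ← map_mul, hT.mul_self, map_one, one_smul]

end Gates

/-! ### The comparison with `PU(2)` -/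

section PU

variable {K : Type*} [Field K]

theorem quatToMat_apply (x : ℍ[ℝ]) : quatToMat x =
    !![x.re + Complex.I * x.imI, x.imJ + Complex.I * x.imK;
    -x.imJ + Complex.I * x.imK, x.re - Complex.I * x.imI] := rfl

theorem toPU_cls (σ : K →+* ℝ) {x : ℍ[K]} (hx : IsUnit x) :
    toPU σ (cls x) = pgl (quatToMat (mapQuat σ x)) := by
  rw [toPU, MonoidHom.comp_apply, PD.map_cls _ hx, PD.toPGL_cls _ (isUnit_mapQuat _ hx)]

theorem toPU_injective (σ : K →+* ℝ) : Function.Injective (toPU σ) := by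
  rw [injective_iff_map_eq_one]
  intro c hc
  obtain ⟨u, rfl⟩ := exists_cls_eq c
  have hu := (isUnit_mapQuat σ u.isUnit).map quatToMat
  rw [toPU_cls σ u.isUnit, ← pgl_one, eq_comm, pgl_eq_pgl_iff isUnit_one hu] at hc
  obtain ⟨κ, hκ, h⟩ := hc
  rw [quatToMat_apply] at h
  have h00 := congrFun (congrFun h 0) 0
  have h01 := congrFun (congrFun h 0) 1
  have h10 := congrFun (congrFun h 1) 0
  have h11 := congrFun (congrFun h 1) 1
  simp [Complex.ext_iff] at h00 h01 h10 h11
  have hre : u.1 = u.1.re • (1 : ℍ[K]) := by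
    have h1 : σ u.1.imI = 0 := by linarith [h00.2, h11.2]
    have h2 : u.1.imI = 0 := (map_eq_zero σ).1 h1
    ext <;> simp_all
  have h0 : u.1.re ≠ 0 := fun h0 => by
    rw [h0, zero_smul] at hre
    exact u.ne_zero hre
  rw [hre, cls_smul h0, cls_one]

/-- Division by the square root of the norm does not change the class, and the matrix of a
quaternion of norm one is unitary because the conjugate transpose corresponds to the conjugate
quaternion. -/
theorem pgl_quatToMat_mem_PU2 {x : ℍ[ℝ]} (hx : IsUnit x) : pgl (quatToMat x) ∈ PU2 := by
  have hn : 0 < Quaternion.normSq x :=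
    lt_of_le_of_ne (Quaternion.normSq_nonneg) (isUnit_iff_normSq_ne_zero.1 hx).symm
  set r : ℝ := (√(Quaternion.normSq x))⁻¹ with hr
  have hr0 : r ≠ 0 := inv_ne_zero (Real.sqrt_ne_zero'.2 hn)
  have hr2 : r ^ 2 * Quaternion.normSq x = 1 := by
    rw [hr, inv_pow, Real.sq_sqrt hn.le, inv_mul_cancel₀ hn.ne']
  have hstar : ∀ y : ℍ[ℝ], star (quatToMat y) = quatToMat (star y) := fun y => by
    ext a b
    fin_cases a <;> fin_cases b <;>
      simp [quatToMat_apply, Matrix.star_apply, sub_eq_add_neg]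
  have hN : Quaternion.normSq (r • x) = 1 := by rw [Quaternion.normSq_smul, hr2]
  have hU : quatToMat (r • x) ∈ unitary (Matrix (Fin 2) (Fin 2) ℂ) := by
    constructor
    · rw [hstar, ← map_mul, Quaternion.star_mul_self, hN, Quaternion.coe_one, map_one]
    · rw [hstar, ← map_mul, Quaternion.self_mul_star, hN, Quaternion.coe_one, map_one]
  have h1 : pgl (quatToMat x) = pgl (quatToMat (r • x)) := by
    rw [map_smul, show r • quatToMat x = (r : ℂ) • quatToMat x by ext; simp,
      pgl_smul (Complex.ofReal_ne_zero.2 hr0)]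
  rw [h1]
  refine ⟨⟨_, hU⟩, ?_⟩
  rw [MonoidHom.comp_apply, ← pgl_coe]
  rfl

theorem toPU_mem_PU2 (σ : K →+* ℝ) (c : PD K) : toPU σ c ∈ PU2 := by
  obtain ⟨u, rfl⟩ := exists_cls_eq c
  rw [toPU_cls σ u.isUnit]
  exact pgl_quatToMat_mem_PU2 (isUnit_mapQuat σ u.isUnit)

theorem correspondsTo (σ : K →+* ℝ) {C : Subgroup (PD K)} {T : PD K}
    {C' : Subgroup (PGL(2, ℂ))} {T' : PGL(2, ℂ)} (hC : C.map (toPU σ) = C') (hT : toPU σ T = T')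
    (hTT : T * T = 1) (h : ∀ g, AltProd C T g → g ∉ C) : CorrespondsTo σ C T C' T' := by
  subst hC hT
  refine ⟨?_, toPU_mem_PU2 σ T, rfl, rfl, isFreeProduct_of_altProd hTT h,
    isFreeProduct_map _ (toPU_injective σ) hTT h⟩
  rintro _ ⟨c, -, rfl⟩
  exact toPU_mem_PU2 σ c

end PU

/-! ### The splittings as isomorphisms -/

section Splitting

variable {F : Type*} [Field F] [CharZero F]

/-- An algebra equivalence onto `M₂(F)` from a multiplicative linear bijection. -/
def algEquivOfLinear (f : ℍ[F] → Matrix (Fin 2) (Fin 2) F) (g : Matrix (Fin 2) (Fin 2) F → ℍ[F])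
    (hl : ∀ x, g (f x) = x) (hr : ∀ m, f (g m) = m) (hm : ∀ x y, f (x * y) = f x * f y)
    (ha : ∀ x y, f (x + y) = f x + f y) (hc : ∀ r : F, f r = algebraMap F _ r) :
    ℍ[F] ≃ₐ[F] Matrix (Fin 2) (Fin 2) F where
  toFun := f
  invFun := g
  left_inv := hl
  right_inv := hr
  map_mul' := hm
  map_add' := ha
  commutes' := hc

/-- The relation `α² + β² = -1` makes the images of `j` and `k`, which are symmetric of trace zero,
square to `-1`; `i` goes to the rotation by a quarter turn. The splittings `A`, `B`, `E` and `I` are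
all of this kind, with `(α, β)` equal to `(1, ρ)`, `(2, ρ)`, `((1 + ρ)/2, (1 - ρ)/2)` and `((√5 -
ρ)/2, (√5 + ρ)/2)`. -/
theorem exists_splitInert {α β : F} (h : α ^ 2 + β ^ 2 = -1) :
    ∃ e : ℍ[F] ≃ₐ[F] Matrix (Fin 2) (Fin 2) F, ∀ x, e x = splitInert α β x := by
  refine ⟨algEquivOfLinear (splitInert α β) (fun m => ⟨(m 0 0 + m 1 1) / 2, (m 0 1 - m 1 0) / 2,
    -((m 0 0 - m 1 1) / 2 * α + (m 0 1 + m 1 0) / 2 * β),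
    -((m 0 0 - m 1 1) / 2 * β - (m 0 1 + m 1 0) / 2 * α)⟩) ?_ ?_ ?_ ?_ ?_, fun x => rfl⟩
  · intro x
    ext <;> simp [splitInert] <;> grind
  · intro m
    ext a b
    fin_cases a <;> fin_cases b <;> simp [splitInert] <;> grind
  · intro x y
    ext a b
    fin_cases a <;> fin_cases b <;>
      simp [splitInert, Matrix.mul_apply, Fin.sum_univ_two] <;> grind
  · intro x y
    ext a b
    fin_cases a <;> fin_cases b <;> simp [splitInert] <;> ring
  · intro r
    ext a b
    fin_cases a <;> fin_cases b <;> simp [splitInert, Matrix.algebraMap_matrix_apply]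

theorem exists_splitOne {ρ : F} (h : ρ ^ 2 = -1) :
    ∃ e : ℍ[F] ≃ₐ[F] Matrix (Fin 2) (Fin 2) F, ∀ x, e x = splitOne ρ x := by
  refine ⟨algEquivOfLinear (splitOne ρ) (fun m => ⟨(m 0 0 + m 1 1) / 2,
    -ρ * (m 0 0 - m 1 1) / 2, (m 0 1 - m 1 0) / 2, -ρ * (m 0 1 + m 1 0) / 2⟩)
    ?_ ?_ ?_ ?_ ?_, fun x => rfl⟩
  · intro x
    ext <;> simp [splitOne] <;> grind
  · intro m
    ext a b
    fin_cases a <;> fin_cases b <;> simp [splitOne] <;> grind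
  · intro x y
    ext a b
    fin_cases a <;> fin_cases b <;>
      simp [splitOne, Matrix.mul_apply, Fin.sum_univ_two] <;> grind
  · intro x y
    ext a b
    fin_cases a <;> fin_cases b <;> simp [splitOne] <;> ring
  · intro r
    ext a b
    fin_cases a <;> fin_cases b <;> simp [splitOne, Matrix.algebraMap_matrix_apply]

theorem exists_splitRamified {r α β : F} (hr : r ^ 2 = 2) (h : α ^ 2 + β ^ 2 = -1) :
    ∃ e : ℍ[F] ≃ₐ[F] Matrix (Fin 2) (Fin 2) F, ∀ x, e x = splitRamified r α β x := by
  refine ⟨algEquivOfLinear (splitRamified r α β) (fun m =>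
    -- Here `y = b + cα + dβ` and `z = b - cβ + dα` are read off the corners, with `1/r = r/2`. Half
    -- the difference of the diagonal entries is `y + z - b`, which gives `b`; the remaining system
    -- for `c, d` has determinant `α² + β² = -1`.
    let y := m 0 1 * r / 2
    let z := -m 1 0 * r / 2
    let b := y + z - (m 0 0 - m 1 1) / 2
    ⟨(m 0 0 + m 1 1) / 2, b, -((y - b) * α - (z - b) * β), -((y - b) * β + (z - b) * α)⟩)
    ?_ ?_ ?_ ?_ ?_, fun x => rfl⟩
  · intro x
    ext <;> simp [splitRamified] <;> grind
  · intro m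
    ext a b
    fin_cases a <;> fin_cases b <;> simp [splitRamified] <;> grind
  · intro x y
    ext a b
    fin_cases a <;> fin_cases b <;>
      simp [splitRamified, Matrix.mul_apply, Fin.sum_univ_two] <;> grind
  · intro x y
    ext a b
    fin_cases a <;> fin_cases b <;> simp [splitRamified] <;> ring
  · intro r
    ext a b
    fin_cases a <;> fin_cases b <;> simp [splitRamified, Matrix.algebraMap_matrix_apply]

theorem det_splitInert {F : Type*} [Field F] {α β : F} (h : α ^ 2 + β ^ 2 = -1) (x : ℍ[F]) :
    (splitInert α β x).det = Quaternion.normSq x := by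
  rw [splitInert, Matrix.det_fin_two_of, Quaternion.normSq_def']
  linear_combination (-x.imJ ^ 2 - x.imK ^ 2) * h

theorem det_splitOne {F : Type*} [Field F] {ρ : F} (h : ρ ^ 2 = -1) (x : ℍ[F]) :
    (splitOne ρ x).det = Quaternion.normSq x := by
  rw [splitOne, Matrix.det_fin_two_of, Quaternion.normSq_def']
  linear_combination (-x.imI ^ 2 - x.imK ^ 2) * h

theorem det_splitRamified {r α β : F} (hr : r ^ 2 = 2) (h : α ^ 2 + β ^ 2 = -1) (x : ℍ[F]) :
    (splitRamified r α β x).det = Quaternion.normSq x := by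
  rw [splitRamified, Matrix.det_fin_two_of, Quaternion.normSq_def']
  grind

end Splitting

section Standard

variable {K : Type*} [Field K] [NumberField K] {v : HeightOneSpectrum (𝓞 K)}

instance : CharZero (v.adicCompletion K) :=
  charZero_of_injective_algebraMap (algebraMap K (v.adicCompletion K)).injective

variable {e : ℍ[v.adicCompletion K] ≃ₐ[v.adicCompletion K]
    Matrix (Fin 2) (Fin 2) (v.adicCompletion K)}

theorem isStandard_splitInert {α β : v.adicCompletion K} (h : α ^ 2 + β ^ 2 = -1)
    (he : ∀ x, e x = splitInert α β x) : IsStandard e where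
  det_eq y := by rw [he, det_splitInert h]
  trace_eq y := by
    rw [he, splitInert, Matrix.trace_fin_two_of]
    ring

theorem isStandard_splitOne {ρ : v.adicCompletion K} (h : ρ ^ 2 = -1)
    (he : ∀ x, e x = splitOne ρ x) : IsStandard e where
  det_eq y := by rw [he, det_splitOne h]
  trace_eq y := by
    rw [he, splitOne, Matrix.trace_fin_two_of]
    ring

theorem isStandard_splitRamified {r α β : v.adicCompletion K} (hr : r ^ 2 = 2)
    (h : α ^ 2 + β ^ 2 = -1) (he : ∀ x, e x = splitRamified r α β x) : IsStandard e where
  det_eq y := by rw [he, det_splitRamified hr h]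
  trace_eq y := by
    rw [he, splitRamified, Matrix.trace_fin_two_of]
    ring

theorem splitTwo_eq {F : Type*} [Field F] (ρ : F) (x : ℍ[F]) :
    splitTwo ρ x = splitInert 1 ρ x := by
  rw [splitTwo, splitInert]
  congr! 3 <;> ring_nf

theorem splitFive_eq {F : Type*} [Field F] (ρ : F) (x : ℍ[F]) :
    splitFive ρ x = splitInert 2 ρ x := by
  rw [splitFive, splitInert]
  congr! 3 <;> ring_nf

theorem splitThree_eq {F : Type*} [Field F] (ρ : F) (x : ℍ[F]) :
    splitThree ρ x = splitInert ((1 + ρ) / 2) ((1 - ρ) / 2) x := by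
  rw [splitThree, splitInert]
  congr! 3 <;> ring_nf

end Standard

/-! ### Square roots in the completions -/

section Hensel

/-- Hensel's lemma for `y² + by + c`, with `b` a unit. -/
theorem exists_root_of_norm_lt_one {F : Type*} [NormedField F] [IsUltrametricDist F]
    [CompleteSpace F] {b c : F} (hb : ‖b‖ = 1) (hc : ‖c‖ < 1) :
    ∃ y : F, y ^ 2 + b * y + c = 0 ∧ ‖y‖ ≤ ‖c‖ := by
  have hb0 : b ≠ 0 := norm_ne_zero_iff.1 (by rw [hb]; exact one_ne_zero)
  -- A root is a fixed point of `f`, which preserves the ball `‖y‖ ≤ ‖c‖` and contracts distances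
  -- there by the factor `‖c‖`, since `y² - y'² = (y + y')(y - y')`.
  let f : F → F := fun y => -(c + y ^ 2) / b
  have hf : Continuous f := by fun_prop
  have hfn : ∀ y, ‖y‖ ≤ ‖c‖ → ‖f y‖ ≤ ‖c‖ := fun y hy => by
    rw [norm_div, norm_neg, hb, div_one]
    refine (IsUltrametricDist.norm_add_le_max _ _).trans (max_le le_rfl ?_)
    rw [norm_pow, pow_two]
    exact mul_le_of_le_one_left (norm_nonneg _) (hy.trans hc.le) |>.trans hy
  let u : ℕ → F := fun n => f^[n] 0
  have hu : ∀ n, u (n + 1) = f (u n) := fun n => Function.iterate_succ_apply' f n 0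
  have hun : ∀ n, ‖u n‖ ≤ ‖c‖ := fun n => by
    induction n with
    | zero => simp [u]
    | succ n ih => rw [hu]; exact hfn _ ih
  have hd : ∀ n, dist (u n) (u (n + 1)) ≤ 1 * ‖c‖ ^ n := fun n => by
    induction n with
    | zero =>
      rw [pow_zero, one_mul, dist_eq_norm, norm_sub_rev]
      have h0 : u 0 = 0 := rfl
      rw [h0, sub_zero]
      exact (hun 1).trans hc.le
    | succ n ih =>
      rw [one_mul] at ih ⊢
      have h1 : u (n + 1) - u (n + 1 + 1) = -((u n + u (n + 1)) * (u n - u (n + 1))) / b := by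
        have h2 : u (n + 1 + 1) = f (u (n + 1)) := hu _
        have h3 : u (n + 1) = f (u n) := hu _
        rw [h2]
        nth_rewrite 1 [h3]
        simp only [f]
        ring
      rw [dist_eq_norm] at ih ⊢
      rw [h1, norm_div, hb, div_one, norm_neg, norm_mul, pow_succ, mul_comm]
      refine mul_le_mul ih ?_ (norm_nonneg _) (by positivity)
      exact (IsUltrametricDist.norm_add_le_max _ _).trans (max_le (hun _) (hun _))
  obtain ⟨y, hy⟩ := cauchySeq_tendsto_of_complete (cauchySeq_of_le_geometric _ _ hc hd)
  refine ⟨y, ?_, le_of_tendsto' hy.norm hun⟩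
  have h1 : Filter.Tendsto (fun n => u (n + 1)) Filter.atTop (nhds (f y)) := by
    simp only [hu]
    exact (hf.tendsto y).comp hy
  have h2 : y = f y := tendsto_nhds_unique (hy.comp (Filter.tendsto_add_atTop_nat 1)) h1
  have h3 : y * b = -(c + y ^ 2) := by
    nth_rewrite 1 [h2]
    exact div_mul_cancel₀ _ hb0
  linear_combination h3

variable {K : Type*} [Field K] [NumberField K] {v : HeightOneSpectrum (𝓞 K)}

theorem exists_root_of_valued_lt_one {b c : v.adicCompletion K} (hb : Valued.v b = 1)
    (hc : Valued.v c < 1) : ∃ y : v.adicCompletion K, y ^ 2 + b * y + c = 0 ∧ Valued.v y < 1 := by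
  have hb' : ‖b‖ = 1 := le_antisymm (Valued.toNormedField.norm_le_one_iff.2 hb.le)
    (Valued.toNormedField.one_le_norm_iff.2 hb.ge)
  obtain ⟨y, hy, hyc⟩ := exists_root_of_norm_lt_one hb' (Valued.toNormedField.norm_lt_one_iff.2 hc)
  refine ⟨y, hy, Valued.toNormedField.norm_lt_one_iff.1 (hyc.trans_lt ?_)⟩
  exact Valued.toNormedField.norm_lt_one_iff.2 hc

/-- The substitution `ρ = s + y` turns `ρ² = d` into `y² + 2sy + (s² - d) = 0`, with unit linear
coefficient and nonunit constant term. -/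
theorem exists_sq_eq {d s : 𝓞 K} (h2 : 2 * s ∉ v.asIdeal) (h : s ^ 2 - d ∈ v.asIdeal) :
    ∃ ρ : v.adicCompletion K, ρ ^ 2 = algebraMap K _ (d : K) ∧
      Valued.v (ρ - algebraMap K _ (s : K)) < 1 := by
  obtain ⟨y, hy, hy1⟩ := exists_root_of_valued_lt_one (v := v)
    (b := algebraMap K _ ((2 * s : 𝓞 K) : K)) (c := algebraMap K _ ((s ^ 2 - d : 𝓞 K) : K))
    (by rw [valued_algebraMap]; exact v.valuation_eq_one_iff_notMem.2 h2)
    (by rw [valued_algebraMap]; exact (v.valuation_lt_one_iff_mem _).2 h)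
  refine ⟨algebraMap K _ (s : K) + y, ?_, by simpa using hy1⟩
  simp only [map_mul, map_sub, map_pow, map_ofNat] at hy
  linear_combination hy

/-- If `2` is a nonunit, `-7` has a square root congruent to `-1` modulo `4`. -/
theorem exists_sq_eq_neg_seven (h : (2 : 𝓞 K) ∈ v.asIdeal) :
    ∃ ρ : v.adicCompletion K, ρ ^ 2 = -7 ∧
      Valued.v (ρ + 1) ≤ Valued.v (4 : v.adicCompletion K) := by
  have h2 : Valued.v (2 : v.adicCompletion K) < 1 := by
    have := (v.valuation_lt_one_iff_mem (K := K) _).2 h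
    rw [← valued_algebraMap] at this
    simpa only [map_ofNat] using this
  -- With `ρ = -(1 + 2y)` one has `ρ² + 7 = 4(y² + y + 2)`, and the quadratic in `y` has unit linear
  -- coefficient even though `2` is not a unit. The small root satisfies `y(y + 1) = -2` with `y +
  -- 1` a unit, so `ρ + 1 = -2y` has the valuation of `4`.
  obtain ⟨y, hy, hy1⟩ := exists_root_of_valued_lt_one (v := v) (b := 1) (c := 2) (map_one _) h2
  refine ⟨-(1 + 2 * y), by linear_combination 4 * hy, ?_⟩
  have h3 : Valued.v (y + 1) = 1 := by
    rw [Valuation.map_add_eq_of_lt_right _ (by rwa [map_one]), map_one]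
  have h4 : Valued.v y = Valued.v (2 : v.adicCompletion K) := by
    have h5 : y * (y + 1) = -2 := by linear_combination hy
    have h6 := congrArg Valued.v h5
    rwa [map_mul, h3, mul_one, Valuation.map_neg] at h6
  rw [show -(1 + 2 * y) + 1 = -(2 * y) by ring, Valuation.map_neg, map_mul, h4, ← map_mul]
  norm_num

end Hensel

/-! ### Integral models -/

section Models

variable {K : Type*} [Field K] [NumberField K] {v : HeightOneSpectrum (𝓞 K)}
variable {e : ℍ[v.adicCompletion K] ≃ₐ[v.adicCompletion K]
    Matrix (Fin 2) (Fin 2) (v.adicCompletion K)}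

/-- The algebraic integers of `K`, as a subring. -/
abbrev intRing (K : Type*) [Field K] : Subring K := (algebraMap (𝓞 K) K).range

theorem exists_intModel_of_mem {x : ℍ[K]}
    (h : ∀ a b, e (mapQuat (algebraMap K _) x) a b ∈ v.adicCompletionIntegers K) :
    ∃ M, IntModel e x M :=
  ⟨fun a b => ⟨_, h a b⟩, rfl⟩

theorem algebraMap_mem_of_two_mul_mem (h2 : (2 : 𝓞 K) ∉ v.asIdeal) {a : K}
    (ha : 2 * a ∈ intRing K) :
    algebraMap K (v.adicCompletion K) a ∈ v.adicCompletionIntegers K := by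
  rw [HeightOneSpectrum.mem_adicCompletionIntegers, valued_algebraMap]
  obtain ⟨c, hc⟩ := ha
  have h1 := congrArg (v.valuation K) hc
  rw [map_mul, show (2 : K) = algebraMap (𝓞 K) K 2 by rw [map_ofNat],
    v.valuation_eq_one_iff_notMem.2 h2, one_mul] at h1
  rw [← h1]
  exact v.valuation_le_one c

/-- Twice the coordinates of `x` are algebraic integers. -/
structure HalfIntegral (x : ℍ[K]) : Prop where
  re : 2 * x.re ∈ intRing K
  imI : 2 * x.imI ∈ intRing K
  imJ : 2 * x.imJ ∈ intRing K
  imK : 2 * x.imK ∈ intRing K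

theorem exists_intModel_splitInert (h2 : (2 : 𝓞 K) ∉ v.asIdeal) {α β : v.adicCompletion K}
    (he : ∀ x, e x = splitInert α β x) (hα : α ∈ v.adicCompletionIntegers K)
    (hβ : β ∈ v.adicCompletionIntegers K) {x : ℍ[K]} (hx : HalfIntegral x) :
    ∃ M, IntModel e x M := by
  have h1 := algebraMap_mem_of_two_mul_mem h2 hx.re
  have h3 := algebraMap_mem_of_two_mul_mem h2 hx.imI
  have h4 := algebraMap_mem_of_two_mul_mem h2 hx.imJ
  have h5 := algebraMap_mem_of_two_mul_mem h2 hx.imK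
  refine exists_intModel_of_mem fun a b => ?_
  rw [he, splitInert]
  fin_cases a <;> fin_cases b
  · exact add_mem (add_mem h1 (mul_mem h4 hα)) (mul_mem h5 hβ)
  · exact sub_mem (add_mem h3 (mul_mem h4 hβ)) (mul_mem h5 hα)
  · exact sub_mem (add_mem (neg_mem h3) (mul_mem h4 hβ)) (mul_mem h5 hα)
  · exact sub_mem (sub_mem h1 (mul_mem h4 hα)) (mul_mem h5 hβ)

theorem exists_intModel_splitOne (h2 : (2 : 𝓞 K) ∉ v.asIdeal) {ρ : v.adicCompletion K}
    (he : ∀ x, e x = splitOne ρ x) (hρ : ρ ∈ v.adicCompletionIntegers K) {x : ℍ[K]}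
    (hx : HalfIntegral x) : ∃ M, IntModel e x M := by
  have h1 := algebraMap_mem_of_two_mul_mem h2 hx.re
  have h3 := algebraMap_mem_of_two_mul_mem h2 hx.imI
  have h4 := algebraMap_mem_of_two_mul_mem h2 hx.imJ
  have h5 := algebraMap_mem_of_two_mul_mem h2 hx.imK
  refine exists_intModel_of_mem fun a b => ?_
  rw [he, splitOne]
  fin_cases a <;> fin_cases b
  · exact add_mem h1 (mul_mem hρ h3)
  · exact add_mem h4 (mul_mem hρ h5)
  · exact add_mem (neg_mem h4) (mul_mem hρ h5)
  · exact sub_mem h1 (mul_mem hρ h3)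

theorem mem_integers_of_sq_mem {ρ : v.adicCompletion K} (h : ρ ^ 2 ∈ v.adicCompletionIntegers K) :
    ρ ∈ v.adicCompletionIntegers K := by
  rw [HeightOneSpectrum.mem_adicCompletionIntegers, map_pow] at h
  rw [HeightOneSpectrum.mem_adicCompletionIntegers]
  by_contra! h1
  exact absurd h (one_lt_pow₀ h1 two_ne_zero).not_ge

end Models

/-! ### Orders -/

section Order

/-- The quaternion with the given coordinates. -/
abbrev quat {F : Type*} [Field F] (a b c d : F) : ℍ[F] := ⟨a, b, c, d⟩

variable {K : Type*} [Field K] [NumberField K] {v : HeightOneSpectrum (𝓞 K)}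

theorem mem_intRing_of_isIntegral {c : K} (h : IsIntegral (𝓞 K) c) : c ∈ intRing K := by
  obtain ⟨a, ha⟩ := (IsIntegrallyClosed.isIntegral_iff (R := 𝓞 K) (K := K)).1 h
  exact ⟨a, ha⟩

open Polynomial in
-- A nonscalar `x` has minimal polynomial `X² - tX + n` over `K`, with `t` the trace and `n` the
-- norm. It divides a monic polynomial over the integrally closed ring `𝓞 K`, so its coefficients
-- are integral (Gauss). A scalar has a linear minimal polynomial and is treated apart.
theorem trace_norm_mem_of_isIntegral {x : ℍ[K]} (hx : IsIntegral (𝓞 K) x) :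
    2 * x.re ∈ intRing K ∧ Quaternion.normSq x ∈ intRing K := by
  by_cases hs : x ∈ (algebraMap K ℍ[K]).range
  · obtain ⟨c, rfl⟩ := hs
    have hc : c ∈ intRing K := mem_intRing_of_isIntegral
      ((isIntegral_algebraMap_iff (algebraMap K ℍ[K]).injective).1 hx)
    rw [Quaternion.algebraMap_def, Quaternion.normSq_coe, Quaternion.re_coe]
    exact ⟨mul_mem (ofNat_mem _ 2) hc, pow_mem hc 2⟩
  · have hxK : IsIntegral K x := hx.tower_top
    let q : K[X] := X ^ 2 + C (-(2 * x.re)) * X + C (Quaternion.normSq x)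
    have hqd : q.natDegree = 2 := by
      simp only [q]; compute_degree!
    have hqm : q.Monic := by
      simp only [q]; monicity!
    have hq : aeval x q = 0 := by
      have h1 : x ^ 2 = algebraMap K ℍ[K] (2 * x.re) * x - algebraMap K ℍ[K] (Quaternion.normSq x) := by
        have h2 : algebraMap K ℍ[K] (2 * x.re) = x + star x :=
          (Quaternion.self_add_star' x).symm
        have h3 : algebraMap K ℍ[K] (Quaternion.normSq x) = star x * x :=
          (Quaternion.star_mul_self x).symm
        rw [h2, h3, pow_two, add_mul, add_sub_cancel_right]
      simp only [q, map_add, map_mul, aeval_C, aeval_X, map_pow, h1, map_neg]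
      rw [neg_mul, ← sub_eq_add_neg, sub_right_comm, sub_self, zero_sub, neg_add_cancel]
    have hmin : minpoly K x = q := by
      refine (eq_of_monic_of_dvd_of_natDegree_le (minpoly.monic hxK) hqm (minpoly.dvd K x hq) ?_).symm
      rw [hqd]
      have h1 := minpoly.natDegree_pos hxK
      have h2 : (minpoly K x).natDegree ≠ 1 := fun h => hs (minpoly.natDegree_eq_one_iff.1 h)
      omega
    obtain ⟨p, hp, hpx⟩ := hx
    have hdvd : q ∣ p.map (algebraMap (𝓞 K) K) := by
      rw [← hmin]
      refine minpoly.dvd K x ?_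
      rw [aeval_map_algebraMap]
      exact hpx
    obtain ⟨g, hg⟩ := IsIntegrallyClosed.eq_map_mul_C_of_dvd K hp hdvd
    rw [hqm.leadingCoeff, C_1, mul_one] at hg
    have hg0 := congrArg (fun r => r.coeff 0) hg
    have hg1 := congrArg (fun r => r.coeff 1) hg
    simp [q, coeff_X, coeff_C] at hg0 hg1
    refine ⟨?_, ⟨_, hg0⟩⟩
    rw [← neg_mem_iff]
    exact ⟨_, hg1⟩

variable {O : Subalgebra (𝓞 K) ℍ[K]}

theorem IsOrder.trace_mem (hO : IsOrder O) {x : ℍ[K]} (hx : x ∈ O) : 2 * x.re ∈ intRing K :=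
  (trace_norm_mem_of_isIntegral (IsIntegral.of_mem_of_fg O hO.1 x hx)).1

theorem IsOrder.normSq_mem (hO : IsOrder O) {x : ℍ[K]} (hx : x ∈ O) :
    Quaternion.normSq x ∈ intRing K :=
  (trace_norm_mem_of_isIntegral (IsIntegral.of_mem_of_fg O hO.1 x hx)).2

theorem smul_mem_of_mem_intRing {x : ℍ[K]} (hx : x ∈ O) {c : K} (hc : c ∈ intRing K) :
    c • x ∈ O := by
  obtain ⟨a, rfl⟩ := hc
  rw [algebraMap_smul]
  exact O.smul_mem hx a

theorem IsOrder.star_mem (hO : IsOrder O) {x : ℍ[K]} (hx : x ∈ O) : star x ∈ O := by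
  rw [Quaternion.star_eq_two_re_sub]
  refine sub_mem ?_ hx
  have := smul_mem_of_mem_intRing O.one_mem (hO.trace_mem hx)
  rwa [← Quaternion.coe_one, Quaternion.smul_coe, mul_one] at this

/-- An element of a larger order has integral norm, and its products with `O` have integral trace.
The norm condition is needed only for the Hurwitz order, which is strictly smaller than its trace
dual. -/
theorem isMaximalOrder_of_dual (hO : IsOrder O)
    (h : ∀ x, (∀ y ∈ O, 2 * (x * y).re ∈ intRing K) → Quaternion.normSq x ∈ intRing K → x ∈ O) :
    IsMaximalOrder O :=
  ⟨hO, fun _ hO' hle x hx =>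
    h x (fun _ hy => hO'.trace_mem (mul_mem hx (hle hy))) (hO'.normSq_mem hx)⟩

theorem isOrder_of_span {S : Set ℍ[K]} (hS : S.Finite)
    (hO : Subalgebra.toSubmodule O = Submodule.span (𝓞 K) S) {c : K} (hc : c ≠ 0)
    (hi : quat 0 c 0 0 ∈ O) (hj : quat 0 0 c 0 ∈ O)
    (hk : quat 0 0 0 c ∈ O) : IsOrder O := by
  refine ⟨hO ▸ Submodule.fg_span hS, ?_⟩
  rw [eq_top_iff]
  rintro x -
  have h1 : x = x.re • 1 + (x.imI / c) • quat 0 c 0 0 +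
      (x.imJ / c) • quat 0 0 c 0 + (x.imK / c) • quat 0 0 0 c := by
    ext <;> simp [hc]
  rw [h1]
  refine add_mem (add_mem (add_mem ?_ ?_) ?_) ?_ <;>
    refine Submodule.smul_mem _ _ (Submodule.subset_span ?_)
  exacts [O.one_mem, hi, hj, hk]

/-! ### Unit groups and `{P}`-arithmetic groups -/

theorem cls_mem_unitGroup (hO : IsOrder O) {x : ℍ[K]} (hx : x ∈ O) {u : (𝓞 K)ˣ}
    (hu : Quaternion.normSq x = ((u : 𝓞 K) : K)) : cls x ∈ unitGroup O := by
  have hu0 : ((u : 𝓞 K) : K) ≠ 0 := by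
    rw [RingOfIntegers.coe_ne_zero_iff]
    exact u.ne_zero
  have hxu : IsUnit x := isUnit_of_normSq_ne_zero (hu ▸ hu0)
  obtain ⟨w, rfl⟩ := hxu
  refine ⟨w, ⟨hx, ?_⟩, (cls_coe w).symm⟩
  have h1 : ((w⁻¹ : (ℍ[K])ˣ) : ℍ[K]) = (((u⁻¹ : (𝓞 K)ˣ) : 𝓞 K) : K) • star (w : ℍ[K]) := by
    rw [Units.inv_eq_of_mul_eq_one_right]
    rw [mul_smul_comm, Quaternion.self_mul_star, hu, Quaternion.smul_coe, ← Quaternion.coe_one]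
    congr 1
    rw [← map_mul, Units.inv_mul, map_one]
  rw [h1]
  exact smul_mem_of_mem_intRing (hO.star_mem hx) ⟨_, rfl⟩

theorem exists_of_mem_unitGroup (hO : IsOrder O) {c : PD K} (hc : c ∈ unitGroup O) :
    ∃ x ∈ O, ∃ u : (𝓞 K)ˣ, Quaternion.normSq x = ((u : 𝓞 K) : K) ∧ cls x = c := by
  obtain ⟨w, ⟨h1, h2⟩, rfl⟩ := hc
  obtain ⟨a, ha⟩ := hO.normSq_mem h1
  obtain ⟨b, hb⟩ := hO.normSq_mem h2
  have hab : a * b = 1 := by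
    apply RingOfIntegers.coe_injective
    rw [map_mul, ha, hb, ← map_mul, Units.mul_inv, map_one, map_one]
  exact ⟨w, h1, ⟨a, b, hab, by rw [mul_comm, hab]⟩, ha.symm, cls_coe w⟩

theorem isUnit_of_normSq_eq_unit {x : ℍ[K]} {u : (𝓞 K)ˣ}
    (hu : Quaternion.normSq x = ((u : 𝓞 K) : K)) : IsUnit x := by
  refine isUnit_of_normSq_ne_zero ?_
  rw [hu, RingOfIntegers.coe_ne_zero_iff]
  exact u.ne_zero

theorem unitGroup_le_arithGroup : unitGroup O ≤ arithGroup v O := by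
  rintro _ ⟨w, ⟨h1, h2⟩, rfl⟩
  exact ⟨w, ⟨⟨0, fun a _ => O.mul_mem (O.algebraMap_mem a) h1⟩,
    ⟨0, fun a _ => O.mul_mem (O.algebraMap_mem a) h2⟩⟩, rfl⟩

/-- The inverse of `x` is its conjugate divided by `n`, so its only denominator is the generator of
`P`. -/
theorem cls_mem_arithGroup (hO : IsOrder O) {x : ℍ[K]} (hx : x ∈ O) {n : 𝓞 K}
    (hn : Quaternion.normSq x = n) (hv : v.asIdeal = Ideal.span {n}) :
    cls x ∈ arithGroup v O := by
  have hn0 : (n : K) ≠ 0 := by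
    rw [RingOfIntegers.coe_ne_zero_iff]
    rintro rfl
    exact v.ne_bot (by rw [hv]; simp)
  obtain ⟨w, rfl⟩ : IsUnit x := isUnit_of_normSq_ne_zero (hn ▸ hn0)
  refine ⟨w, ⟨⟨0, fun a _ => O.mul_mem (O.algebraMap_mem a) hx⟩, ⟨1, fun a ha => ?_⟩⟩,
    (cls_coe w).symm⟩
  rw [pow_one, hv, Ideal.mem_span_singleton] at ha
  obtain ⟨b, rfl⟩ := ha
  have h1 : algebraMap (𝓞 K) ℍ[K] (n * b) * ((w⁻¹ : (ℍ[K])ˣ) : ℍ[K]) =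
      algebraMap (𝓞 K) ℍ[K] b * star (w : ℍ[K]) := by
    rw [Units.mul_inv_eq_iff_eq_mul, mul_assoc, Quaternion.star_mul_self, hn, mul_comm n, map_mul]
    rfl
  rw [h1]
  exact O.mul_mem (O.algebraMap_mem b) (hO.star_mem hx)

/-- `P = (n)`, and `T` is the class of a pure quaternion in `O` of norm `n`. -/
def IsUniformizing (v : HeightOneSpectrum (𝓞 K)) (n : 𝓞 K) (τ : ℍ[K]) : Prop :=
  v.asIdeal = Ideal.span {n} ∧ τ.re = 0 ∧ Quaternion.normSq τ = n

variable {e : ℍ[v.adicCompletion K] ≃ₐ[v.adicCompletion K]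
    Matrix (Fin 2) (Fin 2) (v.adicCompletion K)}

theorem IsUniformizing.ne_zero {n : 𝓞 K} {τ : ℍ[K]} (h : IsUniformizing v n τ) : n ≠ 0 := by
  rintro rfl
  exact v.ne_bot (by rw [h.1]; simp)

theorem IsUniformizing.isUnit {n : 𝓞 K} {τ : ℍ[K]} (h : IsUniformizing v n τ) : IsUnit τ := by
  refine isUnit_of_normSq_ne_zero ?_
  rw [h.2.2, RingOfIntegers.coe_ne_zero_iff]
  exact h.ne_zero

theorem IsUniformizing.isStep (he : IsStandard e) {n : 𝓞 K} {τ : ℍ[K]}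
    (h : IsUniformizing v n τ) {N : Matrix (Fin 2) (Fin 2) (v.adicCompletionIntegers K)}
    (hN : IntModel e τ N) : IsStep N := by
  rw [IsStep, det_incl, hN.det_eq he h.2.2, coe_algebraMap_integers, valued_algebraMap]
  exact (v.valuation_of_algebraMap n).trans (v.intValuation_singleton h.ne_zero h.1)

theorem IsUniformizing.isFlip (he : IsStandard e) {n : 𝓞 K} {τ : ℍ[K]}
    (h : IsUniformizing v n τ) (hN : ∃ N, IntModel e τ N) : IsFlip e (cls τ) := by
  obtain ⟨N, hN⟩ := hN
  exact ⟨τ, N, h.isUnit, rfl, h.2.1, hN, h.isStep he hN⟩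

/-- If the whole unit group acts freely on the neighbors, it is no larger than a subgroup with at
least as many elements as there can be neighbors. -/
theorem eq_unitGroup_of_card_le (hq : Finite (𝓞 K ⧸ v.asIdeal)) {C : Subgroup (PD K)} {T : PD K}
    (hT : IsFlip e T) (hU : ∀ c ∈ unitGroup O, IsElliptic e c) (hC : C ≤ unitGroup O)
    (hcard : Nat.card (𝓞 K ⧸ v.asIdeal) + 1 ≤ Nat.card C) : C = unitGroup O := by
  obtain ⟨h1, h2⟩ := card_le_of_isElliptic hq hU ⟨_, hT.smul_origin⟩
  refine SetLike.coe_injective (Set.eq_of_subset_of_ncard_le hC ?_ (Set.toFinite _))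
  exact h2.trans hcard

/-- Every line modulo `P` comes from a neighbour: the first column of `S` lifts `u`, and the second
has a single nonzero entry, the uniformizer, placed opposite a unit of the first. -/
theorem exists_isStep_mulVec {n : 𝓞 K} (hv : v.asIdeal = Ideal.span {n}) {u : Fin 2 → Residue v}
    (hu : u ≠ 0) : ∃ S, IsStep S ∧ ∃ z, (red v S).mulVec z = u := by
  have hn0 : n ≠ 0 := by
    rintro rfl
    exact v.ne_bot (by rw [hv]; simp)
  set p : v.adicCompletionIntegers K := algebraMap (𝓞 K) _ n with hp
  have hpv : Valued.v (p : v.adicCompletion K) = WithZero.exp (-1 : ℤ) := by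
    rw [hp, coe_algebraMap_integers, valued_algebraMap]
    exact (v.valuation_of_algebraMap n).trans (v.intValuation_singleton hn0 hv)
  have hpr : IsLocalRing.residue _ p = 0 := by
    rw [residue_eq_zero_iff, hpv]
    exact exp_neg_one_lt_one
  obtain ⟨a, ha⟩ := IsLocalRing.residue_surjective (u 0)
  obtain ⟨b, hb⟩ := IsLocalRing.residue_surjective (u 1)
  have hunit : ∀ z : v.adicCompletionIntegers K, IsLocalRing.residue _ z ≠ 0 →
      Valued.v (z : v.adicCompletion K) = 1 := fun z hz =>
    le_antisymm z.2 (not_lt.1 fun h => hz ((residue_eq_zero_iff v z).2 h))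
  by_cases h0 : u 0 = 0
  · have h1 : u 1 ≠ 0 := fun hu1 => hu (by ext i; fin_cases i <;> assumption)
    refine ⟨!![a, p; b, 0], ?_, ![1, 0], ?_⟩
    · rw [IsStep, det_incl, Matrix.det_fin_two_of, mul_zero, zero_sub]
      rw [show ((-(p * b) : v.adicCompletionIntegers K) : v.adicCompletion K) = -(p * b) from rfl,
        Valuation.map_neg, map_mul, hpv, hunit b (hb ▸ h1), mul_one]
    · ext i
      fin_cases i <;> simp [Matrix.mulVec, dotProduct, Fin.sum_univ_two, red_apply, ha, hb]
  · refine ⟨!![a, 0; b, p], ?_, ![1, 0], ?_⟩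
    · rw [IsStep, det_incl, Matrix.det_fin_two_of, zero_mul, sub_zero]
      rw [show ((a * p : v.adicCompletionIntegers K) : v.adicCompletion K) = a * p from rfl,
        map_mul, hpv, hunit a (ha ▸ h0), one_mul]
    · ext i
      fin_cases i <;> simp [Matrix.mulVec, dotProduct, Fin.sum_univ_two, red_apply, ha, hb]

/-- If the matrix of `x` vanishes modulo `P`, the trace of `x y` lies in `P = (n)` for every `y ∈
O`. Thus `x / n` pairs integrally with `O`, and self-duality puts it in `O`. -/
theorem exists_eq_smul_of_red_eq_zero (he : IsStandard e) (hO : IsOrder O)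
    (hm : ∀ x ∈ O, ∃ M, IntModel e x M)
    (hdual : ∀ x, (∀ y ∈ O, 2 * (x * y).re ∈ intRing K) → x ∈ O) {n : 𝓞 K}
    (hv : v.asIdeal = Ideal.span {n}) {x : ℍ[K]} (hx : x ∈ O)
    {X : Matrix (Fin 2) (Fin 2) (v.adicCompletionIntegers K)} (hX : IntModel e x X)
    (h0 : red v X = 0) : ∃ y ∈ O, x = (n : K) • y := by
  have hn0 : (n : K) ≠ 0 := by
    rw [RingOfIntegers.coe_ne_zero_iff]
    rintro rfl
    exact v.ne_bot (by rw [hv]; simp)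
  refine ⟨(n : K)⁻¹ • x, hdual _ fun y hy => ?_, by rw [smul_smul, mul_inv_cancel₀ hn0, one_smul]⟩
  obtain ⟨Y, hY⟩ := hm y hy
  obtain ⟨t, ht⟩ := hO.trace_mem (mul_mem hx hy)
  have h1 : t ∈ v.asIdeal := by
    rw [← residue_algebraMap_eq_zero_iff, ← (hX.mul hY).trace_eq he ht.symm,
      Matrix.trace_fin_two, map_add, ← red_apply, ← red_apply, map_mul, h0, zero_mul]
    simp
  rw [hv, Ideal.mem_span_singleton] at h1
  obtain ⟨s, rfl⟩ := h1
  refine ⟨s, ?_⟩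
  rw [smul_mul_assoc, Quaternion.re_smul, smul_eq_mul]
  rw [map_mul] at ht
  change (n : K) * (s : K) = _ at ht
  change (s : K) = _
  rw [mul_left_comm, ← ht, inv_mul_cancel_left₀ hn0]

end Order

/-! ### Generation of the full arithmetic group by units and the flip -/

section Full

variable {K : Type*} [Field K] [NumberField K] {v : HeightOneSpectrum (𝓞 K)}
  {O : Subalgebra (𝓞 K) ℍ[K]} {e : ℍ[v.adicCompletion K] ≃ₐ[v.adicCompletion K]
    Matrix (Fin 2) (Fin 2) (v.adicCompletion K)}

/-- A vector can be moved by the unit group into the kernel of the flip. -/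
theorem exists_unit_mulVec (he : IsStandard e) (hO : IsOrder O)
    (hm : ∀ x ∈ O, ∃ M, IntModel e x M) (hq : Finite (𝓞 K ⧸ v.asIdeal))
    (hU : ∀ c ∈ unitGroup O, IsElliptic e c)
    (hcard : Nat.card (𝓞 K ⧸ v.asIdeal) + 1 ≤ Nat.card (unitGroup O)) {n : 𝓞 K} {τ : ℍ[K]}
    (hτ : IsUniformizing v n τ) {N : Matrix (Fin 2) (Fin 2) (v.adicCompletionIntegers K)}
    (hN : IntModel e τ N) {u : Fin 2 → Residue v} (hu : u ≠ 0) :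
    ∃ x ∈ O, ∃ w : (𝓞 K)ˣ, Quaternion.normSq x = ((w : 𝓞 K) : K) ∧
      ∃ M, IntModel e x M ∧ (red v N).mulVec ((red v M).mulVec u) = 0 := by
  have hs := hτ.isStep he hN
  obtain ⟨S, hS, z, rfl⟩ := exists_isStep_mulVec hτ.1 hu
  -- The units act transitively on the neighbours, so one of them carries the neighbour with line
  -- `u` to the neighbour with the image line of `N`. That line is also the kernel of `N`, because
  -- `N² = 0` modulo `P`.
  obtain ⟨c, ⟨hc, hcv⟩, -⟩ := simply_transitive_of_isElliptic hq hU hcard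
    (treeAdj_origin_iff.2 ⟨S, hS, rfl⟩) (treeAdj_origin_iff.2 ⟨N, hs, rfl⟩)
  obtain ⟨x, hx, w, hw, rfl⟩ := exists_of_mem_unitGroup hO hc
  obtain ⟨M, hM⟩ := hm x hx
  have hMd : IsUnit M.det := by
    rw [hM.det_eq he hw]
    exact w.isUnit.map _
  rw [treeMap_smul_vtx (isUnit_of_normSq_eq_unit hw) hM hS.isUnit, ← map_mul] at hcv
  obtain ⟨U, -, hU'⟩ := exists_mul_incl_of_vtx_eq hs.isUnit (hS.mul_left hMd).isUnit
    (by rw [hs, hS.mul_left hMd]) hcv.symm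
  rw [← map_mul] at hU'
  have h2 := congrArg (red v) (incl_injective v hU')
  rw [map_mul, map_mul] at h2
  have hNN : red v N * red v N = 0 := by
    refine mul_self_eq_zero_of_trace_eq_zero ?_ hs.det_red_eq_zero
    have h5 : N.trace = 0 := by
      refine Subtype.ext ?_
      rw [hN.trace he, hτ.2.1, mul_zero, map_zero]
      rfl
    rw [Matrix.trace_fin_two] at h5 ⊢
    rw [red_apply, red_apply, ← map_add, h5, map_zero]
  refine ⟨x, hx, w, hw, M, hM, ?_⟩
  rw [Matrix.mulVec_mulVec, Matrix.mulVec_mulVec, mul_assoc, h2, ← mul_assoc, hNN, zero_mul,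
    Matrix.zero_mulVec]

/-- Descent on the exponent `k`. If the matrix of `x` vanishes modulo `P`, divide `x` by `n`; the
exponent drops by two. Otherwise the reduction of `x` has rank one, a unit `c` moves its image line
into the kernel of `τ`, and `τ c x` is divisible by `n`. The quotient has norm a unit times `n ^ (k
- 1)`. -/
theorem cls_mem_sup_of_normSq_eq (he : IsStandard e) (hO : IsOrder O)
    (hm : ∀ x ∈ O, ∃ M, IntModel e x M)
    (hdual : ∀ x, (∀ y ∈ O, 2 * (x * y).re ∈ intRing K) → x ∈ O)
    (hq : Finite (𝓞 K ⧸ v.asIdeal)) (hU : ∀ c ∈ unitGroup O, IsElliptic e c)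
    (hcard : Nat.card (𝓞 K ⧸ v.asIdeal) + 1 ≤ Nat.card (unitGroup O)) {n : 𝓞 K} {τ : ℍ[K]}
    (hτO : τ ∈ O) (hτ : IsUniformizing v n τ) (k : ℕ) :
    ∀ x ∈ O, ∀ u : (𝓞 K)ˣ, Quaternion.normSq x = ((u * n ^ k : 𝓞 K) : K) →
      cls x ∈ unitGroup O ⊔ Subgroup.zpowers (cls τ) := by
  have hn0 : (n : K) ≠ 0 := by
    rw [RingOfIntegers.coe_ne_zero_iff]
    exact hτ.ne_zero
  have hprime : Prime n := by
    rw [← Ideal.span_singleton_prime hτ.ne_zero, ← hτ.1]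
    exact v.isPrime
  induction k using Nat.strong_induction_on with
  | _ k ih =>
    intro x hx u hu
    have hu0 : (((u : 𝓞 K) * n ^ k : 𝓞 K) : K) ≠ 0 := by
      rw [RingOfIntegers.coe_ne_zero_iff]
      exact mul_ne_zero u.ne_zero (pow_ne_zero _ hτ.ne_zero)
    have hxu : IsUnit x := isUnit_of_normSq_ne_zero (hu ▸ hu0)
    obtain ⟨X, hX⟩ := hm x hx
    obtain ⟨N, hN⟩ := hm τ hτO
    have hs := hτ.isStep he hN
    rcases k with _ | k
    · rw [pow_zero, mul_one] at hu
      exact Subgroup.mem_sup_left (cls_mem_unitGroup hO hx hu)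
    by_cases hX0 : red v X = 0
    · obtain ⟨y, hy, rfl⟩ := exists_eq_smul_of_red_eq_zero he hO hm hdual hτ.1 hx hX hX0
      rw [cls_smul hn0]
      obtain ⟨a, ha⟩ := hO.normSq_mem hy
      rw [Quaternion.normSq_smul, ← ha] at hu
      have h1 : n ^ 2 * a = u * n ^ (k + 1) := by
        apply RingOfIntegers.coe_injective
        rw [map_mul, map_pow]
        exact hu
      rcases k with _ | k
      -- The norm of `n y` is divisible by `n²`, so the exponent one cannot occur here.
      · exfalso
        have h2 : n * a = u := by
          apply mul_left_cancel₀ hτ.ne_zero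
          linear_combination h1
        exact hprime.not_isUnit (isUnit_of_mul_isUnit_left (h2 ▸ u.isUnit))
      · refine ih k (by omega) y hy u ?_
        rw [← ha]
        congr 1
        apply mul_left_cancel₀ (pow_ne_zero 2 hτ.ne_zero)
        linear_combination h1
    · obtain ⟨z, hz⟩ := exists_mulVec_ne_zero hX0
      obtain ⟨c, hc, w, hw, M, hM, hNM⟩ :=
        exists_unit_mulVec he hO hm hq hU hcard hτ hN hz
      have hX1 : (red v X).det = 0 := by
        rw [det_red, hX.det_eq he hu, residue_algebraMap_eq_zero_iff, hτ.1,
          Ideal.mem_span_singleton]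
        exact Dvd.intro_left (u * n ^ k) (by ring)
      have hred : red v (N * M * X) = 0 := by
        ext a b
        obtain ⟨r, hr⟩ := exists_smul_of_det_eq_zero hX1 hz rfl (Pi.single b 1)
        have h1 : (red v (N * M * X)).mulVec (Pi.single b 1) = 0 := by
          rw [map_mul, map_mul, ← Matrix.mulVec_mulVec, hr, Matrix.mulVec_smul,
            ← Matrix.mulVec_mulVec, hNM, smul_zero]
        simpa using congrFun h1 a
      have hcu := isUnit_of_normSq_eq_unit hw
      have hτc : τ * c * x ∈ O := mul_mem (mul_mem hτO hc) hx
      obtain ⟨y, hy, hyx⟩ := exists_eq_smul_of_red_eq_zero he hO hm hdual hτ.1 hτc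
        ((hN.mul hM).mul hX) hred
      have hcls : cls y = cls τ * cls c * cls x := by
        rw [← cls_mul hτ.isUnit hcu, ← cls_mul (hτ.isUnit.mul hcu) hxu, hyx, cls_smul hn0]
      have hy' : cls y ∈ unitGroup O ⊔ Subgroup.zpowers (cls τ) := by
        refine ih k (by omega) y hy (u * w) ?_
        have h1 := congrArg Quaternion.normSq hyx
        rw [map_mul, map_mul, Quaternion.normSq_smul, hτ.2.2, hw, hu] at h1
        apply mul_left_cancel₀ (pow_ne_zero 2 hn0)
        rw [← h1]
        simp only [map_mul, map_pow, Units.val_mul]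
        ring
      have h3 : cls x = (cls c)⁻¹ * (cls τ)⁻¹ * cls y := by rw [hcls]; group
      rw [h3]
      refine mul_mem (mul_mem (inv_mem (Subgroup.mem_sup_left (cls_mem_unitGroup hO hc hw)))
        (inv_mem (Subgroup.mem_sup_right (Subgroup.mem_zpowers _)))) hy'

/-- Multiplication by a power of the scalar `n` brings an element of `O[1/P]^×` into `O` without
changing its class. The same holds for the inverse, and the norms of the two multiply to a power of
the prime `n`; so the first norm is a unit times a power of `n` and the descent applies. -/
theorem sup_eq_arithGroup (he : IsStandard e) (hO : IsOrder O)
    (hm : ∀ x ∈ O, ∃ M, IntModel e x M)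
    (hdual : ∀ x, (∀ y ∈ O, 2 * (x * y).re ∈ intRing K) → x ∈ O)
    (hq : Finite (𝓞 K ⧸ v.asIdeal)) (hU : ∀ c ∈ unitGroup O, IsElliptic e c)
    (hcard : Nat.card (𝓞 K ⧸ v.asIdeal) + 1 ≤ Nat.card (unitGroup O)) {n : 𝓞 K} {τ : ℍ[K]}
    (hτO : τ ∈ O) (hτ : IsUniformizing v n τ) :
    unitGroup O ⊔ Subgroup.zpowers (cls τ) = arithGroup v O := by
  apply le_antisymm
  · refine sup_le unitGroup_le_arithGroup ?_
    rw [Subgroup.zpowers_le]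
    exact cls_mem_arithGroup hO hτO hτ.2.2 hτ.1
  rintro _ ⟨u, ⟨⟨k, hk⟩, ⟨l, hl⟩⟩, rfl⟩
  have hn0 : (n : K) ≠ 0 := by
    rw [RingOfIntegers.coe_ne_zero_iff]
    exact hτ.ne_zero
  have hprime : Prime n := by
    rw [← Ideal.span_singleton_prime hτ.ne_zero, ← hτ.1]
    exact v.isPrime
  have hmem : ∀ k : ℕ, n ^ k ∈ v.asIdeal ^ k := fun k =>
    Ideal.pow_mem_pow (hτ.1 ▸ Ideal.mem_span_singleton_self n) k
  have hsm : ∀ (k : ℕ) (y : ℍ[K]), algebraMap (𝓞 K) ℍ[K] (n ^ k) * y = ((n : K) ^ k) • y := by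
    intro k y
    rw [← Algebra.smul_def, ← map_pow]
    exact (algebraMap_smul K (n ^ k) y).symm
  have h1 := hk _ (hmem k)
  have h2 := hl _ (hmem l)
  rw [hsm] at h1 h2
  obtain ⟨a, ha⟩ := hO.normSq_mem h1
  obtain ⟨b, hb⟩ := hO.normSq_mem h2
  have hab : a * b = n ^ (2 * (k + l)) := by
    apply RingOfIntegers.coe_injective
    rw [map_mul, ha, hb, Quaternion.normSq_smul, Quaternion.normSq_smul, map_pow]
    have h3 : Quaternion.normSq (u : ℍ[K]) * Quaternion.normSq ((u⁻¹ : (ℍ[K])ˣ) : ℍ[K]) = 1 := by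
      rw [← map_mul, Units.mul_inv, map_one]
    linear_combination (((n : K) ^ k) ^ 2 * ((n : K) ^ l) ^ 2) * h3
  obtain ⟨i, -, w, hw⟩ := (dvd_prime_pow hprime _).1 (Dvd.intro _ hab)
  have h4 := cls_mem_sup_of_normSq_eq he hO hm hdual hq hU hcard hτO hτ i _ h1 w⁻¹ (by
    rw [← ha, ← hw, mul_comm a, Units.inv_mul_cancel_left])
  rw [cls_smul (pow_ne_zero k hn0), cls_coe] at h4
  exact h4

end Full

/-! ### Primes from ring homomorphisms -/

section Primes

variable {K : Type*} [Field K] [NumberField K]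

theorem exists_prime_of_hom {k : Type*} [CommRing k] [IsDomain k] [Finite k] (χ : 𝓞 K →+* k)
    (hχ : Function.Surjective χ) {n : 𝓞 K} (hn0 : n ≠ 0) (hn : ∀ a, χ a = 0 ↔ n ∣ a) :
    ∃ v : HeightOneSpectrum (𝓞 K), v.asIdeal = Ideal.span {n} ∧ (∀ a, a ∈ v.asIdeal ↔ χ a = 0) ∧
      Finite (𝓞 K ⧸ v.asIdeal) ∧ Nat.card (𝓞 K ⧸ v.asIdeal) = Nat.card k := by
  have h1 : Ideal.span {n} = RingHom.ker χ := by
    ext a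
    rw [Ideal.mem_span_singleton, RingHom.mem_ker, hn]
  have e1 := RingHom.quotientKerEquivOfSurjective hχ
  refine ⟨⟨Ideal.span {n}, ?_, ?_⟩, rfl, fun a => ?_, ?_, ?_⟩
  · rw [h1]; exact RingHom.ker_isPrime χ
  · rw [Ne, Ideal.span_singleton_eq_bot]; exact hn0
  · rw [hn, Ideal.mem_span_singleton]
  · change Finite (𝓞 K ⧸ Ideal.span {n})
    rw [h1]
    exact Finite.of_injective _ e1.injective
  · change Nat.card (𝓞 K ⧸ Ideal.span {n}) = _
    rw [h1]
    exact Nat.card_congr e1.toEquiv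

open Polynomial in
-- The given quadratic is the minimal polynomial of the irrational `x`, and an algebraic integer has
-- its minimal polynomial over `ℤ`.
theorem exists_int_of_quadratic {x : K} {t n : ℚ} (hx : x ^ 2 - t * x + n = 0)
    (hxQ : x ∉ (algebraMap ℚ K).range) (hi : IsIntegral ℤ x) :
    (∃ a : ℤ, t = a) ∧ ∃ a : ℤ, n = a := by
  let q : ℚ[X] := X ^ 2 + C (-t) * X + C n
  have hqd : q.natDegree = 2 := by
    simp only [q]; compute_degree!
  have hqm : q.Monic := by
    simp only [q]; monicity!
  have hxq : IsIntegral ℚ x := hi.tower_top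
  have hq : aeval x q = 0 := by
    simp only [q, map_add, map_mul, aeval_C, aeval_X, map_pow, map_neg]
    simp only [eq_ratCast]
    linear_combination hx
  have hmin : minpoly ℚ x = q := by
    refine (eq_of_monic_of_dvd_of_natDegree_le (minpoly.monic hxq) hqm (minpoly.dvd ℚ x hq) ?_).symm
    rw [hqd]
    have h1 := minpoly.natDegree_pos hxq
    have h2 : (minpoly ℚ x).natDegree ≠ 1 := fun h => hxQ (minpoly.natDegree_eq_one_iff.1 h)
    omega
  have h3 := minpoly.isIntegrallyClosed_eq_field_fractions' ℚ hi
  rw [hmin] at h3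
  have h0 := congrArg (fun r => r.coeff 0) h3
  have h1 := congrArg (fun r => r.coeff 1) h3
  simp [q, coeff_X, coeff_C] at h0 h1
  exact ⟨⟨-(minpoly ℤ x).coeff 1, by push_cast; linarith⟩, ⟨_, h0⟩⟩

theorem exists_int_of_sq {w : ℚ} {m : ℤ} (h : w ^ 2 = m) : ∃ a : ℤ, w = a := by
  have h1 : IsIntegral ℤ w := by
    refine IsIntegral.of_pow two_pos ?_
    rw [h]
    exact isIntegral_algebraMap
  obtain ⟨a, ha⟩ := IsIntegrallyClosed.isIntegral_iff.1 h1
  exact ⟨a, by simpa using ha.symm⟩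

theorem exists_rat_add_mul (d : ℕ) (x : IntermediateField.adjoin ℚ {(√(d : ℝ) : ℝ)}) :
    ∃ p q : ℚ, (x : ℝ) = p + q * √(d : ℝ) := by
  obtain ⟨x, hx⟩ := x
  change ∃ p q : ℚ, x = p + q * √(d : ℝ)
  rw [← IntermediateField.mem_toSubalgebra,
    IntermediateField.adjoin_simple_toSubalgebra_of_isAlgebraic (isIntegral_sqrt d).isAlgebraic] at hx
  induction hx using Algebra.adjoin_induction with
  | mem x hx => exact ⟨0, 1, by rw [Set.mem_singleton_iff.1 hx]; simp⟩
  | algebraMap r => exact ⟨r, 0, by simp⟩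
  | add x y _ _ hx hy =>
    obtain ⟨p, q, rfl⟩ := hx
    obtain ⟨p', q', rfl⟩ := hy
    exact ⟨p + p', q + q', by push_cast; ring⟩
  | mul x y _ _ hx hy =>
    obtain ⟨p, q, rfl⟩ := hx
    obtain ⟨p', q', rfl⟩ := hy
    refine ⟨p * p' + q * q' * d, p * q' + q * p', ?_⟩
    push_cast
    linear_combination (q * q' : ℝ) * Real.mul_self_sqrt (Nat.cast_nonneg d)

theorem rat_add_mul_eq_zero {s : ℝ} (hs : Irrational s) {p q : ℚ} (h : (p : ℝ) + q * s = 0) :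
    p = 0 ∧ q = 0 := by
  by_cases hq : q = 0
  · subst hq
    simpa using h
  · exact absurd h ((hs.ratCast_mul hq).ratCast_add p).ne_zero

end Primes

/-! ### The field `ℚ(√2)` -/

section SqrtTwo

theorem coe_r2 : (r2 : ℝ) = √2 := IntermediateField.AdjoinSimple.coe_gen ℚ (√2 : ℝ)

theorem r2_sq : r2 ^ 2 = 2 := by
  apply Subtype.ext
  have h : ((r2 ^ 2 : K2) : ℝ) = (r2 : ℝ) ^ 2 := rfl
  rw [h, coe_r2, Real.sq_sqrt zero_le_two]
  rfl

theorem r2_ne_zero : r2 ≠ 0 := fun h => by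
  have := r2_sq
  rw [h] at this
  norm_num at this

theorem exists_rat_r2 (x : K2) : ∃ p q : ℚ, x = p + q * r2 := by
  obtain ⟨p, q, h⟩ := exists_rat_add_mul 2 ⟨x.1, by simp⟩
  refine ⟨p, q, Subtype.ext ?_⟩
  have h1 : ((p + q * r2 : K2) : ℝ) = p + q * (r2 : ℝ) := by push_cast; rfl
  rw [h1, coe_r2]
  exact h

theorem rat_r2_eq_zero {p q : ℚ} (h : (p : K2) + q * r2 = 0) : p = 0 ∧ q = 0 := by
  apply rat_add_mul_eq_zero irrational_sqrt_two
  have h1 : ((p + q * r2 : K2) : ℝ) = p + q * (r2 : ℝ) := by push_cast; rfl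
  rw [← coe_r2, ← h1, h]
  rfl

theorem int_r2_ext {a b c d : ℤ} (h : (a : K2) + b * r2 = c + d * r2) : a = c ∧ b = d := by
  have h1 := rat_r2_eq_zero (p := (a - c : ℤ)) (q := (b - d : ℤ)) (by push_cast; linear_combination h)
  norm_cast at h1
  omega

theorem isIntegral_r2 : IsIntegral ℤ r2 := by
  refine IsIntegral.of_pow two_pos ?_
  rw [r2_sq]
  exact isIntegral_algebraMap (R := ℤ) (x := 2)

theorem exists_int_r2 {x : K2} (hx : IsIntegral ℤ x) : ∃ a b : ℤ, x = a + b * r2 := by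
  obtain ⟨p, q, rfl⟩ := exists_rat_r2 x
  by_cases hq : q = 0
  · subst hq
    simp only [Rat.cast_zero, zero_mul, add_zero] at hx ⊢
    have h1 : IsIntegral ℤ p := by
      have : IsIntegral ℤ (algebraMap ℚ K2 p) := by simpa using hx
      exact (isIntegral_algebraMap_iff (algebraMap ℚ K2).injective).1 this
    obtain ⟨a, ha⟩ := IsIntegrallyClosed.isIntegral_iff.1 h1
    exact ⟨a, 0, by rw [← ha]; simp⟩
  · have hxQ : (p + q * r2 : K2) ∉ (algebraMap ℚ K2).range := by
      rintro ⟨r, hr⟩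
      refine hq (rat_r2_eq_zero (p := p - r) (q := q) ?_).2
      rw [eq_ratCast] at hr
      push_cast
      rw [hr]
      ring
    obtain ⟨⟨t, ht⟩, ⟨n, hn⟩⟩ := exists_int_of_quadratic (t := 2 * p) (n := p ^ 2 - 2 * q ^ 2)
      (by push_cast; linear_combination (-q ^ 2 : K2) * r2_sq * (-1)) hxQ hx
    -- Trace `t = 2p` and norm `n = p² - 2q²` give `t² - 4n = 8q²`, so `4q` has integral square and
    -- is an integer. Successive parity arguments then show that `t` is even and `4q` is divisible
    -- by four.
    · obtain ⟨s, hs⟩ := exists_int_of_sq (w := 4 * q) (m := 2 * (t ^ 2 - 4 * n)) (by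
        push_cast; rw [← ht, ← hn]; ring)
      have h1 : s ^ 2 = 2 * (t ^ 2 - 4 * n) := by
        have : (s : ℚ) ^ 2 = 2 * (t ^ 2 - 4 * n) := by rw [← hs, ← ht, ← hn]; ring
        exact_mod_cast this
      have h2 : 2 ∣ s := Int.prime_two.dvd_of_dvd_pow (Dvd.intro _ h1.symm)
      obtain ⟨s, rfl⟩ := h2
      have h3 : 2 ∣ t := by
        apply Int.prime_two.dvd_of_dvd_pow (n := 2)
        exact ⟨s ^ 2 + 2 * n, by linarith⟩
      obtain ⟨t, rfl⟩ := h3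
      have h4 : 2 ∣ s := by
        apply Int.prime_two.dvd_of_dvd_pow (n := 2)
        exact ⟨t ^ 2 - n, by linarith⟩
      obtain ⟨s, rfl⟩ := h4
      refine ⟨t, s, ?_⟩
      have h5 : p = t := by push_cast at ht; linarith
      have h6 : q = s := by push_cast at hs; linarith
      rw [h5, h6]
      push_cast
      rfl

/-- `√2` as an algebraic integer. -/
noncomputable def sqrtTwo : 𝓞 K2 := ⟨r2, isIntegral_r2⟩

theorem coe_sqrtTwo : (sqrtTwo : K2) = r2 := rfl

theorem sqrtTwo_sq : sqrtTwo ^ 2 = 2 := RingOfIntegers.coe_injective r2_sq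

/-- The ring of integers of `ℚ(√2)`. -/
noncomputable def integersTwo : QuadraticAlgebra ℤ 2 0 ≃+* 𝓞 K2 :=
  RingEquiv.ofBijective (QuadraticAlgebra.lift (A := 𝓞 K2)
    ⟨sqrtTwo, by rw [← pow_two, sqrtTwo_sq]; simp⟩ : QuadraticAlgebra ℤ 2 0 →ₐ[ℤ] 𝓞 K2) <| by
    constructor
    · intro x y h
      have h1 := congrArg (fun a : 𝓞 K2 => (a : K2)) h
      simp [coe_sqrtTwo] at h1
      obtain ⟨h2, h3⟩ := int_r2_ext h1
      exact QuadraticAlgebra.ext h2 h3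
    · intro a
      obtain ⟨m, n, h⟩ := exists_int_r2 a.2
      refine ⟨⟨m, n⟩, RingOfIntegers.coe_injective ?_⟩
      have h' : (algebraMap (𝓞 K2) K2 a) = m + n * r2 := h
      simp [h', coe_sqrtTwo]

end SqrtTwo

/-! ### The field `ℚ(√5)` -/

section SqrtFive

theorem coe_r5 : (r5 : ℝ) = √5 := IntermediateField.AdjoinSimple.coe_gen ℚ (√5 : ℝ)

theorem r5_sq : r5 ^ 2 = 5 := by
  apply Subtype.ext
  have h : ((r5 ^ 2 : K5) : ℝ) = (r5 : ℝ) ^ 2 := rfl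
  rw [h, coe_r5, Real.sq_sqrt (by norm_num)]
  rfl

theorem r5_eq : r5 = 2 * phi - 1 := by
  unfold phi
  ring

theorem phi_sq : phi ^ 2 = phi + 1 := by
  have h := r5_sq
  rw [r5_eq] at h
  linear_combination h / 4

theorem phi_inv : phi⁻¹ = phi - 1 := by
  rw [inv_eq_iff_eq_inv]
  refine eq_inv_of_mul_eq_one_left ?_
  linear_combination phi_sq

theorem exists_rat_r5 (x : K5) : ∃ p q : ℚ, x = p + q * r5 := by
  obtain ⟨p, q, h⟩ := exists_rat_add_mul 5 ⟨x.1, by simp⟩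
  refine ⟨p, q, Subtype.ext ?_⟩
  have h1 : ((p + q * r5 : K5) : ℝ) = p + q * (r5 : ℝ) := by push_cast; rfl
  rw [h1, coe_r5]
  exact h

theorem rat_r5_eq_zero {p q : ℚ} (h : (p : K5) + q * r5 = 0) : p = 0 ∧ q = 0 := by
  have h5 : Irrational (√5 : ℝ) := by simpa using Nat.Prime.irrational_sqrt Nat.prime_five
  apply rat_add_mul_eq_zero h5
  have h1 : ((p + q * r5 : K5) : ℝ) = p + q * (r5 : ℝ) := by push_cast; rfl
  rw [← coe_r5, ← h1, h]
  rfl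

theorem int_phi_ext {a b c d : ℤ} (h : (a : K5) + b * phi = c + d * phi) : a = c ∧ b = d := by
  have h1 := rat_r5_eq_zero (p := (2 * a + b - 2 * c - d : ℤ)) (q := (b - d : ℤ)) (by
    rw [r5_eq]; push_cast; linear_combination 2 * h)
  norm_cast at h1
  omega

theorem isIntegral_phi : IsIntegral ℤ phi := by
  refine ⟨Polynomial.X ^ 2 - Polynomial.X - 1, by monicity!, ?_⟩
  simp [phi_sq]

theorem exists_int_phi {x : K5} (hx : IsIntegral ℤ x) : ∃ a b : ℤ, x = a + b * phi := by
  obtain ⟨p, q, rfl⟩ := exists_rat_r5 x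
  by_cases hq : q = 0
  · subst hq
    simp only [Rat.cast_zero, zero_mul, add_zero] at hx ⊢
    have h1 : IsIntegral ℤ p := by
      have : IsIntegral ℤ (algebraMap ℚ K5 p) := by simpa using hx
      exact (isIntegral_algebraMap_iff (algebraMap ℚ K5).injective).1 this
    obtain ⟨a, ha⟩ := IsIntegrallyClosed.isIntegral_iff.1 h1
    exact ⟨a, 0, by rw [← ha]; simp⟩
  · have hxQ : (p + q * r5 : K5) ∉ (algebraMap ℚ K5).range := by
      rintro ⟨r, hr⟩
      refine hq (rat_r5_eq_zero (p := p - r) (q := q) ?_).2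
      rw [eq_ratCast] at hr
      push_cast
      rw [hr]
      ring
    obtain ⟨⟨t, ht⟩, ⟨n, hn⟩⟩ := exists_int_of_quadratic (t := 2 * p) (n := p ^ 2 - 5 * q ^ 2)
      (by push_cast; linear_combination (q ^ 2 : K5) * r5_sq) hxQ hx
    -- Here `t² - 4n = 20q²`, so `10q` is an integer, divisible by five. With `s = 2q` the equation
    -- becomes `t² - 5s² = 4n`, hence `t` and `s` have the same parity; the coordinates in the basis
    -- `1, φ` are `(t - s)/2` and `s`.
    · obtain ⟨s, hs⟩ := exists_int_of_sq (w := 10 * q) (m := 5 * (t ^ 2 - 4 * n)) (by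
        push_cast; rw [← ht, ← hn]; ring)
      have h1 : s ^ 2 = 5 * (t ^ 2 - 4 * n) := by
        have : (s : ℚ) ^ 2 = 5 * (t ^ 2 - 4 * n) := by rw [← hs, ← ht, ← hn]; ring
        exact_mod_cast this
      have h2 : 5 ∣ s := (Int.prime_iff_natAbs_prime (k := 5).2 Nat.prime_five).dvd_of_dvd_pow
        (Dvd.intro _ h1.symm)
      obtain ⟨s, rfl⟩ := h2
      have h3 : Even (t - s) := by
        have : Even (t ^ 2 - s ^ 2) := ⟨2 * (s ^ 2 + n), by linarith⟩
        rw [Int.even_sub, Int.even_pow' two_ne_zero, Int.even_pow' two_ne_zero] at this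
        rwa [Int.even_sub]
      obtain ⟨m, hm⟩ := h3
      refine ⟨m, s, ?_⟩
      have h6 : q = s / 2 := by push_cast at hs; linarith
      have h5 : p = m + s / 2 := by
        have : (t : ℚ) - s = m + m := by exact_mod_cast hm
        linarith
      rw [h5, h6, r5_eq]
      push_cast
      ring

/-- The golden ratio as an algebraic integer. -/
noncomputable def golden : 𝓞 K5 := ⟨phi, isIntegral_phi⟩

theorem coe_golden : (golden : K5) = phi := rfl

theorem golden_sq : golden ^ 2 = golden + 1 := RingOfIntegers.coe_injective phi_sq

/-- The ring of integers of `ℚ(√5)`. -/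
noncomputable def integersFive : QuadraticAlgebra ℤ 1 1 ≃+* 𝓞 K5 :=
  RingEquiv.ofBijective (QuadraticAlgebra.lift (A := 𝓞 K5)
    ⟨golden, by rw [← pow_two, golden_sq]; simp [add_comm]⟩ : QuadraticAlgebra ℤ 1 1 →ₐ[ℤ] 𝓞 K5) <| by
    constructor
    · intro x y h
      have h1 := congrArg (fun a : 𝓞 K5 => (a : K5)) h
      simp [coe_golden] at h1
      obtain ⟨h2, h3⟩ := int_phi_ext h1
      exact QuadraticAlgebra.ext h2 h3
    · intro a
      obtain ⟨m, n, h⟩ := exists_int_phi a.2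
      refine ⟨⟨m, n⟩, RingOfIntegers.coe_injective ?_⟩
      have h' : (algebraMap (𝓞 K5) K5 a) = m + n * phi := h
      simp [h', coe_golden]

end SqrtFive

/-! ### The primes of the gate sets and their residue fields -/

section Residues

variable {K : Type*} [Field K] [NumberField K]

/-- Modulo `g` the element `m + nθ` is congruent to the integer `m + nc`. If `χ` kills it, this
integer is a multiple of `p`, hence of `g`. -/
theorem map_eq_zero_iff_dvd {k : Type*} [CommRing k] {p : ℕ} [CharP k p] (χ : 𝓞 K →+* k)
    {θ g : 𝓞 K} (hθ : ∀ x : 𝓞 K, ∃ m n : ℤ, x = m + n * θ) {c : ℤ} (hc : χ θ = c)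
    (hp : g ∣ (p : 𝓞 K)) (hg : g ∣ θ - c) (h0 : χ g = 0) (x : 𝓞 K) : χ x = 0 ↔ g ∣ x := by
  constructor
  · intro h
    obtain ⟨m, n, rfl⟩ := hθ x
    have h1 : ((m + n * c : ℤ) : k) = 0 := by
      push_cast
      simpa [hc] using h
    obtain ⟨l, hl⟩ := (CharP.intCast_eq_zero_iff k p _).1 h1
    have h2 : (m + n * θ : 𝓞 K) = p * l + n * (θ - c) := by
      have h3 : ((m + n * c : ℤ) : 𝓞 K) = ((p * l : ℤ) : 𝓞 K) := by rw [hl]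
      push_cast at h3
      linear_combination h3
    rw [h2]
    exact dvd_add (hp.mul_right _) (hg.mul_left _)
  · rintro ⟨y, rfl⟩
    rw [map_mul, h0, zero_mul]

theorem exists_prime_rat (p : ℕ) [Fact p.Prime] :
    ∃ (v : HeightOneSpectrum (𝓞 ℚ)) (χ : 𝓞 ℚ →+* ZMod p), v.asIdeal = Ideal.span {(p : 𝓞 ℚ)} ∧
      (∀ a, a ∈ v.asIdeal ↔ χ a = 0) ∧ Finite (𝓞 ℚ ⧸ v.asIdeal) ∧
      Nat.card (𝓞 ℚ ⧸ v.asIdeal) = p := by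
  let χ : 𝓞 ℚ →+* ZMod p := (Int.castRingHom _).comp (Rat.ringOfIntegersEquiv : 𝓞 ℚ →+* ℤ)
  have hθ (x : 𝓞 ℚ) : ∃ m n : ℤ, x = m + n * 0 :=
    ⟨Rat.ringOfIntegersEquiv x, 0, by
      apply Rat.ringOfIntegersEquiv.injective
      simp⟩
  have hχ : Function.Surjective χ :=
    (ZMod.ringHom_surjective (Int.castRingHom (ZMod p))).comp Rat.ringOfIntegersEquiv.surjective
  obtain ⟨v, h1, h2, h3, h4⟩ := exists_prime_of_hom χ hχ (n := (p : 𝓞 ℚ))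
    (Nat.cast_ne_zero.2 (Fact.out : p.Prime).ne_zero)
    (map_eq_zero_iff_dvd χ hθ (c := 0) (by simp) dvd_rfl (by simp) (by simp))
  exact ⟨v, χ, h1, h2, h3, by rw [h4, Nat.card_zmod]⟩

theorem exists_int_sqrtTwo (x : 𝓞 K2) : ∃ m n : ℤ, x = m + n * sqrtTwo := by
  obtain ⟨m, n, h⟩ := exists_int_r2 x.2
  refine ⟨m, n, RingOfIntegers.coe_injective ?_⟩
  have h' : (algebraMap (𝓞 K2) K2 x) = m + n * r2 := h
  simp [h', coe_sqrtTwo]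

theorem exists_int_golden (x : 𝓞 K5) : ∃ m n : ℤ, x = m + n * golden := by
  obtain ⟨m, n, h⟩ := exists_int_phi x.2
  refine ⟨m, n, RingOfIntegers.coe_injective ?_⟩
  have h' : (algebraMap (𝓞 K5) K5 x) = m + n * phi := h
  simp [h', coe_golden]

theorem exists_hom_two {k : Type*} [CommRing k] (c : k) (hc : c ^ 2 = 2) :
    ∃ χ : 𝓞 K2 →+* k, χ sqrtTwo = c := by
  refine ⟨(QuadraticAlgebra.lift (A := k) (R := ℤ) (a := 2) (b := 0)
    ⟨c, by rw [← pow_two, hc]; simp⟩ : QuadraticAlgebra ℤ 2 0 →+* k).comp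
      (integersTwo.symm : 𝓞 K2 →+* QuadraticAlgebra ℤ 2 0), ?_⟩
  have h : integersTwo.symm sqrtTwo = QuadraticAlgebra.omega := by
    rw [RingEquiv.symm_apply_eq]
    refine Eq.trans ?_ (RingEquiv.ofBijective_apply _ _ _).symm
    simp [QuadraticAlgebra.lift]
  simp [h]

theorem exists_hom_five {k : Type*} [CommRing k] (c : k) (hc : c ^ 2 = c + 1) :
    ∃ χ : 𝓞 K5 →+* k, χ golden = c := by
  refine ⟨(QuadraticAlgebra.lift (A := k) (R := ℤ) (a := 1) (b := 1)
    ⟨c, by rw [← pow_two, hc]; simp [add_comm]⟩ : QuadraticAlgebra ℤ 1 1 →+* k).comp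
      (integersFive.symm : 𝓞 K5 →+* QuadraticAlgebra ℤ 1 1), ?_⟩
  have h : integersFive.symm golden = QuadraticAlgebra.omega := by
    rw [RingEquiv.symm_apply_eq]
    refine Eq.trans ?_ (RingEquiv.ofBijective_apply _ _ _).symm
    simp [QuadraticAlgebra.lift]
  simp [h]

theorem exists_prime_two (p : ℕ) [Fact p.Prime] (c : ℤ) (hc : (c : ZMod p) ^ 2 = 2) {g : 𝓞 K2}
    (hp : g ∣ (p : 𝓞 K2)) (hg : g ∣ sqrtTwo - c) {x y : ℤ} (hxy : g = x + y * sqrtTwo)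
    (h0 : ((x + y * c : ℤ) : ZMod p) = 0) :
    ∃ (v : HeightOneSpectrum (𝓞 K2)) (χ : 𝓞 K2 →+* ZMod p), χ sqrtTwo = c ∧
      v.asIdeal = Ideal.span {g} ∧ (∀ a, a ∈ v.asIdeal ↔ χ a = 0) ∧
      Finite (𝓞 K2 ⧸ v.asIdeal) ∧ Nat.card (𝓞 K2 ⧸ v.asIdeal) = p := by
  obtain ⟨χ, hχ⟩ := exists_hom_two (c : ZMod p) hc
  have hp0 : (p : 𝓞 K2) ≠ 0 := Nat.cast_ne_zero.2 (Fact.out : p.Prime).ne_zero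
  obtain ⟨v, h1, h2, h3, h4⟩ := exists_prime_of_hom χ (ZMod.ringHom_surjective _)
    (n := g) (fun h => hp0 (zero_dvd_iff.1 (h ▸ hp)))
    (map_eq_zero_iff_dvd χ exists_int_sqrtTwo hχ hp hg (by
      rw [hxy]; push_cast at h0; simp [hχ, h0]))
  exact ⟨v, χ, hχ, h1, h2, h3, by rw [h4, Nat.card_zmod]⟩

theorem exists_prime_five (p : ℕ) [Fact p.Prime] (c : ℤ) (hc : (c : ZMod p) ^ 2 = c + 1)
    {g : 𝓞 K5} (hp : g ∣ (p : 𝓞 K5)) (hg : g ∣ golden - c) {x y : ℤ} (hxy : g = x + y * golden)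
    (h0 : ((x + y * c : ℤ) : ZMod p) = 0) :
    ∃ (v : HeightOneSpectrum (𝓞 K5)) (χ : 𝓞 K5 →+* ZMod p), χ golden = c ∧
      v.asIdeal = Ideal.span {g} ∧ (∀ a, a ∈ v.asIdeal ↔ χ a = 0) ∧
      Finite (𝓞 K5 ⧸ v.asIdeal) ∧ Nat.card (𝓞 K5 ⧸ v.asIdeal) = p := by
  obtain ⟨χ, hχ⟩ := exists_hom_five (c : ZMod p) hc
  have hp0 : (p : 𝓞 K5) ≠ 0 := Nat.cast_ne_zero.2 (Fact.out : p.Prime).ne_zero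
  obtain ⟨v, h1, h2, h3, h4⟩ := exists_prime_of_hom χ (ZMod.ringHom_surjective _)
    (n := g) (fun h => hp0 (zero_dvd_iff.1 (h ▸ hp)))
    (map_eq_zero_iff_dvd χ exists_int_golden hχ hp hg (by
      rw [hxy]; push_cast at h0; simp [hχ, h0]))
  exact ⟨v, χ, hχ, h1, h2, h3, by rw [h4, Nat.card_zmod]⟩

/-- The field with four elements. -/
abbrev FourField : Type := QuadraticAlgebra (ZMod 2) 1 1

instance : IsDomain FourField := by
  have : Nontrivial FourField := ⟨0, 1, fun h => by
    have := congrArg QuadraticAlgebra.re h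
    exact zero_ne_one (α := ZMod 2) this⟩
  have : NoZeroDivisors FourField := ⟨fun {x y} h => by
    have h1 := congrArg QuadraticAlgebra.re h
    have h2 := congrArg QuadraticAlgebra.im h
    simp only [QuadraticAlgebra.re_mul, QuadraticAlgebra.im_mul, QuadraticAlgebra.re_zero,
      QuadraticAlgebra.im_zero] at h1 h2
    have h3 : ∀ a b c d : ZMod 2, a * c + 1 * b * d = 0 → a * d + b * c + 1 * b * d = 0 →
      (a = 0 ∧ b = 0) ∨ (c = 0 ∧ d = 0) := by decide
    rcases h3 _ _ _ _ h1 h2 with h | h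
    · exact Or.inl (QuadraticAlgebra.ext h.1 h.2)
    · exact Or.inr (QuadraticAlgebra.ext h.1 h.2)⟩
  exact NoZeroDivisors.to_isDomain _

instance : Finite FourField :=
  Finite.of_injective (QuadraticAlgebra.equivProd (1 : ZMod 2) 1) (Equiv.injective _)

/-- `x² = x + 1` is irreducible modulo 2. Reducing both coordinates of `m + nφ` modulo 2 is a ring
homomorphism onto the field of four elements, whose kernel consists of the multiples of 2. -/
theorem exists_prime_inert :
    ∃ (v : HeightOneSpectrum (𝓞 K5)) (χ : 𝓞 K5 →+* FourField), χ golden = QuadraticAlgebra.omega ∧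
      v.asIdeal = Ideal.span {(2 : 𝓞 K5)} ∧ (∀ a, a ∈ v.asIdeal ↔ χ a = 0) ∧
      Finite (𝓞 K5 ⧸ v.asIdeal) ∧ Nat.card (𝓞 K5 ⧸ v.asIdeal) = 4 := by
  obtain ⟨χ, hχ⟩ := exists_hom_five (QuadraticAlgebra.omega : FourField) (by
    apply QuadraticAlgebra.ext <;> simp [pow_two] <;> rfl)
  have h2 : χ 2 = 0 := by
    rw [map_ofNat]
    apply QuadraticAlgebra.ext <;> simp <;> decide
  have hsurj : Function.Surjective χ := fun y => by
    obtain ⟨m, hm⟩ := ZMod.intCast_surjective y.re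
    obtain ⟨n, hn⟩ := ZMod.intCast_surjective y.im
    refine ⟨m + n * golden, ?_⟩
    rw [map_add, map_mul, hχ, map_intCast, map_intCast]
    apply QuadraticAlgebra.ext <;> simp [hm, hn]
  obtain ⟨v, h1, h3, h4, h5⟩ := exists_prime_of_hom χ hsurj (n := 2) two_ne_zero (fun a => by
    constructor
    · intro h
      obtain ⟨m, n, rfl⟩ := exists_int_golden a
      rw [map_add, map_mul, hχ, map_intCast, map_intCast] at h
      have e1 := congrArg QuadraticAlgebra.re h
      have e2 := congrArg QuadraticAlgebra.im h
      simp at e1 e2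
      rw [ZMod.intCast_zmod_eq_zero_iff_dvd _ 2] at e1 e2
      obtain ⟨m, rfl⟩ := e1
      obtain ⟨n, rfl⟩ := e2
      exact ⟨m + n * golden, by push_cast; ring⟩
    · rintro ⟨b, rfl⟩
      rw [map_mul, h2, zero_mul])
  refine ⟨v, χ, hχ, h1, h3, h4, ?_⟩
  rw [h5, Nat.card_congr (QuadraticAlgebra.equivProd (1 : ZMod 2) 1), Nat.card_prod, Nat.card_zmod]

end Residues

/-! ### The fields are totally real -/

section TotallyReal

theorem isTotallyReal_of_sq {K : Type*} [Field K] [NumberField K] {r : K} {d : ℕ}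
    (hr : r ^ 2 = d) (h : ∀ x : K, ∃ p q : ℚ, x = p + q * r) : IsTotallyReal K := by
  refine ⟨fun w => ?_⟩
  rw [InfinitePlace.isReal_iff, ComplexEmbedding.isReal_iff]
  have h1 : w.embedding r ^ 2 = d := by rw [← map_pow, hr, map_natCast]
  have h2 : ∃ s : ℝ, w.embedding r = s := by
    have h3 : (w.embedding r - (√d : ℝ)) * (w.embedding r + (√d : ℝ)) = 0 := by
      have : ((√d : ℝ) : ℂ) ^ 2 = d := by
        rw [← Complex.ofReal_pow, Real.sq_sqrt (Nat.cast_nonneg d)]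
        simp
      linear_combination h1 - this
    rcases mul_eq_zero.1 h3 with h4 | h4
    · exact ⟨√d, sub_eq_zero.1 h4⟩
    · exact ⟨-√d, by rw [Complex.ofReal_neg]; exact eq_neg_of_add_eq_zero_left h4⟩
  obtain ⟨s, hs⟩ := h2
  ext x
  obtain ⟨p, q, rfl⟩ := h x
  simp [ComplexEmbedding.conjugate_coe_eq, hs]

theorem isTotallyReal_two : IsTotallyReal K2 :=
  isTotallyReal_of_sq (d := 2) (by simpa using r2_sq) exists_rat_r2

theorem isTotallyReal_five : IsTotallyReal K5 :=
  isTotallyReal_of_sq (d := 5) (by simpa using r5_sq) exists_rat_r5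

end TotallyReal

/-! ### Real embeddings and the bound on traces -/

section Embeddings

theorem map_normSq_eq {K : Type*} [Field K] (σ : K →+* ℝ) (x : ℍ[K]) :
    σ (Quaternion.normSq x) = σ x.re ^ 2 + σ x.imI ^ 2 + σ x.imJ ^ 2 + σ x.imK ^ 2 := by
  rw [Quaternion.normSq_def']
  simp

theorem map_normSq_nonneg {K : Type*} [Field K] (σ : K →+* ℝ) (x : ℍ[K]) :
    0 ≤ σ (Quaternion.normSq x) := by
  rw [map_normSq_eq]
  positivity

/-- The norm is a sum of four squares in every real embedding, so the real part of a quaternion of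
norm one has absolute value at most one. -/
theorem map_trace_sq_le {K : Type*} [Field K] (σ : K →+* ℝ) {x : ℍ[K]}
    (hx : Quaternion.normSq x = 1) : σ (2 * x.re) ^ 2 ≤ 4 := by
  have h := map_normSq_eq σ x
  rw [hx, map_one] at h
  rw [map_mul, map_ofNat]
  nlinarith [sq_nonneg (σ x.imI), sq_nonneg (σ x.imJ), sq_nonneg (σ x.imK)]

/-- The equality case of the trace bound: the real part already exhausts the norm, so the other
three squares vanish. -/
theorem eq_re_of_trace_sq {K : Type*} [Field K] (σ : K →+* ℝ) {x : ℍ[K]}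
    (hx : Quaternion.normSq x = 1) {s : K} (hs : s ^ 2 = 1) (h : x.re = s) :
    x = algebraMap K ℍ[K] s := by
  have h1 := map_normSq_eq σ x
  rw [hx, map_one, h, ← map_pow, hs, map_one] at h1
  have h2 : ∀ y : K, σ y ^ 2 = 0 → y = 0 := fun y hy =>
    (map_eq_zero σ).1 (pow_eq_zero_iff two_ne_zero |>.1 hy)
  have p1 := sq_nonneg (σ x.imI)
  have p2 := sq_nonneg (σ x.imJ)
  have p3 := sq_nonneg (σ x.imK)
  apply Quaternion.ext
  · exact h
  · exact h2 _ (by linarith)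
  · exact h2 _ (by linarith)
  · exact h2 _ (by linarith)

/-- The real embedding of `ℚ(√2)` with `√2 ↦ -√2`. -/
theorem exists_conj_two : ∃ σ : K2 →+* ℝ, σ r2 = -√2 := by
  obtain ⟨χ, hχ⟩ := exists_hom_two (k := ℝ) (-√2) (by rw [neg_sq, Real.sq_sqrt zero_le_two])
  have hinj : Function.Injective χ := by
    rw [injective_iff_map_eq_zero]
    intro a ha
    obtain ⟨m, n, rfl⟩ := exists_int_sqrtTwo a
    rw [map_add, map_mul, hχ, map_intCast, map_intCast] at ha
    obtain ⟨h1, h2⟩ := rat_add_mul_eq_zero irrational_sqrt_two (p := m) (q := -n)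
      (by push_cast; linear_combination ha)
    have h1' : m = 0 := by exact_mod_cast h1
    have h2' : n = 0 := by simpa using h2
    simp [h1', h2']
  refine ⟨IsFractionRing.lift hinj, ?_⟩
  rw [← coe_sqrtTwo, ← hχ]
  exact IsFractionRing.lift_algebraMap hinj sqrtTwo

/-- The real embedding of `ℚ(√5)` with `√5 ↦ -√5`. -/
theorem exists_conj_five : ∃ σ : K5 →+* ℝ, σ phi = (1 - √5) / 2 := by
  have h5 : (√5 : ℝ) ^ 2 = 5 := Real.sq_sqrt (by norm_num)
  obtain ⟨χ, hχ⟩ := exists_hom_five (k := ℝ) ((1 - √5) / 2) (by linear_combination h5 / 4)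
  have hinj : Function.Injective χ := by
    rw [injective_iff_map_eq_zero]
    intro a ha
    obtain ⟨m, n, rfl⟩ := exists_int_golden a
    rw [map_add, map_mul, hχ, map_intCast, map_intCast] at ha
    have hi : Irrational (√5 : ℝ) := by simpa using Nat.Prime.irrational_sqrt Nat.prime_five
    obtain ⟨h1, h2⟩ := rat_add_mul_eq_zero hi (p := m + n / 2) (q := -n / 2)
      (by push_cast; linear_combination ha)
    have h2' : (n : ℚ) = 0 := by linarith
    have h1' : (m : ℚ) = 0 := by rw [h2'] at h1; simpa using h1
    norm_cast at h1' h2'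
    simp [h1', h2']
  refine ⟨IsFractionRing.lift hinj, ?_⟩
  rw [← coe_golden, ← hχ]
  exact IsFractionRing.lift_algebraMap hinj golden

theorem algebraMap_r2 : algebraMap K2 ℝ r2 = √2 := coe_r2

theorem algebraMap_r5 : algebraMap K5 ℝ r5 = √5 := coe_r5

theorem algebraMap_phi : algebraMap K5 ℝ phi = (1 + √5) / 2 := by
  rw [phi, map_div₀, map_add, algebraMap_r5, map_one, map_ofNat]

end Embeddings

/-! ### Units that are reduced norms are squares -/

section Units

/-- Positive units of norm one in `ℤ[√2]` are squares. With `a = 2m + 1` and `b = 2n` the equation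
reads `m(m + 1) = 2n²`. Halving the even factor leaves two coprime nonnegative integers whose
product is a square, so each is a square. Then `a` is the sum of `m` and `m + 1`. -/
theorem sq_of_pell {a b : ℤ} (h : a ^ 2 - 2 * b ^ 2 = 1) (ha : 0 < a) :
    ∃ c d : ℤ, a = c ^ 2 + 2 * d ^ 2 ∧ b = 2 * c * d := by
  have key : ∀ {x y n : ℤ}, 0 ≤ x → 0 ≤ y → IsCoprime x y → x * y = n ^ 2 →
      ∃ c d : ℤ, x = c ^ 2 ∧ y = d ^ 2 ∧ n = c * d := by
    intro x y n hx hy hxy hn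
    obtain ⟨c, hc | hc⟩ := Int.sq_of_isCoprime hxy hn
    · obtain ⟨d, hd | hd⟩ := Int.sq_of_isCoprime hxy.symm (by rw [mul_comm]; exact hn)
      · rw [hc, hd, ← mul_pow, sq_eq_sq_iff_eq_or_eq_neg] at hn
        rcases hn with hn | hn
        · exact ⟨c, d, hc, hd, hn.symm⟩
        · exact ⟨-c, d, by rw [hc]; ring, hd, by linarith⟩
      · have hd0 : d = 0 := by nlinarith [sq_nonneg d]
        subst hd0
        have : n = 0 := by
          rw [hd] at hn
          simpa using hn.symm
        exact ⟨c, 0, hc, by simpa using hd, by rw [this]; ring⟩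
    · have hc0 : c = 0 := by nlinarith [sq_nonneg c]
      subst hc0
      have h1 : IsUnit y := by rwa [hc, zero_pow two_ne_zero, neg_zero, isCoprime_zero_left] at hxy
      have h2 : y = 1 := by
        rcases Int.isUnit_iff.1 h1 with h | h <;> omega
      have : n = 0 := by
        rw [hc] at hn
        simpa using hn.symm
      exact ⟨0, 1, by simpa using hc, by simpa using h2, by rw [this]; ring⟩
  have hodd : Odd a := by
    rcases Int.even_or_odd a with ⟨m, hm⟩ | h1
    · exfalso
      rw [hm] at h
      ring_nf at h
      omega
    · exact h1
  obtain ⟨m, hm⟩ := hodd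
  have hb : Even b := by
    have h1 : Even (b ^ 2) := ⟨m * (m + 1), by rw [hm] at h; linarith⟩
    exact (Int.even_pow' two_ne_zero).1 h1
  obtain ⟨n, hn⟩ := hb
  have hmn : m * (m + 1) = 2 * n ^ 2 := by
    rw [hm, hn] at h
    linarith
  rcases Int.even_or_odd m with ⟨l, hl⟩ | ⟨l, hl⟩
  · obtain ⟨c, d, h1, h2, h3⟩ := key (x := l) (y := m + 1) (n := n) (by omega) (by omega)
      ⟨-2, 1, by rw [hl]; ring⟩ (by rw [hl] at hmn; rw [hl]; linarith)
    exact ⟨d, c, by rw [← h1, ← h2]; omega, by rw [hn, h3]; ring⟩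
  · obtain ⟨c, d, h1, h2, h3⟩ := key (x := m) (y := l + 1) (n := n) (by omega) (by omega)
      ⟨-1, 2, by rw [hl]; ring⟩ (by rw [hl] at hmn; rw [hl]; linarith)
    exact ⟨c, d, by rw [← h1, ← h2]; omega, by rw [hn, h3]; ring⟩

/-- Descent through division of `a + bφ` by `φ²`, which gives `(2a - b) + (b - a)φ` with a smaller
second coordinate. If the quotient is the square of `c + dφ`, then `a + bφ` is the square of `φ(c +
dφ) = d + (c + d)φ`. -/
theorem sq_of_fibonacci_of_nonneg (n : ℕ) : ∀ {a b : ℤ}, a ^ 2 + a * b - b ^ 2 = 1 →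
    0 < 2 * a + b → 0 ≤ b → b ≤ n → ∃ c d : ℤ, a = c ^ 2 + d ^ 2 ∧ b = 2 * c * d + d ^ 2 := by
  induction n with
  | zero =>
    intro a b h ht h0 hn
    have hb : b = 0 := by push_cast at hn; omega
    subst hb
    exact ⟨1, 0, by nlinarith, by ring⟩
  | succ n ih =>
    intro a b h ht h0 hn
    push_cast at hn
    rcases h0.eq_or_lt with rfl | hb
    · exact ⟨1, 0, by nlinarith, by ring⟩
    · have ha : 0 < a := by
        by_contra ha
        nlinarith
      have hab : a ≤ b := by
        by_contra hab
        nlinarith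
      obtain ⟨c, d, h1, h2⟩ := ih (a := 2 * a - b) (b := b - a) (by linarith)
        (by nlinarith) (by linarith) (by linarith)
      exact ⟨d, c + d, by linarith, by linarith⟩

theorem sq_of_fibonacci {a b : ℤ} (h : a ^ 2 + a * b - b ^ 2 = 1) (ht : 0 < 2 * a + b) :
    ∃ c d : ℤ, a = c ^ 2 + d ^ 2 ∧ b = 2 * c * d + d ^ 2 := by
  rcases le_total 0 b with hb | hb
  · exact sq_of_fibonacci_of_nonneg b.toNat h ht hb (by omega)
  -- The conjugate of `a + bφ` is `(a + b) - bφ`. Conjugation reduces to a nonnegative second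
  -- coordinate and is applied again to the square root.
  · obtain ⟨c, d, h1, h2⟩ := sq_of_fibonacci_of_nonneg (-b).toNat (a := a + b) (b := -b)
      (by linarith) (by linarith) (by linarith) (by omega)
    exact ⟨c + d, -d, by linarith, by linarith⟩

theorem isSquare_of_normSq_rat {u : (𝓞 ℚ)ˣ} {x : ℍ[ℚ]} (h : Quaternion.normSq x = (u : 𝓞 ℚ)) :
    ∃ w : 𝓞 ℚ, (u : 𝓞 ℚ) = w ^ 2 := by
  refine ⟨1, ?_⟩
  have h1 : IsUnit (Rat.ringOfIntegersEquiv u) := u.isUnit.map Rat.ringOfIntegersEquiv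
  have h2 : ((Rat.ringOfIntegersEquiv u : ℤ) : ℚ) = ((u : 𝓞 ℚ) : ℚ) :=
    Rat.ringOfIntegersEquiv_apply_coe _
  have h3 : (0 : ℚ) ≤ ((u : 𝓞 ℚ) : ℚ) := by
    rw [← h, Quaternion.normSq_def']
    positivity
  rw [← h2] at h3
  have h4 : 0 ≤ Rat.ringOfIntegersEquiv u := by exact_mod_cast h3
  apply Rat.ringOfIntegersEquiv.injective
  rcases Int.isUnit_iff.1 h1 with h5 | h5
  · simp [h5]
  · omega

/-- A reduced norm is a sum of four squares, hence nonnegative in both real embeddings. So the unit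
is totally positive, its norm to `ℤ` is `1` and not `-1`, and `sq_of_pell` applies. -/
theorem isSquare_of_normSq_two {u : (𝓞 K2)ˣ} {x : ℍ[K2]} (h : Quaternion.normSq x = (u : 𝓞 K2)) :
    ∃ w : 𝓞 K2, (u : 𝓞 K2) = w ^ 2 := by
  obtain ⟨σ, hσ⟩ := exists_conj_two
  obtain ⟨a, b, hab⟩ := exists_int_sqrtTwo u
  obtain ⟨c, d, hcd⟩ := exists_int_sqrtTwo ((u⁻¹ : (𝓞 K2)ˣ) : 𝓞 K2)
  have hs : (√2 : ℝ) ^ 2 = 2 := Real.sq_sqrt zero_le_two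
  have hu : ((u : 𝓞 K2) : K2) = a + b * r2 := by rw [hab]; simp [coe_sqrtTwo]
  have p1 : (0 : ℝ) ≤ a + b * √2 := by
    have := map_normSq_nonneg (algebraMap K2 ℝ) x
    rwa [h, hu, map_add, map_mul, algebraMap_r2, map_intCast, map_intCast] at this
  have p2 : (0 : ℝ) ≤ a - b * √2 := by
    have := map_normSq_nonneg σ x
    rwa [h, hu, map_add, map_mul, hσ, map_intCast, map_intCast, mul_neg, ← sub_eq_add_neg] at this
  have h1 : ((a + b * sqrtTwo) * (c + d * sqrtTwo) : 𝓞 K2) = 1 := by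
    rw [← hab, ← hcd]
    exact u.mul_inv
  have h2 : ((a * c + 2 * b * d : ℤ) : K2) + ((a * d + b * c : ℤ) : K2) * r2 =
      ((1 : ℤ) : K2) + ((0 : ℤ) : K2) * r2 := by
    have h3 : ((a + b * r2) * (c + d * r2) : K2) = 1 := by
      have := congrArg (fun z : 𝓞 K2 => (z : K2)) h1
      simpa [coe_sqrtTwo] using this
    push_cast
    linear_combination h3 - (b * d : K2) * r2_sq
  obtain ⟨h3, h4⟩ := int_r2_ext h2
  have h5 : (a ^ 2 - 2 * b ^ 2) * (c ^ 2 - 2 * d ^ 2) = 1 := by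
    linear_combination (a * c + 2 * b * d + 1) * h3 - 2 * (a * d + b * c) * h4
  have h6 : 0 ≤ a ^ 2 - 2 * b ^ 2 := by
    have : (0 : ℝ) ≤ ((a ^ 2 - 2 * b ^ 2 : ℤ) : ℝ) := by
      push_cast
      linarith [mul_nonneg p1 p2, congrArg (fun t => (b : ℝ) ^ 2 * t) hs]
    exact_mod_cast this
  have h7 : a ^ 2 - 2 * b ^ 2 = 1 := by
    rcases Int.isUnit_iff.1 (IsUnit.of_mul_eq_one _ h5) with h | h <;> omega
  have h8 : 0 < a := by
    have h9 : (0 : ℝ) ≤ a := by linarith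
    have h10 : 0 ≤ a := by exact_mod_cast h9
    rcases h10.eq_or_lt with rfl | h
    · omega
    · exact h
  obtain ⟨p, q, h9, h10⟩ := sq_of_pell h7 h8
  refine ⟨p + q * sqrtTwo, ?_⟩
  rw [hab, h9, h10]
  push_cast
  linear_combination (-(q : 𝓞 K2) ^ 2) * sqrtTwo_sq

theorem isSquare_of_normSq_five {u : (𝓞 K5)ˣ} {x : ℍ[K5]} (h : Quaternion.normSq x = (u : 𝓞 K5)) :
    ∃ w : 𝓞 K5, (u : 𝓞 K5) = w ^ 2 := by
  obtain ⟨σ, hσ⟩ := exists_conj_five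
  obtain ⟨a, b, hab⟩ := exists_int_golden u
  obtain ⟨c, d, hcd⟩ := exists_int_golden ((u⁻¹ : (𝓞 K5)ˣ) : 𝓞 K5)
  have hs : (√5 : ℝ) ^ 2 = 5 := Real.sq_sqrt (by norm_num)
  have hu : ((u : 𝓞 K5) : K5) = a + b * phi := by rw [hab]; simp [coe_golden]
  have p1 : (0 : ℝ) ≤ a + b * ((1 + √5) / 2) := by
    have := map_normSq_nonneg (algebraMap K5 ℝ) x
    rwa [h, hu, map_add, map_mul, algebraMap_phi, map_intCast, map_intCast] at this
  have p2 : (0 : ℝ) ≤ a + b * ((1 - √5) / 2) := by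
    have := map_normSq_nonneg σ x
    rwa [h, hu, map_add, map_mul, hσ, map_intCast, map_intCast] at this
  have h1 : ((a + b * golden) * (c + d * golden) : 𝓞 K5) = 1 := by
    rw [← hab, ← hcd]
    exact u.mul_inv
  have h2 : ((a * c + b * d : ℤ) : K5) + ((a * d + b * c + b * d : ℤ) : K5) * phi =
      ((1 : ℤ) : K5) + ((0 : ℤ) : K5) * phi := by
    have h3 : ((a + b * phi) * (c + d * phi) : K5) = 1 := by
      have := congrArg (fun z : 𝓞 K5 => (z : K5)) h1
      simpa [coe_golden] using this
    push_cast
    linear_combination h3 - (b * d : K5) * phi_sq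
  obtain ⟨h3, h4⟩ := int_phi_ext h2
  have h5 : (a ^ 2 + a * b - b ^ 2) * (c ^ 2 + c * d - d ^ 2) = 1 := by
    linear_combination (a * c + b * d + 1) * h3 + (a * c + b * d - (a * d + b * c + b * d)) * h4
  have h6 : 0 ≤ a ^ 2 + a * b - b ^ 2 := by
    have : (0 : ℝ) ≤ ((a ^ 2 + a * b - b ^ 2 : ℤ) : ℝ) := by
      push_cast
      linarith [mul_nonneg p1 p2, congrArg (fun t => (b : ℝ) ^ 2 * t) hs]
    exact_mod_cast this
  have h7 : a ^ 2 + a * b - b ^ 2 = 1 := by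
    rcases Int.isUnit_iff.1 (IsUnit.of_mul_eq_one _ h5) with h | h <;> omega
  have h8 : 0 < 2 * a + b := by
    have h9 : (0 : ℝ) ≤ ((2 * a + b : ℤ) : ℝ) := by push_cast; linarith
    have h10 : 0 ≤ 2 * a + b := by exact_mod_cast h9
    rcases h10.eq_or_lt with h | h
    · have : b = -2 * a := by linarith
      rw [this] at h7
      nlinarith
    · exact h
  obtain ⟨p, q, h9, h10⟩ := sq_of_fibonacci h7 h8
  refine ⟨p + q * golden, ?_⟩
  rw [hab, h9, h10]
  push_cast
  linear_combination (-(q : 𝓞 K5) ^ 2) * golden_sq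

end Units

/-! ### The possible traces of units of norm one -/

section Traces

theorem trace_rat {x : ℍ[ℚ]} (hx : Quaternion.normSq x = 1) (ht : 2 * x.re ∈ intRing ℚ) :
    2 * x.re = 0 ∨ 2 * x.re = 1 ∨ 2 * x.re = -1 ∨ cls x = 1 := by
  obtain ⟨t, ht⟩ := ht
  have h2 : ((Rat.ringOfIntegersEquiv t : ℤ) : ℚ) = 2 * x.re := by
    rw [Rat.ringOfIntegersEquiv_apply_coe, ← ht]
  have h := map_trace_sq_le (algebraMap ℚ ℝ) hx
  generalize Rat.ringOfIntegersEquiv t = m at h2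
  rw [← h2] at h ⊢
  simp only [map_intCast] at h
  have h' : m ^ 2 ≤ 4 := by exact_mod_cast h
  have h3 : m ≤ 2 := by nlinarith
  have h4 : -2 ≤ m := by nlinarith
  have key : ∀ s : ℚ, s ^ 2 = 1 → x.re = s → cls x = 1 := fun s hs hxs => by
    rw [eq_re_of_trace_sq (algebraMap ℚ ℝ) hx hs hxs, ← cls_one (K := ℚ),
      Algebra.algebraMap_eq_smul_one, cls_smul (by rintro rfl; norm_num at hs)]
  interval_cases m
  · exact Or.inr (Or.inr (Or.inr (key (-1) (by norm_num) (by push_cast at h2; linarith))))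
  · simp
  · simp
  · simp
  · exact Or.inr (Or.inr (Or.inr (key 1 (by norm_num) (by push_cast at h2; linarith))))

/-- Adding the trace bounds of the two embeddings gives `m² + 2n² ≤ 4` for the trace `m + n√2`. The
cases `±1 ± √2` violate one of the two bounds, and the traces `±2` force a scalar. -/
theorem trace_two {x : ℍ[K2]} (hx : Quaternion.normSq x = 1) (ht : 2 * x.re ∈ intRing K2) :
    2 * x.re = 0 ∨ 2 * x.re = 1 ∨ 2 * x.re = -1 ∨ 2 * x.re = r2 ∨ 2 * x.re = -r2 ∨ cls x = 1 := by
  obtain ⟨σ, hσ⟩ := exists_conj_two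
  obtain ⟨t, ht⟩ := ht
  obtain ⟨m, n, rfl⟩ := exists_int_sqrtTwo t
  have h2 : 2 * x.re = m + n * r2 := by rw [← ht]; simp [coe_sqrtTwo]
  have hs : (√2 : ℝ) ^ 2 = 2 := Real.sq_sqrt zero_le_two
  have h1 := map_trace_sq_le (algebraMap K2 ℝ) hx
  have h3 := map_trace_sq_le σ hx
  rw [h2, map_add, map_mul, map_intCast, map_intCast, algebraMap_r2] at h1
  rw [h2, map_add, map_mul, map_intCast, map_intCast, hσ] at h3
  have h5 : m ^ 2 + 2 * n ^ 2 ≤ 4 := by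
    have : ((m ^ 2 + 2 * n ^ 2 : ℤ) : ℝ) ≤ 4 := by
      push_cast
      linarith [congrArg (fun t => (n : ℝ) ^ 2 * t) hs]
    exact_mod_cast this
  have h6 : m ≤ 2 := by nlinarith
  have h7 : -2 ≤ m := by nlinarith
  have h8 : n ≤ 1 := by nlinarith
  have h9 : -1 ≤ n := by nlinarith
  have hlt : (1 : ℝ) < √2 := by rw [Real.lt_sqrt] <;> norm_num
  have key : ∀ s : K2, s ^ 2 = 1 → x.re = s → cls x = 1 := fun s hs hxs => by
    rw [eq_re_of_trace_sq (algebraMap K2 ℝ) hx hs hxs, ← cls_one (K := K2),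
      Algebra.algebraMap_eq_smul_one, cls_smul (by rintro rfl; norm_num at hs)]
  have h2' : x.re = (m + n * r2) / 2 := by rw [← h2]; ring
  rw [h2]
  interval_cases m <;> interval_cases n <;> first
    | (exfalso; omega)
    | (exfalso; push_cast at h1 h3; nlinarith)
    | (simp; done)
    | (refine Or.inr (Or.inr (Or.inr (Or.inr (Or.inr (key 1 (by norm_num) ?_)))))
       rw [h2']; push_cast; ring1)
    | (refine Or.inr (Or.inr (Or.inr (Or.inr (Or.inr (key (-1) (by norm_num) ?_)))))
       rw [h2']; push_cast; ring1)

/-- For the trace `m + nφ` the two bounds add up to `(2m + n)² + 5n² ≤ 16`. The pairs that remain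
are tested in each embedding separately, and the traces `±2` force a scalar. -/
theorem trace_five {x : ℍ[K5]} (hx : Quaternion.normSq x = 1) (ht : 2 * x.re ∈ intRing K5) :
    2 * x.re = 0 ∨ 2 * x.re = 1 ∨ 2 * x.re = -1 ∨ 2 * x.re = phi ∨ 2 * x.re = -phi ∨
      2 * x.re = phi - 1 ∨ 2 * x.re = 1 - phi ∨ cls x = 1 := by
  obtain ⟨σ, hσ⟩ := exists_conj_five
  obtain ⟨t, ht⟩ := ht
  obtain ⟨m, n, rfl⟩ := exists_int_golden t
  have h2 : 2 * x.re = m + n * phi := by rw [← ht]; simp [coe_golden]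
  have hs : (√5 : ℝ) ^ 2 = 5 := Real.sq_sqrt (by norm_num)
  have h1 := map_trace_sq_le (algebraMap K5 ℝ) hx
  have h3 := map_trace_sq_le σ hx
  rw [h2, map_add, map_mul, map_intCast, map_intCast, algebraMap_phi] at h1
  rw [h2, map_add, map_mul, map_intCast, map_intCast, hσ] at h3
  have h5 : (2 * m + n) ^ 2 + 5 * n ^ 2 ≤ 16 := by
    have : (((2 * m + n) ^ 2 + 5 * n ^ 2 : ℤ) : ℝ) ≤ 16 := by
      push_cast
      linarith [congrArg (fun t => (n : ℝ) ^ 2 * t) hs]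
    exact_mod_cast this
  have h8 : n ≤ 1 := by nlinarith
  have h9 : -1 ≤ n := by nlinarith
  have h6 : m ≤ 2 := by nlinarith
  have h7 : -2 ≤ m := by nlinarith
  have hlt : (2 : ℝ) < √5 := by rw [Real.lt_sqrt] <;> norm_num
  have key : ∀ s : K5, s ^ 2 = 1 → x.re = s → cls x = 1 := fun s hs hxs => by
    rw [eq_re_of_trace_sq (algebraMap K5 ℝ) hx hs hxs, ← cls_one (K := K5),
      Algebra.algebraMap_eq_smul_one, cls_smul (by rintro rfl; norm_num at hs)]
  have h2' : x.re = (m + n * phi) / 2 := by rw [← h2]; ring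
  rw [h2]
  interval_cases n <;> interval_cases m <;> first
    | (exfalso; omega)
    | (exfalso; push_cast at h1 h3; nlinarith)
    | (simp; done)
    | (simp [sub_eq_add_neg, add_comm]; done)
    | (refine Or.inr (Or.inr (Or.inr (Or.inr (Or.inr (Or.inr (Or.inr
        (key 1 (by norm_num) ?_)))))))
       rw [h2']; push_cast; ring1)
    | (refine Or.inr (Or.inr (Or.inr (Or.inr (Or.inr (Or.inr (Or.inr
        (key (-1) (by norm_num) ?_)))))))
       rw [h2']; push_cast; ring1)

end Traces

/-! ### The order of a class from its trace -/

section Powers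

variable {F : Type*} [Field F] [CharZero F]

/-- Cayley–Hamilton in norm one. It reduces all powers of `x` to combinations of `x` and `1`, so
each special value of the trace makes some power equal to `±1`, which is trivial modulo scalars. -/
theorem sq_eq_trace_smul {x : ℍ[F]} (hx : Quaternion.normSq x = 1) :
    x * x = (2 * x.re) • x - 1 := by
  rw [Quaternion.normSq_def'] at hx
  apply Quaternion.ext
  · simp; linear_combination -hx
  · simp; ring
  · simp; ring
  · simp; ring

theorem cls_neg (x : ℍ[F]) : cls (-x) = cls x := by
  rw [← neg_one_smul F, cls_smul (by simp)]

theorem cls_pow_eq_one {x : ℍ[F]} (hx : Quaternion.normSq x = 1) {n : ℕ}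
    (h : x ^ n = 1 ∨ x ^ n = -1) : cls x ^ n = 1 := by
  have hu : IsUnit x := isUnit_of_normSq_ne_zero (by rw [hx]; exact one_ne_zero)
  have h1 : ∀ m : ℕ, cls (x ^ m) = cls x ^ m := fun m => by
    induction m with
    | zero => rw [pow_zero, pow_zero, cls_one]
    | succ m ih => rw [pow_succ, cls_mul (hu.pow m) hu, ih, pow_succ]
  rw [← h1]
  rcases h with h | h
  · rw [h, cls_one]
  · rw [h, cls_neg, cls_one]

theorem cls_sq_eq_one {x : ℍ[F]} (hx : Quaternion.normSq x = 1) (ht : 2 * x.re = 0) :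
    cls x ^ 2 = 1 := by
  refine cls_pow_eq_one hx (Or.inr ?_)
  rw [pow_two, sq_eq_trace_smul hx, ht, zero_smul, zero_sub]

theorem cls_pow_three_eq_one {x : ℍ[F]} (hx : Quaternion.normSq x = 1) (ht : (2 * x.re) ^ 2 = 1) :
    cls x ^ 3 = 1 := by
  have h : x ^ 3 = ((2 * x.re) ^ 2 - 1) • x - (2 * x.re) • (1 : ℍ[F]) := by
    rw [pow_succ, pow_two, sq_eq_trace_smul hx, sub_mul, smul_mul_assoc, sq_eq_trace_smul hx,
      one_mul]
    module
  rw [ht, sub_self, zero_smul, zero_sub] at h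
  rcases (sq_eq_sq_iff_eq_or_eq_neg (b := (1 : F))).1 (by rw [ht, one_pow]) with h1 | h1
  · exact cls_pow_eq_one hx (Or.inr (by rw [h, h1, one_smul]))
  · exact cls_pow_eq_one hx (Or.inl (by rw [h, h1, neg_one_smul, neg_neg]))

theorem cls_pow_four_eq_one {x : ℍ[F]} (hx : Quaternion.normSq x = 1) (ht : (2 * x.re) ^ 2 = 2) :
    cls x ^ 4 = 1 := by
  refine cls_pow_eq_one hx (Or.inr ?_)
  have h : x ^ 4 = ((2 * x.re) * ((2 * x.re) ^ 2 - 2)) • x +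
      (1 - (2 * x.re) ^ 2) • (1 : ℍ[F]) := by
    rw [show x ^ 4 = (x * x) * (x * x) by noncomm_ring, sq_eq_trace_smul hx, sub_mul, mul_sub,
      smul_mul_smul_comm, sq_eq_trace_smul hx]
    simp only [one_mul, mul_one]
    module
  rw [h, ht]
  module

theorem cls_pow_five_eq_one {x : ℍ[F]} (hx : Quaternion.normSq x = 1)
    (ht : (2 * x.re) ^ 2 = 2 * x.re + 1) : cls x ^ 5 = 1 := by
  refine cls_pow_eq_one hx (Or.inr ?_)
  have h4 : x ^ 4 = ((2 * x.re) * ((2 * x.re) ^ 2 - 2)) • x +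
      (1 - (2 * x.re) ^ 2) • (1 : ℍ[F]) := by
    rw [show x ^ 4 = (x * x) * (x * x) by noncomm_ring, sq_eq_trace_smul hx, sub_mul, mul_sub,
      smul_mul_smul_comm, sq_eq_trace_smul hx]
    simp only [one_mul, mul_one]
    module
  have h5 : (2 * x.re) * ((2 * x.re) ^ 2 - 2) = 1 := by linear_combination (2 * x.re + 1) * ht
  have h6 : 1 - (2 * x.re) ^ 2 = -(2 * x.re) := by linear_combination -ht
  rw [pow_succ, h4, h5, h6, add_mul, smul_mul_assoc, smul_mul_assoc, sq_eq_trace_smul hx, one_mul]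
  module

theorem cls_pow_five_eq_one' {x : ℍ[F]} (hx : Quaternion.normSq x = 1)
    (ht : (2 * x.re) ^ 2 = 1 - 2 * x.re) : cls x ^ 5 = 1 := by
  rw [← cls_neg]
  refine cls_pow_five_eq_one (by rwa [Quaternion.normSq_neg]) ?_
  rw [Quaternion.re_neg]
  linear_combination ht

end Powers

/-! ### Unit classes sorted by trace and order -/

section UnitGroups

variable {K : Type*} [Field K] [NumberField K] {v : HeightOneSpectrum (𝓞 K)}
  {O : Subalgebra (𝓞 K) ℍ[K]} {e : ℍ[v.adicCompletion K] ≃ₐ[v.adicCompletion K]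
    Matrix (Fin 2) (Fin 2) (v.adicCompletion K)}

/-- The norm of a unit is a square `w²`; division by the scalar `w` makes the norm one and keeps the
class. -/
theorem exists_norm_one (hO : IsOrder O) {c : PD K} (hc : c ∈ unitGroup O)
    (hsq : ∀ (u : (𝓞 K)ˣ) (x : ℍ[K]), Quaternion.normSq x = (u : 𝓞 K) → ∃ w : 𝓞 K, (u : 𝓞 K) = w ^ 2) :
    ∃ x ∈ O, Quaternion.normSq x = 1 ∧ cls x = c := by
  obtain ⟨x, hx, u, hu, rfl⟩ := exists_of_mem_unitGroup hO hc
  obtain ⟨w, hw⟩ := hsq u x hu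
  have hwu : IsUnit w := (isUnit_pow_iff two_ne_zero).1 (hw ▸ u.isUnit)
  obtain ⟨w, rfl⟩ := hwu
  have h1 : (((w⁻¹ : (𝓞 K)ˣ) : 𝓞 K) : K) * ((w : 𝓞 K) : K) = 1 := by
    rw [← map_mul, Units.inv_mul, map_one]
  refine ⟨(((w⁻¹ : (𝓞 K)ˣ) : 𝓞 K) : K) • x, smul_mem_of_mem_intRing hx ⟨_, rfl⟩, ?_, ?_⟩
  · have h2 : ((u : 𝓞 K) : K) = ((w : 𝓞 K) : K) ^ 2 := by
      rw [hw]
      exact map_pow (algebraMap (𝓞 K) K) _ _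
    rw [Quaternion.normSq_smul, hu, h2, ← mul_pow, h1, one_pow]
  · exact cls_smul (left_ne_zero_of_mul_eq_one h1) x

theorem isElliptic_of_trace {k : Type*} [CommRing k] {χ : 𝓞 K →+* k}
    (hχ : ∀ a, a ∈ v.asIdeal ↔ χ a = 0) (he : IsStandard e) {x : ℍ[K]}
    (hm : ∃ M, IntModel e x M) (hx : Quaternion.normSq x = 1) {t : 𝓞 K} (ht : 2 * x.re = (t : K))
    (h : ∀ z : k, z ^ 2 - χ t * z + 1 ≠ 0) : IsElliptic e (cls x) := by
  obtain ⟨M, hM⟩ := hm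
  refine hM.isElliptic he (n := 1) ht (by simp [hx]) fun a ha => h (χ a) ?_
  have := (hχ _).1 ha
  simpa using this

/-- The trace governs eigenvectors modulo `P`. The order of the class is recorded with it so that
traces that cannot occur in a given finite subgroup may be discarded. -/
theorem cases_rat {O : Subalgebra (𝓞 ℚ) ℍ[ℚ]} (hO : IsOrder O) {c : PD ℚ}
    (hc : c ∈ unitGroup O) : c = 1 ∨ ∃ x ∈ O, Quaternion.normSq x = 1 ∧ cls x = c ∧
      ∃ t : ℤ, 2 * x.re = ((t : 𝓞 ℚ) : ℚ) ∧ (t = 0 ∧ c ^ 2 = 1 ∨ (t = 1 ∨ t = -1) ∧ c ^ 3 = 1) := by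
  obtain ⟨x, hx, h1, rfl⟩ := exists_norm_one hO hc fun u x h => isSquare_of_normSq_rat h
  rcases trace_rat h1 (hO.trace_mem hx) with h | h | h | h
  · exact Or.inr ⟨x, hx, h1, rfl, 0, by simpa using h, by simpa using cls_sq_eq_one h1 h⟩
  · exact Or.inr ⟨x, hx, h1, rfl, 1, by simpa using h,
      by simpa using cls_pow_three_eq_one h1 (by rw [h]; norm_num)⟩
  · exact Or.inr ⟨x, hx, h1, rfl, -1, by simpa using h,
      by simpa using cls_pow_three_eq_one h1 (by rw [h]; norm_num)⟩
  · exact Or.inl h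

theorem cases_two {O : Subalgebra (𝓞 K2) ℍ[K2]} (hO : IsOrder O) {c : PD K2}
    (hc : c ∈ unitGroup O) : c = 1 ∨ ∃ x ∈ O, Quaternion.normSq x = 1 ∧ cls x = c ∧
      ∃ t : 𝓞 K2, 2 * x.re = (t : K2) ∧ (t = 0 ∧ c ^ 2 = 1 ∨ (t = 1 ∨ t = -1) ∧ c ^ 3 = 1 ∨
        (t = sqrtTwo ∨ t = -sqrtTwo) ∧ c ^ 4 = 1) := by
  obtain ⟨x, hx, h1, rfl⟩ := exists_norm_one hO hc fun u x h => isSquare_of_normSq_two h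
  rcases trace_two h1 (hO.trace_mem hx) with h | h | h | h | h | h
  · exact Or.inr ⟨x, hx, h1, rfl, 0, by simpa using h, Or.inl ⟨rfl, cls_sq_eq_one h1 h⟩⟩
  · exact Or.inr ⟨x, hx, h1, rfl, 1, by simpa using h,
      Or.inr (Or.inl ⟨Or.inl rfl, cls_pow_three_eq_one h1 (by rw [h]; norm_num)⟩)⟩
  · exact Or.inr ⟨x, hx, h1, rfl, -1, by simpa using h,
      Or.inr (Or.inl ⟨Or.inr rfl, cls_pow_three_eq_one h1 (by rw [h]; norm_num)⟩)⟩
  · exact Or.inr ⟨x, hx, h1, rfl, sqrtTwo, by simpa [coe_sqrtTwo] using h,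
      Or.inr (Or.inr ⟨Or.inl rfl, cls_pow_four_eq_one h1 (by rw [h, r2_sq])⟩)⟩
  · exact Or.inr ⟨x, hx, h1, rfl, -sqrtTwo, by simpa [coe_sqrtTwo] using h,
      Or.inr (Or.inr ⟨Or.inr rfl, cls_pow_four_eq_one h1 (by rw [h, neg_sq, r2_sq])⟩)⟩
  · exact Or.inl h

theorem cases_five {O : Subalgebra (𝓞 K5) ℍ[K5]} (hO : IsOrder O) {c : PD K5}
    (hc : c ∈ unitGroup O) : c = 1 ∨ ∃ x ∈ O, Quaternion.normSq x = 1 ∧ cls x = c ∧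
      ∃ t : 𝓞 K5, 2 * x.re = (t : K5) ∧ (t = 0 ∧ c ^ 2 = 1 ∨ (t = 1 ∨ t = -1) ∧ c ^ 3 = 1 ∨
        (t = golden ∨ t = -golden ∨ t = golden - 1 ∨ t = 1 - golden) ∧ c ^ 5 = 1) := by
  obtain ⟨x, hx, h1, rfl⟩ := exists_norm_one hO hc fun u x h => isSquare_of_normSq_five h
  rcases trace_five h1 (hO.trace_mem hx) with h | h | h | h | h | h | h | h
  · exact Or.inr ⟨x, hx, h1, rfl, 0, by simpa using h, Or.inl ⟨rfl, cls_sq_eq_one h1 h⟩⟩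
  · exact Or.inr ⟨x, hx, h1, rfl, 1, by simpa using h,
      Or.inr (Or.inl ⟨Or.inl rfl, cls_pow_three_eq_one h1 (by rw [h]; norm_num)⟩)⟩
  · exact Or.inr ⟨x, hx, h1, rfl, -1, by simpa using h,
      Or.inr (Or.inl ⟨Or.inr rfl, cls_pow_three_eq_one h1 (by rw [h]; norm_num)⟩)⟩
  · exact Or.inr ⟨x, hx, h1, rfl, golden, by simpa [coe_golden] using h,
      Or.inr (Or.inr ⟨by simp, cls_pow_five_eq_one h1 (by rw [h]; exact phi_sq)⟩)⟩
  · exact Or.inr ⟨x, hx, h1, rfl, -golden, by simpa [coe_golden] using h,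
      Or.inr (Or.inr ⟨by simp, cls_pow_five_eq_one' h1 (by rw [h]; linear_combination phi_sq)⟩)⟩
  · exact Or.inr ⟨x, hx, h1, rfl, golden - 1, by simpa [coe_golden] using h,
      Or.inr (Or.inr ⟨by simp, cls_pow_five_eq_one' h1 (by rw [h]; linear_combination phi_sq)⟩)⟩
  · exact Or.inr ⟨x, hx, h1, rfl, 1 - golden, by simpa [coe_golden] using h,
      Or.inr (Or.inr ⟨by simp, cls_pow_five_eq_one h1 (by rw [h]; linear_combination phi_sq)⟩)⟩
  · exact Or.inl h

end UnitGroups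

/-! ### Orders given by a basis of four quaternions -/

section Span

variable {K : Type*} [Field K] [NumberField K]

theorem exists_subalgebra_of_span {S : Set ℍ[K]} (h1 : 1 ∈ Submodule.span (𝓞 K) S)
    (h : ∀ x ∈ S, ∀ y ∈ S, x * y ∈ Submodule.span (𝓞 K) S) :
    ∃ O : Subalgebra (𝓞 K) ℍ[K], Subalgebra.toSubmodule O = Submodule.span (𝓞 K) S := by
  refine ⟨(Submodule.span (𝓞 K) S).toSubalgebra h1 fun x y hx hy => ?_,
    Submodule.toSubalgebra_toSubmodule _ _ _⟩
  induction hx, hy using Submodule.span_induction₂ with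
  | mem_mem x y hx hy => exact h x hx y hy
  | zero_left y hy => rw [zero_mul]; exact zero_mem _
  | zero_right x hx => rw [mul_zero]; exact zero_mem _
  | add_left x y z _ _ _ h1 h2 => rw [add_mul]; exact add_mem h1 h2
  | add_right x y z _ _ _ h1 h2 => rw [mul_add]; exact add_mem h1 h2
  | smul_left r x y _ _ h => exact (Algebra.smul_mul_assoc r x y) ▸ Submodule.smul_mem _ r h
  | smul_right r x y _ _ h => exact (Algebra.mul_smul_comm r x y) ▸ Submodule.smul_mem _ r h

theorem mem_span_four {a b c d x : ℍ[K]} {p q r s : K} (hp : p ∈ intRing K) (hq : q ∈ intRing K)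
    (hr : r ∈ intRing K) (hs : s ∈ intRing K) (h : x = p • a + q • b + r • c + s • d) :
    x ∈ Submodule.span (𝓞 K) {a, b, c, d} := by
  obtain ⟨p, rfl⟩ := hp
  obtain ⟨q, rfl⟩ := hq
  obtain ⟨r, rfl⟩ := hr
  obtain ⟨s, rfl⟩ := hs
  simp only [algebraMap_smul] at h
  rw [h]
  refine add_mem (add_mem (add_mem ?_ ?_) ?_) ?_ <;>
    exact Submodule.smul_mem _ _ (Submodule.subset_span (by simp))

theorem exists_of_mem_span_four {a b c d x : ℍ[K]} (h : x ∈ Submodule.span (𝓞 K) {a, b, c, d}) :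
    ∃ p q r s : 𝓞 K, x = (p : K) • a + (q : K) • b + (r : K) • c + (s : K) • d := by
  simp only [Submodule.mem_span_insert, Submodule.mem_span_singleton] at h
  obtain ⟨p, _, ⟨q, _, ⟨r, _, ⟨s, rfl⟩, rfl⟩, rfl⟩, rfl⟩ := h
  exact ⟨p, q, r, s, by simp only [algebraMap_smul, add_assoc]⟩

theorem intModel_of_span {v : HeightOneSpectrum (𝓞 K)}
    {O : Subalgebra (𝓞 K) ℍ[K]} {e : ℍ[v.adicCompletion K] ≃ₐ[v.adicCompletion K]
      Matrix (Fin 2) (Fin 2) (v.adicCompletion K)} {S : Set ℍ[K]}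
    (hO : Subalgebra.toSubmodule O = Submodule.span (𝓞 K) S) (h : ∀ x ∈ S, ∃ M, IntModel e x M)
    {x : ℍ[K]} (hx : x ∈ O) : ∃ M, IntModel e x M := by
  rw [← Subalgebra.mem_toSubmodule, hO] at hx
  induction hx using Submodule.span_induction with
  | mem x hx => exact h x hx
  | zero => exact ⟨0, by simp [IntModel]⟩
  | add x y _ _ hx hy =>
    obtain ⟨M, hM⟩ := hx
    obtain ⟨N, hN⟩ := hy
    exact ⟨_, hM.add hN⟩
  | smul a x _ hx =>
    obtain ⟨M, hM⟩ := hx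
    exact ⟨_, by simpa only [algebraMap_smul] using hM.smul a⟩

theorem exists_subalgebra_of_span_four {a b c : ℍ[K]}
    (haa : a * a ∈ Submodule.span (𝓞 K) {1, a, b, c}) (hab : a * b ∈ Submodule.span (𝓞 K) {1, a, b, c})
    (hac : a * c ∈ Submodule.span (𝓞 K) {1, a, b, c}) (hba : b * a ∈ Submodule.span (𝓞 K) {1, a, b, c})
    (hbb : b * b ∈ Submodule.span (𝓞 K) {1, a, b, c}) (hbc : b * c ∈ Submodule.span (𝓞 K) {1, a, b, c})
    (hca : c * a ∈ Submodule.span (𝓞 K) {1, a, b, c}) (hcb : c * b ∈ Submodule.span (𝓞 K) {1, a, b, c})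
    (hcc : c * c ∈ Submodule.span (𝓞 K) {1, a, b, c}) :
    ∃ O : Subalgebra (𝓞 K) ℍ[K], Subalgebra.toSubmodule O = Submodule.span (𝓞 K) {1, a, b, c} := by
  refine exists_subalgebra_of_span (Submodule.subset_span (by simp)) ?_
  simp only [Set.mem_insert_iff, Set.mem_singleton_iff]
  rintro x (rfl | rfl | rfl | rfl) y (rfl | rfl | rfl | rfl) <;>
    first
    | assumption
    | (rw [one_mul]; exact Submodule.subset_span (by simp))
    | (rw [mul_one]; exact Submodule.subset_span (by simp))

/-- An element of the lattice with basis `1, a, b, c` over `ℤ[θ]`. -/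
abbrev latticePoint {F : Type*} [Field F] (θ : F) (a b c : ℍ[F]) (p q r s p' q' r' s' : ℤ) : ℍ[F] :=
  (p + p' * θ : F) • 1 + (q + q' * θ : F) • a + (r + r' * θ : F) • b + (s + s' * θ : F) • c

theorem int_add_mem {θ : K} (hθ : θ ∈ intRing K) (m n : ℤ) : (m + n * θ : K) ∈ intRing K :=
  add_mem (intCast_mem _ m) (mul_mem (intCast_mem _ n) hθ)

theorem latticePoint_mem {θ : K} (hθ : θ ∈ intRing K) (a b c : ℍ[K]) (p q r s p' q' r' s' : ℤ) :
    latticePoint θ a b c p q r s p' q' r' s' ∈ Submodule.span (𝓞 K) {1, a, b, c} :=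
  mem_span_four (int_add_mem hθ p p') (int_add_mem hθ q q') (int_add_mem hθ r r')
    (int_add_mem hθ s s') rfl

theorem int_combination_mem {θ t₁ t₂ t₃ t₄ : K} (hθ : θ ∈ intRing K) (h₁ : t₁ ∈ intRing K)
    (h₂ : t₂ ∈ intRing K) (h₃ : t₃ ∈ intRing K) (h₄ : t₄ ∈ intRing K)
    (m₁ m₂ m₃ m₄ n₁ n₂ n₃ n₄ : ℤ) : (m₁ + n₁ * θ) * t₁ + (m₂ + n₂ * θ) * t₂ +
      (m₃ + n₃ * θ) * t₃ + (m₄ + n₄ * θ) * t₄ ∈ intRing K :=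
  add_mem (add_mem (add_mem (mul_mem (int_add_mem hθ _ _) h₁) (mul_mem (int_add_mem hθ _ _) h₂))
    (mul_mem (int_add_mem hθ _ _) h₃)) (mul_mem (int_add_mem hθ _ _) h₄)

theorem trace_mem_of_dual {O : Subalgebra (𝓞 K) ℍ[K]} {S : Set ℍ[K]}
    (hO : Subalgebra.toSubmodule O = Submodule.span (𝓞 K) S) {x : ℍ[K]}
    (h : ∀ y ∈ O, 2 * (x * y).re ∈ intRing K) {y : ℍ[K]} (hy : y ∈ S) :
    2 * (x * y).re ∈ intRing K :=
  h y (by rw [← Subalgebra.mem_toSubmodule, hO]; exact Submodule.subset_span hy)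

end Span

/-! ### Multiplication tables and dual bases of the lattices -/

section Identities

theorem quat_mul_quat {F : Type*} [Field F] (a b c d a' b' c' d' : F) :
    quat a b c d * quat a' b' c' d' = quat (a * a' - b * b' - c * c' - d * d')
      (a * b' + b * a' + c * d' - d * c') (a * c' - b * d' + c * a' + d * b')
      (a * d' + b * c' - c * b' + d * a') := by
  apply Quaternion.ext
  exacts [Quaternion.re_mul _ _, Quaternion.imI_mul _ _, Quaternion.imJ_mul _ _,
    Quaternion.imK_mul _ _]

theorem quat_add_quat {F : Type*} [Field F] (a b c d a' b' c' d' : F) :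
    quat a b c d + quat a' b' c' d' = quat (a + a') (b + b') (c + c') (d + d') := rfl

theorem smul_quat {F : Type*} [Field F] (t a b c d : F) :
    t • quat a b c d = quat (t * a) (t * b) (t * c) (t * d) := rfl

theorem one_eq_quat {F : Type*} [Field F] : (1 : ℍ[F]) = quat 1 0 0 0 := rfl

theorem omega_eq (F : Type*) [Field F] : omega F = quat (1 / 2) (1 / 2) (1 / 2) (1 / 2) := rfl

theorem quat_congr {F : Type*} [Field F] {a b c d a' b' c' d' : F} (h1 : a = a') (h2 : b = b')
    (h3 : c = c') (h4 : d = d') : quat a b c d = quat a' b' c' d' := by rw [h1, h2, h3, h4]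

theorem re_quat {F : Type*} [Field F] (a b c d : F) : (quat a b c d).re = a := rfl

variable {F : Type*} [Field F] [CharZero F]

/-- The coefficients in `ℤ[r]` of the nine products of basis elements other than `1`; they show that
the lattice is a ring. -/
theorem octahedral_mul {r : F} (hr : r ^ 2 = 2) :
    (quat (1 / r) (1 / r) 0 0) * (quat (1 / r) (1 / r) 0 0) = latticePoint r (quat (1 / r) (1 / r) 0 0) (quat (1 / r) 0 (1 / r) 0) (omega F) (-1) 0 0 0 0 1 0 0 ∧
    (quat (1 / r) (1 / r) 0 0) * (quat (1 / r) 0 (1 / r) 0) = latticePoint r (quat (1 / r) (1 / r) 0 0) (quat (1 / r) 0 (1 / r) 0) (omega F) 0 0 0 1 0 0 0 0 ∧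
    (quat (1 / r) (1 / r) 0 0) * (omega F) = latticePoint r (quat (1 / r) (1 / r) 0 0) (quat (1 / r) 0 (1 / r) 0) (omega F) 0 0 (-1) 0 0 0 0 1 ∧
    (quat (1 / r) 0 (1 / r) 0) * (quat (1 / r) (1 / r) 0 0) = latticePoint r (quat (1 / r) (1 / r) 0 0) (quat (1 / r) 0 (1 / r) 0) (omega F) (-1) 0 0 (-1) 0 1 1 0 ∧
    (quat (1 / r) 0 (1 / r) 0) * (quat (1 / r) 0 (1 / r) 0) = latticePoint r (quat (1 / r) (1 / r) 0 0) (quat (1 / r) 0 (1 / r) 0) (omega F) (-1) 0 0 0 0 0 1 0 ∧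
    (quat (1 / r) 0 (1 / r) 0) * (omega F) = latticePoint r (quat (1 / r) (1 / r) 0 0) (quat (1 / r) 0 (1 / r) 0) (omega F) 0 1 1 0 (-1) 0 0 0 ∧
    (omega F) * (quat (1 / r) (1 / r) 0 0) = latticePoint r (quat (1 / r) (1 / r) 0 0) (quat (1 / r) 0 (1 / r) 0) (omega F) 0 1 1 0 (-1) 0 0 0 ∧
    (omega F) * (quat (1 / r) 0 (1 / r) 0) = latticePoint r (quat (1 / r) (1 / r) 0 0) (quat (1 / r) 0 (1 / r) 0) (omega F) 0 (-1) 0 0 0 0 0 1 ∧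
    (omega F) * (omega F) = latticePoint r (quat (1 / r) (1 / r) 0 0) (quat (1 / r) 0 (1 / r) 0) (omega F) (-1) 0 0 1 0 0 0 0 := by
  simp only [latticePoint, omega_eq, one_eq_quat, quat_mul_quat, quat_add_quat, smul_quat]
  refine ⟨?_, ?_, ?_, ?_, ?_, ?_, ?_, ?_, ?_⟩ <;> apply quat_congr <;> push_cast <;> grind

theorem octahedral_units {r : F} (hr : r ^ 2 = 2) :
    quat 0 1 0 0 = latticePoint r (quat (1 / r) (1 / r) 0 0) (quat (1 / r) 0 (1 / r) 0) (omega F) (-1) 0 0 0 0 1 0 0 ∧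
    quat 0 0 1 0 = latticePoint r (quat (1 / r) (1 / r) 0 0) (quat (1 / r) 0 (1 / r) 0) (omega F) (-1) 0 0 0 0 0 1 0 ∧
    quat 0 0 0 1 = latticePoint r (quat (1 / r) (1 / r) 0 0) (quat (1 / r) 0 (1 / r) 0) (omega F) 1 0 0 2 0 (-1) (-1) 0 ∧
    quat 0 (1 / r) (-1 / r) 0 = latticePoint r (quat (1 / r) (1 / r) 0 0) (quat (1 / r) 0 (1 / r) 0) (omega F) 0 1 (-1) 0 0 0 0 0 ∧
    quat 0 (1 + 1 / r) (1 / r) (1 - r) = latticePoint r (quat (1 / r) (1 / r) 0 0) (quat (1 / r) 0 (1 / r) 0) (omega F) 0 3 3 2 (-2) 0 (-1) (-2) ∧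
    quat 0 (1 - 1 / r) 1 (1 / r) = latticePoint r (quat (1 / r) (1 / r) 0 0) (quat (1 / r) 0 (1 / r) 0) (omega F) (-2) (-2) (-1) 0 1 1 1 1 ∧
    quat 0 0 (1 - 1 / r) (1 / r) = latticePoint r (quat (1 / r) (1 / r) 0 0) (quat (1 / r) 0 (1 / r) 0) (omega F) (-1) (-1) (-2) 0 1 0 1 1 := by
  simp only [latticePoint, omega_eq, one_eq_quat, quat_add_quat, smul_quat]
  refine ⟨?_, ?_, ?_, ?_, ?_, ?_, ?_⟩ <;> apply quat_congr <;> push_cast <;> grind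

/-- The coefficients are those of the inverse Gram matrix of the basis for the form `2 Re(xy)`. That
this inverse is integral means that the discriminant is a unit and the lattice is its own dual. -/
theorem octahedral_dual {r : F} (hr : r ^ 2 = 2) (x : ℍ[F]) :
    x = ((((-1 : ℤ) : F) + ((0 : ℤ) : F) * r) * (2 * (x * 1).re) +
        (((0 : ℤ) : F) + ((1 : ℤ) : F) * r) * (2 * (x * (quat (1 / r) (1 / r) 0 0)).re) +
        (((0 : ℤ) : F) + ((1 : ℤ) : F) * r) * (2 * (x * (quat (1 / r) 0 (1 / r) 0)).re) +
        (((-1 : ℤ) : F) + ((0 : ℤ) : F) * r) * (2 * (x * (omega F)).re)) • (1 : ℍ[F]) +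
      ((((0 : ℤ) : F) + ((1 : ℤ) : F) * r) * (2 * (x * 1).re) +
        (((-2 : ℤ) : F) + ((0 : ℤ) : F) * r) * (2 * (x * (quat (1 / r) (1 / r) 0 0)).re) +
        (((-1 : ℤ) : F) + ((0 : ℤ) : F) * r) * (2 * (x * (quat (1 / r) 0 (1 / r) 0)).re) +
        (((0 : ℤ) : F) + ((1 : ℤ) : F) * r) * (2 * (x * (omega F)).re)) • (quat (1 / r) (1 / r) 0 0) +
      ((((0 : ℤ) : F) + ((1 : ℤ) : F) * r) * (2 * (x * 1).re) +
        (((-1 : ℤ) : F) + ((0 : ℤ) : F) * r) * (2 * (x * (quat (1 / r) (1 / r) 0 0)).re) +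
        (((-2 : ℤ) : F) + ((0 : ℤ) : F) * r) * (2 * (x * (quat (1 / r) 0 (1 / r) 0)).re) +
        (((0 : ℤ) : F) + ((1 : ℤ) : F) * r) * (2 * (x * (omega F)).re)) • (quat (1 / r) 0 (1 / r) 0) +
      ((((-1 : ℤ) : F) + ((0 : ℤ) : F) * r) * (2 * (x * 1).re) +
        (((0 : ℤ) : F) + ((1 : ℤ) : F) * r) * (2 * (x * (quat (1 / r) (1 / r) 0 0)).re) +
        (((0 : ℤ) : F) + ((1 : ℤ) : F) * r) * (2 * (x * (quat (1 / r) 0 (1 / r) 0)).re) +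
        (((-2 : ℤ) : F) + ((0 : ℤ) : F) * r) * (2 * (x * (omega F)).re)) • (omega F) := by
  have hx : x = quat x.re x.imI x.imJ x.imK := rfl
  generalize x.re = x₀, x.imI = x₁, x.imJ = x₂, x.imK = x₃ at hx
  subst hx
  simp only [omega_eq, one_eq_quat, quat_mul_quat, quat_add_quat, smul_quat, re_quat]
  apply quat_congr <;> push_cast <;> grind

theorem icosian_mul {f : F} (hf : f ^ 2 = f + 1) :
    (quat 0 1 0 0) * (quat 0 1 0 0) = latticePoint f (quat 0 1 0 0) (omega F) (quat 0 (1 / 2) (f⁻¹ / 2) (f / 2)) (-1) 0 0 0 0 0 0 0 ∧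
    (quat 0 1 0 0) * (omega F) = latticePoint f (quat 0 1 0 0) (omega F) (quat 0 (1 / 2) (f⁻¹ / 2) (f / 2)) (-1) (-1) 1 2 1 1 (-2) 0 ∧
    (quat 0 1 0 0) * (quat 0 (1 / 2) (f⁻¹ / 2) (f / 2)) = latticePoint f (quat 0 1 0 0) (omega F) (quat 0 (1 / 2) (f⁻¹ / 2) (f / 2)) 1 2 (-3) (-1) 0 (-1) 0 2 ∧
    (omega F) * (quat 0 1 0 0) = latticePoint f (quat 0 1 0 0) (omega F) (quat 0 (1 / 2) (f⁻¹ / 2) (f / 2)) 0 2 (-1) (-2) (-1) (-1) 2 0 ∧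
    (omega F) * (omega F) = latticePoint f (quat 0 1 0 0) (omega F) (quat 0 (1 / 2) (f⁻¹ / 2) (f / 2)) (-1) 0 1 0 0 0 0 0 ∧
    (omega F) * (quat 0 (1 / 2) (f⁻¹ / 2) (f / 2)) = latticePoint f (quat 0 1 0 0) (omega F) (quat 0 (1 / 2) (f⁻¹ / 2) (f / 2)) 1 2 (-2) (-1) (-1) (-1) 1 1 ∧
    (quat 0 (1 / 2) (f⁻¹ / 2) (f / 2)) * (quat 0 1 0 0) = latticePoint f (quat 0 1 0 0) (omega F) (quat 0 (1 / 2) (f⁻¹ / 2) (f / 2)) (-2) (-2) 3 1 0 1 0 (-2) ∧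
    (quat 0 (1 / 2) (f⁻¹ / 2) (f / 2)) * (omega F) = latticePoint f (quat 0 1 0 0) (omega F) (quat 0 (1 / 2) (f⁻¹ / 2) (f / 2)) (-1) (-2) 2 2 0 1 (-1) (-1) ∧
    (quat 0 (1 / 2) (f⁻¹ / 2) (f / 2)) * (quat 0 (1 / 2) (f⁻¹ / 2) (f / 2)) = latticePoint f (quat 0 1 0 0) (omega F) (quat 0 (1 / 2) (f⁻¹ / 2) (f / 2)) (-1) 0 0 0 0 0 0 0 := by
  simp only [latticePoint, omega_eq, one_eq_quat, quat_mul_quat, quat_add_quat, smul_quat]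
  refine ⟨?_, ?_, ?_, ?_, ?_, ?_, ?_, ?_, ?_⟩ <;> apply quat_congr <;> push_cast <;> grind

theorem icosian_units {f : F} (hf : f ^ 2 = f + 1) :
    quat 0 1 0 0 = latticePoint f (quat 0 1 0 0) (omega F) (quat 0 (1 / 2) (f⁻¹ / 2) (f / 2)) 0 1 0 0 0 0 0 0 ∧
    quat 0 0 1 0 = latticePoint f (quat 0 1 0 0) (omega F) (quat 0 (1 / 2) (f⁻¹ / 2) (f / 2)) 0 1 0 (-2) (-1) (-1) 2 0 ∧
    quat 0 0 0 1 = latticePoint f (quat 0 1 0 0) (omega F) (quat 0 (1 / 2) (f⁻¹ / 2) (f / 2)) (-1) (-2) 2 2 1 1 (-2) 0 ∧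
    quat 0 (1 / 2) (-f⁻¹ / 2) (f / 2) = latticePoint f (quat 0 1 0 0) (omega F) (quat 0 (1 / 2) (f⁻¹ / 2) (f / 2)) 1 2 (-2) (-1) 0 (-1) 0 2 ∧
    quat (f / 2) (f⁻¹ / 2) (1 / 2) 0 = latticePoint f (quat 0 1 0 0) (omega F) (quat 0 (1 / 2) (f⁻¹ / 2) (f / 2)) 0 0 0 (-1) 0 0 1 0 ∧
    quat 0 (2 + f) 1 1 = latticePoint f (quat 0 1 0 0) (omega F) (quat 0 (1 / 2) (f⁻¹ / 2) (f / 2)) (-1) 1 2 0 0 1 0 0 ∧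
    quat 0 (f - 1) 1 1 = latticePoint f (quat 0 1 0 0) (omega F) (quat 0 (1 / 2) (f⁻¹ / 2) (f / 2)) (-1) (-2) 2 0 0 1 0 0 ∧
    quat 0 0 1 1 = latticePoint f (quat 0 1 0 0) (omega F) (quat 0 (1 / 2) (f⁻¹ / 2) (f / 2)) (-1) (-1) 2 0 0 0 0 0 := by
  simp only [latticePoint, omega_eq, one_eq_quat, quat_add_quat, smul_quat]
  refine ⟨?_, ?_, ?_, ?_, ?_, ?_, ?_, ?_⟩ <;> apply quat_congr <;> push_cast <;> grind

/-- As for the octahedral order, the inverse Gram matrix of the trace form has entries in `ℤ[φ]`, so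
the icosians are self-dual. -/
theorem icosian_dual {f : F} (hf : f ^ 2 = f + 1) (x : ℍ[F]) :
    x = ((((-1 : ℤ) : F) + ((0 : ℤ) : F) * f) * (2 * (x * 1).re) +
        (((-2 : ℤ) : F) + ((1 : ℤ) : F) * f) * (2 * (x * (quat 0 1 0 0)).re) +
        (((3 : ℤ) : F) + ((0 : ℤ) : F) * f) * (2 * (x * (omega F)).re) +
        (((1 : ℤ) : F) + ((-2 : ℤ) : F) * f) * (2 * (x * (quat 0 (1 / 2) (f⁻¹ / 2) (f / 2))).re)) • (1 : ℍ[F]) +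
      ((((-2 : ℤ) : F) + ((1 : ℤ) : F) * f) * (2 * (x * 1).re) +
        (((-4 : ℤ) : F) + ((2 : ℤ) : F) * f) * (2 * (x * (quat 0 1 0 0)).re) +
        (((4 : ℤ) : F) + ((-2 : ℤ) : F) * f) * (2 * (x * (omega F)).re) +
        (((3 : ℤ) : F) + ((-2 : ℤ) : F) * f) * (2 * (x * (quat 0 (1 / 2) (f⁻¹ / 2) (f / 2))).re)) • (quat 0 1 0 0) +
      ((((3 : ℤ) : F) + ((0 : ℤ) : F) * f) * (2 * (x * 1).re) +
        (((4 : ℤ) : F) + ((-2 : ℤ) : F) * f) * (2 * (x * (quat 0 1 0 0)).re) +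
        (((-6 : ℤ) : F) + ((0 : ℤ) : F) * f) * (2 * (x * (omega F)).re) +
        (((-2 : ℤ) : F) + ((4 : ℤ) : F) * f) * (2 * (x * (quat 0 (1 / 2) (f⁻¹ / 2) (f / 2))).re)) • (omega F) +
      ((((1 : ℤ) : F) + ((-2 : ℤ) : F) * f) * (2 * (x * 1).re) +
        (((3 : ℤ) : F) + ((-2 : ℤ) : F) * f) * (2 * (x * (quat 0 1 0 0)).re) +
        (((-2 : ℤ) : F) + ((4 : ℤ) : F) * f) * (2 * (x * (omega F)).re) +
        (((-4 : ℤ) : F) + ((0 : ℤ) : F) * f) * (2 * (x * (quat 0 (1 / 2) (f⁻¹ / 2) (f / 2))).re)) • (quat 0 (1 / 2) (f⁻¹ / 2) (f / 2)) := by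
  have hx : x = quat x.re x.imI x.imJ x.imK := rfl
  generalize x.re = x₀, x.imI = x₁, x.imJ = x₂, x.imK = x₃ at hx
  subst hx
  simp only [omega_eq, one_eq_quat, quat_mul_quat, quat_add_quat, smul_quat, re_quat]
  apply quat_congr <;> push_cast <;> grind

theorem hurwitz_mul  :
    (quat 0 1 0 0) * (quat 0 1 0 0) = latticePoint (0 : F) (quat 0 1 0 0) (quat 0 0 1 0) (omega F) (-1) 0 0 0 0 0 0 0 ∧
    (quat 0 1 0 0) * (quat 0 0 1 0) = latticePoint (0 : F) (quat 0 1 0 0) (quat 0 0 1 0) (omega F) (-1) (-1) (-1) 2 0 0 0 0 ∧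
    (quat 0 1 0 0) * (omega F) = latticePoint (0 : F) (quat 0 1 0 0) (quat 0 0 1 0) (omega F) (-1) 0 (-1) 1 0 0 0 0 ∧
    (quat 0 0 1 0) * (quat 0 1 0 0) = latticePoint (0 : F) (quat 0 1 0 0) (quat 0 0 1 0) (omega F) 1 1 1 (-2) 0 0 0 0 ∧
    (quat 0 0 1 0) * (quat 0 0 1 0) = latticePoint (0 : F) (quat 0 1 0 0) (quat 0 0 1 0) (omega F) (-1) 0 0 0 0 0 0 0 ∧
    (quat 0 0 1 0) * (omega F) = latticePoint (0 : F) (quat 0 1 0 0) (quat 0 0 1 0) (omega F) 0 1 1 (-1) 0 0 0 0 ∧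
    (omega F) * (quat 0 1 0 0) = latticePoint (0 : F) (quat 0 1 0 0) (quat 0 0 1 0) (omega F) 0 1 1 (-1) 0 0 0 0 ∧
    (omega F) * (quat 0 0 1 0) = latticePoint (0 : F) (quat 0 1 0 0) (quat 0 0 1 0) (omega F) (-1) (-1) 0 1 0 0 0 0 ∧
    (omega F) * (omega F) = latticePoint (0 : F) (quat 0 1 0 0) (quat 0 0 1 0) (omega F) (-1) 0 0 1 0 0 0 0 := by
  simp only [latticePoint, omega_eq, one_eq_quat, quat_mul_quat, quat_add_quat, smul_quat]
  refine ⟨?_, ?_, ?_, ?_, ?_, ?_, ?_, ?_, ?_⟩ <;> apply quat_congr <;> push_cast <;> grind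

theorem lipschitz_mul  :
    (quat 0 1 0 0) * (quat 0 1 0 0) = latticePoint (0 : F) (quat 0 1 0 0) (quat 0 0 1 0) (quat 0 0 0 1) (-1) 0 0 0 0 0 0 0 ∧
    (quat 0 1 0 0) * (quat 0 0 1 0) = latticePoint (0 : F) (quat 0 1 0 0) (quat 0 0 1 0) (quat 0 0 0 1) 0 0 0 1 0 0 0 0 ∧
    (quat 0 1 0 0) * (quat 0 0 0 1) = latticePoint (0 : F) (quat 0 1 0 0) (quat 0 0 1 0) (quat 0 0 0 1) 0 0 (-1) 0 0 0 0 0 ∧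
    (quat 0 0 1 0) * (quat 0 1 0 0) = latticePoint (0 : F) (quat 0 1 0 0) (quat 0 0 1 0) (quat 0 0 0 1) 0 0 0 (-1) 0 0 0 0 ∧
    (quat 0 0 1 0) * (quat 0 0 1 0) = latticePoint (0 : F) (quat 0 1 0 0) (quat 0 0 1 0) (quat 0 0 0 1) (-1) 0 0 0 0 0 0 0 ∧
    (quat 0 0 1 0) * (quat 0 0 0 1) = latticePoint (0 : F) (quat 0 1 0 0) (quat 0 0 1 0) (quat 0 0 0 1) 0 1 0 0 0 0 0 0 ∧
    (quat 0 0 0 1) * (quat 0 1 0 0) = latticePoint (0 : F) (quat 0 1 0 0) (quat 0 0 1 0) (quat 0 0 0 1) 0 0 1 0 0 0 0 0 ∧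
    (quat 0 0 0 1) * (quat 0 0 1 0) = latticePoint (0 : F) (quat 0 1 0 0) (quat 0 0 1 0) (quat 0 0 0 1) 0 (-1) 0 0 0 0 0 0 ∧
    (quat 0 0 0 1) * (quat 0 0 0 1) = latticePoint (0 : F) (quat 0 1 0 0) (quat 0 0 1 0) (quat 0 0 0 1) (-1) 0 0 0 0 0 0 0 := by
  simp only [latticePoint, one_eq_quat, quat_mul_quat, quat_add_quat, smul_quat]
  refine ⟨?_, ?_, ?_, ?_, ?_, ?_, ?_, ?_, ?_⟩ <;> apply quat_congr <;> push_cast <;> grind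

theorem hurwitz_units  :
    quat 0 1 0 0 = latticePoint (0 : F) (quat 0 1 0 0) (quat 0 0 1 0) (omega F) 0 1 0 0 0 0 0 0 ∧
    quat 0 0 1 0 = latticePoint (0 : F) (quat 0 1 0 0) (quat 0 0 1 0) (omega F) 0 0 1 0 0 0 0 0 ∧
    quat 0 0 0 1 = latticePoint (0 : F) (quat 0 1 0 0) (quat 0 0 1 0) (omega F) (-1) (-1) (-1) 2 0 0 0 0 := by
  simp only [latticePoint, omega_eq, one_eq_quat, quat_add_quat, smul_quat]
  refine ⟨?_, ?_, ?_⟩ <;> apply quat_congr <;> push_cast <;> grind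

end Identities

theorem mem_span_of_eq {K : Type*} [Field K] [NumberField K] {θ : K} (hθ : θ ∈ intRing K)
    {a b c x : ℍ[K]} {p q r s p' q' r' s' : ℤ} (h : x = latticePoint θ a b c p q r s p' q' r' s') :
    x ∈ Submodule.span (𝓞 K) {1, a, b, c} := by
  rw [h]
  exact latticePoint_mem hθ a b c p q r s p' q' r' s'

/-! ### The octahedral order -/

section Octahedral

theorem r2_mem : r2 ∈ intRing K2 := ⟨sqrtTwo, rfl⟩

theorem exists_octahedral :
    ∃ O : Subalgebra (𝓞 K2) ℍ[K2], Subalgebra.toSubmodule O = octahedral := by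
  obtain ⟨h1, h2, h3, h4, h5, h6, h7, h8, h9⟩ := octahedral_mul r2_sq
  refine exists_subalgebra_of_span_four ?_ ?_ ?_ ?_ ?_ ?_ ?_ ?_ ?_
  exacts [mem_span_of_eq r2_mem h1, mem_span_of_eq r2_mem h2, mem_span_of_eq r2_mem h3,
    mem_span_of_eq r2_mem h4, mem_span_of_eq r2_mem h5, mem_span_of_eq r2_mem h6,
    mem_span_of_eq r2_mem h7, mem_span_of_eq r2_mem h8, mem_span_of_eq r2_mem h9]

variable {O : Subalgebra (𝓞 K2) ℍ[K2]} (hO : Subalgebra.toSubmodule O = octahedral)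

include hO

theorem mem_of_eq_latticePoint_octahedral {x : ℍ[K2]} {p q r s p' q' r' s' : ℤ}
    (h : x = latticePoint r2 (quat (1 / r2) (1 / r2) 0 0) (quat (1 / r2) 0 (1 / r2) 0) (omega K2)
      p q r s p' q' r' s') : x ∈ O := by
  rw [← Subalgebra.mem_toSubmodule, hO]
  exact mem_span_of_eq r2_mem h

theorem isOrder_octahedral : IsOrder O := by
  obtain ⟨h1, h2, h3, -⟩ := octahedral_units r2_sq
  exact isOrder_of_span ((((Set.finite_singleton _).insert _).insert _).insert _) hO (c := 1) one_ne_zero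
    (mem_of_eq_latticePoint_octahedral hO h1) (mem_of_eq_latticePoint_octahedral hO h2)
    (mem_of_eq_latticePoint_octahedral hO h3)

theorem mem_octahedral_of_dual {x : ℍ[K2]} (h : ∀ y ∈ O, 2 * (x * y).re ∈ intRing K2) : x ∈ O := by
  have ht : ∀ y ∈ ({1, quat (1 / r2) (1 / r2) 0 0, quat (1 / r2) 0 (1 / r2) 0, omega K2} :
      Set ℍ[K2]), 2 * (x * y).re ∈ intRing K2 := fun y hy => trace_mem_of_dual hO h hy
  rw [← Subalgebra.mem_toSubmodule, hO]
  have hc := int_combination_mem r2_mem (ht 1 (by simp)) (ht _ (Or.inr (Or.inl rfl)))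
    (ht _ (Or.inr (Or.inr (Or.inl rfl)))) (ht _ (Or.inr (Or.inr (Or.inr rfl))))
  exact mem_span_four (hc ..) (hc ..) (hc ..) (hc ..) (octahedral_dual r2_sq x)

theorem isMaximalOrder_octahedral : IsMaximalOrder O :=
  isMaximalOrder_of_dual (isOrder_octahedral hO) fun _ h _ => mem_octahedral_of_dual hO h

end Octahedral

/-! ### The icosians as a lattice and as a maximal order -/

section Icosians

theorem phi_mem : phi ∈ intRing K5 := ⟨golden, rfl⟩

/-- The icosians as a module. -/
noncomputable def icosianLattice : Submodule (𝓞 K5) ℍ[K5] :=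
  Submodule.span (𝓞 K5) {1, quat 0 1 0 0, omega K5, quat 0 (1 / 2) (phi⁻¹ / 2) (phi / 2)}

theorem icosian_coordinates {F : Type*} [Field F] [CharZero F] {f : F} (hf : f ^ 2 = f + 1)
    (p₁ p₂ q₁ q₂ r₁ r₂ s₁ s₂ : ℤ) :
    latticePoint f (quat 0 1 0 0) (omega F) (quat 0 (1 / 2) (f⁻¹ / 2) (f / 2))
      p₁ q₁ r₁ s₁ p₂ q₂ r₂ s₂ =
    quat (((2 * p₁ + r₁ : ℤ) + (2 * p₂ + r₂ : ℤ) * f) / 2)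
      (((2 * q₁ + r₁ + s₁ : ℤ) + (2 * q₂ + r₂ + s₂ : ℤ) * f) / 2)
      (((r₁ + s₂ - s₁ : ℤ) + (r₂ + s₁ : ℤ) * f) / 2)
      (((r₁ + s₂ : ℤ) + (r₂ + s₁ + s₂ : ℤ) * f) / 2) := by
  simp only [latticePoint, omega_eq, one_eq_quat, quat_add_quat, smul_quat]
  apply quat_congr <;> push_cast <;> grind

theorem coe_int_add_golden (m n : ℤ) : ((m + n * golden : 𝓞 K5) : K5) = m + n * phi := by
  simp [coe_golden]

/-- In half-integral coordinates a lattice point is an integral linear expression in the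
coefficients `p, q, r, s`. The congruences that define the icosians are the solvability conditions
of this linear system. -/
theorem coe_icosianLattice : (icosianLattice : Set ℍ[K5]) = icosians := by
  ext x
  constructor
  · intro hx
    obtain ⟨p, q, r, s, rfl⟩ := exists_of_mem_span_four hx
    obtain ⟨p₁, p₂, rfl⟩ := exists_int_golden p
    obtain ⟨q₁, q₂, rfl⟩ := exists_int_golden q
    obtain ⟨r₁, r₂, rfl⟩ := exists_int_golden r
    obtain ⟨s₁, s₂, rfl⟩ := exists_int_golden s
    refine ⟨2 * p₁ + r₁, 2 * p₂ + r₂, 2 * q₁ + r₁ + s₁, 2 * q₂ + r₂ + s₂, r₁ + s₂ - s₁, r₂ + s₁,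
      r₁ + s₂, r₂ + s₁ + s₂, ?_, ?_, ?_, ?_⟩
    · refine Eq.trans ?_ (icosian_coordinates phi_sq p₁ p₂ q₁ q₂ r₁ r₂ s₁ s₂)
      rw [coe_int_add_golden, coe_int_add_golden, coe_int_add_golden, coe_int_add_golden]
    all_goals simp only [Int.ModEq]; omega
  · rintro ⟨a, b, c, d, e, f, g, h, rfl, h1, h2, h3⟩
    simp only [Int.ModEq] at h1 h2 h3
    -- The last four coordinates `e, f, g, h` determine `r` and `s` without division: `r₁ = g - h +
    -- f`, `r₂ = f - g + e`, `s₁ = g - e`, `s₂ = h - f`. The first four then give `p` and `q` after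
    -- halving, which the congruences permit.
    obtain ⟨p₁, hp₁⟩ : ∃ p₁, a = 2 * p₁ + (g - h + f) := ⟨(a - (g - h + f)) / 2, by omega⟩
    obtain ⟨p₂, hp₂⟩ : ∃ p₂, b = 2 * p₂ + (f - g + e) := ⟨(b - (f - g + e)) / 2, by omega⟩
    obtain ⟨q₁, hq₁⟩ : ∃ q₁, c = 2 * q₁ + (g - h + f) + (g - e) :=
      ⟨(c - (g - h + f) - (g - e)) / 2, by omega⟩
    obtain ⟨q₂, hq₂⟩ : ∃ q₂, d = 2 * q₂ + (f - g + e) + (h - f) :=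
      ⟨(d - (f - g + e) - (h - f)) / 2, by omega⟩
    have key := icosian_coordinates phi_sq p₁ p₂ q₁ q₂ (g - h + f) (f - g + e) (g - e) (h - f)
    rw [← hp₁, ← hp₂, ← hq₁, ← hq₂, show g - h + f + (h - f) - (g - e) = e by ring,
      show f - g + e + (g - e) = f by ring, show g - h + f + (h - f) = g by ring,
      show f + (h - f) = h by ring] at key
    exact mem_span_of_eq phi_mem key.symm

theorem exists_icosianLattice :
    ∃ O : Subalgebra (𝓞 K5) ℍ[K5], Subalgebra.toSubmodule O = icosianLattice := by
  obtain ⟨h1, h2, h3, h4, h5, h6, h7, h8, h9⟩ := icosian_mul phi_sq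
  refine exists_subalgebra_of_span_four ?_ ?_ ?_ ?_ ?_ ?_ ?_ ?_ ?_
  exacts [mem_span_of_eq phi_mem h1, mem_span_of_eq phi_mem h2, mem_span_of_eq phi_mem h3,
    mem_span_of_eq phi_mem h4, mem_span_of_eq phi_mem h5, mem_span_of_eq phi_mem h6,
    mem_span_of_eq phi_mem h7, mem_span_of_eq phi_mem h8, mem_span_of_eq phi_mem h9]

variable {O : Subalgebra (𝓞 K5) ℍ[K5]} (hO : Subalgebra.toSubmodule O = icosianLattice)

include hO

theorem mem_of_eq_latticePoint_icosian {x : ℍ[K5]} {p q r s p' q' r' s' : ℤ}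
    (h : x = latticePoint phi (quat 0 1 0 0) (omega K5) (quat 0 (1 / 2) (phi⁻¹ / 2) (phi / 2))
      p q r s p' q' r' s') : x ∈ O := by
  rw [← Subalgebra.mem_toSubmodule, hO]
  exact mem_span_of_eq phi_mem h

theorem isOrder_icosian : IsOrder O := by
  obtain ⟨h1, h2, h3, -⟩ := icosian_units phi_sq
  exact isOrder_of_span ((((Set.finite_singleton _).insert _).insert _).insert _) hO (c := 1) one_ne_zero
    (mem_of_eq_latticePoint_icosian hO h1) (mem_of_eq_latticePoint_icosian hO h2)
    (mem_of_eq_latticePoint_icosian hO h3)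

theorem mem_icosian_of_dual {x : ℍ[K5]} (h : ∀ y ∈ O, 2 * (x * y).re ∈ intRing K5) : x ∈ O := by
  have ht : ∀ y ∈ ({1, quat 0 1 0 0, omega K5, quat 0 (1 / 2) (phi⁻¹ / 2) (phi / 2)} :
      Set ℍ[K5]), 2 * (x * y).re ∈ intRing K5 := fun y hy => trace_mem_of_dual hO h hy
  rw [← Subalgebra.mem_toSubmodule, hO]
  have hc := int_combination_mem phi_mem (ht 1 (by simp)) (ht _ (Or.inr (Or.inl rfl)))
    (ht _ (Or.inr (Or.inr (Or.inl rfl)))) (ht _ (Or.inr (Or.inr (Or.inr rfl))))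
  exact mem_span_four (hc ..) (hc ..) (hc ..) (hc ..) (icosian_dual phi_sq x)

theorem isMaximalOrder_icosian : IsMaximalOrder O :=
  isMaximalOrder_of_dual (isOrder_icosian hO) fun _ h _ => mem_icosian_of_dual hO h

end Icosians

/-! ### The Lipschitz and Hurwitz orders -/

section Rational

theorem zero_mem_intRing : (0 : ℚ) ∈ intRing ℚ := zero_mem _

theorem mem_intRing_rat {x : ℚ} : x ∈ intRing ℚ ↔ ∃ n : ℤ, x = n := by
  constructor
  · rintro ⟨t, rfl⟩
    exact ⟨Rat.ringOfIntegersEquiv t, (Rat.ringOfIntegersEquiv_apply_coe t).symm⟩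
  · rintro ⟨n, rfl⟩
    exact intCast_mem _ n

theorem exists_lipschitz :
    ∃ O : Subalgebra (𝓞 ℚ) ℍ[ℚ], Subalgebra.toSubmodule O = lipschitz := by
  obtain ⟨h1, h2, h3, h4, h5, h6, h7, h8, h9⟩ := lipschitz_mul (F := ℚ)
  refine exists_subalgebra_of_span_four ?_ ?_ ?_ ?_ ?_ ?_ ?_ ?_ ?_
  exacts [mem_span_of_eq zero_mem_intRing h1, mem_span_of_eq zero_mem_intRing h2, mem_span_of_eq zero_mem_intRing h3,
    mem_span_of_eq zero_mem_intRing h4, mem_span_of_eq zero_mem_intRing h5, mem_span_of_eq zero_mem_intRing h6,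
    mem_span_of_eq zero_mem_intRing h7, mem_span_of_eq zero_mem_intRing h8, mem_span_of_eq zero_mem_intRing h9]

theorem exists_hurwitz :
    ∃ O : Subalgebra (𝓞 ℚ) ℍ[ℚ], Subalgebra.toSubmodule O = hurwitz := by
  obtain ⟨h1, h2, h3, h4, h5, h6, h7, h8, h9⟩ := hurwitz_mul (F := ℚ)
  refine exists_subalgebra_of_span_four ?_ ?_ ?_ ?_ ?_ ?_ ?_ ?_ ?_
  exacts [mem_span_of_eq zero_mem_intRing h1, mem_span_of_eq zero_mem_intRing h2, mem_span_of_eq zero_mem_intRing h3,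
    mem_span_of_eq zero_mem_intRing h4, mem_span_of_eq zero_mem_intRing h5, mem_span_of_eq zero_mem_intRing h6,
    mem_span_of_eq zero_mem_intRing h7, mem_span_of_eq zero_mem_intRing h8, mem_span_of_eq zero_mem_intRing h9]

variable {O : Subalgebra (𝓞 ℚ) ℍ[ℚ]}

theorem mem_lipschitz_iff (hO : Subalgebra.toSubmodule O = lipschitz) {x : ℍ[ℚ]} :
    x ∈ O ↔ ∃ a b c d : ℤ, x = quat (a : ℚ) b c d := by
  rw [← Subalgebra.mem_toSubmodule, hO]
  constructor
  · intro hx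
    have hx : x ∈ Submodule.span (𝓞 ℚ) {1, quat 0 1 0 0, quat 0 0 1 0, quat 0 0 0 1} := hx
    obtain ⟨p, q, r, s, rfl⟩ := exists_of_mem_span_four hx
    have hz : ∀ t : 𝓞 ℚ, ∃ n : ℤ, (t : ℚ) = n := fun t => mem_intRing_rat.1 ⟨t, rfl⟩
    obtain ⟨a, ha⟩ := hz p
    obtain ⟨b, hb⟩ := hz q
    obtain ⟨c, hc⟩ := hz r
    obtain ⟨d, hd⟩ := hz s
    refine ⟨a, b, c, d, ?_⟩
    rw [ha, hb, hc, hd, one_eq_quat]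
    simp only [quat_add_quat, smul_quat]
    apply quat_congr <;> ring
  · rintro ⟨a, b, c, d, rfl⟩
    refine mem_span_four (intCast_mem _ a) (intCast_mem _ b) (intCast_mem _ c) (intCast_mem _ d) ?_
    rw [one_eq_quat]
    simp only [quat_add_quat, smul_quat]
    apply quat_congr <;> ring

theorem isOrder_lipschitz (hO : Subalgebra.toSubmodule O = lipschitz) : IsOrder O :=
  isOrder_of_span ((((Set.finite_singleton _).insert _).insert _).insert _) hO (c := 1) one_ne_zero
    ((mem_lipschitz_iff hO).2 ⟨0, 1, 0, 0, by simp⟩) ((mem_lipschitz_iff hO).2 ⟨0, 0, 1, 0, by simp⟩)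
    ((mem_lipschitz_iff hO).2 ⟨0, 0, 0, 1, by simp⟩)

variable (hO : Subalgebra.toSubmodule O = hurwitz)

include hO

theorem mem_of_eq_latticePoint_hurwitz {x : ℍ[ℚ]} {p q r s p' q' r' s' : ℤ}
    (h : x = latticePoint 0 (quat 0 1 0 0) (quat 0 0 1 0) (omega ℚ) p q r s p' q' r' s') :
    x ∈ O := by
  rw [← Subalgebra.mem_toSubmodule, hO]
  exact mem_span_of_eq zero_mem_intRing h

theorem isOrder_hurwitz : IsOrder O := by
  obtain ⟨h1, h2, h3⟩ := hurwitz_units (F := ℚ)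
  exact isOrder_of_span ((((Set.finite_singleton _).insert _).insert _).insert _) hO (c := 1) one_ne_zero
    (mem_of_eq_latticePoint_hurwitz hO h1) (mem_of_eq_latticePoint_hurwitz hO h2)
    (mem_of_eq_latticePoint_hurwitz hO h3)

theorem mem_hurwitz_of_parity {a b c d : ℤ} (hb : Even (b - d)) (hc : Even (c - d))
    (ha : Even (a - d)) : quat (a / 2 : ℚ) (b / 2) (c / 2) (d / 2) ∈ O := by
  obtain ⟨p, hp⟩ := ha
  obtain ⟨q, hq⟩ := hb
  obtain ⟨r, hr⟩ := hc
  refine mem_of_eq_latticePoint_hurwitz hO (p := p) (q := q) (r := r) (s := d)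
    (p' := 0) (q' := 0) (r' := 0) (s' := 0) ?_
  rw [show a = p + p + d by omega, show b = q + q + d by omega, show c = r + r + d by omega]
  simp only [latticePoint, omega_eq, one_eq_quat, quat_add_quat, smul_quat]
  apply quat_congr <;> push_cast <;> ring

/-- Integral traces against the basis leave half-integral coordinates, whose numerators have even
sum. Integrality of the norm says that the sum of the four squares is divisible by four, and this
forces equal parity. -/
theorem isMaximalOrder_hurwitz : IsMaximalOrder O := by
  refine isMaximalOrder_of_dual (isOrder_hurwitz hO) fun x h hn => ?_
  have ht : ∀ y ∈ ({1, quat 0 1 0 0, quat 0 0 1 0, omega ℚ} :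
      Set ℍ[ℚ]), ∃ n : ℤ, 2 * (x * y).re = n := fun y hy =>
    mem_intRing_rat.1 (trace_mem_of_dual hO h hy)
  obtain ⟨a, ha⟩ := ht 1 (by simp)
  obtain ⟨b, hb⟩ := ht _ (Or.inr (Or.inl rfl))
  obtain ⟨c, hc⟩ := ht _ (Or.inr (Or.inr (Or.inl rfl)))
  obtain ⟨d, hd⟩ := ht _ (Or.inr (Or.inr (Or.inr rfl)))
  obtain ⟨n, hn⟩ := mem_intRing_rat.1 hn
  have hx : x = quat x.re x.imI x.imJ x.imK := rfl
  generalize x.re = x₀, x.imI = x₁, x.imJ = x₂, x.imK = x₃ at hx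
  subst hx
  rw [Quaternion.normSq_def'] at hn
  simp only [omega_eq, one_eq_quat, quat_mul_quat, re_quat] at ha hb hc hd hn
  have e0 : x₀ = a / 2 := by linarith
  have e1 : x₁ = (-b : ℤ) / 2 := by push_cast; linarith
  have e2 : x₂ = (-c : ℤ) / 2 := by push_cast; linarith
  have e3 : x₃ = (a + b + c - 2 * d : ℤ) / 2 := by push_cast; linarith
  rw [e0, e1, e2, e3] at hn ⊢
  have h4 : a ^ 2 + b ^ 2 + c ^ 2 + (a + b + c - 2 * d) ^ 2 = 4 * n := by
    have : ((a ^ 2 + b ^ 2 + c ^ 2 + (a + b + c - 2 * d) ^ 2 : ℤ) : ℚ) = ((4 * n : ℤ) : ℚ) := by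
      push_cast
      push_cast at hn
      linarith
    exact_mod_cast this
  -- A sum of four integer squares is congruent modulo 4 to the number of odd terms. That number is
  -- therefore 0 or 4.
  have h5 : Even (a - b) ∧ Even (b - c) := by
    rcases Int.even_or_odd' a with ⟨a', rfl | rfl⟩ <;> rcases Int.even_or_odd' b with ⟨b', rfl | rfl⟩ <;>
      rcases Int.even_or_odd' c with ⟨c', rfl | rfl⟩ <;> ring_nf at h4 <;>
      simp only [Int.even_iff] <;> omega
  rw [Int.even_iff, Int.even_iff] at h5
  exact mem_hurwitz_of_parity hO (by rw [Int.even_iff]; omega) (by rw [Int.even_iff]; omega)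
    (by rw [Int.even_iff]; omega)

theorem hurwitz_eq_adjoin : O = Algebra.adjoin (𝓞 ℚ) {quat 0 1 0 0, omega ℚ} := by
  have hi : quat 0 1 0 0 ∈ Algebra.adjoin (𝓞 ℚ) {quat 0 1 0 0, omega ℚ} :=
    Algebra.subset_adjoin (by simp)
  have hw : omega ℚ ∈ Algebra.adjoin (𝓞 ℚ) {quat 0 1 0 0, omega ℚ} :=
    Algebra.subset_adjoin (by simp)
  have h1 : (1 : ℍ[ℚ]) ∈ Algebra.adjoin (𝓞 ℚ) {quat 0 1 0 0, omega ℚ} := one_mem _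
  have hj : quat 0 0 1 0 ∈ Algebra.adjoin (𝓞 ℚ) {quat 0 1 0 0, omega ℚ} := by
    have h : (quat 0 0 1 0 : ℍ[ℚ]) = omega ℚ * quat 0 1 0 0 - quat 0 1 0 0 + omega ℚ := by
      rw [omega_eq, quat_mul_quat, sub_eq_add_neg, ← neg_one_smul ℚ (quat 0 1 0 0), smul_quat,
        quat_add_quat, quat_add_quat]
      apply quat_congr <;> norm_num
    rw [h]
    exact add_mem (sub_mem (mul_mem hw hi) hi) hw
  apply le_antisymm
  · suffices h : hurwitz ≤ Subalgebra.toSubmodule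
        (Algebra.adjoin (𝓞 ℚ) {quat 0 1 0 0, omega ℚ}) from
      fun x hx => h (hO ▸ hx)
    refine Submodule.span_le.2 ?_
    rintro x (rfl | rfl | rfl | rfl)
    exacts [h1, hi, hj, hw]
  · rw [Algebra.adjoin_le_iff]
    rintro x (rfl | rfl)
    · exact mem_of_eq_latticePoint_hurwitz hO (hurwitz_units (F := ℚ)).1
    · rw [SetLike.mem_coe, ← Subalgebra.mem_toSubmodule, hO]
      exact Submodule.subset_span (Or.inr (Or.inr (Or.inr rfl)))

end Rational

/-! ### Homomorphisms from generators and dihedral groups -/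

section Abstract

variable {G H : Type*} [Group G] [Group H]

/-- The subgroup of `G × H` generated by the pairs is the graph of a homomorphism as soon as it
meets `1 × H` trivially. -/
theorem exists_hom_of_graph (S : Set (G × H))
    (h : ∀ x ∈ Subgroup.closure S, x.1 = 1 → x.2 = 1) :
    ∃ φ : Subgroup.closure (Prod.fst '' S) →* H, φ.range = Subgroup.closure (Prod.snd '' S) := by
  let Γ := Subgroup.closure S
  let p : Γ →* G := (MonoidHom.fst G H).comp Γ.subtype
  let q : Γ →* H := (MonoidHom.snd G H).comp Γ.subtype
  have hq : q.range = Subgroup.closure (Prod.snd '' S) := by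
    rw [MonoidHom.range_comp, Subgroup.range_subtype, MonoidHom.map_closure]
    rfl
  have hp : p.range = Subgroup.closure (Prod.fst '' S) := by
    rw [MonoidHom.range_comp, Subgroup.range_subtype, MonoidHom.map_closure]
    rfl
  have hinj : Function.Injective p := by
    rw [injective_iff_map_eq_one]
    intro x hx
    exact Subtype.ext (Prod.ext hx (h x x.2 hx))
  let E := (MonoidHom.ofInjective hinj).trans (MulEquiv.subgroupCongr hp)
  refine ⟨q.comp E.symm.toMonoidHom, ?_⟩
  rw [MonoidHom.range_comp, MonoidHom.range_eq_top_of_surjective _ E.symm.surjective,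
    ← MonoidHom.range_eq_map, hq]

/-- The relation `c g • f i = f (p i)` between `g` and `p` is closed under products and inverses.
Injectivity of `f` makes `p` depend on `g` alone. -/
theorem exists_hom_perm {M X ι : Type*} [Group M] [MulAction M X] (c : G →* M) {f : ι → X}
    (hf : Function.Injective f) {g₁ g₂ : G} {p₁ p₂ : Equiv.Perm ι}
    (h₁ : ∀ i, c g₁ • f i = f (p₁ i)) (h₂ : ∀ i, c g₂ • f i = f (p₂ i)) :
    ∃ φ : Subgroup.closure {g₁, g₂} →* Equiv.Perm ι, φ.range = Subgroup.closure {p₁, p₂} := by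
  have h := exists_hom_of_graph (G := G) (H := Equiv.Perm ι) {(g₁, p₁), (g₂, p₂)} ?_
  · rwa [Set.image_pair, Set.image_pair] at h
  · have key : ∀ x ∈ Subgroup.closure ({(g₁, p₁), (g₂, p₂)} : Set (G × Equiv.Perm ι)),
        ∀ i, c x.1 • f i = f (x.2 i) := fun x hx => by
      induction hx using Subgroup.closure_induction with
      | mem x hx =>
        rcases hx with rfl | rfl
        exacts [h₁, h₂]
      | one => simp
      | mul x y _ _ hx hy =>
        intro i
        rw [Prod.fst_mul, map_mul, mul_smul, hy, hx]
        rfl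
      | inv x _ hx =>
        intro i
        rw [Prod.fst_inv, map_inv, inv_smul_eq_iff, hx]
        simp
    intro x hx h1
    ext i
    have := key x hx i
    rw [h1, map_one, one_smul] at this
    exact (hf this).symm

theorem nonempty_mulEquiv_of_card_le {C : Subgroup G} {A : Subgroup H} (φ : C →* H)
    (hφ : φ.range = A) [Finite C] (hcard : Nat.card C ≤ Nat.card A) : Nonempty (C ≃* A) := by
  subst hφ
  have : Finite φ.range := Finite.of_surjective _ φ.rangeRestrict_surjective
  refine ⟨MulEquiv.ofBijective φ.rangeRestrict ?_⟩
  exact φ.rangeRestrict_surjective.bijective_of_nat_card_le hcard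

theorem card_le_of_range {C : Subgroup G} {A : Subgroup H} (φ : C →* H)
    (hφ : φ.range = A) [Finite C] : Nat.card A ≤ Nat.card C := by
  subst hφ
  exact Nat.card_le_card_of_surjective _ φ.rangeRestrict_surjective

/-- A group generated by an element of order `n ≥ 3` and an involution that inverts it. -/
theorem nonempty_mulEquiv_dihedral {n : ℕ} (hn : 3 ≤ n) {R s : G} (hR : orderOf R = n)
    (hs : s * s = 1) (h : s * R * s = R⁻¹) :
    Nonempty (Subgroup.closure {R, s} ≃* DihedralGroup n) := by
  have hRn : R ^ n = 1 := hR ▸ pow_orderOf_eq_one R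
  let z : Multiplicative (ZMod n) →* G := AddMonoidHom.toMultiplicativeLeft (ZMod.lift n
    ⟨AddMonoidHom.toMultiplicativeLeft.symm (zpowersHom G R), by
      change Additive.ofMul (R ^ ((n : ℤ))) = 0
      rw [zpow_natCast, hRn]
      rfl⟩)
  have hz : ∀ k : ℤ, z (Multiplicative.ofAdd (k : ZMod n)) = R ^ k := fun k => by
    change Additive.toMul (ZMod.lift n _ (k : ZMod n)) = R ^ k
    rw [ZMod.lift_coe]
    rfl
  have hsz : ∀ x, s * z x = (z x)⁻¹ * s := fun x => by
    obtain ⟨k, hk⟩ := ZMod.intCast_surjective (Multiplicative.toAdd x)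
    obtain rfl : x = Multiplicative.ofAdd (k : ZMod n) := hk ▸ rfl
    have h1 : s * R * s⁻¹ = R⁻¹ := by rw [← h, inv_eq_of_mul_eq_one_left hs]
    rw [hz, ← mul_inv_eq_iff_eq_mul, ← inv_zpow, ← h1, conj_zpow]
  have hzs : ∀ x, z x * s = s * (z x)⁻¹ := fun x => by
    rw [← map_inv, hsz, map_inv, inv_inv]
  let Φ : DihedralGroup n →* G :=
    { toFun := fun d => match d with
        | .r i => z (Multiplicative.ofAdd i)
        | .sr i => s * z (Multiplicative.ofAdd i)
      map_one' := map_one z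
      map_mul' := by
        rintro (i | i) (j | j)
        · exact map_mul z _ _
        · change s * z (Multiplicative.ofAdd (j - i)) = z (Multiplicative.ofAdd i) *
            (s * z (Multiplicative.ofAdd j))
          rw [← mul_assoc, hzs, mul_assoc, ← map_inv, ← map_mul, ofAdd_sub, div_eq_mul_inv, mul_comm]
        · change s * z (Multiplicative.ofAdd (i + j)) = s * z (Multiplicative.ofAdd i) *
            z (Multiplicative.ofAdd j)
          rw [mul_assoc, ← map_mul, ofAdd_add]
        · change z (Multiplicative.ofAdd (j - i)) = s * z (Multiplicative.ofAdd i) *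
            (s * z (Multiplicative.ofAdd j))
          rw [mul_assoc, ← mul_assoc (z _), hzs, ← mul_assoc, ← mul_assoc, hs, one_mul, ← map_inv,
            ← map_mul, ofAdd_sub, div_eq_mul_inv, mul_comm] }
  have hinj : Function.Injective Φ := by
    rw [injective_iff_map_eq_one]
    rintro (i | i) hi
    · change z _ = 1 at hi
      obtain ⟨k, rfl⟩ := ZMod.intCast_surjective i
      rw [hz, ← orderOf_dvd_iff_zpow_eq_one, hR] at hi
      rw [(ZMod.intCast_zmod_eq_zero_iff_dvd k n).2 hi]
      rfl
    · change s * z _ = 1 at hi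
      exfalso
      obtain ⟨k, rfl⟩ := ZMod.intCast_surjective i
      rw [hz] at hi
      -- If `s` were a power of `R` it would commute with `R`, so `R = R⁻¹`, contrary to the order
      -- being at least three.
      have h1 : s = (R ^ k)⁻¹ := eq_inv_of_mul_eq_one_left hi
      have h2 : Commute s R := by
        rw [h1]
        exact ((Commute.refl R).zpow_left k).inv_left
      rw [h2.eq, mul_assoc, hs, mul_one] at h
      have h3 : R ^ 2 = 1 := by
        rw [pow_two]
        nth_rewrite 1 [h]
        exact inv_mul_cancel R
      have := Nat.le_of_dvd two_pos (hR ▸ orderOf_dvd_of_pow_eq_one h3)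
      omega
  have hrange : Φ.range = Subgroup.closure {R, s} := by
    have hzR : z (Multiplicative.ofAdd (1 : ZMod n)) = R := by
      have := hz 1
      rwa [Int.cast_one, zpow_one] at this
    apply le_antisymm
    · rintro _ ⟨d, rfl⟩
      have hzm : ∀ i, z (Multiplicative.ofAdd i) ∈ Subgroup.closure {R, s} := fun i => by
        obtain ⟨k, rfl⟩ := ZMod.intCast_surjective i
        rw [hz]
        exact zpow_mem (Subgroup.subset_closure (by simp)) k
      rcases d with i | i
      · exact hzm i
      · exact mul_mem (Subgroup.subset_closure (by simp)) (hzm i)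
    · rw [Subgroup.closure_le]
      rintro x (rfl | rfl)
      · exact ⟨.r 1, hzR⟩
      · exact ⟨.sr 0, by change _ * z 1 = _; rw [map_one, mul_one]⟩
  exact ⟨((MonoidHom.ofInjective hinj).trans (MulEquiv.subgroupCongr hrange)).symm⟩

end Abstract

/-! ### Generators of the symmetric and alternating groups -/

section Permutations

open Equiv

/-- The action of `(1 + i) / √2` on the diagonals of the cube. -/
def cubeQuarter : Perm (Fin 4) where
  toFun := ![2, 0, 3, 1]
  invFun := ![1, 3, 0, 2]
  left_inv := by decide
  right_inv := by decide

/-- The action of `ω` on the diagonals of the cube. -/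
def cubeThird : Perm (Fin 4) where
  toFun := ![0, 3, 1, 2]
  invFun := ![0, 2, 3, 1]
  left_inv := by decide
  right_inv := by decide

/-- The action of `i` on the diagonals of the cube. -/
def cubeHalf : Perm (Fin 4) where
  toFun := ![3, 2, 1, 0]
  invFun := ![3, 2, 1, 0]
  left_inv := by decide
  right_inv := by decide

/-- The action of `ω` on the five frames of the icosahedron. -/
def frameThird : Perm (Fin 5) where
  toFun := ![0, 2, 3, 1, 4]
  invFun := ![0, 3, 1, 2, 4]
  left_inv := by decide
  right_inv := by decide

/-- The action of `(i + φ⁻¹j + φk) / 2` on the five frames of the icosahedron. -/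
def frameHalf : Perm (Fin 5) where
  toFun := ![1, 0, 4, 3, 2]
  invFun := ![1, 0, 4, 3, 2]
  left_inv := by decide
  right_inv := by decide

theorem closure_cubeQuarter : Subgroup.closure {cubeQuarter, cubeThird} = ⊤ := by
  rw [eq_top_iff]
  rintro x -
  have h : ∀ x : Perm (Fin 4), ∃ a b : Fin 3, ∃ c : Fin 4,
      x = cubeThird ^ (a : ℕ) * cubeQuarter * cubeThird ^ (b : ℕ) * cubeQuarter ^ (c : ℕ) := by decide
  obtain ⟨a, b, c, rfl⟩ := h x
  exact mul_mem (mul_mem (mul_mem (pow_mem (Subgroup.subset_closure (by simp)) _)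
    (Subgroup.subset_closure (by simp))) (pow_mem (Subgroup.subset_closure (by simp)) _))
    (pow_mem (Subgroup.subset_closure (by simp)) _)

theorem closure_cubeHalf : Subgroup.closure {cubeHalf, cubeThird} = alternatingGroup (Fin 4) := by
  apply le_antisymm
  · rw [Subgroup.closure_le]
    rintro x (rfl | rfl) <;> rw [SetLike.mem_coe, Perm.mem_alternatingGroup] <;> decide
  · intro x hx
    have h : ∀ x : Perm (Fin 4), Perm.sign x = 1 → ∃ a : Fin 3, ∃ b : Fin 2, ∃ c : Fin 3,
        x = cubeThird ^ (a : ℕ) * cubeHalf ^ (b : ℕ) * cubeThird ^ (c : ℕ) := by decide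
    obtain ⟨a, b, c, rfl⟩ := h x (Perm.mem_alternatingGroup.1 hx)
    exact mul_mem (mul_mem (pow_mem (Subgroup.subset_closure (by simp)) _)
      (pow_mem (Subgroup.subset_closure (by simp)) _)) (pow_mem (Subgroup.subset_closure (by simp)) _)

/-- The subgroup contains elements of orders 2, 3 and 5, so its order is a multiple of 30 and its
index in the alternating group is 1 or 2. A subgroup of index two would be normal in a simple group.
-/
theorem closure_frameHalf :
    Subgroup.closure {frameThird, frameHalf} = alternatingGroup (Fin 5) := by
  have h0 : Subgroup.closure {frameThird, frameHalf} ≤ alternatingGroup (Fin 5) := by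
    rw [Subgroup.closure_le]
    rintro x (rfl | rfl) <;> rw [SetLike.mem_coe, Perm.mem_alternatingGroup] <;> decide
  have hd : ∀ x ∈ Subgroup.closure {frameThird, frameHalf}, orderOf x ∣
      Nat.card (Subgroup.closure {frameThird, frameHalf}) := fun x hx => by
    rw [← Subgroup.orderOf_mk x hx]
    exact orderOf_dvd_natCard _
  have m3 : frameThird ∈ Subgroup.closure {frameThird, frameHalf} := Subgroup.subset_closure (by simp)
  have m2 : frameHalf ∈ Subgroup.closure {frameThird, frameHalf} := Subgroup.subset_closure (by simp)
  have d3 := hd _ m3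
  have d2 := hd _ m2
  have d5 := hd _ (mul_mem m3 m2)
  rw [orderOf_eq_prime (p := 3) (by decide) (by decide)] at d3
  rw [orderOf_eq_prime (p := 2) (by decide) (by decide)] at d2
  have : Fact (Nat.Prime 5) := ⟨by norm_num⟩
  rw [orderOf_eq_prime (p := 5) (by decide) (by decide)] at d5
  have d30 : 30 ∣ Nat.card (Subgroup.closure {frameThird, frameHalf}) :=
    Nat.Coprime.mul_dvd_of_dvd_of_dvd (by norm_num : Nat.Coprime 6 5)
      (Nat.Coprime.mul_dvd_of_dvd_of_dvd (by norm_num : Nat.Coprime 2 3) d2 d3) d5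
  have h60 : Nat.card (alternatingGroup (Fin 5)) = 60 := by
    rw [nat_card_alternatingGroup]
    simp [Nat.factorial]
  let N := (Subgroup.closure {frameThird, frameHalf}).subgroupOf (alternatingGroup (Fin 5))
  have hN : Nat.card N = Nat.card (Subgroup.closure {frameThird, frameHalf}) :=
    Nat.card_congr (Subgroup.subgroupOfEquivOfLe h0).toEquiv
  have hi := N.card_mul_index
  rw [h60] at hi
  obtain ⟨m, hm⟩ := d30
  rw [hm] at hN
  have hpos : 0 < Nat.card N := Nat.card_pos
  have hsimple : IsSimpleGroup (alternatingGroup (Fin 5)) := alternatingGroup.isSimpleGroup (by simp)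
  suffices h : N = ⊤ from le_antisymm h0 (Subgroup.subgroupOf_eq_top.1 h)
  rw [hN, mul_assoc] at hi
  have hmi : m * N.index = 2 := by omega
  have hm2 : m ∣ 2 := Dvd.intro _ hmi
  have hm3 : m ≤ 2 := Nat.le_of_dvd two_pos hm2
  have hm4 : m ≠ 0 := by
    rintro rfl
    simp at hmi
  by_cases h1 : m = 1
  · have h2 : N.index = 2 := by simpa [h1] using hmi
    have hn : N.Normal := Subgroup.normal_of_index_eq_two h2
    rcases hn.eq_bot_or_eq_top with h | h
    · rw [h, Subgroup.card_bot] at hN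
      omega
    · exact h
  · have h2 : m = 2 := by omega
    rw [h2] at hmi
    exact Subgroup.index_eq_one.1 (by omega)

end Permutations

/-! ### Conjugation of classes of quaternions -/

section Conjugation

variable {F : Type*} [Field F]

/-- Conjugation is expressed by a product identity up to a scalar, so that explicit cases are
polynomial identities without inverses. -/
theorem conj_cls {g x y : ℍ[F]} (hg : IsUnit g) (hx : IsUnit x) (hy : IsUnit y) {κ : F} (hκ : κ ≠ 0)
    (h : y * g = κ • (g * x)) : cls g * cls x * (cls g)⁻¹ = cls y := by
  rw [mul_inv_eq_iff_eq_mul, ← cls_mul hg hx, ← cls_mul hy hg, h, cls_smul hκ]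

theorem isUnit_quat {a b c d : F} (h : a ^ 2 + b ^ 2 + c ^ 2 + d ^ 2 ≠ 0) : IsUnit (quat a b c d) :=
  isUnit_of_normSq_ne_zero (by rw [Quaternion.normSq_def']; exact h)

theorem cls_quat_smul {κ : F} (hκ : κ ≠ 0) (a b c d : F) :
    cls (quat (κ * a) (κ * b) (κ * c) (κ * d)) = cls (quat a b c d) := cls_smul hκ (quat a b c d)

theorem conj_cls_quat {g₀ g₁ g₂ g₃ x₁ x₂ x₃ y₁ y₂ y₃ κ : F}
    (hg : g₀ ^ 2 + g₁ ^ 2 + g₂ ^ 2 + g₃ ^ 2 ≠ 0) (hx : x₁ ^ 2 + x₂ ^ 2 + x₃ ^ 2 ≠ 0)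
    (hy : y₁ ^ 2 + y₂ ^ 2 + y₃ ^ 2 ≠ 0) (hκ : κ ≠ 0)
    (h : quat 0 y₁ y₂ y₃ * quat g₀ g₁ g₂ g₃ = κ • (quat g₀ g₁ g₂ g₃ * quat 0 x₁ x₂ x₃)) :
    MulAut.conj (cls (quat g₀ g₁ g₂ g₃)) • cls (quat 0 x₁ x₂ x₃) = cls (quat 0 y₁ y₂ y₃) :=
  conj_cls (isUnit_quat hg) (isUnit_quat (by simpa using hx)) (isUnit_quat (by simpa using hy)) hκ h

end Conjugation

/-! ### The cube: action on its four diagonals -/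

section Cube

variable {F : Type*} [Field F] [CharZero F]

/-- The diagonals of the cube. -/
noncomputable def cubeDiagonal (F : Type*) [Field F] : Fin 4 → PD F :=
  ![cls (quat 0 1 1 1), cls (quat 0 1 1 (-1)), cls (quat 0 1 (-1) 1), cls (quat 0 (-1) 1 1)]

theorem cls_quat_eq_iff {x₁ x₂ x₃ y₁ y₂ y₃ : F} (hx : x₁ ^ 2 + x₂ ^ 2 + x₃ ^ 2 ≠ 0)
    (hy : y₁ ^ 2 + y₂ ^ 2 + y₃ ^ 2 ≠ 0) (h : cls (quat 0 x₁ x₂ x₃) = cls (quat 0 y₁ y₂ y₃)) :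
    ∃ κ : F, y₁ = κ * x₁ ∧ y₂ = κ * x₂ ∧ y₃ = κ * x₃ := by
  obtain ⟨κ, -, h⟩ := (cls_eq_cls_iff (isUnit_quat (by simpa using hx))
    (isUnit_quat (by simpa using hy))).1 h
  exact ⟨κ, congrArg QuaternionAlgebra.imI h, congrArg QuaternionAlgebra.imJ h,
    congrArg QuaternionAlgebra.imK h⟩

theorem cubeDiagonal_injective : Function.Injective (cubeDiagonal F) := by
  intro i j h
  fin_cases i <;> fin_cases j <;> first
    | rfl
    | (exfalso
       obtain ⟨κ, h1, h2, h3⟩ := cls_quat_eq_iff (by norm_num) (by norm_num) h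
       grind)

theorem conj_cubeDiagonal_quarter (i : Fin 4) :
    MulAut.conj (cls (quat (1 : F) 1 0 0)) • cubeDiagonal F i = cubeDiagonal F (cubeQuarter i) := by
  fin_cases i
  · refine conj_cls_quat (κ := (1 : F)) ?_ ?_ ?_ ?_ ?_
    all_goals first
      | (norm_num; done)
      | (simp only [quat_mul_quat, smul_quat]; apply quat_congr <;> norm_num)
  · refine conj_cls_quat (κ := (1 : F)) ?_ ?_ ?_ ?_ ?_
    all_goals first
      | (norm_num; done)
      | (simp only [quat_mul_quat, smul_quat]; apply quat_congr <;> norm_num)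
  · refine conj_cls_quat (κ := (-1 : F)) ?_ ?_ ?_ ?_ ?_
    all_goals first
      | (norm_num; done)
      | (simp only [quat_mul_quat, smul_quat]; apply quat_congr <;> norm_num)
  · refine conj_cls_quat (κ := (-1 : F)) ?_ ?_ ?_ ?_ ?_
    all_goals first
      | (norm_num; done)
      | (simp only [quat_mul_quat, smul_quat]; apply quat_congr <;> norm_num)

theorem conj_cubeDiagonal_third (i : Fin 4) :
    MulAut.conj (cls (omega F)) • cubeDiagonal F i = cubeDiagonal F (cubeThird i) := by
  rw [omega_eq]
  fin_cases i
  · refine conj_cls_quat (κ := (1 : F)) ?_ ?_ ?_ ?_ ?_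
    all_goals first
      | (norm_num; done)
      | (simp only [quat_mul_quat, smul_quat]; apply quat_congr <;> norm_num)
  · refine conj_cls_quat (κ := (1 : F)) ?_ ?_ ?_ ?_ ?_
    all_goals first
      | (norm_num; done)
      | (simp only [quat_mul_quat, smul_quat]; apply quat_congr <;> norm_num)
  · refine conj_cls_quat (κ := (1 : F)) ?_ ?_ ?_ ?_ ?_
    all_goals first
      | (norm_num; done)
      | (simp only [quat_mul_quat, smul_quat]; apply quat_congr <;> norm_num)
  · refine conj_cls_quat (κ := (1 : F)) ?_ ?_ ?_ ?_ ?_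
    all_goals first
      | (norm_num; done)
      | (simp only [quat_mul_quat, smul_quat]; apply quat_congr <;> norm_num)

theorem conj_cubeDiagonal_half (i : Fin 4) :
    MulAut.conj (cls (quat (0 : F) 1 0 0)) • cubeDiagonal F i = cubeDiagonal F (cubeHalf i) := by
  fin_cases i
  · refine conj_cls_quat (κ := (-1 : F)) ?_ ?_ ?_ ?_ ?_
    all_goals first
      | (norm_num; done)
      | (simp only [quat_mul_quat, smul_quat]; apply quat_congr <;> norm_num)
  · refine conj_cls_quat (κ := (1 : F)) ?_ ?_ ?_ ?_ ?_
    all_goals first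
      | (norm_num; done)
      | (simp only [quat_mul_quat, smul_quat]; apply quat_congr <;> norm_num)
  · refine conj_cls_quat (κ := (1 : F)) ?_ ?_ ?_ ?_ ?_
    all_goals first
      | (norm_num; done)
      | (simp only [quat_mul_quat, smul_quat]; apply quat_congr <;> norm_num)
  · refine conj_cls_quat (κ := (-1 : F)) ?_ ?_ ?_ ?_ ?_
    all_goals first
      | (norm_num; done)
      | (simp only [quat_mul_quat, smul_quat]; apply quat_congr <;> norm_num)

/-- Only surjectivity is obtained at this point. Injectivity follows later from the upper bound on
the size of the group that the tree provides. -/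
theorem exists_hom_cubeQuarter :
    ∃ φ : Subgroup.closure {cls (quat (1 : F) 1 0 0), cls (omega F)} →* Equiv.Perm (Fin 4),
      φ.range = ⊤ := by
  rw [← closure_cubeQuarter]
  exact exists_hom_perm MulAut.conj cubeDiagonal_injective conj_cubeDiagonal_quarter
    conj_cubeDiagonal_third

theorem exists_hom_cubeHalf :
    ∃ φ : Subgroup.closure {cls (quat (0 : F) 1 0 0), cls (omega F)} →* Equiv.Perm (Fin 4),
      φ.range = alternatingGroup (Fin 4) := by
  rw [← closure_cubeHalf]
  exact exists_hom_perm MulAut.conj cubeDiagonal_injective conj_cubeDiagonal_half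
    conj_cubeDiagonal_third

end Cube

/-! ### The icosahedron: action on its five frames -/

section Frames

open scoped Pointwise

variable {F : Type*} [Field F] [CharZero F] {f : F}

/-- The five frames of half-turns in the icosahedral group. -/
noncomputable def frame (f : F) : Fin 5 → Set (PD F) :=
  ![{cls (quat 0 1 0 0), cls (quat 0 0 1 0), cls (quat 0 0 0 1)},
    {cls (quat 0 1 (-1 - f) f), cls (quat 0 1 (-1 + f) (2 - f)), cls (quat 0 1 (1 - f) (-f))},
    {cls (quat 0 1 (1 + f) f), cls (quat 0 1 (-1 + f) (-f)), cls (quat 0 1 (1 - f) (2 - f))},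
    {cls (quat 0 1 (1 - f) (-2 + f)), cls (quat 0 1 (1 + f) (-f)), cls (quat 0 1 (-1 + f) f)},
    {cls (quat 0 1 (-1 + f) (-2 + f)), cls (quat 0 1 (-1 - f) (-f)), cls (quat 0 1 (1 - f) f)}]

theorem golden_ne (hf : f ^ 2 = f + 1) : f ≠ 0 := by
  rintro rfl
  norm_num at hf

/-- The images of the three axes may come in another order than in the frame `S`; since `S` is a
set, only the equality of the two triples as sets is required. -/
theorem conj_frame {g a b c a' b' c' : ℍ[F]} {S : Set (PD F)} {κ₁ κ₂ κ₃ : F} (hg : IsUnit g)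
    (ha : IsUnit a) (hb : IsUnit b) (hc : IsUnit c) (ha' : IsUnit a') (hb' : IsUnit b')
    (hc' : IsUnit c') (h₁ : κ₁ ≠ 0) (h₂ : κ₂ ≠ 0) (h₃ : κ₃ ≠ 0) (e₁ : a' * g = κ₁ • (g * a))
    (e₂ : b' * g = κ₂ • (g * b)) (e₃ : c' * g = κ₃ • (g * c))
    (hS : ({cls a', cls b', cls c'} : Set (PD F)) = S) :
    MulAut.conj (cls g) • ({cls a, cls b, cls c} : Set (PD F)) = S := by
  rw [← hS, ← conj_cls hg ha ha' h₁ e₁, ← conj_cls hg hb hb' h₂ e₂, ← conj_cls hg hc hc' h₃ e₃]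
  change (fun x => MulAut.conj (cls g) • x) '' _ = _
  rw [Set.image_insert_eq, Set.image_pair]
  rfl

theorem conj_frame_third (hf : f ^ 2 = f + 1) (i : Fin 5) :
    MulAut.conj (cls (omega F)) • frame f i = frame f (frameThird i) := by
  have h0 := golden_ne hf
  rw [omega_eq]
  fin_cases i
  · refine conj_frame (κ₁ := (1 : F)) (κ₂ := (1 : F)) (κ₃ := (1 : F)) (a' := quat 0 0 1 0) (b' := quat 0 0 0 1) (c' := quat 0 1 0 0) (S := {cls (quat 0 1 0 0), cls (quat 0 0 1 0), cls (quat 0 0 0 1)}) ?_ ?_ ?_ ?_ ?_ ?_ ?_ ?_ ?_ ?_ ?_ ?_ ?_ ?_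
    all_goals first | exact isUnit_quat (by grind) | (simp only [quat_mul_quat, smul_quat]; apply quat_congr <;> grind) | grind
  · refine conj_frame (κ₁ := (-1 + 1 * f : F)) (κ₂ := (1 + 1 * f : F)) (κ₃ := (1 + -1 * f : F)) (a' := quat 0 1 (-1 + f) (-f)) (b' := quat 0 1 (1 + f) f) (c' := quat 0 1 (1 - f) (2 - f)) (S := {cls (quat 0 1 (1 + f) f), cls (quat 0 1 (-1 + f) (-f)), cls (quat 0 1 (1 - f) (2 - f))}) ?_ ?_ ?_ ?_ ?_ ?_ ?_ ?_ ?_ ?_ ?_ ?_ ?_ ?_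
    all_goals first | exact isUnit_quat (by grind) | (simp only [quat_mul_quat, smul_quat]; apply quat_congr <;> grind) | grind
  · refine conj_frame (κ₁ := (-1 + 1 * f : F)) (κ₂ := (1 + -1 * f : F)) (κ₃ := (1 + 1 * f : F)) (a' := quat 0 1 (-1 + f) f) (b' := quat 0 1 (1 - f) (-2 + f)) (c' := quat 0 1 (1 + f) (-f)) (S := {cls (quat 0 1 (1 - f) (-2 + f)), cls (quat 0 1 (1 + f) (-f)), cls (quat 0 1 (-1 + f) f)}) ?_ ?_ ?_ ?_ ?_ ?_ ?_ ?_ ?_ ?_ ?_ ?_ ?_ ?_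
    all_goals first | exact isUnit_quat (by grind) | (simp only [quat_mul_quat, smul_quat]; apply quat_congr <;> grind) | grind
  · refine conj_frame (κ₁ := (-1 + -1 * f : F)) (κ₂ := (1 + -1 * f : F)) (κ₃ := (-1 + 1 * f : F)) (a' := quat 0 1 (-1 - f) f) (b' := quat 0 1 (1 - f) (-f)) (c' := quat 0 1 (-1 + f) (2 - f)) (S := {cls (quat 0 1 (-1 - f) f), cls (quat 0 1 (-1 + f) (2 - f)), cls (quat 0 1 (1 - f) (-f))}) ?_ ?_ ?_ ?_ ?_ ?_ ?_ ?_ ?_ ?_ ?_ ?_ ?_ ?_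
    all_goals first | exact isUnit_quat (by grind) | (simp only [quat_mul_quat, smul_quat]; apply quat_congr <;> grind) | grind
  · refine conj_frame (κ₁ := (-1 + -1 * f : F)) (κ₂ := (1 + -1 * f : F)) (κ₃ := (-1 + 1 * f : F)) (a' := quat 0 1 (-1 - f) (-f)) (b' := quat 0 1 (1 - f) f) (c' := quat 0 1 (-1 + f) (-2 + f)) (S := {cls (quat 0 1 (-1 + f) (-2 + f)), cls (quat 0 1 (-1 - f) (-f)), cls (quat 0 1 (1 - f) f)}) ?_ ?_ ?_ ?_ ?_ ?_ ?_ ?_ ?_ ?_ ?_ ?_ ?_ ?_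
    all_goals first | exact isUnit_quat (by grind) | (simp only [quat_mul_quat, smul_quat]; apply quat_congr <;> grind) | grind

theorem conj_frame_half (hf : f ^ 2 = f + 1) (i : Fin 5) :
    MulAut.conj (cls (quat 0 (1 / 2) (f⁻¹ / 2) (f / 2))) • frame f i = frame f (frameHalf i) := by
  have h0 := golden_ne hf
  fin_cases i
  · refine conj_frame (κ₁ := (-2 : F)) (κ₂ := (2 * f : F)) (κ₃ := (-2 + 2 * f : F)) (a' := quat 0 1 (1 - f) (-f)) (b' := quat 0 1 (-1 - f) f) (c' := quat 0 1 (-1 + f) (2 - f)) (S := {cls (quat 0 1 (-1 - f) f), cls (quat 0 1 (-1 + f) (2 - f)), cls (quat 0 1 (1 - f) (-f))}) ?_ ?_ ?_ ?_ ?_ ?_ ?_ ?_ ?_ ?_ ?_ ?_ ?_ ?_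
    all_goals first | exact isUnit_quat (by grind) | (simp only [quat_mul_quat, smul_quat]; apply quat_congr <;> grind) | grind
  · refine conj_frame (κ₁ := (-1/2 + 1/2 * f : F)) (κ₂ := (1/2 * f : F)) (κ₃ := (-1/2 : F)) (a' := quat 0 0 1 0) (b' := quat 0 0 0 1) (c' := quat 0 1 0 0) (S := {cls (quat 0 1 0 0), cls (quat 0 0 1 0), cls (quat 0 0 0 1)}) ?_ ?_ ?_ ?_ ?_ ?_ ?_ ?_ ?_ ?_ ?_ ?_ ?_ ?_
    all_goals first | exact isUnit_quat (by grind) | (simp only [quat_mul_quat, smul_quat]; apply quat_congr <;> grind) | grind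
  · refine conj_frame (κ₁ := (-1 + 1 * f : F)) (κ₂ := (1 + -1 * f : F)) (κ₃ := (-1 + -1 * f : F)) (a' := quat 0 1 (1 - f) f) (b' := quat 0 1 (-1 + f) (-2 + f)) (c' := quat 0 1 (-1 - f) (-f)) (S := {cls (quat 0 1 (-1 + f) (-2 + f)), cls (quat 0 1 (-1 - f) (-f)), cls (quat 0 1 (1 - f) f)}) ?_ ?_ ?_ ?_ ?_ ?_ ?_ ?_ ?_ ?_ ?_ ?_ ?_ ?_
    all_goals first | exact isUnit_quat (by grind) | (simp only [quat_mul_quat, smul_quat]; apply quat_congr <;> grind) | grind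
  · refine conj_frame (κ₁ := (-1 : F)) (κ₂ := (-1 : F)) (κ₃ := (1 : F)) (a' := quat 0 1 (1 - f) (-2 + f)) (b' := quat 0 1 (1 + f) (-f)) (c' := quat 0 1 (-1 + f) f) (S := {cls (quat 0 1 (1 - f) (-2 + f)), cls (quat 0 1 (1 + f) (-f)), cls (quat 0 1 (-1 + f) f)}) ?_ ?_ ?_ ?_ ?_ ?_ ?_ ?_ ?_ ?_ ?_ ?_ ?_ ?_
    all_goals first | exact isUnit_quat (by grind) | (simp only [quat_mul_quat, smul_quat]; apply quat_congr <;> grind) | grind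
  · refine conj_frame (κ₁ := (-1 * f : F)) (κ₂ := (-2 + 1 * f : F)) (κ₃ := (1 * f : F)) (a' := quat 0 1 (-1 + f) (-f)) (b' := quat 0 1 (1 - f) (2 - f)) (c' := quat 0 1 (1 + f) f) (S := {cls (quat 0 1 (1 + f) f), cls (quat 0 1 (-1 + f) (-f)), cls (quat 0 1 (1 - f) (2 - f))}) ?_ ?_ ?_ ?_ ?_ ?_ ?_ ?_ ?_ ?_ ?_ ?_ ?_ ?_
    all_goals first | exact isUnit_quat (by grind) | (simp only [quat_mul_quat, smul_quat]; apply quat_congr <;> grind) | grind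

/-- The two conjugations permute the indices, so one explicit inequality, between the frames `0` and
`1`, propagates to all pairs. -/
theorem frame_injective (hf : f ^ 2 = f + 1) : Function.Injective (frame f) := by
  have ha : ∀ {i j}, frame f (frameThird i) ≠ frame f (frameThird j) → frame f i ≠ frame f j :=
    fun {i j} h h' => h (by rw [← conj_frame_third hf, ← conj_frame_third hf, h'])
  have hb : ∀ {i j}, frame f (frameHalf i) ≠ frame f (frameHalf j) → frame f i ≠ frame f j :=
    fun {i j} h h' => h (by rw [← conj_frame_half hf, ← conj_frame_half hf, h'])
  have h01 : frame f 0 ≠ frame f 1 := fun h => by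
    have h1 : cls (quat 0 1 0 0) ∈ frame f 0 := Or.inl rfl
    rw [h] at h1
    have hne := golden_ne hf
    rcases h1 with h1 | h1 | h1
    all_goals
      obtain ⟨κ, h2, h3, h4⟩ := cls_quat_eq_iff (by grind) (by grind) h1
      grind
  have h10 := h01.symm
  have h30 : frame f 3 ≠ frame f 0 := ha h10
  have h20 : frame f 2 ≠ frame f 0 := ha h30
  have h13 : frame f 1 ≠ frame f 3 := hb h30.symm
  have h32 : frame f 3 ≠ frame f 2 := ha h13
  have h21 : frame f 2 ≠ frame f 1 := ha h32
  have h40 : frame f 4 ≠ frame f 0 := hb h21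
  have h41 : frame f 4 ≠ frame f 1 := hb h20
  have h43 : frame f 4 ≠ frame f 3 := ha h41
  have h42 : frame f 4 ≠ frame f 2 := ha h43
  intro i j h
  fin_cases i <;> fin_cases j <;> first
    | rfl
    | exact absurd h (by assumption)
    | exact absurd h.symm (by assumption)

theorem exists_hom_frame (hf : f ^ 2 = f + 1) :
    ∃ φ : Subgroup.closure {cls (omega F), cls (quat 0 (1 / 2) (f⁻¹ / 2) (f / 2))} →*
      Equiv.Perm (Fin 5), φ.range = alternatingGroup (Fin 5) := by
  rw [← closure_frameHalf]
  exact exists_hom_perm MulAut.conj (frame_injective hf) (conj_frame_third hf) (conj_frame_half hf)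

end Frames

/-! ### Integral splittings and the assembly of the local conditions -/

section Splitting

variable {K : Type*} [Field K] [NumberField K] {v : HeightOneSpectrum (𝓞 K)}
  {O : Subalgebra (𝓞 K) ℍ[K]} {S : Set ℍ[K]}

theorem exists_standard_splitInert (h2 : (2 : 𝓞 K) ∉ v.asIdeal) {α β : v.adicCompletion K}
    (h : α ^ 2 + β ^ 2 = -1) (hα : α ∈ v.adicCompletionIntegers K)
    (hβ : β ∈ v.adicCompletionIntegers K)
    (hO : Subalgebra.toSubmodule O = Submodule.span (𝓞 K) S) (hS : ∀ x ∈ S, HalfIntegral x) :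
    ∃ e : ℍ[v.adicCompletion K] ≃ₐ[v.adicCompletion K] Matrix (Fin 2) (Fin 2) (v.adicCompletion K),
      (∀ x, e x = splitInert α β x) ∧ IsStandard e ∧ ∀ x ∈ O, ∃ M, IntModel e x M := by
  obtain ⟨e, he⟩ := exists_splitInert h
  exact ⟨e, he, isStandard_splitInert h he, fun x hx =>
    intModel_of_span hO (fun y hy => exists_intModel_splitInert h2 he hα hβ (hS y hy)) hx⟩

theorem exists_standard_splitTwo (h2 : (2 : 𝓞 K) ∉ v.asIdeal) {ρ : v.adicCompletion K}
    (h : ρ ^ 2 = -2) (hO : Subalgebra.toSubmodule O = Submodule.span (𝓞 K) S)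
    (hS : ∀ x ∈ S, HalfIntegral x) :
    ∃ e : ℍ[v.adicCompletion K] ≃ₐ[v.adicCompletion K] Matrix (Fin 2) (Fin 2) (v.adicCompletion K),
      (∀ x, e x = splitTwo ρ x) ∧ IsStandard e ∧ ∀ x ∈ O, ∃ M, IntModel e x M := by
  simp only [splitTwo_eq]
  refine exists_standard_splitInert h2 ?_ (one_mem _) (mem_integers_of_sq_mem ?_) hO hS
  · rw [h]; norm_num
  · rw [h]; exact neg_mem (ofNat_mem _ 2)

theorem exists_standard_splitFive (h2 : (2 : 𝓞 K) ∉ v.asIdeal) {ρ : v.adicCompletion K}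
    (h : ρ ^ 2 = -5) (hO : Subalgebra.toSubmodule O = Submodule.span (𝓞 K) S)
    (hS : ∀ x ∈ S, HalfIntegral x) :
    ∃ e : ℍ[v.adicCompletion K] ≃ₐ[v.adicCompletion K] Matrix (Fin 2) (Fin 2) (v.adicCompletion K),
      (∀ x, e x = splitFive ρ x) ∧ IsStandard e ∧ ∀ x ∈ O, ∃ M, IntModel e x M := by
  simp only [splitFive_eq]
  refine exists_standard_splitInert h2 ?_ (ofNat_mem _ 2) (mem_integers_of_sq_mem ?_) hO hS
  · rw [h]; norm_num
  · rw [h]; exact neg_mem (ofNat_mem _ 5)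

theorem exists_standard_splitThree (h2 : (2 : 𝓞 K) ∉ v.asIdeal) {ρ : v.adicCompletion K}
    (h : ρ ^ 2 = -3) (hO : Subalgebra.toSubmodule O = Submodule.span (𝓞 K) S)
    (hS : ∀ x ∈ S, HalfIntegral x) :
    ∃ e : ℍ[v.adicCompletion K] ≃ₐ[v.adicCompletion K] Matrix (Fin 2) (Fin 2) (v.adicCompletion K),
      (∀ x, e x = splitThree ρ x) ∧ IsStandard e ∧ ∀ x ∈ O, ∃ M, IntModel e x M := by
  simp only [splitThree_eq]
  have hρ : ρ ∈ v.adicCompletionIntegers K :=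
    mem_integers_of_sq_mem (by rw [h]; exact neg_mem (ofNat_mem _ 3))
  have hhalf : (2 : v.adicCompletion K)⁻¹ ∈ v.adicCompletionIntegers K := by
    have := algebraMap_mem_of_two_mul_mem (K := K) h2 (a := 2⁻¹) (by norm_num)
    rwa [map_inv₀, map_ofNat] at this
  refine exists_standard_splitInert h2 ?_ ?_ ?_ hO hS
  · have : (2 : v.adicCompletion K) ≠ 0 := two_ne_zero
    field_simp
    linear_combination 2 * h
  · exact mul_mem (add_mem (one_mem _) hρ) hhalf
  · exact mul_mem (sub_mem (one_mem _) hρ) hhalf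

/-- A pair `(C, T)` for which all the local conditions hold corresponds to its image in `PU(2)`, and
is a Super-Golden-Gate set. -/
theorem gates_of_local (hK : IsTotallyReal K) (hO : IsOrder O) (σ : K →+* ℝ)
    {C : Subgroup (PD K)} {T : PD K} {C' : Subgroup (PGL(2, ℂ))} {T' : PGL(2, ℂ)}
    (hC : C.map (toPU σ) = C') (hT : toPU σ T = T') (hq : Finite (𝓞 K ⧸ v.asIdeal))
    (hcard : Nat.card (𝓞 K ⧸ v.asIdeal) + 1 ≤ Nat.card C)
    (hΛ : ∃ Λ : Subgroup (PD K), IsArithmetic v O Λ ∧ C ≤ Λ ∧ T ∈ Λ)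
    {P : v.adicCompletion K → Prop}
    {s : v.adicCompletion K → ℍ[v.adicCompletion K] →
      Matrix (Fin 2) (Fin 2) (v.adicCompletion K)}
    (hP : ∃ ρ, P ρ)
    (h : ∀ ρ, P ρ → ∃ e : ℍ[v.adicCompletion K] ≃ₐ[v.adicCompletion K]
      Matrix (Fin 2) (Fin 2) (v.adicCompletion K), (∀ x, e x = s ρ x) ∧ IsStandard e ∧
      (∀ c ∈ C, IsElliptic e c) ∧ IsFlip e T) :
    CorrespondsTo σ C T C' T' ∧ ∀ ρ, P ρ → ∃ e : ℍ[v.adicCompletion K] ≃ₐ[v.adicCompletion K]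
      Matrix (Fin 2) (Fin 2) (v.adicCompletion K), (∀ x, e x = s ρ x) ∧
        IsSuperGoldenGateSet O e C T := by
  constructor
  · obtain ⟨ρ, hρ⟩ := hP
    obtain ⟨e, -, he, hell, hflip⟩ := h ρ hρ
    exact correspondsTo σ hC hT hflip.mul_self fun g hg => notMem_of_altProd he hell hflip g hg
  · intro ρ hρ
    obtain ⟨e, hs, he, hell, hflip⟩ := h ρ hρ
    exact ⟨e, hs, isSuperGoldenGateSet hK hO hq hΛ he hell hcard hflip⟩

theorem exists_arithmetic {C : Subgroup (PD K)} {T : PD K} (hC : C ≤ unitGroup O)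
    (hT : T ∈ arithGroup v O) : ∃ Λ : Subgroup (PD K), IsArithmetic v O Λ ∧ C ≤ Λ ∧ T ∈ Λ :=
  ⟨arithGroup v O, Subgroup.Commensurable.refl _, hC.trans unitGroup_le_arithGroup, hT⟩

end Splitting

/-! ### Corresponding matrices in `PU(2)` -/

section Complex

variable {K : Type*} [Field K] [NumberField K] (σ : K →+* ℝ)

/-- The listed complex matrices are normalized differently from the images of the quaternions; `κ`
is the scalar between the two. -/
theorem toPU_cls_quat {a b c d : K} (h : a ^ 2 + b ^ 2 + c ^ 2 + d ^ 2 ≠ 0) {κ p q r s : ℂ}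
    (hκ : κ ≠ 0) (hp : (σ a : ℂ) + Complex.I * σ b = κ * p) (hq : (σ c : ℂ) + Complex.I * σ d = κ * q)
    (hr : -(σ c : ℂ) + Complex.I * σ d = κ * r) (hs : (σ a : ℂ) - Complex.I * σ b = κ * s) :
    toPU σ (cls (quat a b c d)) = pgl !![p, q; r, s] := by
  rw [toPU_cls σ (isUnit_quat h), ← pgl_smul hκ !![p, q; r, s]]
  congr 1
  change !![(σ a : ℂ) + Complex.I * σ b, (σ c : ℂ) + Complex.I * σ d;
    -(σ c : ℂ) + Complex.I * σ d, (σ a : ℂ) - Complex.I * σ b] = _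
  rw [hp, hq, hr, hs]
  simp

theorem map_gen_pair (x y : ℍ[K]) :
    (gen {x, y}).map (toPU σ) = Subgroup.closure {toPU σ (cls x), toPU σ (cls y)} := by
  rw [gen, MonoidHom.map_closure, Set.image_image, Set.image_pair]

theorem genU_pair (a b : Matrix (Fin 2) (Fin 2) ℂ) :
    genU {a, b} = Subgroup.closure {pgl a, pgl b} := by
  rw [genU, Set.image_pair]

theorem gen_pair (x y : ℍ[K]) : gen {x, y} = Subgroup.closure {cls x, cls y} := by
  rw [gen, Set.image_pair]

theorem toPU_omega : toPU σ (cls (omega K)) = pgl !![1, 1; Complex.I, -Complex.I] := by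
  have h2 : σ (1 / 2) = 1 / 2 := by rw [map_div₀, map_one, map_ofNat]
  rw [omega_eq]
  refine toPU_cls_quat σ (by norm_num) (κ := (1 + Complex.I) / 2) ?_ ?_ ?_ ?_ ?_
  · intro h
    simpa using congrArg Complex.re h
  all_goals
    rw [h2]
    push_cast
    grind [Complex.I_sq]

end Complex

theorem halfIntegral_quat {K : Type*} [Field K] [NumberField K] {a b c d : K}
    (ha : 2 * a ∈ intRing K) (hb : 2 * b ∈ intRing K) (hc : 2 * c ∈ intRing K)
    (hd : 2 * d ∈ intRing K) : HalfIntegral (quat a b c d) :=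
  ⟨ha, hb, hc, hd⟩

theorem exists_root {K : Type*} [Field K] [NumberField K] {v : HeightOneSpectrum (𝓞 K)}
    {k : Type*} [CommRing k] {χ : 𝓞 K →+* k} (hχ : ∀ a, a ∈ v.asIdeal ↔ χ a = 0) (d s : ℤ)
    (h2 : ((2 * s : ℤ) : k) ≠ 0) (h : ((s ^ 2 - d : ℤ) : k) = 0) :
    ∃ ρ : v.adicCompletion K, ρ ^ 2 = d ∧ Valued.v (ρ - s) < 1 := by
  obtain ⟨ρ, h3, h4⟩ := exists_sq_eq (v := v) (d := d) (s := s)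
    ((hχ _).not.2 (by rw [← map_intCast χ] at h2; exact_mod_cast h2))
    ((hχ _).2 (by rw [← map_intCast χ] at h; exact_mod_cast h))
  exact ⟨ρ, by simpa using h3, by simpa using h4⟩

theorem ofNat_notMem {K : Type*} [Field K] [NumberField K] {v : HeightOneSpectrum (𝓞 K)}
    {k : Type*} [CommRing k] {χ : 𝓞 K →+* k} (hχ : ∀ a, a ∈ v.asIdeal ↔ χ a = 0)
    (h : (2 : k) ≠ 0) : (2 : 𝓞 K) ∉ v.asIdeal :=
  (hχ _).not.2 (by rwa [map_ofNat])

theorem normSq_quat {F : Type*} [Field F] (a b c d : F) :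
    Quaternion.normSq (quat a b c d) = a ^ 2 + b ^ 2 + c ^ 2 + d ^ 2 :=
  Quaternion.normSq_def' _

theorem isUniformizing_quat {K : Type*} [Field K] [NumberField K] {v : HeightOneSpectrum (𝓞 K)}
    {n : 𝓞 K} (hv : v.asIdeal = Ideal.span {n}) {b c d : K} (h : b ^ 2 + c ^ 2 + d ^ 2 = n) :
    IsUniformizing v n (quat 0 b c d) :=
  ⟨hv, rfl, by rw [normSq_quat, ← h]; ring⟩

theorem coe_ofNat_integers {K : Type*} [Field K] [NumberField K] (n : ℕ) [n.AtLeastTwo] :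
    ((ofNat(n) : 𝓞 K) : K) = ofNat(n) := map_ofNat _ _

/-! ### The tetrahedral gates over `ℚ` at 11 -/

section Rational

variable {v : HeightOneSpectrum (𝓞 ℚ)} {O : Subalgebra (𝓞 ℚ) ℍ[ℚ]}

theorem intRing_simp {K : Type*} [Field K] [NumberField K] :
    2 * (0 : K) ∈ intRing K ∧ 2 * (1 : K) ∈ intRing K ∧ 2 * (1 / 2 : K) ∈ intRing K := by
  refine ⟨?_, ?_, ?_⟩
  · rw [mul_zero]; exact zero_mem _
  · rw [mul_one]; exact ofNat_mem _ 2
  · rw [mul_one_div_cancel two_ne_zero]; exact one_mem _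

theorem halfIntegral_hurwitz :
    ∀ x ∈ ({1, quat 0 1 0 0, quat 0 0 1 0, omega ℚ} : Set ℍ[ℚ]), HalfIntegral x := by
  obtain ⟨h0, h1, h2⟩ := intRing_simp (K := ℚ)
  rintro x (rfl | rfl | rfl | rfl)
  · exact ⟨h1, h0, h0, h0⟩
  · exact ⟨h0, h1, h0, h0⟩
  · exact ⟨h0, h0, h1, h0⟩
  · exact ⟨h2, h2, h2, h2⟩

theorem isElliptic_rat {k : Type*} [CommRing k] {χ : 𝓞 ℚ →+* k}
    (hχ : ∀ a, a ∈ v.asIdeal ↔ χ a = 0) {e : ℍ[v.adicCompletion ℚ] ≃ₐ[v.adicCompletion ℚ]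
      Matrix (Fin 2) (Fin 2) (v.adicCompletion ℚ)} (he : IsStandard e) (hO : IsOrder O)
    (hm : ∀ x ∈ O, ∃ M, IntModel e x M) (h0 : ∀ z : k, z ^ 2 + 1 ≠ 0)
    (h1 : ∀ z : k, z ^ 2 - z + 1 ≠ 0) {c : PD ℚ} (hc : c ∈ unitGroup O) : IsElliptic e c := by
  obtain rfl | ⟨x, hx, hn, rfl, t, ht, h⟩ := cases_rat hO hc
  · exact isElliptic_one
  refine isElliptic_of_trace hχ he (hm x hx) hn ht fun z => ?_
  obtain ⟨rfl, -⟩ | ⟨rfl | rfl, -⟩ := h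
  · simpa using h0 z
  · simpa using h1 z
  · have := h1 (-z)
    simpa using this

theorem isGeneratedBy_of_eq {K : Type*} [Field K] [NumberField K] {v : HeightOneSpectrum (𝓞 K)}
    {a : 𝓞 K} {x : K} (h : v.asIdeal = Ideal.span {a}) (hx : (a : K) = x) : IsGeneratedBy v x :=
  ⟨a, hx, h⟩

end Rational

/-- Modulo 11, `-1` and `-3` are not squares, so no unit of order 2 or 3 has an eigenvector, while
`-2 = 3²` provides the splitting. The alternating group of degree four has `12 = 11 + 1` elements.
-/
theorem gates_twelve {O : Subalgebra (𝓞 ℚ) ℍ[ℚ]} (hO : Subalgebra.toSubmodule O = hurwitz) :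
    C12 = unitGroup O ∧ Nonempty (C12 ≃* alternatingGroup (Fin 4)) ∧
      CorrespondsTo (algebraMap ℚ ℝ) C12 T12 C12U T12U ∧
      ∃ v : HeightOneSpectrum (𝓞 ℚ), IsGeneratedBy v (11 : ℚ) ∧
        (∃ ρ : v.adicCompletion ℚ, ρ ^ 2 = -2) ∧
        ∀ ρ : v.adicCompletion ℚ, ρ ^ 2 = -2 →
          ∃ e : ℍ[v.adicCompletion ℚ] ≃ₐ[v.adicCompletion ℚ]
            Matrix (Fin 2) (Fin 2) (v.adicCompletion ℚ),
            (∀ x, e x = splitTwo ρ x) ∧ IsSuperGoldenGateSet O e C12 T12 := by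
  have hO' := isOrder_hurwitz hO
  have : Fact (Nat.Prime 11) := ⟨by norm_num⟩
  obtain ⟨v, χ, hv, hχ, hq, hcard⟩ := exists_prime_rat 11
  replace hv : v.asIdeal = Ideal.span {(11 : 𝓞 ℚ)} := by simpa using hv
  have h2 : (2 : 𝓞 ℚ) ∉ v.asIdeal := ofNat_notMem hχ (by decide)
  have hi : quat 0 1 0 0 ∈ O := mem_of_eq_latticePoint_hurwitz hO hurwitz_units.1
  have hj : quat 0 0 1 0 ∈ O := mem_of_eq_latticePoint_hurwitz hO hurwitz_units.2.1
  have hk : quat 0 0 0 1 ∈ O := mem_of_eq_latticePoint_hurwitz hO hurwitz_units.2.2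
  have hω : omega ℚ ∈ O := (Subalgebra.mem_toSubmodule (S := O)).1
    (hO ▸ Submodule.subset_span (.inr (.inr (.inr rfl))))
  have hτ : quat 0 3 1 1 ∈ O := by
    have := O.add_mem (smul_mem_of_mem_intRing hi (c := 3) (ofNat_mem _ 3)) (O.add_mem hj hk)
    convert this using 1
    simp only [smul_quat, quat_add_quat]
    norm_num
  have hunif : IsUniformizing v 11 (quat 0 3 1 1) :=
    isUniformizing_quat hv (by rw [coe_ofNat_integers]; norm_num)
  have hpair : C12 = Subgroup.closure {cls (quat 0 1 0 0), cls (omega ℚ)} := gen_pair _ _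
  have hle : C12 ≤ unitGroup O := by
    rw [hpair, Subgroup.closure_le]
    rintro _ (rfl | rfl)
    · exact cls_mem_unitGroup hO' hi (u := 1) (by rw [Quaternion.normSq_def']; norm_num [quat])
    · exact cls_mem_unitGroup hO' hω (u := 1) (by rw [Quaternion.normSq_def']; norm_num [omega])
  have hroot : ∃ ρ : v.adicCompletion ℚ, ρ ^ 2 = -2 := by
    obtain ⟨ρ, hρ, -⟩ := exists_root (v := v) hχ (-2) 3 (by decide) (by decide)
    exact ⟨ρ, by simpa using hρ⟩
  have key : ∀ ρ : v.adicCompletion ℚ, ρ ^ 2 = -2 →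
      ∃ e : ℍ[v.adicCompletion ℚ] ≃ₐ[v.adicCompletion ℚ]
        Matrix (Fin 2) (Fin 2) (v.adicCompletion ℚ), (∀ x, e x = splitTwo ρ x) ∧ IsStandard e ∧
        (∀ c ∈ unitGroup O, IsElliptic e c) ∧ IsFlip e T12 := by
    intro ρ hρ
    obtain ⟨e, hs, he, hm⟩ := exists_standard_splitTwo h2 hρ hO halfIntegral_hurwitz
    exact ⟨e, hs, he, fun c hc => isElliptic_rat hχ he hO' hm (by decide) (by decide) hc,
      hunif.isFlip he (hm _ hτ)⟩
  obtain ⟨ρ₀, hρ₀⟩ := hroot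
  obtain ⟨e, -, he, hell, hflip⟩ := key ρ₀ hρ₀
  obtain ⟨hfin, hU⟩ := card_le_of_isElliptic hq hell ⟨_, hflip.smul_origin⟩
  have : Finite C12 := Finite.of_injective _ (Subgroup.inclusion_injective hle)
  obtain ⟨φ, hφ⟩ : ∃ φ : C12 →* Equiv.Perm (Fin 4), φ.range = alternatingGroup (Fin 4) := by
    rw [hpair]
    exact exists_hom_cubeHalf
  have hA : Nat.card (alternatingGroup (Fin 4)) = 12 := by
    rw [nat_card_alternatingGroup]; simp; decide
  have hge := card_le_of_range φ hφ
  -- The sandwich: the unit group has at most 12 elements by its free action on the neighbours, and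
  -- `C12` has at least 12 because it maps onto the alternating group.
  have hCU : C12 = unitGroup O := eq_unitGroup_of_card_le hq hflip hell hle (by omega)
  refine ⟨hCU, nonempty_mulEquiv_of_card_le φ hφ ?_, ?_⟩
  · rw [hCU]; omega
  have hCmap : C12.map (toPU (algebraMap ℚ ℝ)) = C12U := by
    have hi : toPU (algebraMap ℚ ℝ) (cls (quat 0 1 0 0)) =
        pgl !![Complex.I, 0; 0, -Complex.I] :=
      toPU_cls_quat _ (by norm_num) one_ne_zero (by simp) (by simp) (by simp) (by simp)
    rw [C12U, genU_pair, ← hi, ← toPU_omega (algebraMap ℚ ℝ)]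
    exact map_gen_pair _ _ _
  have hTmap : toPU (algebraMap ℚ ℝ) T12 = T12U := by
    refine toPU_cls_quat _ (by norm_num) Complex.I_ne_zero ?_ ?_ ?_ ?_ <;> simp <;>
      grind [Complex.I_sq]
  obtain ⟨hcor, hsg⟩ := gates_of_local inferInstance hO' (algebraMap ℚ ℝ) hCmap hTmap hq
    (by omega) (exists_arithmetic hle (cls_mem_arithGroup hO' hτ hunif.2.2 hv)) ⟨ρ₀, hρ₀⟩
    (fun ρ hρ => by rw [hCU]; exact key ρ hρ)
  exact ⟨hcor, v, isGeneratedBy_of_eq hv (map_ofNat _ 11), ⟨ρ₀, hρ₀⟩, hsg⟩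

/-! ### The Pauli gates at 3 -/

variable {O : Subalgebra (𝓞 ℚ) ℍ[ℚ]}

/-- The classes of the basic units. -/
noncomputable def pauli : Fin 4 → PD ℚ :=
  ![cls (quat 1 0 0 0), cls (quat 0 1 0 0), cls (quat 0 0 1 0), cls (quat 0 0 0 1)]

theorem range_pauli : Set.range pauli =
    cls '' {1, quat 0 1 0 0, quat 0 0 1 0, quat 0 0 0 1} := by
  simp only [Set.image_insert_eq, Set.image_singleton]
  ext c
  simp only [Set.mem_range, Set.mem_insert_iff, Set.mem_singleton_iff, pauli, one_eq_quat]
  constructor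
  · rintro ⟨i, rfl⟩
    fin_cases i
    · exact .inl rfl
    · exact .inr (.inl rfl)
    · exact .inr (.inr (.inl rfl))
    · exact .inr (.inr (.inr rfl))
  · rintro (rfl | rfl | rfl | rfl)
    exacts [⟨0, rfl⟩, ⟨1, rfl⟩, ⟨2, rfl⟩, ⟨3, rfl⟩]

theorem cross_eq_of_cls_eq {F : Type*} [Field F] [CharZero F]
    {a b c d a' b' c' d' : F} (h : a ^ 2 + b ^ 2 + c ^ 2 + d ^ 2 ≠ 0)
    (h' : a' ^ 2 + b' ^ 2 + c' ^ 2 + d' ^ 2 ≠ 0)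
    (hc : cls (quat a b c d) = cls (quat a' b' c' d')) :
    ∃ κ : F, a' = κ * a ∧ b' = κ * b ∧ c' = κ * c ∧ d' = κ * d := by
  obtain ⟨κ, -, hκ⟩ := (cls_eq_cls_iff (isUnit_quat h) (isUnit_quat h')).1 hc
  exact ⟨κ, congrArg QuaternionAlgebra.re hκ, congrArg QuaternionAlgebra.imI hκ,
    congrArg QuaternionAlgebra.imJ hκ, congrArg QuaternionAlgebra.imK hκ⟩

theorem pauli_injective : Function.Injective pauli := by
  intro i j hij
  by_contra hne
  fin_cases i <;> fin_cases j <;> first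
    | exact hne rfl
    | (obtain ⟨κ, h1, h2, h3, h4⟩ := cross_eq_of_cls_eq (F := ℚ) (by norm_num) (by norm_num) hij
       first
         | exact one_ne_zero (h1.trans (mul_zero κ))
         | exact one_ne_zero (h2.trans (mul_zero κ))
         | exact one_ne_zero (h3.trans (mul_zero κ))
         | exact one_ne_zero (h4.trans (mul_zero κ)))

theorem sq_sum_eq_one {a b c d : ℤ} (h : a ^ 2 + b ^ 2 + c ^ 2 + d ^ 2 = 1) :
    (a ^ 2 = 1 ∧ b = 0 ∧ c = 0 ∧ d = 0) ∨ (a = 0 ∧ b ^ 2 = 1 ∧ c = 0 ∧ d = 0) ∨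
      (a = 0 ∧ b = 0 ∧ c ^ 2 = 1 ∧ d = 0) ∨ (a = 0 ∧ b = 0 ∧ c = 0 ∧ d ^ 2 = 1) := by
  have ha := sq_nonneg a
  have hb := sq_nonneg b
  have hc := sq_nonneg c
  have hd := sq_nonneg d
  have key : ∀ {x : ℤ}, x ^ 2 < 1 → x = 0 := fun {x} hx =>
    pow_eq_zero_iff two_ne_zero |>.1 (le_antisymm (by omega) (sq_nonneg x))
  by_cases h1 : 1 ≤ a ^ 2
  · exact .inl ⟨by omega, key (by omega), key (by omega), key (by omega)⟩
  by_cases h2 : 1 ≤ b ^ 2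
  · exact .inr (.inl ⟨key (by omega), by omega, key (by omega), key (by omega)⟩)
  by_cases h3 : 1 ≤ c ^ 2
  · exact .inr (.inr (.inl ⟨key (by omega), key (by omega), by omega, key (by omega)⟩))
  · exact .inr (.inr (.inr ⟨key (by omega), key (by omega), key (by omega), by omega⟩))

/-- A Lipschitz quaternion of norm one has a single nonzero coordinate, equal to `±1`. The unit
group is found by this count alone, without the tree. -/
theorem unitGroup_lipschitz_subset (hO : Subalgebra.toSubmodule O = lipschitz) {c : PD ℚ}
    (hc : c ∈ unitGroup O) : c ∈ Set.range pauli := by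
  obtain ⟨x, hx, hn, rfl⟩ := exists_norm_one (isOrder_lipschitz hO) hc
    fun u x h => isSquare_of_normSq_rat h
  obtain ⟨a, b, c, d, rfl⟩ := (mem_lipschitz_iff hO).1 hx
  rw [normSq_quat] at hn
  have key : ∀ {t : ℤ}, t ^ 2 = 1 → (t : ℚ) ≠ 0 := fun {t} ht h => by
    rw [Int.cast_eq_zero] at h
    simp [h] at ht
  obtain ⟨h, rfl, rfl, rfl⟩ | ⟨rfl, h, rfl, rfl⟩ | ⟨rfl, rfl, h, rfl⟩ | ⟨rfl, rfl, rfl, h⟩ :=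
    sq_sum_eq_one (a := a) (b := b) (c := c) (d := d) (by exact_mod_cast hn)
  · exact ⟨0, by simpa [pauli] using (cls_quat_smul (key h) 1 0 0 0).symm⟩
  · exact ⟨1, by simpa [pauli] using (cls_quat_smul (key h) 0 1 0 0).symm⟩
  · exact ⟨2, by simpa [pauli] using (cls_quat_smul (key h) 0 0 1 0).symm⟩
  · exact ⟨3, by simpa [pauli] using (cls_quat_smul (key h) 0 0 0 1).symm⟩

theorem C4_le (hO : Subalgebra.toSubmodule O = lipschitz) : C4 ≤ unitGroup O := by
  have h : C4 = Subgroup.closure {cls (quat 0 1 0 0), cls (quat 0 0 1 0)} := gen_pair _ _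
  rw [h, Subgroup.closure_le]
  rintro _ (rfl | rfl)
  · exact cls_mem_unitGroup (isOrder_lipschitz hO) ((mem_lipschitz_iff hO).2 ⟨0, 1, 0, 0, by simp⟩)
      (u := 1) (by rw [normSq_quat]; norm_num)
  · exact cls_mem_unitGroup (isOrder_lipschitz hO) ((mem_lipschitz_iff hO).2 ⟨0, 0, 1, 0, by simp⟩)
      (u := 1) (by rw [normSq_quat]; norm_num)

theorem range_pauli_subset : Set.range pauli ⊆ C4 := by
  have hi : cls (quat 0 1 0 0) ∈ C4 := Subgroup.subset_closure ⟨_, .inl rfl, rfl⟩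
  have hj : cls (quat 0 0 1 0) ∈ C4 := Subgroup.subset_closure ⟨_, .inr rfl, rfl⟩
  rintro _ ⟨i, rfl⟩
  fin_cases i
  · have := one_mem C4
    rwa [← cls_one, one_eq_quat] at this
  · exact hi
  · exact hj
  · have := mul_mem hi hj
    rw [← cls_mul (isUnit_quat (by norm_num)) (isUnit_quat (by norm_num)), quat_mul_quat] at this
    simpa [pauli] using this

theorem coe_C4 : (C4 : Set (PD ℚ)) = Set.range pauli := by
  obtain ⟨O, hO⟩ := exists_lipschitz
  exact Set.Subset.antisymm (fun c hc => unitGroup_lipschitz_subset hO (C4_le hO hc))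
    range_pauli_subset

theorem C4_eq (hO : Subalgebra.toSubmodule O = lipschitz) : C4 = unitGroup O :=
  le_antisymm (C4_le hO) fun _ hc => range_pauli_subset (unitGroup_lipschitz_subset hO hc)

theorem card_C4 : Nat.card C4 = 4 := by
  have h : Nat.card (C4 : Set (PD ℚ)) = 4 := by
    rw [coe_C4, Nat.card_range_of_injective pauli_injective, Nat.card_fin]
  exact h

theorem image_C4 : (toPU (algebraMap ℚ ℝ)) '' (Set.range pauli) =
    pgl '' {!![1, 0; 0, 1], !![Complex.I, 0; 0, -Complex.I], !![0, 1; -1, 0],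
      !![0, Complex.I; Complex.I, 0]} := by
  rw [range_pauli, one_eq_quat]
  simp only [Set.image_insert_eq, Set.image_singleton]
  congr
  · exact toPU_cls_quat _ (by norm_num) one_ne_zero (by simp) (by simp) (by simp) (by simp)
  · exact toPU_cls_quat _ (by norm_num) one_ne_zero (by simp) (by simp) (by simp) (by simp)
  · exact toPU_cls_quat _ (by norm_num) one_ne_zero (by simp) (by simp) (by simp) (by simp)
  · exact toPU_cls_quat _ (by norm_num) one_ne_zero (by simp) (by simp) (by simp) (by simp)

theorem map_C4 : C4.map (toPU (algebraMap ℚ ℝ)) = C4U := by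
  have hi : toPU (algebraMap ℚ ℝ) (cls (quat 0 1 0 0)) = pgl !![Complex.I, 0; 0, -Complex.I] :=
    toPU_cls_quat _ (by norm_num) one_ne_zero (by simp) (by simp) (by simp) (by simp)
  have hj : toPU (algebraMap ℚ ℝ) (cls (quat 0 0 1 0)) = pgl !![0, 1; -1, 0] :=
    toPU_cls_quat _ (by norm_num) one_ne_zero (by simp) (by simp) (by simp) (by simp)
  rw [C4U, genU_pair, ← hi, ← hj]
  exact map_gen_pair _ _ _

theorem valued_ofNat_eq_one {K : Type*} [Field K] [NumberField K] {v : HeightOneSpectrum (𝓞 K)}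
    {n : 𝓞 K} (hn : n ∉ v.asIdeal) :
    Valued.v (algebraMap K (v.adicCompletion K) (n : K)) = 1 := by
  rw [valued_algebraMap]
  exact v.valuation_eq_one_iff_notMem.2 hn

theorem mapQuat_quat {F L : Type*} [Field F] [Field L] (f : F →+* L) (a b c d : F) :
    mapQuat f (quat a b c d) = quat (f a) (f b) (f c) (f d) := rfl

theorem splitTwo_quat {F : Type*} [Field F] (ρ a b c d : F) : splitTwo ρ (quat a b c d) =
    !![a + c + ρ * d, b + ρ * c - d; -b + ρ * c - d, a - c - ρ * d] := rfl

/-- `508² + 2 = 3⁶ · 354`. For the root congruent to `1` modulo 3, the factor `ρ + 508` in `(ρ -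
508)(ρ + 508) = -(508² + 2)` is a unit, so all six factors 3 divide `ρ - 508`. -/
theorem exists_root_near_508 {v : HeightOneSpectrum (𝓞 ℚ)} {χ : 𝓞 ℚ →+* ZMod 3}
    (hχ : ∀ a, a ∈ v.asIdeal ↔ χ a = 0) : ∃ ρ : v.adicCompletion ℚ, ρ ^ 2 = -2 ∧
      Valued.v (ρ - 508) ≤ Valued.v (3 ^ 6 : v.adicCompletion ℚ) := by
  obtain ⟨ρ, hρ, h1⟩ := exists_root (v := v) hχ (-2) 1 (by decide) (by decide)
  have hρ : ρ ^ 2 = -2 := by simpa using hρ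
  refine ⟨ρ, hρ, ?_⟩
  have h2 : Valued.v (509 : v.adicCompletion ℚ) = 1 := by
    have := valued_ofNat_eq_one (v := v) (n := 509) ((hχ _).not.2 (by rw [map_ofNat]; decide))
    rwa [coe_ofNat_integers, map_ofNat] at this
  have h3 : Valued.v (ρ + 508) = 1 := by
    rw [show ρ + 508 = 509 + (ρ - (1 : ℤ)) by push_cast; ring, ← h2]
    exact Valuation.map_add_eq_of_lt_left _ (h1.trans_eq h2.symm)
  have h4 : Valued.v (354 : v.adicCompletion ℚ) ≤ 1 := ofNat_mem (v.adicCompletionIntegers ℚ) 354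
  have h5 : (ρ - 508) * (ρ + 508) = -(3 ^ 6 * 354) := by linear_combination hρ
  have h6 := congrArg Valued.v h5
  rw [map_mul, h3, mul_one, Valuation.map_neg, map_mul] at h6
  rw [h6]
  exact mul_le_of_le_one_right' h4

/-- Both matrices are steps, and with `ρ ≡ 1` modulo 3 both reductions have the image line spanned
by `(1, 1)`; equal lines give equal vertices. -/
theorem smul_origin_T4 {v : HeightOneSpectrum (𝓞 ℚ)} (hv : v.asIdeal = Ideal.span {3})
    {ρ : v.adicCompletion ℚ} {e : ℍ[v.adicCompletion ℚ] ≃ₐ[v.adicCompletion ℚ]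
      Matrix (Fin 2) (Fin 2) (v.adicCompletion ℚ)} (hρ : ρ ^ 2 = -2)
    (he : ∀ x, e x = splitTwo ρ x) (hst : IsStandard e)
    (h508 : Valued.v (ρ - 508) ≤ Valued.v (3 ^ 6 : v.adicCompletion ℚ)) :
    ∃ g : GL (Fin 2) (v.adicCompletion ℚ),
      (g : Matrix (Fin 2) (Fin 2) (v.adicCompletion ℚ)) = !![3, 1; 0, 1] ∧
      treeMap e T4 • origin v = vertexOf v g := by
  have hρi : ρ ∈ v.adicCompletionIntegers ℚ :=
    mem_integers_of_sq_mem (by rw [hρ]; exact neg_mem (ofNat_mem _ 2))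
  let r : v.adicCompletionIntegers ℚ := ⟨ρ, hρi⟩
  let M : Matrix (Fin 2) (Fin 2) (v.adicCompletionIntegers ℚ) := !![1 + r, r; r - 2, -1 - r]
  let N : Matrix (Fin 2) (Fin 2) (v.adicCompletionIntegers ℚ) := !![3, 1; 0, 1]
  have hN : incl v N = !![3, 1; 0, 1] := by
    ext a b
    fin_cases a <;> fin_cases b <;> rfl
  have hM : incl v M = !![1 + ρ, ρ; ρ - 2, -1 - ρ] := by
    ext a b
    fin_cases a <;> fin_cases b <;> rfl
  have hmodel : IntModel e (quat 0 1 1 1) M := by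
    rw [IntModel, he, hM, mapQuat_quat, map_zero, map_one, splitTwo_quat]
    ext a b
    fin_cases a <;> fin_cases b <;> simp <;> ring_nf
  have hunif : IsUniformizing v 3 (quat 0 1 1 1) :=
    isUniformizing_quat hv (by rw [coe_ofNat_integers]; norm_num)
  have hMs : IsStep M := hunif.isStep hst hmodel
  have hdet : (incl v N).det = (incl v M).det := by
    rw [hN, hM, Matrix.det_fin_two_of, Matrix.det_fin_two_of]
    linear_combination 2 * hρ
  have hNs : IsStep N := by rw [IsStep, hdet]; exact hMs
  have hNu := hNs.isUnit
  have h3 : IsLocalRing.residue (v.adicCompletionIntegers ℚ) 3 = 0 := by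
    have := (residue_algebraMap_eq_zero_iff v 3).2 (hv ▸ Ideal.mem_span_singleton_self 3)
    rwa [map_ofNat] at this
  have hr : IsLocalRing.residue (v.adicCompletionIntegers ℚ) r = 508 := by
    rw [← sub_eq_zero, ← map_ofNat (IsLocalRing.residue (v.adicCompletionIntegers ℚ)) 508, ← map_sub,
      residue_eq_zero_iff]
    refine lt_of_le_of_lt h508 ?_
    rw [map_pow]
    exact pow_lt_one₀ zero_le ((residue_eq_zero_iff v 3).1 h3) (by norm_num)
  have hredM : red v M = !![509, 508; 506, -509] := by
    ext a b
    fin_cases a <;> fin_cases b <;> simp only [red_apply, M] <;> simp [hr] <;> norm_num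
    rw [map_ofNat]
    norm_num
  have hredN : red v N = !![3, 1; 0, 1] := by
    ext a b
    fin_cases a <;> fin_cases b <;> simp [red_apply, N]
    rw [map_ofNat]
  rw [map_ofNat] at h3
  have hres : vtx (incl v M) = vtx (incl v N) := by
    refine vtx_eq_of_adjugate_mul hMs hNs ?_
    rw [hredM, hredN, Matrix.adjugate_fin_two_of, Matrix.mul_fin_two]
    ext a b
    fin_cases a <;> fin_cases b
    · change (-509 * 3 + -508 * 0 : Residue v) = 0
      linear_combination -509 * h3
    · change (-509 * 1 + -508 * 1 : Residue v) = 0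
      linear_combination -339 * h3
    · change (-506 * 3 + 509 * 0 : Residue v) = 0
      linear_combination -506 * h3
    · change (-506 * 1 + 509 * 1 : Residue v) = 0
      linear_combination h3
  refine ⟨hNu.unit, hN, ?_⟩
  rw [vertexOf_eq, IsUnit.unit_spec, ← hres, origin_eq]
  have := treeMap_smul_vtx (isUnit_quat (by norm_num)) hmodel (isUnit_one (M := Matrix (Fin 2) (Fin 2) (v.adicCompletion ℚ)))
  rw [mul_one] at this
  exact this

variable {O : Subalgebra (𝓞 ℚ) ℍ[ℚ]}

theorem halfIntegral_lipschitz :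
    ∀ x ∈ ({1, quat 0 1 0 0, quat 0 0 1 0, quat 0 0 0 1} : Set ℍ[ℚ]), HalfIntegral x := by
  obtain ⟨h0, h1, h2⟩ := intRing_simp (K := ℚ)
  rintro x (rfl | rfl | rfl | rfl)
  · exact ⟨h1, h0, h0, h0⟩
  · exact ⟨h0, h1, h0, h0⟩
  · exact ⟨h0, h0, h1, h0⟩
  · exact ⟨h0, h0, h0, h1⟩

theorem isElliptic_pauli {v : HeightOneSpectrum (𝓞 ℚ)} {k : Type*} [CommRing k] {χ : 𝓞 ℚ →+* k}
    (hχ : ∀ a, a ∈ v.asIdeal ↔ χ a = 0) {e : ℍ[v.adicCompletion ℚ] ≃ₐ[v.adicCompletion ℚ]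
      Matrix (Fin 2) (Fin 2) (v.adicCompletion ℚ)} (he : IsStandard e)
    (hO : Subalgebra.toSubmodule O = lipschitz)
    (hm : ∀ x ∈ O, ∃ M, IntModel e x M) (h0 : ∀ z : k, z ^ 2 + 1 ≠ 0) (i : Fin 4) :
    IsElliptic e (pauli i) := by
  have key : ∀ b c d : ℤ, b ^ 2 + c ^ 2 + d ^ 2 = 1 → IsElliptic e (cls (quat 0 b c d)) := by
    intro b c d h
    refine isElliptic_of_trace hχ he (hm _ ((mem_lipschitz_iff hO).2 ⟨0, b, c, d, by simp⟩)) ?_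
      (t := 0) ?_ fun z => by simpa using h0 z
    · rw [normSq_quat]
      have : (b : ℚ) ^ 2 + c ^ 2 + d ^ 2 = 1 := by exact_mod_cast h
      linear_combination this
    · rw [re_quat, mul_zero]; exact (map_zero (algebraMap (𝓞 ℚ) ℚ)).symm
  fin_cases i
  · have := isElliptic_one (e := e)
    rwa [← cls_one, one_eq_quat] at this
  · simpa [pauli] using key 1 0 0 (by norm_num)
  · simpa [pauli] using key 0 1 0 (by norm_num)
  · simpa [pauli] using key 0 0 1 (by norm_num)

/-- The nontrivial elements have trace zero, and `-1` is not a square modulo 3; the group has `4 = 3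
+ 1` elements. The polynomial `z² - z + 1` does have a root modulo 3, but no unit of order 3 occurs
in the Lipschitz order. -/
theorem gates_four (hO : Subalgebra.toSubmodule O = lipschitz) :
    C4 = unitGroup O ∧
      (C4 : Set (PD ℚ)) = cls '' {1, ⟨0, 1, 0, 0⟩, ⟨0, 0, 1, 0⟩, ⟨0, 0, 0, 1⟩} ∧
      (C4U : Set (PGL(2, ℂ))) = pgl '' {!![1, 0; 0, 1], !![Complex.I, 0; 0, -Complex.I],
        !![0, 1; -1, 0], !![0, Complex.I; Complex.I, 0]} ∧
      CorrespondsTo (algebraMap ℚ ℝ) C4 T4 C4U T4U ∧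
      ∃ v : HeightOneSpectrum (𝓞 ℚ), IsGeneratedBy v (3 : ℚ) ∧
        (∃ ρ : v.adicCompletion ℚ, ρ ^ 2 = -2 ∧
          Valued.v (ρ - 508) ≤ Valued.v (3 ^ 6 : v.adicCompletion ℚ)) ∧
        ∀ ρ : v.adicCompletion ℚ, ρ ^ 2 = -2 →
          ∃ e : ℍ[v.adicCompletion ℚ] ≃ₐ[v.adicCompletion ℚ]
            Matrix (Fin 2) (Fin 2) (v.adicCompletion ℚ),
            (∀ x, e x = splitTwo ρ x) ∧ IsSuperGoldenGateSet O e C4 T4 ∧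
              (Valued.v (ρ - 508) ≤ Valued.v (3 ^ 6 : v.adicCompletion ℚ) →
                ∃ g : GL (Fin 2) (v.adicCompletion ℚ),
                  (g : Matrix (Fin 2) (Fin 2) (v.adicCompletion ℚ)) = !![3, 1; 0, 1] ∧
                  treeMap e T4 • origin v = vertexOf v g) := by
  have hO' := isOrder_lipschitz hO
  refine ⟨C4_eq hO, coe_C4.trans range_pauli, ?_, ?_⟩
  · rw [← map_C4, Subgroup.coe_map, coe_C4, image_C4]
  have : Fact (Nat.Prime 3) := ⟨by norm_num⟩
  obtain ⟨v, χ, hv, hχ, hq, hcard⟩ := exists_prime_rat 3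
  replace hv : v.asIdeal = Ideal.span {(3 : 𝓞 ℚ)} := by simpa using hv
  have h2 : (2 : 𝓞 ℚ) ∉ v.asIdeal := ofNat_notMem hχ (by decide)
  have hτ : quat 0 1 1 1 ∈ O := (mem_lipschitz_iff hO).2 ⟨0, 1, 1, 1, by simp⟩
  have hunif : IsUniformizing v 3 (quat 0 1 1 1) :=
    isUniformizing_quat hv (by rw [coe_ofNat_integers]; norm_num)
  obtain ⟨ρ₀, hρ₀, h508⟩ := exists_root_near_508 hχ
  have key : ∀ ρ : v.adicCompletion ℚ, ρ ^ 2 = -2 →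
      ∃ e : ℍ[v.adicCompletion ℚ] ≃ₐ[v.adicCompletion ℚ]
        Matrix (Fin 2) (Fin 2) (v.adicCompletion ℚ), (∀ x, e x = splitTwo ρ x) ∧ IsStandard e ∧
        (∀ c ∈ C4, IsElliptic e c) ∧ IsFlip e T4 := by
    intro ρ hρ
    obtain ⟨e, hs, he, hm⟩ := exists_standard_splitTwo h2 hρ hO halfIntegral_lipschitz
    refine ⟨e, hs, he, fun c hc => ?_, hunif.isFlip he (hm _ hτ)⟩
    obtain ⟨i, rfl⟩ := coe_C4.subset hc
    exact isElliptic_pauli hχ he hO hm (by decide) i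
  have hTmap : toPU (algebraMap ℚ ℝ) T4 = T4U := by
    refine toPU_cls_quat _ (by norm_num) Complex.I_ne_zero ?_ ?_ ?_ ?_ <;> simp <;>
      grind [Complex.I_sq]
  obtain ⟨hcor, hsg⟩ := gates_of_local inferInstance hO' (algebraMap ℚ ℝ) map_C4 hTmap hq
    (by rw [hcard, card_C4]) (exists_arithmetic (C4_le hO) (cls_mem_arithGroup hO' hτ hunif.2.2 hv))
    ⟨ρ₀, hρ₀⟩ key
  refine ⟨hcor, v, isGeneratedBy_of_eq hv (coe_ofNat_integers 3), ⟨ρ₀, hρ₀, h508⟩, fun ρ hρ => ?_⟩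
  obtain ⟨e, hs, hg⟩ := hsg ρ hρ
  refine ⟨e, hs, hg, smul_origin_T4 hv hρ hs (isStandard_splitInert (α := 1) (β := ρ) ?_ ?_)⟩
  · rw [hρ]; norm_num
  · simpa only [← splitTwo_eq] using hs

/-! ### Normalizers and commensurability -/

section Normalizer

variable {G : Type*} [Group G] {A : Subgroup G}

/-- As `g` has finite order, conjugation by `g⁻¹` is conjugation by a power of `g`, so one inclusion
suffices. -/
theorem mem_normalizer_of_pow_eq_one {g : G} (h : ∀ k ∈ A, g * k * g⁻¹ ∈ A) {n : ℕ}
    (hn : g ^ (n + 1) = 1) : g ∈ Subgroup.normalizer (A : Set G) := by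
  have h1 : ∀ m : ℕ, ∀ k ∈ A, g ^ m * k * (g ^ m)⁻¹ ∈ A := by
    intro m
    induction m with
    | zero => simp
    | succ m ih =>
      intro k hk
      have := ih _ (h k hk)
      rw [pow_succ, mul_inv_rev]
      simpa only [mul_assoc] using this
  refine Subgroup.mem_normalizer_iff.2 fun k => ⟨h k, fun hk => ?_⟩
  have h2 := h1 n _ hk
  have h3 : g ^ n * (g * k * g⁻¹) * (g ^ n)⁻¹ = g ^ (n + 1) * k * (g ^ (n + 1))⁻¹ := by
    rw [pow_succ, mul_inv_rev]
    simp only [mul_assoc]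
  rwa [h3, hn, one_mul, inv_one, mul_one] at h2

/-- By the second isomorphism theorem the quotient of `H ⊔ A` by `A` is a quotient of the finite
group `H`. -/
theorem commensurable_sup {H : Subgroup G} [Finite H] (h : H ≤ Subgroup.normalizer (A : Set G)) :
    Subgroup.Commensurable (H ⊔ A) A := by
  constructor
  · rw [Subgroup.relIndex_eq_one.2 le_sup_right]
    exact one_ne_zero
  · have := Subgroup.normal_subgroupOf_of_le_normalizer h
    have := Subgroup.normal_subgroupOf_sup_of_le_normalizer h
    have e := QuotientGroup.quotientInfEquivProdNormalizerQuotient H A h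
    rw [Subgroup.relIndex, Subgroup.index, ← Nat.card_congr e.toEquiv]
    exact Nat.card_pos.ne'

theorem mem_closure_pair_dihedral {R s : G} (hs : s * s = 1) (h : s * R * s = R⁻¹) {c : G}
    (hc : c ∈ Subgroup.closure {R, s}) : ∃ k : ℤ, c = R ^ k ∨ c = R ^ k * s := by
  have h1 : s⁻¹ = s := inv_eq_of_mul_eq_one_left hs
  have h2 : ∀ k : ℤ, s * R ^ k = R ^ (-k) * s := fun k => by
    have h3 : s * R * s = s * R * s⁻¹ := by rw [h1]
    rw [zpow_neg, ← inv_zpow, ← h, ← mul_inv_eq_iff_eq_mul, h3, conj_zpow]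
  induction hc using Subgroup.closure_induction with
  | mem x hx =>
    obtain rfl | rfl := hx
    · exact ⟨1, .inl (zpow_one _).symm⟩
    · exact ⟨0, .inr (by simp)⟩
  | one => exact ⟨0, .inl (by simp)⟩
  | mul x y _ _ hx hy =>
    obtain ⟨k, rfl | rfl⟩ := hx <;> obtain ⟨l, rfl | rfl⟩ := hy
    · exact ⟨k + l, .inl (zpow_add _ _ _).symm⟩
    · exact ⟨k + l, .inr (by rw [zpow_add, mul_assoc])⟩
    · exact ⟨k - l, .inr (by rw [mul_assoc, h2, ← mul_assoc, ← zpow_add, sub_eq_add_neg])⟩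
    · refine ⟨k - l, .inl ?_⟩
      rw [mul_assoc, ← mul_assoc s, h2, mul_assoc _ s, hs, mul_one, ← zpow_add, sub_eq_add_neg]
  | inv x _ hx =>
    obtain ⟨k, rfl | rfl⟩ := hx
    · exact ⟨-k, .inl (zpow_neg _ _).symm⟩
    · refine ⟨k, .inr ?_⟩
      rw [mul_inv_rev, h1, ← zpow_neg, h2, neg_neg]

theorem zpow_eq_of_pow_three {R : G} (h : R ^ 3 = 1) (k : ℤ) :
    R ^ k = 1 ∨ R ^ k = R ∨ R ^ k = R ^ 2 := by
  have h1 : R ^ k = R ^ (k % 3) := zpow_eq_zpow_emod k (by exact_mod_cast h)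
  have h2 : k % 3 = 0 ∨ k % 3 = 1 ∨ k % 3 = 2 := by omega
  rw [h1]
  obtain h | h | h := h2 <;> rw [h]
  · simp
  · simp
  · exact .inr (.inr (by norm_cast))

end Normalizer

/-- Conjugation by `g` maps `O` into itself and commutes with scalars, so it preserves integrality
outside `P`. -/
theorem conj_mem_arithGroup {K : Type*} [Field K] [NumberField K] {v : HeightOneSpectrum (𝓞 K)}
    {O : Subalgebra (𝓞 K) ℍ[K]} {g : ℍ[K]} (hg : IsUnit g) (h : ∀ x ∈ O, ∃ y ∈ O, y * g = g * x)
    {c : PD K} (hc : c ∈ arithGroup v O) : cls g * c * (cls g)⁻¹ ∈ arithGroup v O := by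
  obtain ⟨γ, rfl⟩ := hg
  have key : ∀ x, IntegralOutside v O x → IntegralOutside v O (γ * x * (γ⁻¹ : (ℍ[K])ˣ)) := by
    rintro x ⟨n, hn⟩
    refine ⟨n, fun a ha => ?_⟩
    obtain ⟨y, hy, hyg⟩ := h _ (hn a ha)
    convert hy using 1
    rw [← mul_assoc, Units.mul_inv_eq_iff_eq_mul, hyg, ← mul_assoc, ← mul_assoc,
      Algebra.commutes]
  obtain ⟨u, ⟨h1, h2⟩, rfl⟩ := hc
  have hγ : cls (γ : ℍ[K]) = QuotientGroup.mk' (scalars K) γ := by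
    rw [cls, dif_pos γ.isUnit]
    congr 1
    exact Units.ext rfl
  rw [hγ, ← map_mul, ← map_inv, ← map_mul]
  refine Subgroup.mem_map_of_mem _ ⟨?_, ?_⟩
  · simpa using key _ h1
  · simpa [mul_assoc] using key _ h2

/-! ### The hybrid V-gates at 5 -/

section Triangle

variable {F : Type*} [Field F] [CharZero F]

theorem isUnit_omega : IsUnit (omega F) := isUnit_quat (by norm_num)

theorem cls_eq_one_of_eq_smul {x : ℍ[F]} {κ : F} (hκ : κ ≠ 0) (h : x = κ • (1 : ℍ[F])) :
    cls x = 1 := by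
  rw [h, cls_smul hκ, cls_one]

theorem cls_ones : cls (quat (1 : F) 1 1 1) = cls (omega F) := by
  rw [omega_eq, ← cls_quat_smul (κ := 1 / 2) (by norm_num), mul_one]

theorem cls_omega_pow_three : cls (omega F) ^ 3 = 1 :=
  cls_pow_three_eq_one (by rw [omega_eq, normSq_quat]; norm_num) (by rw [omega_eq, re_quat]; norm_num)

theorem cls_omega_ne_one : cls (omega F) ≠ 1 := by
  intro h
  rw [← cls_one, omega_eq, one_eq_quat, eq_comm] at h
  obtain ⟨κ, -, h2, -⟩ := cross_eq_of_cls_eq (by norm_num) (by norm_num) h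
  norm_num at h2

theorem orderOf_cls_omega : orderOf (cls (omega F)) = 3 :=
  have : Fact (Nat.Prime 3) := ⟨by norm_num⟩
  orderOf_eq_prime cls_omega_pow_three cls_omega_ne_one

theorem isUnit_reflection : IsUnit (quat (0 : F) 1 (-1) 0) := isUnit_quat (by norm_num)

theorem cls_reflection_mul_self :
    cls (quat (0 : F) 1 (-1) 0) * cls (quat (0 : F) 1 (-1) 0) = 1 := by
  rw [← cls_mul isUnit_reflection isUnit_reflection]
  refine cls_eq_one_of_eq_smul (κ := -2) (by norm_num) ?_
  simp only [quat_mul_quat, one_eq_quat, smul_quat]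
  norm_num

theorem cls_reflection_conj : cls (quat (0 : F) 1 (-1) 0) * cls (omega F) *
    cls (quat (0 : F) 1 (-1) 0) = (cls (omega F))⁻¹ := by
  rw [eq_inv_iff_mul_eq_one, ← cls_mul isUnit_reflection isUnit_omega,
    ← cls_mul (isUnit_reflection.mul isUnit_omega) isUnit_reflection,
    ← cls_mul ((isUnit_reflection.mul isUnit_omega).mul isUnit_reflection) isUnit_omega]
  refine cls_eq_one_of_eq_smul (κ := -2) (by norm_num) ?_
  simp only [omega_eq, quat_mul_quat, one_eq_quat, smul_quat]
  norm_num

theorem cls_omega_mul_reflection : cls (omega F) * cls (quat (0 : F) 1 (-1) 0) =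
    cls (quat 0 1 0 (-1)) := by
  rw [← cls_mul isUnit_omega isUnit_reflection]
  simp only [omega_eq, quat_mul_quat]
  norm_num

theorem cls_omega_sq_mul_reflection : cls (omega F) ^ 2 * cls (quat (0 : F) 1 (-1) 0) =
    cls (quat 0 0 1 (-1)) := by
  rw [pow_two, mul_assoc, cls_omega_mul_reflection, ← cls_mul isUnit_omega (isUnit_quat (by norm_num))]
  simp only [omega_eq, quat_mul_quat]
  norm_num

end Triangle

theorem C6_eq : C6 = Subgroup.closure {cls (omega ℚ), cls (quat 0 1 (-1) 0)} := by
  rw [← cls_ones]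
  exact gen_pair _ _

theorem nonempty_mulEquiv_C6 : Nonempty (C6 ≃* Equiv.Perm (Fin 3)) := by
  rw [C6_eq]
  obtain ⟨f⟩ := nonempty_mulEquiv_dihedral le_rfl (orderOf_cls_omega (F := ℚ)) cls_reflection_mul_self
    cls_reflection_conj
  have h1 : Subgroup.closure {finRotate 3, Equiv.swap (0 : Fin 3) 1} = ⊤ :=
    Equiv.Perm.closure_cycle_adjacent_swap (σ := finRotate 3) isCycle_finRotate support_finRotate 0
  have : Fact (Nat.Prime 3) := ⟨by norm_num⟩
  obtain ⟨g⟩ := nonempty_mulEquiv_dihedral (R := finRotate 3) (s := Equiv.swap (0 : Fin 3) 1) le_rfl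
    (orderOf_eq_prime (by decide) (by decide)) (by decide) (by decide)
  rw [h1] at g
  exact ⟨f.trans (g.symm.trans Subgroup.topEquiv)⟩

theorem card_C6 : Nat.card C6 = 6 := by
  obtain ⟨f⟩ := nonempty_mulEquiv_C6
  rw [Nat.card_congr f.toEquiv, Nat.card_perm, Nat.card_fin]
  rfl

/-- The second complex generator is the image of `j - k`, not of `i - j`. The two differ by the
square of `ω`, so each generates the same group together with `ω`. -/
theorem map_C6 : C6.map (toPU (algebraMap ℚ ℝ)) = C6U := by
  have h1 : C6 = Subgroup.closure {cls (omega ℚ), cls (quat 0 0 1 (-1))} := by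
    rw [C6_eq, ← cls_omega_sq_mul_reflection]
    apply le_antisymm <;> rw [Subgroup.closure_le] <;> rintro _ (rfl | rfl)
    · exact Subgroup.subset_closure (.inl rfl)
    · have h2 : cls (omega ℚ) ∈ Subgroup.closure
          {cls (omega ℚ), cls (omega ℚ) ^ 2 * cls (quat 0 1 (-1) 0)} :=
        Subgroup.subset_closure (.inl rfl)
      rw [SetLike.mem_coe, ← Subgroup.mul_mem_cancel_left _ (pow_mem h2 2)]
      exact Subgroup.subset_closure (.inr rfl)
    · exact Subgroup.subset_closure (.inl rfl)
    · exact mul_mem (pow_mem (Subgroup.subset_closure (.inl rfl)) 2)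
        (Subgroup.subset_closure (.inr rfl))
  rw [h1, MonoidHom.map_closure, Set.image_pair, toPU_omega, C6U, genU_pair]
  congr 3
  refine toPU_cls_quat _ (by norm_num) (κ := -1 - Complex.I) ?_ ?_ ?_ ?_ ?_
  · intro h
    simpa using congrArg Complex.re h
  all_goals simp
  · linear_combination Complex.I_sq
  · ring

/-- The half-turns of `C6` are represented by `i - j`, `i - k` and `j - k`, of norm 2; this is why
the polynomial is `z² + 2` and not `z² + 1`, which has roots modulo 5. The group is dihedral, so it
consists of three powers of `ω` and three half-turns. -/
theorem isElliptic_C6 {v : HeightOneSpectrum (𝓞 ℚ)} {k : Type*} [CommRing k] {χ : 𝓞 ℚ →+* k}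
    (hχ : ∀ a, a ∈ v.asIdeal ↔ χ a = 0) {e : ℍ[v.adicCompletion ℚ] ≃ₐ[v.adicCompletion ℚ]
      Matrix (Fin 2) (Fin 2) (v.adicCompletion ℚ)} (he : IsStandard e)
    (hm : ∀ x : ℍ[ℚ], HalfIntegral x → ∃ M, IntModel e x M) (h0 : ∀ z : k, z ^ 2 + 2 ≠ 0)
    (h1 : ∀ z : k, z ^ 2 - z + 1 ≠ 0) {c : PD ℚ} (hc : c ∈ C6) : IsElliptic e c := by
  obtain ⟨i0, i1, i2⟩ := intRing_simp (K := ℚ)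
  have i3 : 2 * (-1 : ℚ) ∈ intRing ℚ := by rw [mul_neg]; exact neg_mem i1
  have i4 : 2 * (-(1 / 2) : ℚ) ∈ intRing ℚ := by rw [mul_neg]; exact neg_mem i2
  have hω : IsElliptic e (cls (omega ℚ)) :=
    isElliptic_of_trace hχ he (hm _ (halfIntegral_quat i2 i2 i2 i2))
      (by rw [omega_eq, normSq_quat]; norm_num) (t := 1)
      (by rw [omega_eq, re_quat]; exact mul_one_div_cancel two_ne_zero) fun z => by simpa using h1 z
  have hω2 : IsElliptic e (cls (omega ℚ) ^ 2) := by
    rw [pow_two, ← cls_mul isUnit_omega isUnit_omega, omega_eq, quat_mul_quat]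
    norm_num
    refine isElliptic_of_trace hχ he (hm _ (halfIntegral_quat i4 i2 i2 i2))
      (by rw [normSq_quat]; norm_num) (t := -1) ?_ fun z => ?_
    · rw [re_quat]
      norm_num
    · have := h1 (-z)
      simpa using this
  have key : ∀ b c d : ℚ, 2 * b ∈ intRing ℚ → 2 * c ∈ intRing ℚ → 2 * d ∈ intRing ℚ →
      b ^ 2 + c ^ 2 + d ^ 2 = 2 → IsElliptic e (cls (quat 0 b c d)) := by
    intro b c d hb hc hd h
    obtain ⟨M, hM⟩ := hm _ (halfIntegral_quat i0 hb hc hd)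
    refine hM.isElliptic he (t := 0) (n := 2) ?_ ?_ fun a => ?_
    · rw [re_quat, mul_zero]
      exact (map_zero (algebraMap (𝓞 ℚ) ℚ)).symm
    · rw [normSq_quat, coe_ofNat_integers, ← h]
      ring
    · rw [hχ]
      simpa [map_ofNat χ] using h0 (χ a)
  rw [C6_eq] at hc
  obtain ⟨k, rfl | rfl⟩ := mem_closure_pair_dihedral cls_reflection_mul_self cls_reflection_conj hc
  · obtain h | h | h := zpow_eq_of_pow_three (cls_omega_pow_three (F := ℚ)) k <;> rw [h]
    · exact isElliptic_one
    · exact hω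
    · exact hω2
  · obtain h | h | h := zpow_eq_of_pow_three (cls_omega_pow_three (F := ℚ)) k <;> rw [h]
    · rw [one_mul]
      exact key _ _ _ i1 i3 i0 (by norm_num)
    · rw [cls_omega_mul_reflection]
      exact key _ _ _ i1 i0 i3 (by norm_num)
    · rw [cls_omega_sq_mul_reflection]
      exact key _ _ _ i0 i1 i3 (by norm_num)

variable {O : Subalgebra (𝓞 ℚ) ℍ[ℚ]}

/-- Conjugation by `ω` permutes `i, j, k` cyclically. Conjugation by `i - j` exchanges `i` with `-j`
and changes the sign of `k`. Both preserve the Lipschitz order. -/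
theorem C6_le_normalizer (hO : Subalgebra.toSubmodule O = lipschitz)
    (v : HeightOneSpectrum (𝓞 ℚ)) :
    C6 ≤ Subgroup.normalizer (arithGroup v O : Set (PD ℚ)) := by
  rw [C6_eq, Subgroup.closure_le]
  rintro _ (rfl | rfl)
  · refine mem_normalizer_of_pow_eq_one (fun c hc => conj_mem_arithGroup isUnit_omega ?_ hc)
      cls_omega_pow_three
    intro x hx
    obtain ⟨a, b, c, d, rfl⟩ := (mem_lipschitz_iff hO).1 hx
    refine ⟨quat a d b c, (mem_lipschitz_iff hO).2 ⟨a, d, b, c, rfl⟩, ?_⟩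
    simp only [omega_eq, quat_mul_quat]
    apply quat_congr <;> ring
  · refine mem_normalizer_of_pow_eq_one (n := 1)
      (fun c hc => conj_mem_arithGroup isUnit_reflection ?_ hc)
      (by rw [pow_two, cls_reflection_mul_self])
    intro x hx
    obtain ⟨a, b, c, d, rfl⟩ := (mem_lipschitz_iff hO).1 hx
    refine ⟨quat a (-c) (-b) (-d), (mem_lipschitz_iff hO).2 ⟨a, -c, -b, -d, by push_cast; rfl⟩, ?_⟩
    simp only [quat_mul_quat]
    apply quat_congr <;> ring

theorem gates_six (hO : Subalgebra.toSubmodule O = lipschitz) :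
    Nonempty (C6 ≃* Equiv.Perm (Fin 3)) ∧
      CorrespondsTo (algebraMap ℚ ℝ) C6 T6 C6U T6U ∧
      ∃ v : HeightOneSpectrum (𝓞 ℚ), IsGeneratedBy v (5 : ℚ) ∧
        (∃ ρ : v.adicCompletion ℚ, ρ ^ 2 = -1) ∧
        ∀ ρ : v.adicCompletion ℚ, ρ ^ 2 = -1 →
          ∃ e : ℍ[v.adicCompletion ℚ] ≃ₐ[v.adicCompletion ℚ]
            Matrix (Fin 2) (Fin 2) (v.adicCompletion ℚ),
            (∀ x, e x = splitOne ρ x) ∧ IsSuperGoldenGateSet O e C6 T6 := by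
  have hO' := isOrder_lipschitz hO
  refine ⟨nonempty_mulEquiv_C6, ?_⟩
  have : Fact (Nat.Prime 5) := ⟨by norm_num⟩
  obtain ⟨v, χ, hv, hχ, hq, hcard⟩ := exists_prime_rat 5
  replace hv : v.asIdeal = Ideal.span {(5 : 𝓞 ℚ)} := by simpa using hv
  have h2 : (2 : 𝓞 ℚ) ∉ v.asIdeal := ofNat_notMem hχ (by decide)
  have hτ : quat 0 0 1 2 ∈ O := (mem_lipschitz_iff hO).2 ⟨0, 0, 1, 2, by simp⟩
  have hunif : IsUniformizing v 5 (quat 0 0 1 2) :=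
    isUniformizing_quat hv (by rw [coe_ofNat_integers]; norm_num)
  obtain ⟨ρ₀, hρ₀, -⟩ := exists_root (v := v) hχ (-1) 2 (by decide) (by decide)
  replace hρ₀ : ρ₀ ^ 2 = -1 := by simpa using hρ₀
  have key : ∀ ρ : v.adicCompletion ℚ, ρ ^ 2 = -1 →
      ∃ e : ℍ[v.adicCompletion ℚ] ≃ₐ[v.adicCompletion ℚ]
        Matrix (Fin 2) (Fin 2) (v.adicCompletion ℚ), (∀ x, e x = splitOne ρ x) ∧ IsStandard e ∧
        (∀ c ∈ C6, IsElliptic e c) ∧ IsFlip e T6 := by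
    intro ρ hρ
    obtain ⟨e, hs⟩ := exists_splitOne hρ
    have he := isStandard_splitOne hρ hs
    have hρi : ρ ∈ v.adicCompletionIntegers ℚ :=
      mem_integers_of_sq_mem (by rw [hρ]; exact neg_mem (one_mem _))
    exact ⟨e, hs, he, fun c hc => isElliptic_C6 hχ he
      (fun x hx => exists_intModel_splitOne h2 hs hρi hx) (by decide) (by decide) hc,
      hunif.isFlip he (intModel_of_span hO
        (fun x hx => exists_intModel_splitOne h2 hs hρi (halfIntegral_lipschitz x hx)) hτ)⟩
  have hfin : Finite C6 := Nat.finite_of_card_ne_zero (by rw [card_C6]; norm_num)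
  have hTmap : toPU (algebraMap ℚ ℝ) T6 = T6U := by
    refine toPU_cls_quat _ (by norm_num) Complex.I_ne_zero ?_ ?_ ?_ ?_ <;> simp <;>
      grind [Complex.I_sq]
  -- `ω` is not a Lipschitz quaternion. The arithmetic group is the one generated by `C6` and the
  -- arithmetic group that it normalizes.
  obtain ⟨hcor, hsg⟩ := gates_of_local inferInstance hO' (algebraMap ℚ ℝ) map_C6 hTmap hq
    (by rw [hcard, card_C6]) ⟨C6 ⊔ arithGroup v O, commensurable_sup (C6_le_normalizer hO v),
      le_sup_left, Subgroup.mem_sup_right (cls_mem_arithGroup hO' hτ hunif.2.2 hv)⟩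
    ⟨ρ₀, hρ₀⟩ key
  exact ⟨hcor, v, isGeneratedBy_of_eq hv (coe_ofNat_integers 5), ⟨ρ₀, hρ₀⟩, hsg⟩

/-! ### The gate sets over `ℚ(√2)` -/

theorem two_mul_inv_r2 : 2 * (1 / r2) = r2 := by
  rw [mul_one_div, div_eq_iff r2_ne_zero, ← pow_two, r2_sq]

theorem halfIntegral_octahedral : ∀ x ∈ ({1, quat (1 / r2) (1 / r2) 0 0, quat (1 / r2) 0 (1 / r2) 0,
    omega K2} : Set ℍ[K2]), HalfIntegral x := by
  obtain ⟨h0, h1, h2⟩ := intRing_simp (K := K2)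
  have h3 : 2 * (1 / r2) ∈ intRing K2 := by rw [two_mul_inv_r2]; exact r2_mem
  rintro x (rfl | rfl | rfl | rfl)
  · exact ⟨h1, h0, h0, h0⟩
  · exact ⟨h3, h3, h0, h0⟩
  · exact ⟨h3, h0, h3, h0⟩
  · exact ⟨h2, h2, h2, h2⟩

/-- Each hypothesis is a disjunction so that subgroups are covered too: an order that does not occur
in the subgroup imposes no condition on the residue field. -/
theorem isElliptic_two {v : HeightOneSpectrum (𝓞 K2)} {O : Subalgebra (𝓞 K2) ℍ[K2]} {k : Type*}
    [CommRing k] {χ : 𝓞 K2 →+* k} (hχ : ∀ a, a ∈ v.asIdeal ↔ χ a = 0)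
    {e : ℍ[v.adicCompletion K2] ≃ₐ[v.adicCompletion K2]
      Matrix (Fin 2) (Fin 2) (v.adicCompletion K2)} (he : IsStandard e) (hO : IsOrder O)
    (hm : ∀ x ∈ O, ∃ M, IntModel e x M) {c : PD K2} (hc : c ∈ unitGroup O)
    (h2 : c ^ 2 = 1 → c = 1 ∨ ∀ z : k, z ^ 2 + 1 ≠ 0)
    (h3 : c ^ 3 = 1 → c = 1 ∨ ∀ z : k, z ^ 2 - z + 1 ≠ 0)
    (h4 : c ^ 4 = 1 → c = 1 ∨ ∀ z : k, z ^ 2 - χ sqrtTwo * z + 1 ≠ 0) : IsElliptic e c := by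
  obtain rfl | ⟨x, hx, hn, rfl, t, ht, h⟩ := cases_two hO hc
  · exact isElliptic_one
  by_cases h1 : cls x = 1
  · rw [h1]
    exact isElliptic_one
  refine isElliptic_of_trace hχ he (hm x hx) hn ht fun z => ?_
  obtain ⟨rfl, h⟩ | ⟨rfl | rfl, h⟩ | ⟨rfl | rfl, h⟩ := h
  · simpa using (h2 h).resolve_left h1 z
  · simpa using (h3 h).resolve_left h1 z
  · simpa using (h3 h).resolve_left h1 (-z)
  · simpa using (h4 h).resolve_left h1 z
  · simpa using (h4 h).resolve_left h1 (-z)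

section Quarter

variable {F : Type*} [Field F] [CharZero F]

theorem isUnit_quarter : IsUnit (quat (1 : F) 1 0 0) := isUnit_quat (by norm_num)

theorem cls_quarter {r : F} (hr : r ≠ 0) : cls (quat (1 / r) (1 / r) 0 0) = cls (quat 1 1 0 0) := by
  simpa using cls_quat_smul (κ := 1 / r) (one_div_ne_zero hr) 1 1 0 0

theorem cls_quarter_sq : cls (quat (1 : F) 1 0 0) ^ 2 = cls (quat 0 1 0 0) := by
  have h := cls_quat_smul (F := F) (κ := 2) two_ne_zero 0 1 0 0
  rw [pow_two, ← cls_mul isUnit_quarter isUnit_quarter, quat_mul_quat, ← h]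
  norm_num

theorem orderOf_cls_quarter : orderOf (cls (quat (1 : F) 1 0 0)) = 4 := by
  have : Fact (Nat.Prime 2) := ⟨by norm_num⟩
  refine orderOf_eq_prime_pow (p := 2) (n := 1) ?_ ?_
  · rw [pow_one, cls_quarter_sq]
    intro h
    rw [← cls_one, one_eq_quat, eq_comm] at h
    obtain ⟨κ, -, h2, -⟩ := cross_eq_of_cls_eq (by norm_num) (by norm_num) h
    norm_num at h2
  · have h : IsUnit (quat (0 : F) 1 0 0) := isUnit_quat (by norm_num)
    rw [show 2 ^ (1 + 1) = 2 * 2 from rfl, pow_mul, cls_quarter_sq, pow_two, ← cls_mul h h]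
    refine cls_eq_one_of_eq_smul (κ := -1) (by norm_num) ?_
    simp only [quat_mul_quat, one_eq_quat, smul_quat]
    norm_num

theorem isUnit_k : IsUnit (quat (0 : F) 0 0 1) := isUnit_quat (by norm_num)

theorem cls_k_mul_self : cls (quat (0 : F) 0 0 1) * cls (quat (0 : F) 0 0 1) = 1 := by
  rw [← cls_mul isUnit_k isUnit_k]
  refine cls_eq_one_of_eq_smul (κ := -1) (by norm_num) ?_
  simp only [quat_mul_quat, one_eq_quat, smul_quat]
  norm_num

theorem cls_k_conj : cls (quat (0 : F) 0 0 1) * cls (quat (1 : F) 1 0 0) *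
    cls (quat (0 : F) 0 0 1) = (cls (quat (1 : F) 1 0 0))⁻¹ := by
  rw [eq_inv_iff_mul_eq_one, ← cls_mul isUnit_k isUnit_quarter,
    ← cls_mul (isUnit_k.mul isUnit_quarter) isUnit_k,
    ← cls_mul ((isUnit_k.mul isUnit_quarter).mul isUnit_k) isUnit_quarter]
  refine cls_eq_one_of_eq_smul (κ := -2) (by norm_num) ?_
  simp only [quat_mul_quat, one_eq_quat, smul_quat]
  norm_num

theorem cls_quarter_inv : (cls (quat (1 : F) 1 0 0))⁻¹ = cls (quat 1 (-1) 0 0) := by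
  have h : IsUnit (quat (1 : F) (-1) 0 0) := isUnit_quat (by norm_num)
  rw [inv_eq_iff_mul_eq_one, ← cls_mul isUnit_quarter h]
  refine cls_eq_one_of_eq_smul (κ := 2) (by norm_num) ?_
  simp only [quat_mul_quat, one_eq_quat, smul_quat]
  norm_num

end Quarter

theorem closure_pair_inv {G : Type*} [Group G] (a b : G) :
    Subgroup.closure {a⁻¹, b} = Subgroup.closure {a, b} := by
  apply le_antisymm <;> rw [Subgroup.closure_le] <;> rintro c (h | h)
  · rw [h]
    exact inv_mem (Subgroup.subset_closure (.inl rfl))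
  · exact Subgroup.subset_closure (.inr h)
  · have := inv_mem (Subgroup.subset_closure (k := {a⁻¹, b}) (.inl rfl))
    rw [h]
    rwa [inv_inv] at this
  · exact Subgroup.subset_closure (.inr h)

theorem C24_eq : C24 = Subgroup.closure {cls (quat 1 1 0 0), cls (omega K2)} := by
  rw [← cls_quarter r2_ne_zero]
  exact gen_pair _ _

theorem C8_eq : C8 = Subgroup.closure {cls (quat 1 1 0 0), cls (quat 0 0 0 1)} := by
  rw [← cls_quarter r2_ne_zero, Set.pair_comm]
  exact gen_pair _ _

theorem C3_eq : C3 = Subgroup.zpowers (cls (omega K2)) := by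
  rw [C3, gen, Set.image_singleton, Subgroup.zpowers_eq_closure]

/-- The diagonal matrix in the list corresponds to `1 - i`, the inverse of `1 + i` modulo scalars.
The generated group is the same. -/
theorem toPU_quarter_inv {K : Type*} [Field K] [NumberField K] (σ : K →+* ℝ) :
    toPU σ (cls (quat 1 1 0 0))⁻¹ = pgl !![1, 0; 0, Complex.I] := by
  rw [cls_quarter_inv]
  refine toPU_cls_quat σ (by norm_num) (κ := 1 - Complex.I) ?_ ?_ ?_ ?_ ?_
  · intro h
    simpa using congrArg Complex.re h
  all_goals simp
  · ring
  · linear_combination Complex.I_sq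

theorem map_C24 : C24.map (toPU (algebraMap K2 ℝ)) = C24U := by
  rw [C24_eq, ← closure_pair_inv, MonoidHom.map_closure, Set.image_pair, toPU_omega,
    toPU_quarter_inv, C24U, genU_pair]

theorem map_C8 : C8.map (toPU (algebraMap K2 ℝ)) = C8U := by
  rw [C8_eq, ← closure_pair_inv, MonoidHom.map_closure, Set.image_pair,
    toPU_quarter_inv, C8U, genU_pair, Set.pair_comm]
  congr 3
  exact toPU_cls_quat _ (by norm_num) Complex.I_ne_zero (by simp) (by simp) (by simp) (by simp)

theorem map_C3 : C3.map (toPU (algebraMap K2 ℝ)) = C3U := by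
  rw [C3_eq, MonoidHom.map_zpowers, toPU_omega, C3U, genU, Set.image_singleton,
    Subgroup.zpowers_eq_closure]

theorem s2_sq : s2 ^ 2 = 2 := by
  rw [s2, ← Complex.ofReal_pow, Real.sq_sqrt (by norm_num), Complex.ofReal_ofNat]

theorem coe_algebraMap_r2 : ((algebraMap K2 ℝ r2 : ℝ) : ℂ) = s2 := by
  rw [algebraMap_r2, s2]

theorem s2_ne_zero : s2 ≠ 0 := fun h => by
  have := s2_sq
  rw [h] at this
  norm_num at this

theorem normSq_T24 {F : Type*} [Field F] [CharZero F] {r : F} (hr : r ^ 2 = 2) :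
    (1 + 1 / r) ^ 2 + (1 / r) ^ 2 + (1 - r) ^ 2 = 5 - r := by
  have : r ≠ 0 := by rintro rfl; norm_num at hr
  grind

theorem normSq_T8 {F : Type*} [Field F] [CharZero F] {r : F} (hr : r ^ 2 = 2) :
    (1 - 1 / r) ^ 2 + 1 ^ 2 + (1 / r) ^ 2 = 3 - r := by
  have : r ≠ 0 := by rintro rfl; norm_num at hr
  grind

theorem normSq_T3 {F : Type*} [Field F] [CharZero F] {r : F} (hr : r ^ 2 = 2) :
    (0 : F) ^ 2 + (1 - 1 / r) ^ 2 + (1 / r) ^ 2 = 2 - r := by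
  have : r ≠ 0 := by rintro rfl; norm_num at hr
  grind

theorem ne_int_r2 {a b : ℤ} (h : a ≠ 0) : (a : K2) + b * r2 ≠ 0 := fun h' =>
  h (int_r2_ext (c := 0) (d := 0) (by simpa using h')).1

theorem toPU_T24 : toPU (algebraMap K2 ℝ) T24 = T24U := by
  have h := s2_sq
  have h0 := s2_ne_zero
  refine toPU_cls_quat _ ?_ (κ := -Complex.I / s2) ?_ ?_ ?_ ?_ ?_
  · have := ne_int_r2 (a := 5) (b := -1) (by norm_num)
    rw [zero_pow two_ne_zero, zero_add, normSq_T24 r2_sq]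
    convert this using 1
    push_cast
    ring
  · exact div_ne_zero (neg_ne_zero.2 Complex.I_ne_zero) h0
  all_goals
    simp only [map_add, map_sub, map_div₀, map_one, map_zero, Complex.ofReal_add, Complex.ofReal_sub,
      Complex.ofReal_div, Complex.ofReal_one, Complex.ofReal_zero, coe_algebraMap_r2]
    field_simp
    grind [Complex.I_sq]

theorem toPU_T8 : toPU (algebraMap K2 ℝ) T8 = T8U := by
  have h := s2_sq
  have h0 := s2_ne_zero
  refine toPU_cls_quat _ ?_ (κ := Complex.I / s2) ?_ ?_ ?_ ?_ ?_
  · have := ne_int_r2 (a := 3) (b := -1) (by norm_num)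
    rw [zero_pow two_ne_zero, zero_add, normSq_T8 r2_sq]
    convert this using 1
    push_cast
    ring
  · exact div_ne_zero Complex.I_ne_zero h0
  all_goals
    simp only [map_sub, map_div₀, map_one, map_zero, Complex.ofReal_sub,
      Complex.ofReal_div, Complex.ofReal_one, Complex.ofReal_zero, coe_algebraMap_r2]
    field_simp
    grind [Complex.I_sq]

theorem toPU_T3 : toPU (algebraMap K2 ℝ) T3 = T3U := by
  have h := s2_sq
  have h0 := s2_ne_zero
  -- The scalar is the upper right entry `1 - 1/√2 + I/√2` of the image of `T3`, divided by the
  -- listed entry `√2`.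
  refine toPU_cls_quat _ ?_ (κ := 1 / s2 - 1 / 2 + Complex.I / 2) ?_ ?_ ?_ ?_ ?_
  · have := ne_int_r2 (a := 2) (b := -1) (by norm_num)
    rw [add_assoc ((0 : K2) ^ 2), add_assoc ((0 : K2) ^ 2),
      normSq_T3 r2_sq, zero_pow two_ne_zero, zero_add]
    convert this using 1
    push_cast
    ring
  · intro h
    have := congrArg Complex.im h
    rw [s2, ← Complex.ofReal_one, ← Complex.ofReal_div] at this
    simp at this
  all_goals
    simp only [map_sub, map_div₀, map_one, map_zero, Complex.ofReal_sub,
      Complex.ofReal_div, Complex.ofReal_one, Complex.ofReal_zero, coe_algebraMap_r2]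
    field_simp
    grind [Complex.I_sq]

instance fact_prime_twentyThree : Fact (Nat.Prime 23) := ⟨by norm_num⟩

instance fact_prime_seven : Fact (Nat.Prime 7) := ⟨by norm_num⟩

variable {O : Subalgebra (𝓞 K2) ℍ[K2]}

theorem quarter_mem (hO : Subalgebra.toSubmodule O = octahedral) :
    quat (1 / r2) (1 / r2) 0 0 ∈ O :=
  (Subalgebra.mem_toSubmodule (S := O)).1 (hO ▸ Submodule.subset_span (.inr (.inl rfl)))

theorem omega_mem_octahedral (hO : Subalgebra.toSubmodule O = octahedral) : omega K2 ∈ O :=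
  (Subalgebra.mem_toSubmodule (S := O)).1 (hO ▸ Submodule.subset_span (.inr (.inr (.inr rfl))))

theorem cls_quarter_mem (hO : Subalgebra.toSubmodule O = octahedral) :
    cls (quat 1 1 0 0) ∈ unitGroup O := by
  rw [← cls_quarter r2_ne_zero]
  refine cls_mem_unitGroup (isOrder_octahedral hO) (quarter_mem hO) (u := 1) ?_
  rw [normSq_quat, div_pow, r2_sq]
  norm_num

theorem cls_omega_mem (hO : Subalgebra.toSubmodule O = octahedral) :
    cls (omega K2) ∈ unitGroup O :=
  cls_mem_unitGroup (isOrder_octahedral hO) (omega_mem_octahedral hO) (u := 1)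
    (by rw [omega_eq, normSq_quat]; norm_num)

theorem C24_le (hO : Subalgebra.toSubmodule O = octahedral) : C24 ≤ unitGroup O := by
  rw [C24_eq, Subgroup.closure_le]
  rintro _ (rfl | rfl)
  exacts [cls_quarter_mem hO, cls_omega_mem hO]

theorem C8_le (hO : Subalgebra.toSubmodule O = octahedral) : C8 ≤ unitGroup O := by
  rw [C8_eq, Subgroup.closure_le]
  rintro _ (rfl | rfl)
  · exact cls_quarter_mem hO
  · exact cls_mem_unitGroup (isOrder_octahedral hO)
      (mem_of_eq_latticePoint_octahedral hO (octahedral_units r2_sq).2.2.1) (u := 1)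
      (by rw [normSq_quat]; norm_num)

theorem C3_le (hO : Subalgebra.toSubmodule O = octahedral) : C3 ≤ unitGroup O := by
  rw [C3_eq, Subgroup.zpowers_le]
  exact cls_omega_mem hO

theorem coe_ofNat_sub_sqrtTwo (n : ℕ) [n.AtLeastTwo] :
    ((OfNat.ofNat n - sqrtTwo : 𝓞 K2) : K2) = OfNat.ofNat n - r2 := by
  have h := map_sub (algebraMap (𝓞 K2) K2) (OfNat.ofNat n) sqrtTwo
  rwa [map_ofNat] at h

/-- The residue field has 23 elements, with `√2 ↦ 5` and `-5 = 8²`. There `-1`, `-3` and `-2`, the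
discriminants up to squares for orders 2, 3 and 4, are not squares. The sandwich closes because `24
= 23 + 1`, and self-duality of the order gives the full arithmetic group. -/
theorem gates_twentyFour (hO : Subalgebra.toSubmodule O = octahedral) :
    C24 = unitGroup O ∧ Nonempty (C24 ≃* Equiv.Perm (Fin 4)) ∧
      CorrespondsTo (algebraMap K2 ℝ) C24 T24 C24U T24U ∧
      ∃ v : HeightOneSpectrum (𝓞 K2), IsGeneratedBy v (5 - r2 : K2) ∧
        (∃ ρ : v.adicCompletion K2, ρ ^ 2 = -5) ∧
        ∀ ρ : v.adicCompletion K2, ρ ^ 2 = -5 →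
          ∃ e : ℍ[v.adicCompletion K2] ≃ₐ[v.adicCompletion K2]
            Matrix (Fin 2) (Fin 2) (v.adicCompletion K2),
            (∀ x, e x = splitFive ρ x) ∧ IsSuperGoldenGateSet O e C24 T24 ∧
              C24 ⊔ Subgroup.zpowers T24 = arithGroup v O := by
  have hO' := isOrder_octahedral hO
  obtain ⟨v, χ, hχs, hv, hχ, hq, hcard⟩ := exists_prime_two 23 5 (by decide)
    (g := 5 - sqrtTwo) ⟨5 + sqrtTwo, by push_cast; linear_combination sqrtTwo_sq⟩
    ⟨-1, by push_cast; ring⟩ (x := 5) (y := -1) (by push_cast; ring) (by decide)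
  have hgen : ((5 - sqrtTwo : 𝓞 K2) : K2) = 5 - r2 :=
    coe_ofNat_sub_sqrtTwo 5
  have h2 : (2 : 𝓞 K2) ∉ v.asIdeal := ofNat_notMem hχ (by decide)
  have hτ : quat 0 (1 + 1 / r2) (1 / r2) (1 - r2) ∈ O :=
    mem_of_eq_latticePoint_octahedral hO (octahedral_units r2_sq).2.2.2.2.1
  have hunif : IsUniformizing v (5 - sqrtTwo) (quat 0 (1 + 1 / r2) (1 / r2) (1 - r2)) :=
    isUniformizing_quat hv (by rw [hgen]; exact normSq_T24 r2_sq)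
  obtain ⟨ρ₀, hρ₀, -⟩ := exists_root (v := v) hχ (-5) 8 (by decide) (by decide)
  replace hρ₀ : ρ₀ ^ 2 = -5 := by simpa using hρ₀
  have key : ∀ ρ : v.adicCompletion K2, ρ ^ 2 = -5 →
      ∃ e : ℍ[v.adicCompletion K2] ≃ₐ[v.adicCompletion K2]
        Matrix (Fin 2) (Fin 2) (v.adicCompletion K2), (∀ x, e x = splitFive ρ x) ∧ IsStandard e ∧
        (∀ x ∈ O, ∃ M, IntModel e x M) ∧ (∀ c ∈ unitGroup O, IsElliptic e c) ∧
        IsFlip e T24 := by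
    intro ρ hρ
    obtain ⟨e, hs, he, hm⟩ := exists_standard_splitFive h2 hρ hO halfIntegral_octahedral
    refine ⟨e, hs, he, hm, fun c hc => isElliptic_two hχ he hO' hm hc (fun _ => .inr (by decide))
      (fun _ => .inr (by decide)) (fun _ => .inr ?_), hunif.isFlip he (hm _ hτ)⟩
    rw [hχs]
    decide
  obtain ⟨e, -, he, -, hell, hflip⟩ := key ρ₀ hρ₀
  have hle := C24_le hO
  obtain ⟨hfin, hU⟩ := card_le_of_isElliptic hq hell ⟨_, hflip.smul_origin⟩
  have : Finite C24 := Finite.of_injective _ (Subgroup.inclusion_injective hle)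
  obtain ⟨φ, hφ⟩ : ∃ φ : C24 →* Equiv.Perm (Fin 4), φ.range = ⊤ := by
    rw [C24_eq]
    exact exists_hom_cubeQuarter
  have hA : Nat.card (⊤ : Subgroup (Equiv.Perm (Fin 4))) = 24 := by
    rw [Subgroup.card_top, Nat.card_perm, Nat.card_fin]; rfl
  have hge := card_le_of_range φ hφ
  have hCU : C24 = unitGroup O := eq_unitGroup_of_card_le hq hflip hell hle (by omega)
  obtain ⟨f⟩ := nonempty_mulEquiv_of_card_le φ hφ (by rw [hCU]; omega)
  refine ⟨hCU, ⟨f.trans Subgroup.topEquiv⟩, ?_⟩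
  obtain ⟨hcor, hsg⟩ := gates_of_local isTotallyReal_two hO' (algebraMap K2 ℝ) map_C24 toPU_T24 hq
    (by omega) (exists_arithmetic hle (cls_mem_arithGroup hO' hτ hunif.2.2 hv)) ⟨ρ₀, hρ₀⟩
    (fun ρ hρ => by
      obtain ⟨e, hs, he, -, hell, hflip⟩ := key ρ hρ
      exact ⟨e, hs, he, hCU ▸ hell, hflip⟩)
  have hfull : C24 ⊔ Subgroup.zpowers T24 = arithGroup v O := by
    obtain ⟨e, -, he, hm, hell, -⟩ := key ρ₀ hρ₀
    rw [hCU]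
    exact sup_eq_arithGroup he hO' hm (fun x hx => mem_octahedral_of_dual hO hx) hq hell
      (by rw [← hCU]; omega) hτ hunif
  refine ⟨hcor, v, isGeneratedBy_of_eq hv hgen, ⟨ρ₀, hρ₀⟩, fun ρ hρ => ?_⟩
  obtain ⟨e, hs, hg⟩ := hsg ρ hρ
  exact ⟨e, hs, hg, hfull⟩

/-- The residue field has 7 elements, with `√2 ↦ 3`. Units of order 3 have eigenvectors modulo 7, as
`-3 = 2²`; so the whole unit group cannot act freely, but the dihedral subgroup, of order `8 = 7 +
1`, does. -/
theorem gates_eight (hO : Subalgebra.toSubmodule O = octahedral) :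
    C8 ≤ unitGroup O ∧ Nonempty (C8 ≃* DihedralGroup 4) ∧
      CorrespondsTo (algebraMap K2 ℝ) C8 T8 C8U T8U ∧
      ∃ v : HeightOneSpectrum (𝓞 K2), IsGeneratedBy v (3 - r2 : K2) ∧
        (∃ ρ : v.adicCompletion K2, ρ ^ 2 = -3) ∧
        ∀ ρ : v.adicCompletion K2, ρ ^ 2 = -3 →
          ∃ e : ℍ[v.adicCompletion K2] ≃ₐ[v.adicCompletion K2]
            Matrix (Fin 2) (Fin 2) (v.adicCompletion K2),
            (∀ x, e x = splitThree ρ x) ∧ IsSuperGoldenGateSet O e C8 T8 := by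
  have hO' := isOrder_octahedral hO
  have hle := C8_le hO
  have hdih : Nonempty (C8 ≃* DihedralGroup 4) := by
    rw [C8_eq]
    exact nonempty_mulEquiv_dihedral (by norm_num) orderOf_cls_quarter cls_k_mul_self cls_k_conj
  have hC : Nat.card C8 = 8 := by
    obtain ⟨f⟩ := hdih
    rw [Nat.card_congr f.toEquiv, DihedralGroup.nat_card]
  refine ⟨hle, hdih, ?_⟩
  obtain ⟨v, χ, hχs, hv, hχ, hq, hcard⟩ := exists_prime_two 7 3 (by decide)
    (g := 3 - sqrtTwo) ⟨3 + sqrtTwo, by push_cast; linear_combination sqrtTwo_sq⟩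
    ⟨-1, by push_cast; ring⟩ (x := 3) (y := -1) (by push_cast; ring) (by decide)
  have hgen : ((3 - sqrtTwo : 𝓞 K2) : K2) = 3 - r2 :=
    coe_ofNat_sub_sqrtTwo 3
  have h2 : (2 : 𝓞 K2) ∉ v.asIdeal := ofNat_notMem hχ (by decide)
  have hτ : quat 0 (1 - 1 / r2) 1 (1 / r2) ∈ O :=
    mem_of_eq_latticePoint_octahedral hO (octahedral_units r2_sq).2.2.2.2.2.1
  have hunif : IsUniformizing v (3 - sqrtTwo) (quat 0 (1 - 1 / r2) 1 (1 / r2)) :=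
    isUniformizing_quat hv (by rw [hgen]; exact normSq_T8 r2_sq)
  obtain ⟨ρ₀, hρ₀, -⟩ := exists_root (v := v) hχ (-3) 2 (by decide) (by decide)
  replace hρ₀ : ρ₀ ^ 2 = -3 := by simpa using hρ₀
  have key : ∀ ρ : v.adicCompletion K2, ρ ^ 2 = -3 →
      ∃ e : ℍ[v.adicCompletion K2] ≃ₐ[v.adicCompletion K2]
        Matrix (Fin 2) (Fin 2) (v.adicCompletion K2), (∀ x, e x = splitThree ρ x) ∧
        IsStandard e ∧ (∀ c ∈ C8, IsElliptic e c) ∧ IsFlip e T8 := by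
    intro ρ hρ
    obtain ⟨e, hs, he, hm⟩ := exists_standard_splitThree h2 hρ hO halfIntegral_octahedral
    refine ⟨e, hs, he, fun c hc => isElliptic_two hχ he hO' hm (hle hc)
      (fun _ => .inr (by decide)) (fun h3 => .inl ?_) (fun _ => .inr ?_), hunif.isFlip he (hm _ hτ)⟩
    -- An element of `C8` with trivial cube is trivial, since `c = c⁹ = (c³)³`.
    · have h8 : c ^ 8 = 1 := by
        have := pow_card_eq_one' (x := (⟨c, hc⟩ : C8))
        rw [hC] at this
        exact congrArg Subtype.val this
      calc c = c ^ 9 := by rw [pow_succ, h8, one_mul]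
        _ = 1 := by rw [show 9 = 3 * 3 from rfl, pow_mul, h3, one_pow]
    · rw [hχs]
      decide
  obtain ⟨hcor, hsg⟩ := gates_of_local isTotallyReal_two hO' (algebraMap K2 ℝ) map_C8 toPU_T8 hq
    (by omega) (exists_arithmetic hle (cls_mem_arithGroup hO' hτ hunif.2.2 hv)) ⟨ρ₀, hρ₀⟩ key
  exact ⟨hcor, v, isGeneratedBy_of_eq hv hgen, ⟨ρ₀, hρ₀⟩, hsg⟩

variable {O : Subalgebra (𝓞 K2) ℍ[K2]}

theorem splitRamified_quat {F : Type*} [Field F] (r α β a b c d : F) :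
    splitRamified r α β (quat a b c d) =
      !![a + b + c * (α - β) + d * (α + β), r * (b + c * α + d * β);
        -r * (b - c * β + d * α), a - b - c * (α - β) - d * (α + β)] := rfl

/-! ### Integrality of the splitting at the ramified prime -/

section RamifiedEntries

variable {F : Type*} [Field F] [CharZero F] {r ρ α β : F} {A : Subring F}

theorem sq_add_sq_ramified (hr : r ^ 2 = 2) (hρ : ρ ^ 2 = -7) :
    ((2 + r * ρ) / 3) ^ 2 + ((2 * r - ρ) / 3) ^ 2 = -1 := by
  field_simp
  linear_combination (ρ ^ 2 + 4) * hr + 3 * hρ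

theorem splitRamified_quarter_mem (hr : r ^ 2 = 2) (hrA : r ∈ A) (i j : Fin 2) :
    splitRamified r α β (quat (1 / r) (1 / r) 0 0) i j ∈ A := by
  have hr0 : r ≠ 0 := by rintro rfl; norm_num at hr
  have h : splitRamified r α β (quat (1 / r) (1 / r) 0 0) = !![r, 1; -1, 0] := by
    rw [splitRamified_quat]
    have : 1 / r = r / 2 := by field_simp; exact hr.symm
    ext i j
    fin_cases i <;> fin_cases j <;> simp <;> grind
  rw [h]
  fin_cases i <;> fin_cases j
  exacts [hrA, one_mem A, neg_mem (one_mem A), zero_mem A]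

theorem splitRamified_diagonal_mem (hr : r ^ 2 = 2) (hα : α ∈ A) (hβ : β ∈ A)
    (h1 : (1 + α - β) / r ∈ A) (h2 : (1 - α + β) / r ∈ A) (i j : Fin 2) :
    splitRamified r α β (quat (1 / r) 0 (1 / r) 0) i j ∈ A := by
  have hr0 : r ≠ 0 := by rintro rfl; norm_num at hr
  have h : splitRamified r α β (quat (1 / r) 0 (1 / r) 0) =
      !![(1 + α - β) / r, α; β, (1 - α + β) / r] := by
    rw [splitRamified_quat]
    ext i j
    fin_cases i <;> fin_cases j <;> simp <;> field_simp <;> grind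
  rw [h]
  fin_cases i <;> fin_cases j
  exacts [h1, hα, hβ, h2]

theorem splitRamified_omega_mem (hr : r ^ 2 = 2) (hα : α ∈ A)
    (h1 : (1 + α - β) / r ∈ A) (h3 : (1 + α + β) / r ∈ A) (i j : Fin 2) :
    splitRamified r α β (omega F) i j ∈ A := by
  have hr0 : r ≠ 0 := by rintro rfl; norm_num at hr
  have h : splitRamified r α β (omega F) =
      !![1 + α, (1 + α + β) / r; -((1 + α - β) / r), -α] := by
    rw [omega_eq, splitRamified_quat]
    ext i j
    fin_cases i <;> fin_cases j <;> simp <;> field_simp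
    all_goals grind
  rw [h]
  fin_cases i <;> fin_cases j
  exacts [add_mem (one_mem A) hα, h3, neg_mem h1, neg_mem hα]

/-- The basis quaternions have denominators `√2` and 2, neither a unit here. After the choice of `α`
and `β`, all quotients by `r` reduce to the single quotient `(ρ + 1) / r`; the denominator 3 is
harmless. -/
theorem ramified_quotients_mem (hr : r ^ 2 = 2) (hrA : r ∈ A) (hρA : ρ ∈ A)
    (h3 : (3 : F)⁻¹ ∈ A) (hu : (ρ + 1) / r ∈ A) :
    (2 + r * ρ) / 3 ∈ A ∧ (2 * r - ρ) / 3 ∈ A ∧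
      (1 + (2 + r * ρ) / 3 - (2 * r - ρ) / 3) / r ∈ A ∧
      (1 - (2 + r * ρ) / 3 + (2 * r - ρ) / 3) / r ∈ A ∧
      (1 + (2 + r * ρ) / 3 + (2 * r - ρ) / 3) / r ∈ A := by
  have hr0 : r ≠ 0 := by rintro rfl; norm_num at hr
  have h2 : (2 : F) ∈ A := ofNat_mem A 2
  have h3' : (3 : F) ∈ A := ofNat_mem A 3
  refine ⟨div_eq_mul_inv _ (3 : F) ▸ mul_mem (add_mem h2 (mul_mem hrA hρA)) h3,
    div_eq_mul_inv _ (3 : F) ▸ mul_mem (sub_mem (mul_mem h2 hrA) hρA) h3, ?_, ?_, ?_⟩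
  · rw [show (1 + (2 + r * ρ) / 3 - (2 * r - ρ) / 3) / r =
      ((ρ + 1) / r + 2 * r + ρ - 2) * 3⁻¹ by field_simp; linear_combination -2 * hr]
    exact mul_mem (sub_mem (add_mem (add_mem hu (mul_mem h2 hrA)) hρA) h2) h3
  · rw [show (1 - (2 + r * ρ) / 3 + (2 * r - ρ) / 3) / r =
      (r - (ρ + 1) / r - ρ + 2) * 3⁻¹ by field_simp; linear_combination -hr]
    exact mul_mem (add_mem (sub_mem (sub_mem hrA hu) hρA) h2) h3
  · rw [show (1 + (2 + r * ρ) / 3 + (2 * r - ρ) / 3) / r =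
      (3 * r - (ρ + 1) / r + ρ + 2) * 3⁻¹ by field_simp; linear_combination -3 * hr]
    exact mul_mem (add_mem (add_mem (sub_mem (mul_mem h3' hrA) hu) hρA) h2) h3

end RamifiedEntries

theorem exists_standard_splitRamified {v : HeightOneSpectrum (𝓞 K2)} (h3 : (3 : 𝓞 K2) ∉ v.asIdeal)
    {ρ : v.adicCompletion K2} (hρ : ρ ^ 2 = -7) (hO : Subalgebra.toSubmodule O = octahedral) :
    ∃ e : ℍ[v.adicCompletion K2] ≃ₐ[v.adicCompletion K2]
      Matrix (Fin 2) (Fin 2) (v.adicCompletion K2),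
      (∀ x, e x = splitRamified (algebraMap K2 (v.adicCompletion K2) r2)
        ((2 + algebraMap K2 (v.adicCompletion K2) r2 * ρ) / 3)
        ((2 * algebraMap K2 (v.adicCompletion K2) r2 - ρ) / 3) x) ∧ IsStandard e ∧
      ∀ x ∈ O, ∃ M, IntModel e x M := by
  set f := algebraMap K2 (v.adicCompletion K2) with hf
  set r := f r2 with hr'
  have hr : r ^ 2 = 2 := by rw [hr', ← map_pow, r2_sq, map_ofNat]
  have hr0 : r ≠ 0 := by intro h; rw [h] at hr; norm_num at hr
  have hab := sq_add_sq_ramified hr hρ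
  obtain ⟨e, he⟩ := exists_splitRamified hr hab
  refine ⟨e, he, isStandard_splitRamified hr hab he, ?_⟩
  have hrA : r ∈ v.adicCompletionIntegers K2 :=
    mem_integers_of_sq_mem (by rw [hr]; exact ofNat_mem _ 2)
  have hρA : ρ ∈ v.adicCompletionIntegers K2 :=
    mem_integers_of_sq_mem (by rw [hρ]; exact neg_mem (ofNat_mem _ 7))
  have hu : (ρ + 1) / r ∈ v.adicCompletionIntegers K2 := by
    refine mem_integers_of_sq_mem ?_
    -- `(ρ + 1)² = 2ρ - 6` because `ρ² = -7`, and `r² = 2`. The quotient has an integral square, so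
    -- it is integral, for either root `ρ`.
    rw [show ((ρ + 1) / r) ^ 2 = ρ - 3 by
      field_simp
      linear_combination hρ - (ρ - 3) * hr]
    exact sub_mem hρA (ofNat_mem _ 3)
  have h3A : (3 : v.adicCompletion K2)⁻¹ ∈ v.adicCompletionIntegers K2 := by
    have := valued_ofNat_eq_one (v := v) h3
    rw [coe_ofNat_integers, map_ofNat] at this
    rw [HeightOneSpectrum.mem_adicCompletionIntegers, map_inv₀, this, inv_one]
  obtain ⟨hα, hβ, m1, m2, m3⟩ := ramified_quotients_mem
    (A := (v.adicCompletionIntegers K2).toSubring) hr hrA hρA h3A hu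
  have hr1 : f (1 / r2) = 1 / r := by rw [map_div₀, map_one]
  intro x hx
  refine intModel_of_span hO ?_ hx
  rintro x (rfl | rfl | rfl | rfl)
  · exact ⟨1, intModel_one⟩
  · refine exists_intModel_of_mem fun a b => ?_
    rw [he]
    change splitRamified _ _ _ (quat (f (1 / r2)) (f (1 / r2)) (f 0) (f 0)) a b ∈ _
    rw [hr1, map_zero]
    exact splitRamified_quarter_mem (A := (v.adicCompletionIntegers K2).toSubring) hr hrA a b
  · refine exists_intModel_of_mem fun a b => ?_
    rw [he]
    change splitRamified _ _ _ (quat (f (1 / r2)) (f 0) (f (1 / r2)) (f 0)) a b ∈ _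
    rw [hr1, map_zero]
    exact splitRamified_diagonal_mem (A := (v.adicCompletionIntegers K2).toSubring) hr hα hβ m1 m2 a b
  · refine exists_intModel_of_mem fun a b => ?_
    rw [he]
    change splitRamified _ _ _ (quat (f (1 / 2)) (f (1 / 2)) (f (1 / 2)) (f (1 / 2))) a b ∈ _
    rw [map_div₀, map_one, map_ofNat]
    exact splitRamified_omega_mem (A := (v.adicCompletionIntegers K2).toSubring) hr hα m1 m3 a b

theorem gates_three (hO : Subalgebra.toSubmodule O = octahedral) :
    C3 ≤ unitGroup O ∧
      CorrespondsTo (algebraMap K2 ℝ) C3 T3 C3U T3U ∧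
      ∃ v : HeightOneSpectrum (𝓞 K2), IsGeneratedBy v (r2 : K2) ∧
        (∃ ρ : v.adicCompletion K2, ρ ^ 2 = -7) ∧
        ∀ ρ : v.adicCompletion K2, ρ ^ 2 = -7 →
          ∃ e : ℍ[v.adicCompletion K2] ≃ₐ[v.adicCompletion K2]
            Matrix (Fin 2) (Fin 2) (v.adicCompletion K2),
            (∀ x, e x = splitRamified (algebraMap K2 (v.adicCompletion K2) r2)
              ((2 + algebraMap K2 (v.adicCompletion K2) r2 * ρ) / 3)
              ((2 * algebraMap K2 (v.adicCompletion K2) r2 - ρ) / 3) x) ∧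
              IsSuperGoldenGateSet O e C3 T3 := by
  have hO' := isOrder_octahedral hO
  have hle := C3_le hO
  have hC : Nat.card C3 = 3 := by
    rw [C3_eq, Nat.card_zpowers, orderOf_cls_omega]
  refine ⟨hle, ?_⟩
  obtain ⟨v, χ, hχs, hv, hχ, hq, hcard⟩ := exists_prime_two 2 0 (by decide)
    (g := sqrtTwo) ⟨sqrtTwo, by push_cast; linear_combination -sqrtTwo_sq⟩
    ⟨1, by push_cast; ring⟩ (x := 0) (y := 1) (by push_cast; ring) (by decide)
  -- The norm of the quaternion of `T3` is `2 - √2 = √2 (√2 - 1)`, another generator of the prime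
  -- `(√2)`.
  have hv' : v.asIdeal = Ideal.span {2 - sqrtTwo} := by
    rw [hv, Ideal.span_singleton_eq_span_singleton]
    exact associated_of_dvd_dvd ⟨sqrtTwo - 1, by linear_combination -sqrtTwo_sq⟩
      ⟨sqrtTwo + 1, by linear_combination sqrtTwo_sq⟩
  have h3 : (3 : 𝓞 K2) ∉ v.asIdeal := (hχ _).not.2 (by rw [map_ofNat]; decide)
  have hτ : quat 0 0 (1 - 1 / r2) (1 / r2) ∈ O :=
    mem_of_eq_latticePoint_octahedral hO (octahedral_units r2_sq).2.2.2.2.2.2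
  have hunif : IsUniformizing v (2 - sqrtTwo) (quat 0 0 (1 - 1 / r2) (1 / r2)) :=
    isUniformizing_quat hv' (by rw [coe_ofNat_sub_sqrtTwo 2]; exact normSq_T3 r2_sq)
  obtain ⟨ρ₀, hρ₀, -⟩ := exists_sq_eq_neg_seven (v := v) ((hχ _).2 (by rw [map_ofNat]; decide))
  have key : ∀ ρ : v.adicCompletion K2, ρ ^ 2 = -7 →
      ∃ e : ℍ[v.adicCompletion K2] ≃ₐ[v.adicCompletion K2]
        Matrix (Fin 2) (Fin 2) (v.adicCompletion K2),
        (∀ x, e x = splitRamified (algebraMap K2 (v.adicCompletion K2) r2)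
          ((2 + algebraMap K2 (v.adicCompletion K2) r2 * ρ) / 3)
          ((2 * algebraMap K2 (v.adicCompletion K2) r2 - ρ) / 3) x) ∧
        IsStandard e ∧ (∀ c ∈ C3, IsElliptic e c) ∧ IsFlip e T3 := by
    intro ρ hρ
    obtain ⟨e, hs, he, hm⟩ := exists_standard_splitRamified h3 hρ hO
    refine ⟨e, hs, he, fun c hc => ?_, hunif.isFlip he (hm _ hτ)⟩
    have hc3 : c ^ 3 = 1 := by
      have := pow_card_eq_one' (x := (⟨c, hc⟩ : C3))
      rw [hC] at this
      exact congrArg Subtype.val this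
    refine isElliptic_two hχ he hO' hm (hle hc) (fun h => .inl ?_) (fun _ => .inr (by decide))
      (fun h => .inl ?_)
    · rwa [pow_succ, h, one_mul] at hc3
    · rwa [pow_succ, hc3, one_mul] at h
  obtain ⟨hcor, hsg⟩ := gates_of_local isTotallyReal_two hO' (algebraMap K2 ℝ) map_C3 toPU_T3 hq
    (by omega) (exists_arithmetic hle (cls_mem_arithGroup hO' hτ hunif.2.2 hv')) ⟨ρ₀, hρ₀⟩ key
  exact ⟨hcor, v, isGeneratedBy_of_eq hv coe_sqrtTwo, ⟨ρ₀, hρ₀⟩, hsg⟩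

theorem map_C6_two (hO : Subalgebra.toSubmodule O = octahedral) (f : ℚ →+* K2) :
    C6.map (PD.map f) = gen {omega K2, ⟨0, 1 / r2, -1 / r2, 0⟩} ∧
      C6.map (PD.map f) ≤ unitGroup O := by
  have h1 : PD.map f (cls (omega ℚ)) = cls (omega K2) := by
    rw [PD.map_cls f isUnit_omega, omega_eq, mapQuat_quat, map_div₀, map_one, map_ofNat, omega_eq]
  have h2 : PD.map f (cls (quat 0 1 (-1) 0)) = cls (quat 0 (1 / r2) (-1 / r2) 0) := by
    have h := cls_quat_smul (one_div_ne_zero r2_ne_zero) 0 1 (-1) 0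
    rw [PD.map_cls f isUnit_reflection, mapQuat_quat, map_zero, map_neg, map_one, ← h, neg_div,
      mul_zero, mul_neg, mul_one]
  have h3 : C6.map (PD.map f) =
      Subgroup.closure {cls (omega K2), cls (quat 0 (1 / r2) (-1 / r2) 0)} := by
    rw [C6_eq, MonoidHom.map_closure, Set.image_pair, h1, h2]
  refine ⟨h3.trans (gen_pair _ _).symm, ?_⟩
  rw [h3, Subgroup.closure_le]
  rintro _ (rfl | rfl)
  · exact cls_omega_mem hO
  · refine cls_mem_unitGroup (isOrder_octahedral hO)
      (mem_of_eq_latticePoint_octahedral hO (octahedral_units r2_sq).2.2.2.1) (u := 1) ?_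
    rw [normSq_quat, neg_div, neg_sq, div_pow, r2_sq]
    norm_num

/-! ### The gate sets over `ℚ(√5)` -/

variable {O : Subalgebra (𝓞 K5) ℍ[K5]}

theorem halfIntegral_icosian : ∀ x ∈ ({1, quat 0 1 0 0, omega K5,
    quat 0 (1 / 2) (phi⁻¹ / 2) (phi / 2)} : Set ℍ[K5]), HalfIntegral x := by
  obtain ⟨h0, h1, h2⟩ := intRing_simp (K := K5)
  have h3 : 2 * (phi / 2) ∈ intRing K5 := by
    rw [mul_div_cancel₀ _ two_ne_zero]
    exact phi_mem
  have h4 : 2 * (phi⁻¹ / 2) ∈ intRing K5 := by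
    rw [mul_div_cancel₀ _ two_ne_zero, phi_inv]
    exact sub_mem phi_mem (one_mem _)
  rintro x (rfl | rfl | rfl | rfl)
  · exact ⟨h1, h0, h0, h0⟩
  · exact ⟨h0, h1, h0, h0⟩
  · exact ⟨h2, h2, h2, h2⟩
  · exact ⟨h0, h2, h4, h3⟩

/-- Classes of order 5 have trace `±φ` or `±(φ - 1)`. The sign is absorbed by `z ↦ -z`, so two
polynomials remain. -/
theorem isElliptic_five {v : HeightOneSpectrum (𝓞 K5)} {k : Type*}
    [CommRing k] {χ : 𝓞 K5 →+* k} (hχ : ∀ a, a ∈ v.asIdeal ↔ χ a = 0)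
    {e : ℍ[v.adicCompletion K5] ≃ₐ[v.adicCompletion K5]
      Matrix (Fin 2) (Fin 2) (v.adicCompletion K5)} (he : IsStandard e) (hO : IsOrder O)
    (hm : ∀ x ∈ O, ∃ M, IntModel e x M) {c : PD K5} (hc : c ∈ unitGroup O)
    (h2 : c ^ 2 = 1 → c = 1 ∨ ∀ z : k, z ^ 2 + 1 ≠ 0)
    (h3 : c ^ 3 = 1 → c = 1 ∨ ∀ z : k, z ^ 2 - z + 1 ≠ 0)
    (h5 : c ^ 5 = 1 → c = 1 ∨ (∀ z : k, z ^ 2 - χ golden * z + 1 ≠ 0) ∧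
      ∀ z : k, z ^ 2 - (χ golden - 1) * z + 1 ≠ 0) : IsElliptic e c := by
  obtain rfl | ⟨x, hx, hn, rfl, t, ht, h⟩ := cases_five hO hc
  · exact isElliptic_one
  by_cases h1 : cls x = 1
  · rw [h1]
    exact isElliptic_one
  refine isElliptic_of_trace hχ he (hm x hx) hn ht fun z => ?_
  obtain ⟨rfl, h⟩ | ⟨rfl | rfl, h⟩ | ⟨rfl | rfl | rfl | rfl, h⟩ := h
  · simpa using (h2 h).resolve_left h1 z
  · simpa using (h3 h).resolve_left h1 z
  · simpa using (h3 h).resolve_left h1 (-z)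
  · exact ((h5 h).resolve_left h1).1 z
  · simpa using ((h5 h).resolve_left h1).1 (-z)
  · simpa using ((h5 h).resolve_left h1).2 z
  · rw [map_sub, map_one]
    convert ((h5 h).resolve_left h1).2 (-z) using 1
    ring

theorem gen_singleton {K : Type*} [Field K] (x : ℍ[K]) : gen {x} = Subgroup.zpowers (cls x) := by
  rw [gen, Set.image_singleton, Subgroup.zpowers_eq_closure]

theorem C60_eq : C60 =
    Subgroup.closure {cls (omega K5), cls (quat 0 (1 / 2) (phi⁻¹ / 2) (phi / 2))} :=
  gen_pair _ _

theorem C12'_eq : C12' =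
    Subgroup.closure {cls (omega K5), cls (quat 0 (1 / 2) (-phi⁻¹ / 2) (phi / 2))} :=
  gen_pair _ _

theorem C5_eq : C5 = Subgroup.zpowers (cls (quat (phi / 2) (phi⁻¹ / 2) (1 / 2) 0)) :=
  gen_singleton _

section Golden

variable {F : Type*} [Field F] [CharZero F] {f : F}

theorem normSq_edge (hf : f ^ 2 = f + 1) : 0 ^ 2 + (1 / 2) ^ 2 + (f⁻¹ / 2) ^ 2 + (f / 2) ^ 2 = 1 := by
  have := golden_ne hf
  grind

theorem normSq_edge' (hf : f ^ 2 = f + 1) :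
    0 ^ 2 + (1 / 2) ^ 2 + (-f⁻¹ / 2) ^ 2 + (f / 2) ^ 2 = 1 := by
  have := golden_ne hf
  grind

theorem normSq_fifth (hf : f ^ 2 = f + 1) :
    (f / 2) ^ 2 + (f⁻¹ / 2) ^ 2 + (1 / 2) ^ 2 + 0 ^ 2 = 1 := by
  have := golden_ne hf
  grind

theorem normSq_T60 (hf : f ^ 2 = f + 1) : (2 + f) ^ 2 + 1 ^ 2 + 1 ^ 2 = 7 + 5 * f := by
  grind

theorem normSq_T12' (hf : f ^ 2 = f + 1) : (f - 1) ^ 2 + 1 ^ 2 + 1 ^ 2 = 4 - f := by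
  grind

theorem cls_fifth_pow_five (hf : f ^ 2 = f + 1) :
    cls (quat (f / 2) (f⁻¹ / 2) (1 / 2) 0) ^ 5 = 1 :=
  cls_pow_five_eq_one (by rw [normSq_quat, normSq_fifth hf])
    (by rw [re_quat, mul_div_cancel₀ _ two_ne_zero, hf])

theorem cls_fifth_ne_one (hf : f ^ 2 = f + 1) : cls (quat (f / 2) (f⁻¹ / 2) (1 / 2) 0) ≠ 1 := by
  intro h
  rw [← cls_one, one_eq_quat, eq_comm] at h
  obtain ⟨κ, -, -, h2, -⟩ := cross_eq_of_cls_eq (by norm_num)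
    (by rw [normSq_fifth hf]; exact one_ne_zero) h
  norm_num at h2

theorem orderOf_cls_fifth (hf : f ^ 2 = f + 1) :
    orderOf (cls (quat (f / 2) (f⁻¹ / 2) (1 / 2) 0)) = 5 :=
  have : Fact (Nat.Prime 5) := ⟨by norm_num⟩
  orderOf_eq_prime (cls_fifth_pow_five hf) (cls_fifth_ne_one hf)

theorem cls_omega_inv : (cls (omega F))⁻¹ = cls (quat (1 / 2) (-1 / 2) (-1 / 2) (-1 / 2)) := by
  have h : IsUnit (quat (1 / 2 : F) (-1 / 2) (-1 / 2) (-1 / 2)) := isUnit_quat (by norm_num)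
  rw [inv_eq_iff_mul_eq_one, ← cls_mul isUnit_omega h]
  refine cls_eq_one_of_eq_smul (κ := 1) one_ne_zero ?_
  simp only [omega_eq, quat_mul_quat, one_eq_quat, smul_quat]
  norm_num

theorem normSq_halfTurn (hf : f ^ 2 = f + 1) : 0 ^ 2 + 1 ^ 2 + f⁻¹ ^ 2 + (-f) ^ 2 = 4 := by
  have := golden_ne hf
  grind

theorem conj_halfTurn_omega (hf : f ^ 2 = f + 1) :
    cls (quat 0 1 f⁻¹ (-f)) * cls (omega F) * (cls (quat 0 1 f⁻¹ (-f)))⁻¹ = (cls (omega F))⁻¹ := by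
  have := golden_ne hf
  rw [cls_omega_inv]
  refine conj_cls (isUnit_quat (by rw [normSq_halfTurn hf]; norm_num)) isUnit_omega
    (isUnit_quat (by norm_num)) one_ne_zero ?_
  simp only [omega_eq, quat_mul_quat, smul_quat]
  apply quat_congr <;> grind

theorem conj_halfTurn_i (hf : f ^ 2 = f + 1) :
    cls (quat 0 1 f⁻¹ (-f)) * cls (quat 0 1 0 0) * (cls (quat 0 1 f⁻¹ (-f)))⁻¹ =
      cls (quat 0 (1 / 2) (-f⁻¹ / 2) (f / 2)) := by
  have := golden_ne hf
  refine conj_cls (isUnit_quat (by rw [normSq_halfTurn hf]; norm_num)) (isUnit_quat (by norm_num))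
    (isUnit_quat (by rw [normSq_edge' hf]; exact one_ne_zero)) (κ := -1) (by norm_num) ?_
  simp only [quat_mul_quat, smul_quat]
  apply quat_congr <;> grind

end Golden

theorem PD.map_injective {K L : Type*} [Field K] [CharZero K] [Field L] (f : K →+* L) :
    Function.Injective (PD.map f) := by
  rw [injective_iff_map_eq_one]
  intro c hc
  obtain ⟨u, rfl⟩ := exists_cls_eq c
  have hx := u.isUnit
  generalize u.val = x at hx hc ⊢
  rw [PD.map_cls f hx, ← cls_one, eq_comm, cls_eq_cls_iff isUnit_one (isUnit_mapQuat f hx)] at hc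
  obtain ⟨κ, -, hκ⟩ := hc
  have hi := congrArg QuaternionAlgebra.imI hκ
  have hj := congrArg QuaternionAlgebra.imJ hκ
  have hk := congrArg QuaternionAlgebra.imK hκ
  have h0 : ∀ t : K, f t = κ * 0 → t = 0 := fun t ht => by
    rwa [mul_zero, map_eq_zero] at ht
  have h : x = x.re • (1 : ℍ[K]) := by
    apply Quaternion.ext
    · exact (mul_one x.re).symm
    · exact (h0 _ hi).trans (mul_zero x.re).symm
    · exact (h0 _ hj).trans (mul_zero x.re).symm
    · exact (h0 _ hk).trans (mul_zero x.re).symm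
  refine cls_eq_one_of_eq_smul (fun h1 => ?_) h
  rw [h1, zero_smul] at h
  exact not_isUnit_zero (h ▸ hx)

/-- The half-turn given by `i + φ⁻¹j - φk` conjugates the Hurwitz group `C12`, viewed over `ℚ(√5)`,
onto `C12'`: it inverts `ω` and carries `i` to the other generator. -/
theorem nonempty_mulEquiv_C12' : Nonempty (C12' ≃* alternatingGroup (Fin 4)) := by
  obtain ⟨O, hO⟩ := exists_hurwitz
  obtain ⟨g⟩ := (gates_twelve hO).2.1
  let f : ℚ →+* K5 := algebraMap ℚ K5
  let ψ : PD ℚ →* PD K5 :=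
    (MulAut.conj (cls (quat 0 1 phi⁻¹ (-phi)))).toMonoidHom.comp (PD.map f)
  have hψ : Function.Injective ψ := (MulAut.conj (cls (quat 0 1 phi⁻¹ (-phi)))).injective.comp
    (PD.map_injective f)
  have hω : ψ (cls (omega ℚ)) = (cls (omega K5))⁻¹ := by
    rw [← conj_halfTurn_omega phi_sq]
    change _ * PD.map f _ * _ = _
    rw [PD.map_cls f isUnit_omega, omega_eq, mapQuat_quat, map_div₀, map_one, map_ofNat, omega_eq]
  have hi : ψ (cls (quat 0 1 0 0)) = cls (quat 0 (1 / 2) (-phi⁻¹ / 2) (phi / 2)) := by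
    rw [← conj_halfTurn_i phi_sq]
    change _ * PD.map f _ * _ = _
    rw [PD.map_cls f (isUnit_quat (by norm_num)), mapQuat_quat, map_zero, map_one]
  have h : C12.map ψ = C12' := by
    have h1 : C12 = Subgroup.closure {cls (quat 0 1 0 0), cls (omega ℚ)} := gen_pair _ _
    rw [h1, MonoidHom.map_closure, Set.image_pair, hi, hω, Set.pair_comm, closure_pair_inv, C12'_eq]
  exact h ▸ ⟨(C12.equivMapOfInjective ψ hψ).symm.trans g⟩

variable {O : Subalgebra (𝓞 K5) ℍ[K5]}

section Complex

theorem gr_sq : gr ^ 2 = gr + 1 := by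
  have h : ((1 + √5) / 2 : ℝ) ^ 2 = (1 + √5) / 2 + 1 := by
    have := Real.sq_sqrt (show (0 : ℝ) ≤ 5 by norm_num)
    linear_combination this / 4
  rw [gr, ← Complex.ofReal_pow, h, Complex.ofReal_add, Complex.ofReal_one]

theorem coe_algebraMap_phi : ((algebraMap K5 ℝ phi : ℝ) : ℂ) = gr := by
  rw [algebraMap_phi, gr]

theorem toPU_edge : toPU (algebraMap K5 ℝ) (cls (quat 0 (1 / 2) (phi⁻¹ / 2) (phi / 2))) =
    pgl !![1, gr - Complex.I / gr; gr + Complex.I / gr, -1] := by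
  have h0 := golden_ne gr_sq
  refine toPU_cls_quat _ (by rw [normSq_edge phi_sq]; exact one_ne_zero) (κ := Complex.I / 2)
    (div_ne_zero Complex.I_ne_zero two_ne_zero) ?_ ?_ ?_ ?_
  all_goals
    simp only [map_div₀, map_inv₀, map_one, map_zero, map_ofNat, Complex.ofReal_inv,
      Complex.ofReal_div, Complex.ofReal_one, Complex.ofReal_zero, Complex.ofReal_ofNat,
      coe_algebraMap_phi]
    field_simp
    grind [Complex.I_sq]

theorem toPU_edge' : toPU (algebraMap K5 ℝ) (cls (quat 0 (1 / 2) (-phi⁻¹ / 2) (phi / 2))) =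
    pgl !![1, gr + Complex.I / gr; gr - Complex.I / gr, -1] := by
  have h0 := golden_ne gr_sq
  refine toPU_cls_quat _ (by rw [normSq_edge' phi_sq]; exact one_ne_zero) (κ := Complex.I / 2)
    (div_ne_zero Complex.I_ne_zero two_ne_zero) ?_ ?_ ?_ ?_
  all_goals
    simp only [map_div₀, map_inv₀, map_neg, map_one, map_zero, map_ofNat, Complex.ofReal_inv,
      Complex.ofReal_div, Complex.ofReal_neg, Complex.ofReal_one, Complex.ofReal_zero,
      Complex.ofReal_ofNat, coe_algebraMap_phi]
    field_simp
    grind [Complex.I_sq]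

theorem map_C60 : C60.map (toPU (algebraMap K5 ℝ)) = C60U := by
  rw [C60_eq, MonoidHom.map_closure, Set.image_pair, toPU_omega, toPU_edge, C60U, genU_pair]

theorem map_C12' : C12'.map (toPU (algebraMap K5 ℝ)) = C12U' := by
  rw [C12'_eq, MonoidHom.map_closure, Set.image_pair, toPU_omega, toPU_edge', C12U', genU_pair]

theorem map_C5 : C5.map (toPU (algebraMap K5 ℝ)) = C5U := by
  have h : toPU (algebraMap K5 ℝ) (cls (quat (phi / 2) (phi⁻¹ / 2) (1 / 2) 0)) =
      pgl !![1 + gr + Complex.I, gr; -gr, 1 + gr - Complex.I] := by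
    have h0 := golden_ne gr_sq
    have h := gr_sq
    refine toPU_cls_quat _ (by rw [normSq_fifth phi_sq]; exact one_ne_zero) (κ := 1 / (2 * gr))
      (one_div_ne_zero (mul_ne_zero two_ne_zero h0)) ?_ ?_ ?_ ?_
    all_goals
      simp only [map_div₀, map_inv₀, map_one, map_zero, map_ofNat, Complex.ofReal_inv,
        Complex.ofReal_div, Complex.ofReal_one, Complex.ofReal_zero, Complex.ofReal_ofNat,
        coe_algebraMap_phi]
      field_simp
      grind
  rw [C5_eq, MonoidHom.map_zpowers, h, C5U, genU, Set.image_singleton, Subgroup.zpowers_eq_closure]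

theorem ne_int_phi {a b : ℤ} (h : a ≠ 0) : (a : K5) + b * phi ≠ 0 := fun h' =>
  h (int_phi_ext (c := 0) (d := 0) (by simpa using h')).1

theorem toPU_T60 : toPU (algebraMap K5 ℝ) T60 = T60U := by
  refine toPU_cls_quat _ ?_ Complex.I_ne_zero ?_ ?_ ?_ ?_
  · have := ne_int_phi (a := 7) (b := 5) (by norm_num)
    rw [zero_pow two_ne_zero, zero_add, normSq_T60 phi_sq]
    exact_mod_cast this
  all_goals
    simp only [map_add, map_one, map_zero, map_ofNat, Complex.ofReal_add,
      Complex.ofReal_one, Complex.ofReal_zero, Complex.ofReal_ofNat, coe_algebraMap_phi]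
    grind [Complex.I_sq]

theorem toPU_T12' : toPU (algebraMap K5 ℝ) T12' = T12U' := by
  refine toPU_cls_quat _ ?_ Complex.I_ne_zero ?_ ?_ ?_ ?_
  · have := ne_int_phi (a := 4) (b := -1) (by norm_num)
    rw [zero_pow two_ne_zero, zero_add, normSq_T12' phi_sq]
    convert this using 1
    push_cast
    ring
  all_goals
    simp only [map_sub, map_one, map_zero, Complex.ofReal_sub,
      Complex.ofReal_one, Complex.ofReal_zero, coe_algebraMap_phi]
    grind [Complex.I_sq]

theorem toPU_T5 : toPU (algebraMap K5 ℝ) T5 = T5U := by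
  refine toPU_cls_quat _ (by norm_num) (κ := 1 + Complex.I) ?_ ?_ ?_ ?_ ?_
  · intro h
    simpa using congrArg Complex.re h
  all_goals
    simp only [map_one, map_zero, Complex.ofReal_one, Complex.ofReal_zero]
    grind [Complex.I_sq]

end Complex

instance fact_prime_fiftyNine : Fact (Nat.Prime 59) := ⟨by norm_num⟩

instance fact_prime_eleven : Fact (Nat.Prime 11) := ⟨by norm_num⟩

section Members

variable (hO : Subalgebra.toSubmodule O = icosianLattice)

include hO

theorem cls_omega_mem_icosian : cls (omega K5) ∈ unitGroup O :=
  cls_mem_unitGroup (isOrder_icosian hO) ((Subalgebra.mem_toSubmodule (S := O)).1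
    (hO ▸ Submodule.subset_span (.inr (.inr (.inl rfl))))) (u := 1)
    (by rw [omega_eq, normSq_quat]; norm_num)

theorem C60_le : C60 ≤ unitGroup O := by
  rw [C60_eq, Subgroup.closure_le]
  rintro _ (rfl | rfl)
  · exact cls_omega_mem_icosian hO
  · exact cls_mem_unitGroup (isOrder_icosian hO) ((Subalgebra.mem_toSubmodule (S := O)).1
      (hO ▸ Submodule.subset_span (.inr (.inr (.inr rfl))))) (u := 1)
      (by rw [normSq_quat, normSq_edge phi_sq]; simp)

theorem C12'_le : C12' ≤ unitGroup O := by
  rw [C12'_eq, Subgroup.closure_le]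
  rintro _ (rfl | rfl)
  · exact cls_omega_mem_icosian hO
  · exact cls_mem_unitGroup (isOrder_icosian hO)
      (mem_of_eq_latticePoint_icosian hO (icosian_units phi_sq).2.2.2.1) (u := 1)
      (by rw [normSq_quat, normSq_edge' phi_sq]; simp)

theorem C5_le : C5 ≤ unitGroup O := by
  rw [C5_eq, Subgroup.zpowers_le]
  exact cls_mem_unitGroup (isOrder_icosian hO)
    (mem_of_eq_latticePoint_icosian hO (icosian_units phi_sq).2.2.2.2.1) (u := 1)
    (by rw [normSq_quat, normSq_fifth phi_sq]; simp)

end Members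

variable {O : Subalgebra (𝓞 K5) ℍ[K5]}

theorem coe_seven_add_golden : ((7 + 5 * golden : 𝓞 K5) : K5) = 7 + 5 * phi := by
  have h := map_add (algebraMap (𝓞 K5) K5) 7 (5 * golden)
  rwa [map_mul, map_ofNat, map_ofNat] at h

theorem coe_four_sub_golden : ((4 - golden : 𝓞 K5) : K5) = 4 - phi := by
  have h := map_sub (algebraMap (𝓞 K5) K5) 4 golden
  rwa [map_ofNat] at h

/-- The residue field has 59 elements, with `φ ↦ 34` and `-2 = 23²`. None of the polynomials for
orders 2, 3 and 5 has a root there, and the alternating group of degree five has `60 = 59 + 1`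
elements. -/
theorem gates_sixty (hO : Subalgebra.toSubmodule O = icosianLattice) :
    C60 = unitGroup O ∧ Nonempty (C60 ≃* alternatingGroup (Fin 5)) ∧
      CorrespondsTo (algebraMap K5 ℝ) C60 T60 C60U T60U ∧
      ∃ v : HeightOneSpectrum (𝓞 K5), IsGeneratedBy v (7 + 5 * phi : K5) ∧
        (∃ ρ : v.adicCompletion K5, ρ ^ 2 = -2) ∧
        ∀ ρ : v.adicCompletion K5, ρ ^ 2 = -2 →
          ∃ e : ℍ[v.adicCompletion K5] ≃ₐ[v.adicCompletion K5]
            Matrix (Fin 2) (Fin 2) (v.adicCompletion K5),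
            (∀ x, e x = splitTwo ρ x) ∧ IsSuperGoldenGateSet O e C60 T60 ∧
              C60 ⊔ Subgroup.zpowers T60 = arithGroup v O := by
  have hO' := isOrder_icosian hO
  obtain ⟨v, χ, hχs, hv, hχ, hq, hcard⟩ := exists_prime_five 59 34 (by decide)
    (g := 7 + 5 * golden) ⟨12 - 5 * golden, by push_cast; linear_combination 25 * golden_sq⟩
    ⟨-7 + 3 * golden, by push_cast; linear_combination -15 * golden_sq⟩
    (x := 7) (y := 5) (by push_cast; ring) (by decide)
  have h2 : (2 : 𝓞 K5) ∉ v.asIdeal := ofNat_notMem hχ (by decide)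
  have hτ : quat 0 (2 + phi) 1 1 ∈ O :=
    mem_of_eq_latticePoint_icosian hO (icosian_units phi_sq).2.2.2.2.2.1
  have hunif : IsUniformizing v (7 + 5 * golden) (quat 0 (2 + phi) 1 1) :=
    isUniformizing_quat hv (by rw [coe_seven_add_golden]; exact normSq_T60 phi_sq)
  obtain ⟨ρ₀, hρ₀, -⟩ := exists_root (v := v) hχ (-2) 23 (by decide) (by decide)
  replace hρ₀ : ρ₀ ^ 2 = -2 := by simpa using hρ₀
  have key : ∀ ρ : v.adicCompletion K5, ρ ^ 2 = -2 →
      ∃ e : ℍ[v.adicCompletion K5] ≃ₐ[v.adicCompletion K5]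
        Matrix (Fin 2) (Fin 2) (v.adicCompletion K5), (∀ x, e x = splitTwo ρ x) ∧ IsStandard e ∧
        (∀ x ∈ O, ∃ M, IntModel e x M) ∧ (∀ c ∈ unitGroup O, IsElliptic e c) ∧
        IsFlip e T60 := by
    intro ρ hρ
    obtain ⟨e, hs, he, hm⟩ := exists_standard_splitTwo h2 hρ hO halfIntegral_icosian
    refine ⟨e, hs, he, hm, fun c hc => isElliptic_five hχ he hO' hm hc (fun _ => .inr (by decide))
      (fun _ => .inr (by decide)) (fun _ => .inr ?_), hunif.isFlip he (hm _ hτ)⟩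
    rw [hχs]
    decide
  obtain ⟨e, -, he, -, hell, hflip⟩ := key ρ₀ hρ₀
  have hle := C60_le hO
  obtain ⟨hfin, hU⟩ := card_le_of_isElliptic hq hell ⟨_, hflip.smul_origin⟩
  have : Finite C60 := Finite.of_injective _ (Subgroup.inclusion_injective hle)
  obtain ⟨φ, hφ⟩ : ∃ φ : C60 →* Equiv.Perm (Fin 5), φ.range = alternatingGroup (Fin 5) := by
    rw [C60_eq]
    exact exists_hom_frame phi_sq
  have hA : Nat.card (alternatingGroup (Fin 5)) = 60 := by
    rw [nat_card_alternatingGroup, Nat.card_fin]; rfl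
  have hge := card_le_of_range φ hφ
  have hCU : C60 = unitGroup O := eq_unitGroup_of_card_le hq hflip hell hle (by omega)
  refine ⟨hCU, nonempty_mulEquiv_of_card_le φ hφ (by rw [hCU]; omega), ?_⟩
  obtain ⟨hcor, hsg⟩ := gates_of_local isTotallyReal_five hO' (algebraMap K5 ℝ) map_C60 toPU_T60 hq
    (by omega) (exists_arithmetic hle (cls_mem_arithGroup hO' hτ hunif.2.2 hv)) ⟨ρ₀, hρ₀⟩
    (fun ρ hρ => by
      obtain ⟨e, hs, he, -, hell, hflip⟩ := key ρ hρ
      exact ⟨e, hs, he, hCU ▸ hell, hflip⟩)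
  have hfull : C60 ⊔ Subgroup.zpowers T60 = arithGroup v O := by
    obtain ⟨e, -, he, hm, hell, -⟩ := key ρ₀ hρ₀
    rw [hCU]
    exact sup_eq_arithGroup he hO' hm (fun x hx => mem_icosian_of_dual hO hx) hq hell
      (by rw [← hCU]; omega) hτ hunif
  refine ⟨hcor, v, isGeneratedBy_of_eq hv coe_seven_add_golden, ⟨ρ₀, hρ₀⟩, fun ρ hρ => ?_⟩
  obtain ⟨e, hs, hg⟩ := hsg ρ hρ
  exact ⟨e, hs, hg, hfull⟩

/-- The residue field has 11 elements, with `φ ↦ 4`. The polynomials for order 5 do have roots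
modulo 11, but `C12'` has no elements of that order. -/
theorem gates_twelve' (hO : Subalgebra.toSubmodule O = icosianLattice) :
    C12' ≤ unitGroup O ∧ Nonempty (C12' ≃* alternatingGroup (Fin 4)) ∧
      CorrespondsTo (algebraMap K5 ℝ) C12' T12' C12U' T12U' ∧
      ∃ v : HeightOneSpectrum (𝓞 K5), IsGeneratedBy v (4 - phi : K5) ∧
        (∃ ρ : v.adicCompletion K5, ρ ^ 2 = -2) ∧
        ∀ ρ : v.adicCompletion K5, ρ ^ 2 = -2 →
          ∃ e : ℍ[v.adicCompletion K5] ≃ₐ[v.adicCompletion K5]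
            Matrix (Fin 2) (Fin 2) (v.adicCompletion K5),
            (∀ x, e x = splitTwo ρ x) ∧ IsSuperGoldenGateSet O e C12' T12' := by
  have hO' := isOrder_icosian hO
  have hle := C12'_le hO
  have hC : Nat.card C12' = 12 := by
    obtain ⟨f⟩ := nonempty_mulEquiv_C12'
    rw [Nat.card_congr f.toEquiv, nat_card_alternatingGroup, Nat.card_fin]
    rfl
  refine ⟨hle, nonempty_mulEquiv_C12', ?_⟩
  obtain ⟨v, χ, hχs, hv, hχ, hq, hcard⟩ := exists_prime_five 11 4 (by decide)
    (g := 4 - golden) ⟨3 + golden, by push_cast; linear_combination golden_sq⟩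
    ⟨-1, by push_cast; ring⟩ (x := 4) (y := -1) (by push_cast; ring) (by decide)
  have h2 : (2 : 𝓞 K5) ∉ v.asIdeal := ofNat_notMem hχ (by decide)
  have hτ : quat 0 (phi - 1) 1 1 ∈ O :=
    mem_of_eq_latticePoint_icosian hO (icosian_units phi_sq).2.2.2.2.2.2.1
  have hunif : IsUniformizing v (4 - golden) (quat 0 (phi - 1) 1 1) :=
    isUniformizing_quat hv (by rw [coe_four_sub_golden]; exact normSq_T12' phi_sq)
  obtain ⟨ρ₀, hρ₀, -⟩ := exists_root (v := v) hχ (-2) 3 (by decide) (by decide)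
  replace hρ₀ : ρ₀ ^ 2 = -2 := by simpa using hρ₀
  have key : ∀ ρ : v.adicCompletion K5, ρ ^ 2 = -2 →
      ∃ e : ℍ[v.adicCompletion K5] ≃ₐ[v.adicCompletion K5]
        Matrix (Fin 2) (Fin 2) (v.adicCompletion K5), (∀ x, e x = splitTwo ρ x) ∧
        IsStandard e ∧ (∀ c ∈ C12', IsElliptic e c) ∧ IsFlip e T12' := by
    intro ρ hρ
    obtain ⟨e, hs, he, hm⟩ := exists_standard_splitTwo h2 hρ hO halfIntegral_icosian
    refine ⟨e, hs, he, fun c hc => isElliptic_five hχ he hO' hm (hle hc)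
      (fun _ => .inr (by decide)) (fun _ => .inr (by decide)) (fun h5 => .inl ?_),
      hunif.isFlip he (hm _ hτ)⟩
    -- As `25 = 2 · 12 + 1`, an element of `C12'` with trivial fifth power is trivial.
    have h12 : c ^ 12 = 1 := by
      have := pow_card_eq_one' (x := (⟨c, hc⟩ : C12'))
      rw [hC] at this
      exact congrArg Subtype.val this
    calc c = c ^ 25 := by rw [pow_succ, show 24 = 12 * 2 from rfl, pow_mul, h12, one_pow, one_mul]
      _ = 1 := by rw [show 25 = 5 * 5 from rfl, pow_mul, h5, one_pow]
  obtain ⟨hcor, hsg⟩ := gates_of_local isTotallyReal_five hO' (algebraMap K5 ℝ) map_C12' toPU_T12'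
    hq (by omega) (exists_arithmetic hle (cls_mem_arithGroup hO' hτ hunif.2.2 hv)) ⟨ρ₀, hρ₀⟩ key
  exact ⟨hcor, v, isGeneratedBy_of_eq hv coe_four_sub_golden, ⟨ρ₀, hρ₀⟩, hsg⟩

variable {O : Subalgebra (𝓞 K5) ℍ[K5]}

theorem splitInert_quat {F : Type*} [Field F] (α β a b c d : F) :
    splitInert α β (quat a b c d) =
      !![a + c * α + d * β, b + c * β - d * α; -b + c * β - d * α, a - c * α - d * β] := rfl

/-! ### Integrality of the splitting at the inert prime -/

section InertEntries

variable {F : Type*} [Field F] [CharZero F] {f ρ : F} {A : Subring F}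

theorem sq_add_sq_inert (hf : f ^ 2 = f + 1) (hρ : ρ ^ 2 = -7) :
    ((2 * f - 1 - ρ) / 2) ^ 2 + ((2 * f - 1 + ρ) / 2) ^ 2 = -1 := by
  linear_combination 2 * hf + hρ / 2

theorem splitInert_i_mem (α β : F) (i j : Fin 2) : splitInert α β (quat 0 1 0 0) i j ∈ A := by
  have h : splitInert α β (quat 0 1 0 0) = !![0, 1; -1, 0] := by
    rw [splitInert_quat]
    simp
  rw [h]
  fin_cases i <;> fin_cases j
  exacts [zero_mem A, one_mem A, neg_mem (one_mem A), zero_mem A]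

theorem splitInert_omega_mem (hfA : f ∈ A) (hw : (ρ + 1) / 4 ∈ A) (i j : Fin 2) :
    splitInert ((2 * f - 1 - ρ) / 2) ((2 * f - 1 + ρ) / 2) (omega F) i j ∈ A := by
  have h : splitInert ((2 * f - 1 - ρ) / 2) ((2 * f - 1 + ρ) / 2) (omega F) =
      !![f, 2 * ((ρ + 1) / 4); 2 * ((ρ + 1) / 4) - 1, 1 - f] := by
    rw [omega_eq, splitInert_quat]
    ext i j
    fin_cases i <;> fin_cases j <;> simp <;> ring
  rw [h]
  have h2 := mul_mem (ofNat_mem A 2) hw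
  fin_cases i <;> fin_cases j
  exacts [hfA, h2, sub_mem h2 (one_mem A), sub_mem (one_mem A) hfA]

theorem splitInert_edge_mem (hf : f ^ 2 = f + 1) (hfA : f ∈ A) (hw : (ρ + 1) / 4 ∈ A)
    (i j : Fin 2) : splitInert ((2 * f - 1 - ρ) / 2) ((2 * f - 1 + ρ) / 2)
      (quat 0 (1 / 2) (f⁻¹ / 2) (f / 2)) i j ∈ A := by
  have hinv : f⁻¹ = f - 1 := by
    have := golden_ne hf
    grind
  have h : splitInert ((2 * f - 1 - ρ) / 2) ((2 * f - 1 + ρ) / 2)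
      (quat 0 (1 / 2) (f⁻¹ / 2) (f / 2)) =
      !![(ρ + 1) / 4 + 1, (1 - f) + (2 * f - 1) * ((ρ + 1) / 4);
        -f + (2 * f - 1) * ((ρ + 1) / 4), -((ρ + 1) / 4 + 1)] := by
    rw [hinv, splitInert_quat]
    ext i j
    fin_cases i <;> fin_cases j <;> simp <;> grind
  rw [h]
  have h2 := mul_mem (sub_mem (mul_mem (ofNat_mem A 2) hfA) (one_mem A)) hw
  have h3 := add_mem hw (one_mem A)
  fin_cases i <;> fin_cases j
  exacts [h3, add_mem (sub_mem (one_mem A) hfA) h2, add_mem (neg_mem hfA) h2, neg_mem h3]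

end InertEntries

/-- The images of the basis are integral polynomials in `φ` and `(ρ + 1) / 4`. This is where the
choice of the root `ρ ≡ -1` modulo 4 enters, since 2 is not a unit. -/
theorem exists_standard_splitInert_of_le {v : HeightOneSpectrum (𝓞 K5)}
    {ρ : v.adicCompletion K5} (hρ : ρ ^ 2 = -7)
    (h4 : Valued.v (ρ + 1) ≤ Valued.v (4 : v.adicCompletion K5))
    (hO : Subalgebra.toSubmodule O = icosianLattice) :
    ∃ e : ℍ[v.adicCompletion K5] ≃ₐ[v.adicCompletion K5]
      Matrix (Fin 2) (Fin 2) (v.adicCompletion K5),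
      (∀ x, e x = splitInert ((algebraMap K5 (v.adicCompletion K5) r5 - ρ) / 2)
        ((algebraMap K5 (v.adicCompletion K5) r5 + ρ) / 2) x) ∧ IsStandard e ∧
      ∀ x ∈ O, ∃ M, IntModel e x M := by
  set g := algebraMap K5 (v.adicCompletion K5) with hg
  set f := g phi with hf'
  have hf : f ^ 2 = f + 1 := by rw [hf', ← map_pow, phi_sq, map_add, map_one]
  have hr : g r5 = 2 * f - 1 := by rw [r5_eq, map_sub, map_mul, map_ofNat, map_one]
  rw [hr]
  have hab := sq_add_sq_inert hf hρ
  obtain ⟨e, he⟩ := exists_splitInert hab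
  refine ⟨e, he, isStandard_splitInert hab he, ?_⟩
  have hfA : f ∈ (v.adicCompletionIntegers K5).toSubring := v.coe_mem_adicCompletionIntegers golden
  have hw : (ρ + 1) / 4 ∈ (v.adicCompletionIntegers K5).toSubring := by
    refine (HeightOneSpectrum.mem_adicCompletionIntegers _ _ _).2 ?_
    rw [map_div₀]
    exact div_le_one_of_le₀ h4 zero_le
  intro x hx
  refine intModel_of_span hO ?_ hx
  rintro x (rfl | rfl | rfl | rfl)
  · exact ⟨1, intModel_one⟩
  · refine exists_intModel_of_mem fun a b => ?_
    rw [he]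
    change splitInert _ _ (quat (g 0) (g 1) (g 0) (g 0)) a b ∈ _
    rw [map_zero, map_one]
    exact splitInert_i_mem (A := (v.adicCompletionIntegers K5).toSubring) _ _ a b
  · refine exists_intModel_of_mem fun a b => ?_
    rw [he]
    change splitInert _ _ (quat (g (1 / 2)) (g (1 / 2)) (g (1 / 2)) (g (1 / 2))) a b ∈ _
    rw [map_div₀, map_one, map_ofNat]
    exact splitInert_omega_mem hfA hw a b
  · refine exists_intModel_of_mem fun a b => ?_
    rw [he]
    change splitInert _ _ (quat (g 0) (g (1 / 2)) (g (phi⁻¹ / 2)) (g (phi / 2))) a b ∈ _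
    rw [map_zero, map_div₀, map_div₀, map_div₀, map_inv₀, map_one, map_ofNat]
    exact splitInert_edge_mem hf hfA hw a b

theorem fourField_ne (z : FourField) : z ^ 2 - QuadraticAlgebra.omega * z + 1 ≠ 0 ∧
    z ^ 2 - (QuadraticAlgebra.omega - 1) * z + 1 ≠ 0 := by
  obtain ⟨a, b⟩ := z
  have h : ∀ a b : ZMod 2, ¬(a * a + b * b - b + 1 = 0 ∧ a * b + b * a + b * b - (a + b) = 0) ∧
      ¬(a * a + b * b - (b - a) + 1 = 0 ∧ a * b + b * a + b * b - a = 0) := by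
    decide
  have h1 : (1 : FourField).re = 1 := rfl
  have h2 : (1 : FourField).im = 0 := rfl
  constructor
  · refine fun h0 => (h a b).1 ⟨?_, ?_⟩
    · simpa [pow_two, h1, h2] using congrArg QuadraticAlgebra.re h0
    · simpa [pow_two, h1, h2] using congrArg QuadraticAlgebra.im h0
  · refine fun h0 => (h a b).2 ⟨?_, ?_⟩
    · simpa [pow_two, sub_mul, h1, h2] using congrArg QuadraticAlgebra.re h0
    · simpa [pow_two, sub_mul, h1, h2] using congrArg QuadraticAlgebra.im h0

/-- The residue field has four elements and contains the cube roots of unity, but it has no roots of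
the polynomials for order 5. The cyclic group has `5 = 4 + 1` elements. -/
theorem gates_five (hO : Subalgebra.toSubmodule O = icosianLattice) :
    C5 ≤ unitGroup O ∧
      CorrespondsTo (algebraMap K5 ℝ) C5 T5 C5U T5U ∧
      ∃ v : HeightOneSpectrum (𝓞 K5), IsGeneratedBy v (2 : K5) ∧
        (∃ ρ : v.adicCompletion K5, ρ ^ 2 = -7 ∧
          Valued.v (ρ + 1) ≤ Valued.v (4 : v.adicCompletion K5)) ∧
        ∀ ρ : v.adicCompletion K5, ρ ^ 2 = -7 →
          Valued.v (ρ + 1) ≤ Valued.v (4 : v.adicCompletion K5) →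
          ∃ e : ℍ[v.adicCompletion K5] ≃ₐ[v.adicCompletion K5]
            Matrix (Fin 2) (Fin 2) (v.adicCompletion K5),
            (∀ x, e x = splitInert ((algebraMap K5 (v.adicCompletion K5) r5 - ρ) / 2)
              ((algebraMap K5 (v.adicCompletion K5) r5 + ρ) / 2) x) ∧
              IsSuperGoldenGateSet O e C5 T5 := by
  have hO' := isOrder_icosian hO
  have hle := C5_le hO
  have hC : Nat.card C5 = 5 := by
    rw [C5_eq, Nat.card_zpowers, orderOf_cls_fifth phi_sq]
  refine ⟨hle, ?_⟩
  obtain ⟨v, χ, hχs, hv, hχ, hq, hcard⟩ := exists_prime_inert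
  have hτ : quat 0 0 1 1 ∈ O :=
    mem_of_eq_latticePoint_icosian hO (icosian_units phi_sq).2.2.2.2.2.2.2
  have hunif : IsUniformizing v 2 (quat 0 0 1 1) :=
    isUniformizing_quat hv (by rw [coe_ofNat_integers]; norm_num)
  have hex := exists_sq_eq_neg_seven (v := v) (hv ▸ Ideal.mem_span_singleton_self _)
  have key : ∀ ρ : v.adicCompletion K5, (ρ ^ 2 = -7 ∧
      Valued.v (ρ + 1) ≤ Valued.v (4 : v.adicCompletion K5)) →
      ∃ e : ℍ[v.adicCompletion K5] ≃ₐ[v.adicCompletion K5]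
        Matrix (Fin 2) (Fin 2) (v.adicCompletion K5),
        (∀ x, e x = splitInert ((algebraMap K5 (v.adicCompletion K5) r5 - ρ) / 2)
          ((algebraMap K5 (v.adicCompletion K5) r5 + ρ) / 2) x) ∧
        IsStandard e ∧ (∀ c ∈ C5, IsElliptic e c) ∧ IsFlip e T5 := by
    rintro ρ ⟨hρ, h4⟩
    obtain ⟨e, hs, he, hm⟩ := exists_standard_splitInert_of_le hρ h4 hO
    refine ⟨e, hs, he, fun c hc => ?_, hunif.isFlip he (hm _ hτ)⟩
    -- `c⁶ = c` excludes orders 2 and 3 at once, both being divisors of 6.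
    have hc6 : c ^ 6 = c := by
      have := pow_card_eq_one' (x := (⟨c, hc⟩ : C5))
      rw [hC] at this
      rw [pow_succ, show c ^ 5 = 1 from congrArg Subtype.val this, one_mul]
    refine isElliptic_five hχ he hO' hm (hle hc) (fun h => .inl ?_) (fun h => .inl ?_)
      (fun _ => .inr ?_)
    · rw [← hc6, show 6 = 2 * 3 from rfl, pow_mul, h, one_pow]
    · rw [← hc6, show 6 = 3 * 2 from rfl, pow_mul, h, one_pow]
    · rw [hχs]
      exact ⟨fun z => (fourField_ne z).1, fun z => (fourField_ne z).2⟩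
  obtain ⟨hcor, hsg⟩ := gates_of_local isTotallyReal_five hO' (algebraMap K5 ℝ) map_C5 toPU_T5 hq
    (by omega) (exists_arithmetic hle (cls_mem_arithGroup hO' hτ hunif.2.2 hv)) hex key
  exact ⟨hcor, v, isGeneratedBy_of_eq hv (coe_ofNat_integers 2), hex,
    fun ρ h7 h4 => hsg ρ ⟨h7, h4⟩⟩

end SuperGolden

theorem mainTheorem8 :
    -- the Lipschitz quaternions
    (∃ O : Subalgebra (𝓞 ℚ) ℍ[ℚ], Subalgebra.toSubmodule O = lipschitz ∧ IsOrder O ∧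
      -- Pauli gates
      (C4 = unitGroup O ∧
        (C4 : Set (PD ℚ)) = cls '' {1, ⟨0, 1, 0, 0⟩, ⟨0, 0, 1, 0⟩, ⟨0, 0, 0, 1⟩} ∧
        (C4U : Set (PGL(2, ℂ))) = pgl '' {!![1, 0; 0, 1], !![Complex.I, 0; 0, -Complex.I],
          !![0, 1; -1, 0], !![0, Complex.I; Complex.I, 0]} ∧
        CorrespondsTo (algebraMap ℚ ℝ) C4 T4 C4U T4U ∧
        ∃ v : HeightOneSpectrum (𝓞 ℚ), IsGeneratedBy v (3 : ℚ) ∧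
          (∃ ρ : v.adicCompletion ℚ, ρ ^ 2 = -2 ∧ Valued.v (ρ - 508) ≤ Valued.v (3 ^ 6 : v.adicCompletion ℚ)) ∧
          ∀ ρ : v.adicCompletion ℚ, ρ ^ 2 = -2 →
            ∃ e : ℍ[v.adicCompletion ℚ] ≃ₐ[v.adicCompletion ℚ] Matrix (Fin 2) (Fin 2) (v.adicCompletion ℚ),
              (∀ x, e x = splitTwo ρ x) ∧ IsSuperGoldenGateSet O e C4 T4 ∧
                (Valued.v (ρ - 508) ≤ Valued.v (3 ^ 6 : v.adicCompletion ℚ) →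
                  ∃ g : GL (Fin 2) (v.adicCompletion ℚ),
                    (g : Matrix (Fin 2) (Fin 2) (v.adicCompletion ℚ)) = !![3, 1; 0, 1] ∧
                    treeMap e T4 • origin v = vertexOf v g)) ∧
      -- hybrid V-gates
      (Nonempty (C6 ≃* Equiv.Perm (Fin 3)) ∧
        CorrespondsTo (algebraMap ℚ ℝ) C6 T6 C6U T6U ∧
        ∃ v : HeightOneSpectrum (𝓞 ℚ), IsGeneratedBy v (5 : ℚ) ∧
          (∃ ρ : v.adicCompletion ℚ, ρ ^ 2 = -1) ∧
          ∀ ρ : v.adicCompletion ℚ, ρ ^ 2 = -1 →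
            ∃ e : ℍ[v.adicCompletion ℚ] ≃ₐ[v.adicCompletion ℚ] Matrix (Fin 2) (Fin 2) (v.adicCompletion ℚ),
              (∀ x, e x = splitOne ρ x) ∧ IsSuperGoldenGateSet O e C6 T6)) ∧
    -- the Hurwitz quaternions
    (∃ O : Subalgebra (𝓞 ℚ) ℍ[ℚ], Subalgebra.toSubmodule O = hurwitz ∧
      O = Algebra.adjoin (𝓞 ℚ) {⟨0, 1, 0, 0⟩, omega ℚ} ∧ IsMaximalOrder O ∧
      C12 = unitGroup O ∧ Nonempty (C12 ≃* alternatingGroup (Fin 4)) ∧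
      CorrespondsTo (algebraMap ℚ ℝ) C12 T12 C12U T12U ∧
      ∃ v : HeightOneSpectrum (𝓞 ℚ), IsGeneratedBy v (11 : ℚ) ∧
        (∃ ρ : v.adicCompletion ℚ, ρ ^ 2 = -2) ∧
        ∀ ρ : v.adicCompletion ℚ, ρ ^ 2 = -2 →
          ∃ e : ℍ[v.adicCompletion ℚ] ≃ₐ[v.adicCompletion ℚ] Matrix (Fin 2) (Fin 2) (v.adicCompletion ℚ),
            (∀ x, e x = splitTwo ρ x) ∧ IsSuperGoldenGateSet O e C12 T12) ∧
    -- the octahedral order over `ℚ(√2)`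
    (∃ O : Subalgebra (𝓞 K2) ℍ[K2], Subalgebra.toSubmodule O = octahedral ∧ IsMaximalOrder O ∧
      -- octahedral gates
      (C24 = unitGroup O ∧ Nonempty (C24 ≃* Equiv.Perm (Fin 4)) ∧
        CorrespondsTo (algebraMap K2 ℝ) C24 T24 C24U T24U ∧
        ∃ v : HeightOneSpectrum (𝓞 K2), IsGeneratedBy v (5 - r2 : K2) ∧
          (∃ ρ : v.adicCompletion K2, ρ ^ 2 = -5) ∧
          ∀ ρ : v.adicCompletion K2, ρ ^ 2 = -5 →
            ∃ e : ℍ[v.adicCompletion K2] ≃ₐ[v.adicCompletion K2] Matrix (Fin 2) (Fin 2) (v.adicCompletion K2),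
              (∀ x, e x = splitFive ρ x) ∧ IsSuperGoldenGateSet O e C24 T24 ∧
                C24 ⊔ Subgroup.zpowers T24 = arithGroup v O) ∧
      -- 8-gates
      (C8 ≤ unitGroup O ∧ Nonempty (C8 ≃* DihedralGroup 4) ∧
        CorrespondsTo (algebraMap K2 ℝ) C8 T8 C8U T8U ∧
        ∃ v : HeightOneSpectrum (𝓞 K2), IsGeneratedBy v (3 - r2 : K2) ∧
          (∃ ρ : v.adicCompletion K2, ρ ^ 2 = -3) ∧
          ∀ ρ : v.adicCompletion K2, ρ ^ 2 = -3 →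
            ∃ e : ℍ[v.adicCompletion K2] ≃ₐ[v.adicCompletion K2] Matrix (Fin 2) (Fin 2) (v.adicCompletion K2),
              (∀ x, e x = splitThree ρ x) ∧ IsSuperGoldenGateSet O e C8 T8) ∧
      -- 3-gates, at the ramified prime
      (C3 ≤ unitGroup O ∧
        CorrespondsTo (algebraMap K2 ℝ) C3 T3 C3U T3U ∧
        ∃ v : HeightOneSpectrum (𝓞 K2), IsGeneratedBy v (r2 : K2) ∧
          (∃ ρ : v.adicCompletion K2, ρ ^ 2 = -7) ∧
          ∀ ρ : v.adicCompletion K2, ρ ^ 2 = -7 →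
            ∃ e : ℍ[v.adicCompletion K2] ≃ₐ[v.adicCompletion K2] Matrix (Fin 2) (Fin 2) (v.adicCompletion K2),
              (∀ x, e x = splitRamified (algebraMap K2 (v.adicCompletion K2) r2)
                  ((2 + algebraMap K2 (v.adicCompletion K2) r2 * ρ) / 3)
                  ((2 * algebraMap K2 (v.adicCompletion K2) r2 - ρ) / 3) x) ∧ IsSuperGoldenGateSet O e C3 T3) ∧
      -- the group of the V-gates, over `ℚ(√2)`
      (C6.map (PD.map (algebraMap ℚ K2)) = gen {omega K2, ⟨0, 1 / r2, -1 / r2, 0⟩} ∧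
        C6.map (PD.map (algebraMap ℚ K2)) ≤ unitGroup O)) ∧
    -- the icosians over `ℚ(√5)`
    (∃ O : Subalgebra (𝓞 K5) ℍ[K5], (O : Set ℍ[K5]) = icosians ∧ IsMaximalOrder O ∧
      -- icosahedral gates
      (C60 = unitGroup O ∧ Nonempty (C60 ≃* alternatingGroup (Fin 5)) ∧
        CorrespondsTo (algebraMap K5 ℝ) C60 T60 C60U T60U ∧
        ∃ v : HeightOneSpectrum (𝓞 K5), IsGeneratedBy v (7 + 5 * phi : K5) ∧
          (∃ ρ : v.adicCompletion K5, ρ ^ 2 = -2) ∧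
          ∀ ρ : v.adicCompletion K5, ρ ^ 2 = -2 →
            ∃ e : ℍ[v.adicCompletion K5] ≃ₐ[v.adicCompletion K5] Matrix (Fin 2) (Fin 2) (v.adicCompletion K5),
              (∀ x, e x = splitTwo ρ x) ∧ IsSuperGoldenGateSet O e C60 T60 ∧
                C60 ⊔ Subgroup.zpowers T60 = arithGroup v O) ∧
      -- icosahedral 12-gates
      (C12' ≤ unitGroup O ∧ Nonempty (C12' ≃* alternatingGroup (Fin 4)) ∧
        CorrespondsTo (algebraMap K5 ℝ) C12' T12' C12U' T12U' ∧
        ∃ v : HeightOneSpectrum (𝓞 K5), IsGeneratedBy v (4 - phi : K5) ∧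
          (∃ ρ : v.adicCompletion K5, ρ ^ 2 = -2) ∧
          ∀ ρ : v.adicCompletion K5, ρ ^ 2 = -2 →
            ∃ e : ℍ[v.adicCompletion K5] ≃ₐ[v.adicCompletion K5] Matrix (Fin 2) (Fin 2) (v.adicCompletion K5),
              (∀ x, e x = splitTwo ρ x) ∧ IsSuperGoldenGateSet O e C12' T12') ∧
      -- 5-gates, at the inert prime
      (C5 ≤ unitGroup O ∧
        CorrespondsTo (algebraMap K5 ℝ) C5 T5 C5U T5U ∧
        ∃ v : HeightOneSpectrum (𝓞 K5), IsGeneratedBy v (2 : K5) ∧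
          (∃ ρ : v.adicCompletion K5, ρ ^ 2 = -7 ∧ Valued.v (ρ + 1) ≤ Valued.v (4 : v.adicCompletion K5)) ∧
          ∀ ρ : v.adicCompletion K5, ρ ^ 2 = -7 → Valued.v (ρ + 1) ≤ Valued.v (4 : v.adicCompletion K5) →
            ∃ e : ℍ[v.adicCompletion K5] ≃ₐ[v.adicCompletion K5] Matrix (Fin 2) (Fin 2) (v.adicCompletion K5),
              (∀ x, e x = splitInert ((algebraMap K5 (v.adicCompletion K5) r5 - ρ) / 2)
                  ((algebraMap K5 (v.adicCompletion K5) r5 + ρ) / 2) x) ∧ IsSuperGoldenGateSet O e C5 T5)) := by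
  obtain ⟨O₁, h₁⟩ := exists_lipschitz
  obtain ⟨O₂, h₂⟩ := exists_hurwitz
  obtain ⟨O₃, h₃⟩ := exists_octahedral
  obtain ⟨O₄, h₄⟩ := exists_icosianLattice
  have hic : (O₄ : Set ℍ[K5]) = icosians := by
    rw [← coe_icosianLattice, ← h₄]
    rfl
  exact ⟨⟨O₁, h₁, isOrder_lipschitz h₁, gates_four h₁, gates_six h₁⟩,
    ⟨O₂, h₂, hurwitz_eq_adjoin h₂, isMaximalOrder_hurwitz h₂, gates_twelve h₂⟩,
    ⟨O₃, h₃, isMaximalOrder_octahedral h₃, gates_twentyFour h₃, gates_eight h₃, gates_three h₃,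
      map_C6_two h₃ _⟩,
    ⟨O₄, hic, isMaximalOrder_icosian h₄, gates_sixty h₄, gates_twelve' h₄, gates_five h₄⟩⟩
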